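/- Let $p$ be a prime, let $F$ be a field that is an algebraic extension of $\mathbb F_p$, and let $S$ be a finite (possibly empty) set of irreducible elements of $\mathbb F_p[z]$ which remain irreducible in $F[z]$. Let $R=F[z,\,s^{-1}: s\in S]\subseteq F(z)$ be the ring generated over $F$ by $z$ and the inverses of the elements of $S$. Let $\mathcal L_p=\{+,=,x\mapsto x^p,0,1\}$, interpreted in $F$ in the obvious way. Let $\mathcal L_p(z)^e$ be the first-order language with the symbols of $\mathcal L_p$, a unary function symbol $x\mapsto zx$, a unary predicate symbol "$\in F$", and, for every $n\ge 0$ and every $\mathcal L_p$-formula $\sigma(a_1,\dots,a_n)$ (all free variables among $a_1,\dots,a_n$), an $n$-ary predicate symbol $P_\sigma$. Regard $R$ as an $\mathcal L_p(z)^e$-structure $\mathcal R$, where $+$, $x\mapsto x^p$, $0$, $1$, $x\mapsto zx$ and $\in F$ have their usual meaning and $P_\sigma(\alpha_1,\dots,\alpha_n)$ means that $\alpha_1,\dots,\alpha_n\in F$ and $\sigma(\alpha_1,\dots,\alpha_n)$ is true in $F$. Then: 1. The $\mathcal L_p(z)^e$-theory of $\mathcal R$ is effectively model-complete: there is an algorithm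 which, given an $\mathcal L_p(z)^e$-formula $\varphi(a_1,\dots,a_m)$, produces an existential $\mathcal L_p(z)^e$-formula $\psi(a_1,\dots,a_m)$ that is equivalent to $\varphi$ modulo the theory of $\mathcal R$. 2. Every $\mathcal L_p(z)^e$-sentence $\varphi$ is equivalent in $\mathcal R$ to a sentence of the form $P_\sigma$, where $\sigma$ is a sentence of $\mathcal L_p$; moreover there is an algorithm which produces such a $\sigma$ from $\varphi$. -/

import Mathlib

namespace AddFrob

/-! ### Gödel numbers of first-order terms and formulas -/

/-- An injective numbering of the symbols of each arity of a first-order language. -/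
class SymbolNumbering (L : FirstOrder.Language.{0, 0}) where
  funNum : ∀ n : ℕ, L.Functions n → ℕ
  relNum : ∀ n : ℕ, L.Relations n → ℕ
  funNum_injective : ∀ n : ℕ, Function.Injective (funNum n)
  relNum_injective : ∀ n : ℕ, Function.Injective (relNum n)

section Coding

variable {L : FirstOrder.Language.{0, 0}} [SymbolNumbering L]

/-- Number of a variable: the free variables `a₀, …, a_{m-1}` get even numbers and the variables
bound by quantifiers get odd numbers. -/
def varCode {m k : ℕ} : Fin m ⊕ Fin k → ℕ
  | Sum.inl i => 2 * (i : ℕ)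
  | Sum.inr i => 2 * (i : ℕ) + 1

/-- Gödel number of a term. -/
def termCode {m k : ℕ} : L.Term (Fin m ⊕ Fin k) → ℕ
  | .var x => Nat.pair 0 (varCode x)
  | .func (l := n) f ts =>
      Nat.pair 1 (Nat.pair n (Nat.pair (SymbolNumbering.funNum n f)
        (Encodable.encode (List.ofFn fun i => termCode (ts i)))))

/-- Gödel number of a formula with free variables indexed by `Fin m`, and with `k` further
variables waiting to be quantified. -/
def formulaCode {m : ℕ} : ∀ {k : ℕ}, L.BoundedFormula (Fin m) k → ℕ
  | _, .falsum => Nat.pair 0 0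
  | _, .equal t₁ t₂ => Nat.pair 1 (Nat.pair (termCode t₁) (termCode t₂))
  | _, .rel (l := n) R ts =>
      Nat.pair 2 (Nat.pair n (Nat.pair (SymbolNumbering.relNum n R)
        (Encodable.encode (List.ofFn fun i => termCode (ts i)))))
  | _, .imp φ ψ => Nat.pair 3 (Nat.pair (formulaCode φ) (formulaCode ψ))
  | _, .all φ => Nat.pair 4 (formulaCode φ)

theorem varCode_injective {m k : ℕ} :
    Function.Injective (varCode : Fin m ⊕ Fin k → ℕ) := by
  rintro (a | a) (b | b) h <;> simp only [varCode] at h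
  · congr 1; ext; omega
  · omega
  · omega
  · congr 1; ext; omega

theorem termCode_injective {m k : ℕ} :
    Function.Injective (termCode : L.Term (Fin m ⊕ Fin k) → ℕ) := by
  intro s
  induction s with
  | var x =>
    intro t h
    cases t with
    | var y =>
      simp only [termCode, Nat.pair_eq_pair, true_and] at h
      rw [varCode_injective h]
    | func g us => simp [termCode, Nat.pair_eq_pair] at h
  | func f ts ih =>
    intro t h
    cases t with
    | var y => simp [termCode, Nat.pair_eq_pair] at h
    | func g us =>
      simp only [termCode, Nat.pair_eq_pair, true_and] at h
      obtain ⟨rfl, h₁, h₂⟩ := h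
      have h₃ := SymbolNumbering.funNum_injective _ h₁
      have h₄ := List.ofFn_injective (Encodable.encode_injective h₂)
      subst h₃
      congr 1
      funext i
      exact ih i (congrFun h₄ i)

/-- Distinct formulas have distinct Gödel numbers. -/
theorem formulaCode_injective {m k : ℕ} :
    Function.Injective (formulaCode : L.BoundedFormula (Fin m) k → ℕ) := by
  intro φ
  induction φ with
  | falsum => intro ψ h; cases ψ <;> simp [formulaCode, Nat.pair_eq_pair] at h ⊢
  | equal t₁ t₂ =>
    intro ψ h
    cases ψ with
    | equal u₁ u₂ =>
      simp only [formulaCode, Nat.pair_eq_pair, true_and] at h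
      rw [termCode_injective h.1, termCode_injective h.2]
    | _ => simp [formulaCode, Nat.pair_eq_pair] at h
  | rel R ts =>
    intro ψ h
    cases ψ with
    | rel R' us =>
      simp only [formulaCode, Nat.pair_eq_pair, true_and] at h
      obtain ⟨rfl, h₁, h₂⟩ := h
      have h₃ := SymbolNumbering.relNum_injective _ h₁
      have h₄ := List.ofFn_injective (Encodable.encode_injective h₂)
      subst h₃
      congr 1
      funext i
      exact termCode_injective (congrFun h₄ i)
    | _ => simp [formulaCode, Nat.pair_eq_pair] at h
  | imp φ₁ φ₂ ih₁ ih₂ =>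
    intro ψ h
    cases ψ with
    | imp ψ₁ ψ₂ =>
      simp only [formulaCode, Nat.pair_eq_pair, true_and] at h
      rw [ih₁ h.1, ih₂ h.2]
    | _ => simp [formulaCode, Nat.pair_eq_pair] at h
  | all φ ih =>
    intro ψ h
    cases ψ with
    | all ψ =>
      simp only [formulaCode, Nat.pair_eq_pair, true_and] at h
      rw [ih h]
    | _ => simp [formulaCode, Nat.pair_eq_pair] at h

/-- A theory `T` is effectively model-complete if there is an algorithm which, given a formula
`φ(a₀, …, a_{m-1})`, produces an existential formula `ψ(a₀, …, a_{m-1})` which is equivalent to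
`φ` modulo `T`. -/
def EffectivelyModelComplete (T : L.Theory) : Prop :=
  ∃ g : ℕ → ℕ → ℕ, Computable₂ g ∧
    ∀ (m : ℕ) (φ : L.Formula (Fin m)), ∃ ψ : L.Formula (Fin m),
      ψ.IsExistential ∧ T.Iff φ ψ ∧ g m (formulaCode φ) = formulaCode ψ

end Coding

/-! ### The languages -/

/-- Function symbols of the language `{+, =, x ↦ x ^ p, 0, 1}`. -/
inductive LpFunctions : ℕ → Type
  | zero : LpFunctions 0
  | one : LpFunctions 0
  | frob : LpFunctions 1
  | add : LpFunctions 2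

/-- The language `{+, =, x ↦ x ^ p, 0, 1}` (equality is a logical symbol). The parameter `p`
only serves to determine the interpretation of the symbol for the Frobenius map. -/
def Lp (_p : ℕ) : FirstOrder.Language.{0, 0} := ⟨LpFunctions, fun _ => Empty⟩

/-- Numbers of the function symbols of `Lp p`. -/
def LpFunctions.num : ∀ n : ℕ, LpFunctions n → ℕ
  | _, .zero => 0
  | _, .one => 1
  | _, .frob => 2
  | _, .add => 3

theorem LpFunctions.num_injective (n : ℕ) : Function.Injective (LpFunctions.num n) := by
  intro f g h
  cases f <;> cases g <;> first | rfl | simp [LpFunctions.num] at h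

instance LpNumbering (p : ℕ) : SymbolNumbering (Lp p) where
  funNum := LpFunctions.num
  relNum _ R := Empty.elim R
  funNum_injective := LpFunctions.num_injective
  relNum_injective := fun _ R => Empty.elim R

/-- Function symbols of the languages with the multiplication-by-`z` map. -/
inductive LpzFunctions : ℕ → Type
  | zero : LpzFunctions 0
  | one : LpzFunctions 0
  | frob : LpzFunctions 1
  | mulZ : LpzFunctions 1
  | add : LpzFunctions 2

/-- Relation symbols: the unary predicate `∈ F`, and an `n`-ary predicate `P_σ` for each formula
`σ(a₀, …, a_{n-1})` of the language `{+, =, x ↦ x ^ p, 0, 1}`. -/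
inductive LpzeRelations (p : ℕ) : ℕ → Type
  | memF : LpzeRelations p 1
  | P {n : ℕ} (σ : (Lp p).Formula (Fin n)) : LpzeRelations p n

/-- The language `{+, =, x ↦ x ^ p, 0, 1, x ↦ z x, ∈ F}` extended by the predicates `P_σ`. -/
def Lpze (p : ℕ) : FirstOrder.Language.{0, 0} := ⟨LpzFunctions, LpzeRelations p⟩

/-- Numbers of the function symbols of `Lpze p`. -/
def LpzFunctions.num : ∀ n : ℕ, LpzFunctions n → ℕ
  | _, .zero => 0
  | _, .one => 1
  | _, .frob => 2
  | _, .mulZ => 3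
  | _, .add => 4

theorem LpzFunctions.num_injective (n : ℕ) : Function.Injective (LpzFunctions.num n) := by
  intro f g h
  cases f <;> cases g <;> first | rfl | simp [LpzFunctions.num] at h

/-- Numbers of the relation symbols of `Lpze p`: the number of `P_σ` is determined by the Gödel
number of `σ`. -/
def LpzeRelations.num {p : ℕ} : ∀ n : ℕ, LpzeRelations p n → ℕ
  | _, .memF => 0
  | _, .P σ => formulaCode σ + 1

theorem LpzeRelations.num_injective {p : ℕ} (n : ℕ) :
    Function.Injective (LpzeRelations.num (p := p) n) := by
  intro f g h
  cases f with
  | memF =>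
    cases g with
    | memF => rfl
    | P τ => simp [LpzeRelations.num] at h
  | P σ =>
    cases g with
    | memF => simp [LpzeRelations.num] at h
    | P τ =>
      simp only [LpzeRelations.num, Nat.add_right_cancel_iff] at h
      rw [formulaCode_injective h]

instance LpzeNumbering (p : ℕ) : SymbolNumbering (Lpze p) where
  funNum := LpzFunctions.num
  relNum := LpzeRelations.num
  funNum_injective := LpzFunctions.num_injective
  relNum_injective := LpzeRelations.num_injective

/-! ### The structures -/

/-- A field `F` as a structure for the language `{+, =, x ↦ x ^ p, 0, 1}`. -/
instance fieldStructure (p : ℕ) (F : Type*) [Field F] : (Lp p).Structure F where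
  funMap f v := match f, v with
    | LpFunctions.zero, _ => 0
    | LpFunctions.one, _ => 1
    | LpFunctions.frob, v => v 0 ^ p
    | LpFunctions.add, v => v 0 + v 1
  RelMap R _ := Empty.elim R

/-- The subring `F[z, s⁻¹ : s ∈ S]` of the field of rational functions `F(z)`, for a finite set
`S` of polynomials over the prime field. -/
noncomputable def invRing (p : ℕ) (F : Type*) [Field F] [Algebra (ZMod p) F]
    (S : Finset (Polynomial (ZMod p))) : Subalgebra F (RatFunc F) :=
  Algebra.adjoin F ({RatFunc.X} ∪
    {x | ∃ s ∈ S, x = (algebraMap (Polynomial F) (RatFunc F)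
      (s.map (algebraMap (ZMod p) F)))⁻¹})

/-- The element `z` of `F[z, s⁻¹ : s ∈ S]`. -/
noncomputable def invRing.z (p : ℕ) (F : Type*) [Field F] [Algebra (ZMod p) F]
    (S : Finset (Polynomial (ZMod p))) : invRing p F S :=
  ⟨RatFunc.X, Algebra.subset_adjoin (Or.inl rfl)⟩

/-- The ring `F[z, s⁻¹ : s ∈ S]` as a structure for the extended language: `P_σ` holds of a tuple
if all its entries lie in `F` and `σ` is true of the tuple in the structure `F`. -/
noncomputable instance invRingStructure (p : ℕ) (F : Type*) [Field F] [Algebra (ZMod p) F]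
    (S : Finset (Polynomial (ZMod p))) : (Lpze p).Structure (invRing p F S) where
  funMap f v := match f, v with
    | LpzFunctions.zero, _ => 0
    | LpzFunctions.one, _ => 1
    | LpzFunctions.frob, v => v 0 ^ p
    | LpzFunctions.mulZ, v => invRing.z p F S * v 0
    | LpzFunctions.add, v => v 0 + v 1
  RelMap R v := match R, v with
    | LpzeRelations.memF, v => ∃ a : F, algebraMap F (invRing p F S) a = v 0
    | LpzeRelations.P (n := n) σ, v =>
        ∃ a : Fin n → F, (∀ i, algebraMap F (invRing p F S) (a i) = v i) ∧ σ.Realize a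

/-- The sentence `P_σ` of the extended language, for a sentence `σ` (a formula without free
variables) of the language `{+, =, x ↦ x ^ p, 0, 1}`. -/
def sentenceP {p : ℕ} (σ : (Lp p).Formula (Fin 0)) : (Lpze p).Formula (Fin 0) :=
  FirstOrder.Language.Relations.formula (L := Lpze p) (n := 0) (LpzeRelations.P σ) Fin.elim0

end AddFrob

/-! Let `Q` be the product of the elements of `S`, so that `R = F[z, 1/Q]`. All operations of the
language are additive: apart from the constant 1, a term is a sum of monomials `z^i y^(p^j)`. Since
`F` is perfect, every element of `R` is uniquely of the form `∑ z^i x_i^(p^e)` with `i < p^e`. This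
packs tuples into single elements, and only subsets of `R` have to be studied.

The subsets used are finite unions of clauses. A clause is the set of values of an additive form
`Λ(y, c)`, where `y` ranges over `R` and `c` over `F`, subject to additive equations, additive
inequalities (`≠ 0`) and a formula `σ(c)` about `F`. Such sets are existentially definable
(`exists_dataC`) and include those given by atomic formulas. Intersections are formed by equating
the values of two clauses, and projection along a coordinate adds a free summand `z^j w^(p^e)`. What
remains is closure under complements.

For this, `R` is filtered by finite-dimensional `F`-spaces `V N`, whose elements are described by
finitely many constants. Suppose that all variables of a form have the same top order `p^s` and that
the leading coefficients are independent over the `p^s`-th powers. The coordinates of these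
coefficients form independent columns, which complete to a nonsingular matrix over `F_p[z]`. The top
part of the completed form is then invertible up to the determinant, while the lower terms
contribute only about half as much to the order. This contraction shows that the completed form is
injective and surjective up to elements of bounded order (`Certified.bounded`,
`Certified.cobounded`). Every form can be brought into this shape: a dependence between leading
coefficients gives a substitution that lowers an order (`exists_elim`), and passing to coordinates
equalises the orders (`exists_expand`).

Consequently an equation has only bounded solutions in its variables. These variables become
constants, and the equation becomes a condition over `F` (`den_solve`, `sem_linC`). For a clause
without equations, an element outside it has a completing variable of large order, or fails a
condition over `F`, or meets an inequality whose form takes a bounded value. The last case is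
handled by recursion on the number of inequalities (`notMem_den_iff`, `mem_den_restrict`).

For effectivity, normal forms are never computed. Certificates and transformations are finite data
that are checked primitive recursively, and rules built on them enumerate pairs of complementary
sets and sets defined by formulas. The enumerations are sound (`compEnum_spec`, `defEnum_spec`) and
complete (`exists_compEnum`, `exists_defEnum`), so an unbounded search for a given formula always
succeeds. For a sentence only the non-emptiness of a set matters. `Λ` may then be replaced by zero,
all equations and inequalities disappear, and the existential closure of the remaining `σ` is the
required sentence about `F`. -/

namespace AddFrob

/-! ### Automation for primitive recursive functions -/

section PrimrecRules

attribute [fun_prop] Primrec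
attribute [fun_prop] Primrec.comp Primrec.id Primrec.const Primrec.pair

variable {α β γ σ : Type*} [Primcodable α] [Primcodable β] [Primcodable γ] [Primcodable σ]

@[fun_prop]
theorem primrec_fst {f : α → β × γ} (hf : Primrec f) : Primrec fun a => (f a).1 :=
  Primrec.fst.comp hf

@[fun_prop]
theorem primrec_snd {f : α → β × γ} (hf : Primrec f) : Primrec fun a => (f a).2 :=
  Primrec.snd.comp hf

@[fun_prop]
theorem primrec_add {f g : α → ℕ} (hf : Primrec f) (hg : Primrec g) :
    Primrec fun a => f a + g a := Primrec.nat_add.comp hf hg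

@[fun_prop]
theorem primrec_sub {f g : α → ℕ} (hf : Primrec f) (hg : Primrec g) :
    Primrec fun a => f a - g a := Primrec.nat_sub.comp hf hg

@[fun_prop]
theorem primrec_mul {f g : α → ℕ} (hf : Primrec f) (hg : Primrec g) :
    Primrec fun a => f a * g a := Primrec.nat_mul.comp hf hg

@[fun_prop]
theorem primrec_div {f g : α → ℕ} (hf : Primrec f) (hg : Primrec g) :
    Primrec fun a => f a / g a := Primrec.nat_div.comp hf hg

@[fun_prop]
theorem primrec_mod {f g : α → ℕ} (hf : Primrec f) (hg : Primrec g) :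
    Primrec fun a => f a % g a := Primrec.nat_mod.comp hf hg

@[fun_prop]
theorem primrec_pow {f g : α → ℕ} (hf : Primrec f) (hg : Primrec g) :
    Primrec fun a => f a ^ g a := by
  have h : Primrec₂ fun a b : ℕ => a ^ b := by
    have := Primrec.nat_rec (f := fun _ : ℕ => 1) (g := fun a (x : ℕ × ℕ) => x.2 * a)
      (by fun_prop) (by unfold Primrec₂; fun_prop)
    refine this.of_eq fun a b => ?_
    induction b with
    | zero => simp
    | succ b ih => simp [pow_succ, ← ih]
  exact h.comp hf hg

@[fun_prop]
theorem primrec_natPair {f g : α → ℕ} (hf : Primrec f) (hg : Primrec g) :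
    Primrec fun a => Nat.pair (f a) (g a) := Primrec₂.natPair.comp hf hg

@[fun_prop]
theorem primrec_natUnpair {f : α → ℕ} (hf : Primrec f) :
    Primrec fun a => Nat.unpair (f a) := Primrec.unpair.comp hf

@[fun_prop]
theorem primrec_cond {c : α → Bool} {f g : α → σ} (hc : Primrec c) (hf : Primrec f)
    (hg : Primrec g) : Primrec fun a => bif c a then f a else g a := Primrec.cond hc hf hg

@[fun_prop]
theorem primrec_and {f g : α → Bool} (hf : Primrec f) (hg : Primrec g) :
    Primrec fun a => f a && g a := Primrec.and.comp hf hg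

@[fun_prop]
theorem primrec_or {f g : α → Bool} (hf : Primrec f) (hg : Primrec g) :
    Primrec fun a => f a || g a := Primrec.or.comp hf hg

@[fun_prop]
theorem primrec_not {f : α → Bool} (hf : Primrec f) :
    Primrec fun a => !(f a) := Primrec.not.comp hf

@[fun_prop]
theorem primrec_decide_eq [DecidableEq β] {f g : α → β} (hf : Primrec f) (hg : Primrec g) :
    Primrec fun a => decide (f a = g a) := Primrec.eq.decide.comp hf hg

@[fun_prop]
theorem primrec_decide_le {f g : α → ℕ} (hf : Primrec f) (hg : Primrec g) :
    Primrec fun a => decide (f a ≤ g a) := Primrec.nat_le.decide.comp hf hg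

@[fun_prop]
theorem primrec_decide_lt {f g : α → ℕ} (hf : Primrec f) (hg : Primrec g) :
    Primrec fun a => decide (f a < g a) := Primrec.nat_lt.decide.comp hf hg

@[fun_prop]
theorem primrec_list_cons {f : α → β} {g : α → List β} (hf : Primrec f) (hg : Primrec g) :
    Primrec fun a => f a :: g a := Primrec.list_cons.comp hf hg

@[fun_prop]
theorem primrec_list_append {f g : α → List β} (hf : Primrec f) (hg : Primrec g) :
    Primrec fun a => f a ++ g a := Primrec.list_append.comp hf hg

@[fun_prop]
theorem primrec_list_map {f : α → List β} {g : α → β → σ} (hf : Primrec f)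
    (hg : Primrec fun q : α × β => g q.1 q.2) : Primrec fun a => (f a).map (g a) :=
  Primrec.list_map hf hg

@[fun_prop]
theorem primrec_list_flatMap {f : α → List β} {g : α → β → List σ} (hf : Primrec f)
    (hg : Primrec fun q : α × β => g q.1 q.2) : Primrec fun a => (f a).flatMap (g a) :=
  Primrec.list_flatMap hf hg

@[fun_prop]
theorem primrec_list_foldr {f : α → List β} {g : α → σ} {h : α → β → σ → σ} (hf : Primrec f)
    (hg : Primrec g) (hh : Primrec fun q : α × β × σ => h q.1 q.2.1 q.2.2) :
    Primrec fun a => (f a).foldr (h a) (g a) :=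
  Primrec.list_foldr (h := fun a x => h a x.1 x.2) hf hg hh

@[fun_prop]
theorem primrec_list_foldl {f : α → List β} {g : α → σ} {h : α → σ → β → σ} (hf : Primrec f)
    (hg : Primrec g) (hh : Primrec fun q : α × σ × β => h q.1 q.2.1 q.2.2) :
    Primrec fun a => (f a).foldl (h a) (g a) :=
  Primrec.list_foldl (h := fun a x => h a x.1 x.2) hf hg hh

@[fun_prop]
theorem primrec_list_filter {f : α → List β} {c : α → β → Bool} (hf : Primrec f)
    (hc : Primrec fun q : α × β => c q.1 q.2) : Primrec fun a => (f a).filter (c a) := by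
  have := Primrec.listFilterMap (f := f) (g := fun a b => bif c a b then some b else none) hf
    (Primrec.cond hc (Primrec.option_some.comp Primrec.snd) (Primrec.const none))
  refine this.of_eq fun a => ?_
  rw [← List.filterMap_eq_filter]
  congr 1
  funext b
  cases h : c a b <;> simp [Option.guard, h]

@[fun_prop]
theorem primrec_list_all {f : α → List β} {c : α → β → Bool} (hf : Primrec f)
    (hc : Primrec fun q : α × β => c q.1 q.2) : Primrec fun a => (f a).all (c a) := by
  have : Primrec fun a => (f a).foldr (fun b r => c a b && r) true := by fun_prop
  exact this.of_eq fun a => by induction f a <;> simp_all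

@[fun_prop]
theorem primrec_list_any {f : α → List β} {c : α → β → Bool} (hf : Primrec f)
    (hc : Primrec fun q : α × β => c q.1 q.2) : Primrec fun a => (f a).any (c a) := by
  have : Primrec fun a => (f a).foldr (fun b r => c a b || r) false := by fun_prop
  exact this.of_eq fun a => by induction f a <;> simp_all

@[fun_prop]
theorem primrec_list_length {f : α → List β} (hf : Primrec f) :
    Primrec fun a => (f a).length := Primrec.list_length.comp hf

@[fun_prop]
theorem primrec_list_range {f : α → ℕ} (hf : Primrec f) :
    Primrec fun a => List.range (f a) := Primrec.list_range.comp hf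

@[fun_prop]
theorem primrec_list_sum {f : α → List ℕ} (hf : Primrec f) : Primrec fun a => (f a).sum := by
  have : Primrec fun a => (f a).foldr (fun b r => b + r) 0 := by fun_prop
  exact this.of_eq fun a => by induction f a <;> simp_all

@[fun_prop]
theorem primrec_list_headD {f : α → List β} {g : α → β} (hf : Primrec f) (hg : Primrec g) :
    Primrec fun a => (f a).headD (g a) := by
  have : Primrec fun a => ((f a).head?).getD (g a) :=
    Primrec.option_getD.comp (Primrec.list_head?.comp hf) hg
  exact this.of_eq fun a => by cases f a <;> rfl

@[fun_prop]
theorem primrec_list_getD {f : α → List β} {n : α → ℕ} {d : β} (hf : Primrec f)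
    (hn : Primrec n) : Primrec fun a => (f a).getD (n a) d :=
  (Primrec.list_getD d).comp hf hn

@[fun_prop]
theorem primrec_list_lookup [DecidableEq β] {f : α → β} {l : α → List (β × γ)} (hf : Primrec f)
    (hl : Primrec l) : Primrec fun a => List.lookup (f a) (l a) :=
  Primrec.listLookup.comp hf hl

@[fun_prop]
theorem primrec_option_getD {f : α → Option β} {g : α → β} (hf : Primrec f) (hg : Primrec g) :
    Primrec fun a => (f a).getD (g a) := Primrec.option_getD.comp hf hg

@[fun_prop]
theorem primrec_encode {f : α → β} (hf : Primrec f) :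
    Primrec fun a => Encodable.encode (f a) := Primrec.encode.comp hf

@[fun_prop]
theorem primrec_decode {f : α → ℕ} (hf : Primrec f) :
    Primrec fun a => (Encodable.decode (f a) : Option β) := Primrec.decode.comp hf

@[fun_prop]
theorem primrec_iterate {f : α → ℕ} {g : α → β} {h : α → β → β} (hf : Primrec f) (hg : Primrec g)
    (hh : Primrec fun q : α × β => h q.1 q.2) : Primrec fun a => (h a)^[f a] (g a) :=
  Primrec.nat_iterate hf hg hh

end PrimrecRules

/-! ### Enumerating the closure of a rule -/

section TreeEval

variable {P X : Type} [Primcodable P]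

/-- Evaluation of (the code of) a binary tree whose inner nodes carry parameters. -/
def treeEval (x₀ : X) (f : P → X → X → X) : ℕ → X
  | 0 => x₀
  | n + 1 =>
    match (Encodable.decode n.unpair.1 : Option P) with
    | none => x₀
    | some q => f q (treeEval x₀ f n.unpair.2.unpair.1) (treeEval x₀ f n.unpair.2.unpair.2)
decreasing_by
  · exact Nat.lt_succ_of_le ((Nat.unpair_left_le _).trans (Nat.unpair_right_le _))
  · exact Nat.lt_succ_of_le ((Nat.unpair_right_le _).trans (Nat.unpair_right_le _))

/-- Soundness principle for enumerations: an invariant of the leaf that is kept by all rules holds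
for every enumerated object. Codes that do not decode yield the leaf, so no side condition on `n` is
needed. -/
theorem treeEval_valid {x₀ : X} {f : P → X → X → X} {valid : X → Prop} (h₀ : valid x₀)
    (hf : ∀ q a b, valid a → valid b → valid (f q a b)) (n : ℕ) : valid (treeEval x₀ f n) := by
  induction n using Nat.strong_induction_on with
  | _ n ih =>
    cases n with
    | zero => rwa [treeEval]
    | succ n =>
      rw [treeEval]
      split
      · exact h₀
      · exact hf _ _ _
          (ih _ (Nat.lt_succ_of_le ((Nat.unpair_left_le _).trans (Nat.unpair_right_le _))))
          (ih _ (Nat.lt_succ_of_le ((Nat.unpair_right_le _).trans (Nat.unpair_right_le _))))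

/-- Completeness principle: the enumerated objects are closed under the rule with arbitrary
parameters. -/
theorem exists_treeEval_node (x₀ : X) (f : P → X → X → X) (q : P) (s t : ℕ) :
    ∃ n, treeEval x₀ f n = f q (treeEval x₀ f s) (treeEval x₀ f t) :=
  ⟨Nat.pair (Encodable.encode q) (Nat.pair s t) + 1, by rw [treeEval]; simp⟩

theorem primrec_treeEval [Primcodable X] {x₀ : X} {f : P → X → X → X}
    (hf : Primrec fun q : P × X × X => f q.1 q.2.1 q.2.2) : Primrec (treeEval x₀ f) := by
  have key : Primrec₂ fun (_ : Unit) (n : ℕ) => treeEval x₀ f n := by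
    -- The argument `n` is recovered as the length of the list of earlier values. For `n > 0` the
    -- code that is unpaired is `n - 1`, and both subtrees have smaller indices.
    refine Primrec.nat_strong_rec (α := Unit) (fun _ n => treeEval x₀ f n)
      (g := fun _ l => some (bif decide (l.length = 0) then x₀ else
        ((Encodable.decode (l.length - 1).unpair.1 : Option P).map fun q =>
          f q (l.getD (l.length - 1).unpair.2.unpair.1 x₀)
            (l.getD (l.length - 1).unpair.2.unpair.2 x₀)).getD x₀)) ?_ ?_
    · refine Primrec.option_some.comp (primrec_cond (by fun_prop) (by fun_prop)
        (primrec_option_getD (Primrec.option_map (by fun_prop) ?_) (by fun_prop)))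
      have hg : Primrec fun z : (Unit × List X) × P =>
          (z.2, z.1.2.getD (z.1.2.length - 1).unpair.2.unpair.1 x₀,
            z.1.2.getD (z.1.2.length - 1).unpair.2.unpair.2 x₀) := by fun_prop
      exact hf.comp hg
    · intro _ n
      cases n with
      | zero => simp [treeEval]
      | succ n =>
        have h1 : n.unpair.2.unpair.1 < n + 1 :=
          Nat.lt_succ_of_le ((Nat.unpair_left_le _).trans (Nat.unpair_right_le _))
        have h2 : n.unpair.2.unpair.2 < n + 1 :=
          Nat.lt_succ_of_le ((Nat.unpair_right_le _).trans (Nat.unpair_right_le _))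
        rw [treeEval]
        cases h : (Encodable.decode n.unpair.1 : Option P) <;>
          simp [h, List.getD_eq_getElem?_getD, h1, h2]
  exact key.comp (Primrec.const ()) Primrec.id

end TreeEval

end AddFrob

namespace AddFrob

open Polynomial

/-! ### The localised polynomial ring and its filtration by finite-dimensional spaces -/

/-- The sum of the monomials whose exponents are listed. -/
noncomputable def lpoly {k : Type*} [CommRing k] (l : List ℕ) : k[X] :=
  (l.map fun i => (X : k[X]) ^ i).sum

/-- The numerical data on which the algorithms depend: the characteristic, the exponents of the
inverted polynomial `Q`, and the degree of `z Q`. -/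
structure Par where
  p : ℕ
  D : ℕ
  Q : List ℕ

/-- A presentation of `R` as the localisation of `F[z]` at `Q`, for a perfect field `F`. -/
structure Setting (P : Par) (F R : Type*) [Field F] [CommRing R] where
  prime : P.p.Prime
  char : CharP F P.p
  perfect : ∀ a : F, ∃ b, b ^ P.p = a
  toR : F[X] →+* R
  inj : Function.Injective toR
  qi : R
  mul_qi : toR (lpoly P.Q) * qi = 1
  surj : ∀ x, ∃ n f, x = toR f * qi ^ n
  hD : P.D = (lpoly P.Q : F[X]).natDegree + 1

section Coprime

variable {F : Type*} [Field F]

theorem exists_common_factor {f g : F[X]} (hf : f ≠ 0) (h : ¬ IsCoprime f g) :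
    ∃ π f' g', f = π * f' ∧ g = π * g' ∧ 1 ≤ π.natDegree := by
  classical
  rw [← EuclideanDomain.gcd_isUnit_iff] at h
  obtain ⟨f', hf'⟩ := EuclideanDomain.gcd_dvd_left f g
  obtain ⟨g', hg'⟩ := EuclideanDomain.gcd_dvd_right f g
  refine ⟨_, f', g', hf', hg', ?_⟩
  by_contra hd
  apply h
  rw [Polynomial.isUnit_iff_degree_eq_zero]
  have h0 : EuclideanDomain.gcd f g ≠ 0 := by
    intro h0; rw [h0] at hf'; simp at hf'; exact hf hf'
  rw [Polynomial.degree_eq_natDegree h0]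
  simp; omega

/-- If `P` and `Q` share a factor of positive degree, cancelling it lowers the degree of `P` and
costs at most one factor `Q`; once they are coprime, nothing more is lost. Hence at most `d` factors
are lost, even if `Q` is reducible. -/
theorem pow_sub_dvd_of_pow_dvd_mul {Q : F[X]} (d : ℕ) : ∀ (P f : F[X]) (a : ℕ), P ≠ 0 →
    P.natDegree ≤ d → Q ^ a ∣ P * f → Q ^ (a - d) ∣ f := by
  induction d with
  | zero =>
    intro P f a hP hd h
    have : IsUnit P := by
      rw [Polynomial.isUnit_iff_degree_eq_zero, Polynomial.degree_eq_natDegree hP]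
      simp; omega
    simpa using this.dvd_mul_left.1 h
  | succ d ih =>
    intro P f a hP hd h
    by_cases hc : IsCoprime P Q
    · have := (hc.symm.pow_left (m := a)).dvd_of_dvd_mul_left h
      exact (pow_dvd_pow _ (Nat.sub_le _ _)).trans this
    · obtain ⟨π, P', Q', h1, h2, h3⟩ := exists_common_factor hP hc
      cases a with
      | zero => simp
      | succ a =>
        have hπ : π ≠ 0 := by rintro rfl; simp at h3
        have hP' : P' ≠ 0 := by rintro rfl; simp at h1; exact hP h1
        have h4 : Q ^ a * Q' ∣ P' * f := by
          have : π * (Q ^ a * Q') ∣ π * (P' * f) := by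
            convert h using 1
            · rw [pow_succ]; nth_rewrite 3 [h2]; ring
            · rw [h1]; ring
          exact (mul_dvd_mul_iff_left hπ).1 this
        have h5 := ih P' f a hP' (by
          rw [h1, natDegree_mul hπ hP'] at hd; omega) ((dvd_mul_right _ _).trans h4)
        simpa using h5

end Coprime

namespace Setting

variable {P : Par} {F R : Type*} [Field F] [CommRing R] (K : Setting P F R)

/-- The element `z`. -/
noncomputable def z : R := K.toR X

/-- The embedding of the constants. -/
noncomputable def ι : F →+* R := K.toR.comp C

theorem toR_X : K.toR X = K.z := rfl

theorem toR_C (a : F) : K.toR (C a) = K.ι a := rfl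

theorem toR_lpoly (l : List ℕ) : K.toR (lpoly l) = (l.map fun i => K.z ^ i).sum := by
  simp [lpoly, map_list_sum, Function.comp_def, z]

include K in
theorem charR : CharP R P.p := by
  have := K.char
  exact charP_of_injective_ringHom (f := K.ι) (K.inj.comp C_injective) P.p

include K in
theorem add_pow (a b : R) (j : ℕ) : (a + b) ^ P.p ^ j = a ^ P.p ^ j + b ^ P.p ^ j := by
  have := Fact.mk K.prime
  have := K.charR
  exact add_pow_char_pow a b P.p j

include K in
theorem sub_pow (a b : R) (j : ℕ) : (a - b) ^ P.p ^ j = a ^ P.p ^ j - b ^ P.p ^ j := by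
  have := Fact.mk K.prime
  have := K.charR
  exact sub_pow_char_pow a b j

include K in
theorem sum_pow {β : Type*} (s : Finset β) (f : β → R) (j : ℕ) :
    (∑ i ∈ s, f i) ^ P.p ^ j = ∑ i ∈ s, f i ^ P.p ^ j := by
  have := Fact.mk K.prime
  have := K.charR
  exact sum_pow_char_pow P.p j s f

include K in
theorem p_pos : 0 < P.p := K.prime.pos

include K in
theorem q_pos (j : ℕ) : 0 < P.p ^ j := Nat.pow_pos K.p_pos

theorem mul_qi_pow (n : ℕ) : K.toR (lpoly P.Q) ^ n * K.qi ^ n = 1 := by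
  rw [← mul_pow, K.mul_qi, one_pow]

include K in
theorem lpolyQ_ne_zero : (lpoly P.Q : F[X]) ≠ 0 := by
  intro h
  have h1 := K.mul_qi
  rw [h, map_zero, zero_mul] at h1
  have h2 : K.toR 0 = K.toR 1 := by rw [map_zero, map_one, h1]
  exact zero_ne_one (K.inj h2)

theorem qi_raise (f : F[X]) {n m : ℕ} (h : n ≤ m) :
    K.toR f * K.qi ^ n = K.toR (f * lpoly P.Q ^ (m - n)) * K.qi ^ m := by
  obtain ⟨k, rfl⟩ := Nat.exists_eq_add_of_le h
  have := K.mul_qi_pow k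
  simp only [Nat.add_sub_cancel_left, map_mul, map_pow, pow_add]
  linear_combination (-(K.toR f * K.qi ^ n)) * this

theorem toR_mul_qi_inj {f g : F[X]} {n m : ℕ} (h : K.toR f * K.qi ^ n = K.toR g * K.qi ^ m) :
    f * lpoly P.Q ^ m = g * lpoly P.Q ^ n := by
  apply K.inj
  have h1 := K.mul_qi_pow n
  have h2 := K.mul_qi_pow m
  simp only [map_mul, map_pow]
  linear_combination (K.toR (lpoly P.Q) ^ n * K.toR (lpoly P.Q) ^ m) * h
    - K.toR f * K.toR (lpoly P.Q) ^ m * h1 + K.toR g * K.toR (lpoly P.Q) ^ n * h2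

/-- The elements `f / Q ^ N` with `deg f < N D`. -/
def V (N : ℕ) : AddSubgroup R where
  carrier := {x | ∃ f : F[X], f.degree < (N * P.D : ℕ) ∧ x = K.toR f * K.qi ^ N}
  zero_mem' := ⟨0, by rw [degree_zero]; exact WithBot.bot_lt_coe _, by simp⟩
  add_mem' := by
    rintro _ _ ⟨f, hf, rfl⟩ ⟨g, hg, rfl⟩
    exact ⟨f + g, (degree_add_le _ _).trans_lt (max_lt hf hg), by rw [map_add]; ring⟩
  neg_mem' := by
    rintro _ ⟨f, hf, rfl⟩
    exact ⟨-f, by rwa [degree_neg], by rw [map_neg]; ring⟩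

theorem degree_mul_lt {f g : F[X]} {a b : ℕ} (hf : f.degree < (a : ℕ)) (hg : g.natDegree ≤ b) :
    (f * g).degree < ((a + b : ℕ) : WithBot ℕ) := by
  by_cases hf0 : f = 0
  · subst hf0; simp
  · rw [← natDegree_lt_iff_degree_lt hf0] at hf
    refine (degree_le_natDegree).trans_lt ?_
    have := natDegree_mul_le (p := f) (q := g)
    exact_mod_cast (show (f * g).natDegree < a + b by omega)

/-- Passing from the denominator `Q^n` to `Q^N` multiplies the numerator by `Q^(N-n)`, whose degree
is `(N-n)(D-1)`. Since `D` exceeds the degree of `Q` by one, membership in `V N` bounds the poles at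
the zeros of `Q` and the pole at infinity at the same time. -/
theorem mem_V_of {f : F[X]} {k n N : ℕ} (hf : f.degree < (k : ℕ)) (hn : n ≤ N)
    (hk : k + (N - n) * (P.D - 1) ≤ N * P.D) : K.toR f * K.qi ^ n ∈ K.V N := by
  refine ⟨_, ?_, K.qi_raise f hn⟩
  have h1 : (lpoly P.Q ^ (N - n) : F[X]).natDegree ≤ (N - n) * (P.D - 1) := by
    refine natDegree_pow_le.trans ?_
    rw [K.hD]; simp
  refine (degree_mul_lt hf h1).trans_le ?_
  exact_mod_cast hk

include K in
theorem D_pos : 0 < P.D := by rw [K.hD]; omega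

theorem V_mono {N M : ℕ} (h : N ≤ M) : K.V N ≤ K.V M := by
  rintro _ ⟨f, hf, rfl⟩
  refine K.mem_V_of hf h ?_
  obtain ⟨d, hd⟩ : ∃ d, P.D = d + 1 := ⟨_, K.hD⟩
  obtain ⟨k, rfl⟩ := Nat.exists_eq_add_of_le h
  rw [hd]; simp; nlinarith

theorem V_monomial {N i n : ℕ} {x : R} (hx : x ∈ K.V N) :
    K.z ^ i * K.qi ^ n * x ∈ K.V (N + i + n) := by
  obtain ⟨f, hf, rfl⟩ := hx
  have h : K.z ^ i * K.qi ^ n * (K.toR f * K.qi ^ N) = K.toR (f * X ^ i) * K.qi ^ (N + n) := by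
    rw [map_mul, map_pow, K.toR_X]; ring
  rw [h]
  refine K.mem_V_of (degree_mul_lt hf (natDegree_X_pow_le i)) (by omega) ?_
  obtain ⟨d, hd⟩ : ∃ d, P.D = d + 1 := ⟨_, K.hD⟩
  rw [hd, show N + i + n - (N + n) = i by omega]; simp; nlinarith

theorem V_z_pow {N i : ℕ} {x : R} (hx : x ∈ K.V N) : K.z ^ i * x ∈ K.V (N + i) := by
  have := K.V_monomial (i := i) (n := 0) hx
  simpa using this

theorem toR_mem_V {f : F[X]} {k : ℕ} (hf : f.degree < (k : ℕ)) : K.toR f ∈ K.V k := by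
  have := K.mem_V_of (n := 0) (N := k) hf (Nat.zero_le _) (by
    obtain ⟨d, hd⟩ : ∃ d, P.D = d + 1 := ⟨_, K.hD⟩
    rw [hd]; simp; nlinarith)
  simpa using this

theorem ι_mem_V (a : F) : K.ι a ∈ K.V 1 :=
  K.toR_mem_V (f := C a) (k := 1) (degree_C_le.trans_lt (by norm_num))

/-- The exponent zero has to be excluded: `V 0` contains only zero, and `0^0 = 1`. -/
theorem V_pow {N : ℕ} {x : R} (hx : x ∈ K.V N) (m : ℕ) (hm : 0 < m) : x ^ m ∈ K.V (m * N) := by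
  obtain ⟨f, hf, rfl⟩ := hx
  by_cases hf0 : f = 0
  · subst hf0; simp [hm.ne', (K.V _).zero_mem]
  refine ⟨f ^ m, ?_, by rw [mul_pow, map_pow]; ring⟩
  rw [← natDegree_lt_iff_degree_lt hf0] at hf
  refine degree_le_natDegree.trans_lt ?_
  have h1 := natDegree_pow_le (p := f) (n := m)
  have : (f ^ m).natDegree < m * N * P.D := by
    calc _ ≤ m * f.natDegree := h1
      _ < m * (N * P.D) := Nat.mul_lt_mul_of_pos_left hf hm
      _ = _ := by ring
  exact_mod_cast this

theorem exists_mem_V (x : R) : ∃ N, x ∈ K.V N := by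
  obtain ⟨n, f, rfl⟩ := K.surj x
  refine ⟨(f.natDegree + 1) + n, ?_⟩
  have h1 : K.toR f ∈ K.V (f.natDegree + 1) :=
    K.toR_mem_V (degree_le_natDegree.trans_lt (by exact_mod_cast Nat.lt_succ_self _))
  have := K.V_monomial (i := 0) (n := n) h1
  simpa [mul_comm] using this

/-- Multiplication by `G` can cancel at most `deg G` powers of `Q` in the denominator
(`pow_sub_dvd_of_pow_dvd_mul`), and it does not lower the degree of the numerator. -/
theorem mem_V_of_mul_mem {G : F[X]} (hG : G ≠ 0) {d N : ℕ} (hd : G.natDegree ≤ d) {x : R}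
    (hx : K.toR G * x ∈ K.V N) : x ∈ K.V (N + d) := by
  obtain ⟨n, f, rfl⟩ := K.surj x
  rw [K.qi_raise f (show n ≤ n + (N + d) by omega)] at hx ⊢
  set m := n + (N + d) with hm
  generalize f * lpoly P.Q ^ (m - n) = f at hx ⊢
  obtain ⟨g, hg, h⟩ := hx
  have h1 : K.toR (G * f) * K.qi ^ m = K.toR g * K.qi ^ N := by rw [map_mul, ← h]; ring
  have h2 := K.toR_mul_qi_inj h1
  have hQ := K.lpolyQ_ne_zero
  have h3 : G * f = g * lpoly P.Q ^ (m - N) := by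
    apply mul_right_cancel₀ (pow_ne_zero N hQ)
    rw [h2, mul_assoc, ← pow_add]
    congr 2; omega
  obtain ⟨e, he⟩ := pow_sub_dvd_of_pow_dvd_mul (Q := lpoly P.Q) d G f (m - N) hG hd
    ⟨g, by rw [h3]; ring⟩
  have h4 : m - N - d = n := by omega
  rw [h4] at he
  have h5 : K.toR f * K.qi ^ m = K.toR e * K.qi ^ (N + d) := by
    have := K.mul_qi_pow n
    rw [he, hm, map_mul, map_pow, pow_add]
    linear_combination (K.toR e * K.qi ^ (N + d)) * this
  refine ⟨e, ?_, h5⟩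
  have h6 : G * e = g * lpoly P.Q ^ d := by
    apply mul_left_cancel₀ (pow_ne_zero n hQ)
    have : m - N = n + d := by omega
    rw [this, he] at h3
    linear_combination h3
  have h7 : (G * e).degree < ((N * P.D + d * (P.D - 1) : ℕ) : WithBot ℕ) := by
    rw [h6]
    refine degree_mul_lt hg (natDegree_pow_le.trans ?_)
    rw [K.hD]; simp
  have h8 : e.degree ≤ (G * e).degree := by
    rw [mul_comm]; exact degree_le_mul_left _ hG
  refine (h8.trans_lt h7).trans_le ?_
  have : N * P.D + d * (P.D - 1) ≤ (N + d) * P.D := by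
    rw [add_mul]; gcongr; omega
  exact_mod_cast this

/-- If `G` is prime to `Q`, then `Q` is invertible modulo `G`, so division with remainder works for
fractions as well. A common factor of `G` and `Q` is a unit of `R`; it can be removed from `G`,
which lowers the degree. -/
theorem exists_eq_add_mul (d : ℕ) : ∀ G : F[X], G ≠ 0 → G.natDegree ≤ d → ∀ x : R,
    ∃ (v : F[X]) (y : R), v.degree < (d : ℕ) ∧ x = K.toR v + K.toR G * y := by
  have cop : ∀ (d : ℕ) (G : F[X]), G ≠ 0 → G.natDegree ≤ d → IsCoprime G (lpoly P.Q) →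
      ∀ x : R, ∃ (v : F[X]) (y : R), v.degree < (d : ℕ) ∧ x = K.toR v + K.toR G * y := by
    intro d G hG hd hc x
    obtain ⟨n, f, rfl⟩ := K.surj x
    obtain ⟨a, b, hab⟩ := hc.pow_right (n := n)
    refine ⟨(f * b) % G, K.toR (f * a + (f * b) / G * lpoly P.Q ^ n) * K.qi ^ n, ?_, ?_⟩
    -- By the Bezout identity `a G + b Q^n = 1`, the fraction `f / Q^n` is congruent to `f b` modulo
    -- `G`; the remainder of `f b` is the required polynomial.
    · refine (EuclideanDomain.mod_lt _ hG).trans_le ?_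
      exact (degree_le_natDegree).trans (by exact_mod_cast hd)
    · have h1 := EuclideanDomain.mod_add_div (f * b) G
      have h2 := K.mul_qi_pow n
      have h3 : f = (f * b) % G * lpoly P.Q ^ n +
          G * (f * a + (f * b) / G * lpoly P.Q ^ n) := by
        linear_combination (-f) * hab - lpoly P.Q ^ n * h1
      have h4 := congrArg K.toR h3
      simp only [map_add, map_mul, map_pow] at h4 ⊢
      linear_combination K.qi ^ n * h4 + K.toR ((f * b) % G) * h2
  induction d with
  | zero =>
    intro G hG hd
    refine cop 0 G hG hd ?_
    have : IsUnit G := by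
      rw [Polynomial.isUnit_iff_degree_eq_zero, Polynomial.degree_eq_natDegree hG]
      simp; omega
    exact (isCoprime_one_left (x := lpoly P.Q)).of_isCoprime_of_dvd_left this.dvd
  | succ d ih =>
    intro G hG hd x
    by_cases hc : IsCoprime G (lpoly P.Q)
    · exact cop _ G hG hd hc x
    · obtain ⟨π, G', Q', h1, h2, h3⟩ := exists_common_factor hG hc
      have hπ : π ≠ 0 := by rintro rfl; simp at h3
      have hG' : G' ≠ 0 := by rintro rfl; simp at h1; exact hG h1
      obtain ⟨v, y, hv, hx⟩ := ih G' hG' (by rw [h1, natDegree_mul hπ hG'] at hd; omega) x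
      refine ⟨v, y * (K.toR Q' * K.qi), hv.trans_le (by exact_mod_cast Nat.le_succ d), ?_⟩
      have h4 := K.mul_qi
      rw [h2, map_mul] at h4
      rw [hx, h1, map_mul]
      linear_combination (-(K.toR G' * y)) * h4

/-- The polynomial `z Q + 1`, which is prime to `Q`. -/
noncomputable def G : F[X] := X * lpoly P.Q + 1

include K in
theorem natDegree_G : (G (P := P) : F[X]).natDegree = P.D := by
  have hQ := K.lpolyQ_ne_zero
  rw [G, natDegree_add_eq_left_of_natDegree_lt, natDegree_X_mul hQ, K.hD]
  rw [natDegree_X_mul hQ]; simp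

include K in
theorem G_ne_zero : (G (P := P) : F[X]) ≠ 0 := by
  intro h
  have h1 := K.natDegree_G
  rw [h, natDegree_zero] at h1
  have := K.D_pos
  omega

include K in
theorem natDegree_G_pow (N : ℕ) : ((G (P := P) : F[X]) ^ N).natDegree = N * P.D := by
  rw [natDegree_pow, K.natDegree_G]

/-- Division of `x Q^N` by `G^N`, of degree `N D`, leaves a remainder that becomes an element of `V
N` after division by `Q^N`. Together with `eq_zero_of_G_pow_mul_mem` this gives a direct sum `R = V
N ⊕ G^N R`, so that "not in `V N`" can be expressed by an inequality `y ≠ 0`. -/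
theorem exists_eq_add_G_pow_mul (N : ℕ) (x : R) :
    ∃ v ∈ K.V N, ∃ y : R, x = v + K.toR (G (P := P)) ^ N * y := by
  obtain ⟨v, y, hv, h⟩ := K.exists_eq_add_mul (N * P.D) (G (P := P) ^ N)
    (pow_ne_zero _ K.G_ne_zero) (K.natDegree_G_pow N).le (x * K.toR (lpoly P.Q) ^ N)
  refine ⟨K.toR v * K.qi ^ N, ⟨v, hv, rfl⟩, y * K.qi ^ N, ?_⟩
  rw [map_pow] at h
  linear_combination K.qi ^ N * h - x * K.mul_qi_pow N

/-- As `G^N` is prime to `Q`, it would divide the numerator of an element of `V N`, whose degree is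
smaller than `N D = deg G^N`. -/
theorem eq_zero_of_G_pow_mul_mem {N : ℕ} {y : R} (h : K.toR (G (P := P)) ^ N * y ∈ K.V N) :
    y = 0 := by
  obtain ⟨v, hv, h⟩ := h
  obtain ⟨n, g, rfl⟩ := K.surj y
  have h1 : K.toR (G (P := P) ^ N * g) * K.qi ^ n = K.toR v * K.qi ^ N := by
    rw [← h, map_mul, map_pow]; ring
  have h2 := K.toR_mul_qi_inj h1
  have hc : IsCoprime (G (P := P) ^ N : F[X]) (lpoly P.Q ^ n) :=
    IsCoprime.pow (show IsCoprime (G (P := P)) (lpoly P.Q : F[X]) from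
      ⟨1, -X, by rw [G]; ring⟩)
  have h3 : G (P := P) ^ N ∣ v :=
    hc.dvd_of_dvd_mul_right ⟨g * lpoly P.Q ^ N, by rw [← h2]; ring⟩
  have hv0 : v = 0 := by
    by_contra hv0
    have h4 := natDegree_le_of_dvd h3 hv0
    rw [K.natDegree_G_pow] at h4
    rw [← natDegree_lt_iff_degree_lt hv0] at hv
    omega
  rw [hv0, zero_mul] at h2
  have := K.lpolyQ_ne_zero
  have := K.G_ne_zero
  simp_all

end Setting

end AddFrob

namespace AddFrob

open Polynomial

/-! ### Coordinates with respect to the powers of `z` over the `p ^ e`-th powers -/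

section Coordinates

variable {k : Type*} [Field k] {p : ℕ} [Fact p.Prime] [CharP k p]

theorem coeff_pow_char_pow (f : k[X]) (n m : ℕ) :
    (f ^ p ^ n).coeff m = if p ^ n ∣ m then f.coeff (m / p ^ n) ^ p ^ n else 0 := by
  have hp : 0 < p ^ n := Nat.pow_pos (Fact.out (p := p.Prime)).pos
  rw [← map_iterateFrobenius_expand p f n, coeff_map, coeff_expand hp]
  split_ifs
  · simp [iterateFrobenius_def]
  · simp [iterateFrobenius_def, zero_pow hp.ne']

/-- The exponents occurring in the summand with index `l` are congruent to `l` modulo `p^n`, so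
different summands do not interfere. -/
theorem coeff_sum_coordinates (g : ℕ → k[X]) (n i l : ℕ) (hl : l < p ^ n) :
    (∑ l ∈ Finset.range (p ^ n), X ^ l * g l ^ p ^ n).coeff (p ^ n * i + l)
      = (g l).coeff i ^ p ^ n := by
  have hp : 0 < p ^ n := Nat.pow_pos (Fact.out (p := p.Prime)).pos
  rw [finsetSum_coeff, Finset.sum_eq_single l]
  · rw [coeff_X_pow_mul, coeff_pow_char_pow, if_pos (dvd_mul_right _ _),
      Nat.mul_div_cancel_left _ hp]
  · intro l' hl' hne
    rw [Finset.mem_range] at hl'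
    rw [coeff_X_pow_mul', coeff_pow_char_pow]
    split_ifs with h1 h2
    · exfalso
      obtain ⟨c, hc⟩ := h2
      have h3 : (p ^ n * i + l) % p ^ n = (p ^ n * c + l') % p ^ n := by
        congr 1; omega
      rw [Nat.mul_add_mod, Nat.mul_add_mod, Nat.mod_eq_of_lt hl, Nat.mod_eq_of_lt hl'] at h3
      exact hne h3.symm
    · rfl
    · rfl
  · intro h; simp [hl] at h

theorem coordinates_unique {g h : ℕ → k[X]} {n : ℕ}
    (e : ∑ l ∈ Finset.range (p ^ n), X ^ l * g l ^ p ^ n =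
      ∑ l ∈ Finset.range (p ^ n), X ^ l * h l ^ p ^ n) {l : ℕ} (hl : l < p ^ n) : g l = h l := by
  ext i
  have h1 := congrArg (fun f => f.coeff (p ^ n * i + l)) e
  simp only [coeff_sum_coordinates _ _ _ _ hl] at h1
  exact iterateFrobenius_inj k p n (by simpa [iterateFrobenius_def] using h1)

/-- Sort the monomials by their exponents modulo `p^n` and extract `p^n`-th roots of the
coefficients. -/
theorem exists_coordinates (hperf : ∀ a : k, ∃ b, b ^ p = a) (n : ℕ) {m : ℕ} {f : k[X]}
    (hf : f.degree < ((p ^ n * m : ℕ) : WithBot ℕ)) : ∃ g : ℕ → k[X],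
      (∀ l, (g l).degree < (m : ℕ)) ∧ f = ∑ l ∈ Finset.range (p ^ n), X ^ l * g l ^ p ^ n := by
  have hp : 0 < p ^ n := Nat.pow_pos (Fact.out (p := p.Prime)).pos
  have hr : ∀ a : k, ∃ b, b ^ p ^ n = a := by
    intro a
    induction n with
    | zero => exact ⟨a, by simp⟩
    | succ n ih =>
      clear ih
      -- The outer induction hypothesis depends on the degree bound for `f`; the roots are extracted
      -- by a separate induction on the exponent.
      have : ∀ n : ℕ, ∃ b, b ^ p ^ n = a := by
        intro n
        induction n with
        | zero => exact ⟨a, by simp⟩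
        | succ n ih =>
          obtain ⟨b, hb⟩ := ih
          obtain ⟨c, hc⟩ := hperf b
          exact ⟨c, by rw [pow_succ', pow_mul, hc, hb]⟩
      exact this _
  choose r hr using hr
  have hcoef : ∀ l i, (∑ i ∈ Finset.range m, C (r (f.coeff (p ^ n * i + l))) * X ^ i).coeff i
      = if i < m then r (f.coeff (p ^ n * i + l)) else 0 := by
    intro l i
    simp [coeff_X_pow]
  refine ⟨fun l => ∑ i ∈ Finset.range m, C (r (f.coeff (p ^ n * i + l))) * X ^ i, ?_, ?_⟩
  · intro l
    rw [degree_lt_iff_coeff_zero]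
    intro i hi
    rw [hcoef, if_neg (by omega)]
  · ext j
    obtain ⟨i, l, hl, rfl⟩ : ∃ i l, l < p ^ n ∧ j = p ^ n * i + l :=
      ⟨j / p ^ n, j % p ^ n, Nat.mod_lt _ hp, (Nat.div_add_mod _ _).symm⟩
    rw [coeff_sum_coordinates _ _ _ _ hl, hcoef]
    split_ifs with h
    · rw [hr]
    · rw [zero_pow hp.ne']
      rw [degree_lt_iff_coeff_zero] at hf
      apply hf
      have : p ^ n * m ≤ p ^ n * i := Nat.mul_le_mul_left _ (by omega)
      omega

end Coordinates

namespace Setting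

variable {P : Par} {F R : Type*} [Field F] [CommRing R] (K : Setting P F R)

/-- The denominator `Q^(p^n m)` is the `p^n`-th power of `Q^m`, so only the numerator has to be
split. Taking coordinates divides the order by `p^n`, which is the source of the contraction used
for certified forms. -/
theorem exists_coordinates (n : ℕ) {m : ℕ} {x : R} (hx : x ∈ K.V (P.p ^ n * m)) :
    ∃ c : ℕ → R, (∀ l, c l ∈ K.V m) ∧
      x = ∑ l ∈ Finset.range (P.p ^ n), K.z ^ l * c l ^ P.p ^ n := by
  have := Fact.mk K.prime
  have := K.char
  obtain ⟨f, hf, rfl⟩ := hx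
  obtain ⟨g, hg, h⟩ := AddFrob.exists_coordinates (p := P.p) K.perfect n (m := m * P.D) (f := f)
    (by rwa [mul_assoc] at hf)
  refine ⟨fun l => K.toR (g l) * K.qi ^ m, fun l => ⟨g l, hg l, rfl⟩, ?_⟩
  rw [h, map_sum, Finset.sum_mul]
  refine Finset.sum_congr rfl fun l _ => ?_
  rw [map_mul, map_pow, map_pow, K.toR_X]
  ring

theorem exists_coordinates' (n : ℕ) (x : R) :
    ∃ c : ℕ → R, x = ∑ l ∈ Finset.range (P.p ^ n), K.z ^ l * c l ^ P.p ^ n := by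
  obtain ⟨N, hN⟩ := K.exists_mem_V x
  obtain ⟨c, -, hc⟩ := K.exists_coordinates n (m := N)
    (K.V_mono (Nat.le_mul_of_pos_left N (K.q_pos n)) hN)
  exact ⟨c, hc⟩

theorem coordinates_eq_zero {n : ℕ} {c : ℕ → R}
    (h : ∑ l ∈ Finset.range (P.p ^ n), K.z ^ l * c l ^ P.p ^ n = 0) {l : ℕ} (hl : l < P.p ^ n) :
    c l = 0 := by
  have := Fact.mk K.prime
  have := K.char
  choose N hN using fun l => K.exists_mem_V (c l)
  -- A common exponent for the denominators of the finitely many coordinates, which reduces the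
  -- claim to polynomials.
  set M : ℕ := ∑ l ∈ Finset.range (P.p ^ n), N l
  have hM : ∀ l : ℕ, ∃ f : F[X], l < P.p ^ n → c l = K.toR f * K.qi ^ M := by
    intro l
    by_cases hl : l < P.p ^ n
    · obtain ⟨f, -, hf⟩ := K.V_mono (show N l ≤ M from Finset.single_le_sum (f := N) (fun _ _ => Nat.zero_le _)
        (Finset.mem_range.2 hl)) (hN l)
      exact ⟨f, fun _ => hf⟩
    · exact ⟨0, fun h => absurd h hl⟩
  choose f hf using hM
  have h1 : K.toR (∑ l ∈ Finset.range (P.p ^ n), X ^ l * f l ^ P.p ^ n) = K.toR 0 := by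
    have h2 : K.toR (∑ l ∈ Finset.range (P.p ^ n), X ^ l * f l ^ P.p ^ n) *
        K.qi ^ (P.p ^ n * M) = 0 := by
      rw [← h, map_sum, Finset.sum_mul]
      refine Finset.sum_congr rfl fun l hl => ?_
      rw [hf l (Finset.mem_range.1 hl), map_mul, map_pow, map_pow, K.toR_X]
      ring
    have h3 := K.mul_qi_pow (P.p ^ n * M)
    rw [map_zero]
    linear_combination K.toR (lpoly P.Q) ^ (P.p ^ n * M) * h2
      - K.toR (∑ l ∈ Finset.range (P.p ^ n), X ^ l * f l ^ P.p ^ n) * h3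
  have h2 := K.inj h1
  have h3 := coordinates_unique (p := P.p) (g := f) (h := fun _ => 0) (n := n) (by
    rw [h2]; symm; apply Finset.sum_eq_zero; intro l _
    rw [zero_pow (K.q_pos n).ne', mul_zero]) hl
  rw [hf l hl, h3, map_zero, zero_mul]

theorem coordinates_unique {n : ℕ} {c d : ℕ → R}
    (h : ∑ l ∈ Finset.range (P.p ^ n), K.z ^ l * c l ^ P.p ^ n =
      ∑ l ∈ Finset.range (P.p ^ n), K.z ^ l * d l ^ P.p ^ n) {l : ℕ} (hl : l < P.p ^ n) :
    c l = d l := by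
  rw [← sub_eq_zero]
  refine K.coordinates_eq_zero (c := fun l => c l - d l) (n := n) ?_ hl
  rw [← sub_eq_zero.2 h, ← Finset.sum_sub_distrib]
  refine Finset.sum_congr rfl fun l _ => ?_
  rw [K.sub_pow]; ring

theorem coordinates_mem_V {n m : ℕ} {c : ℕ → R}
    (h : ∑ l ∈ Finset.range (P.p ^ n), K.z ^ l * c l ^ P.p ^ n ∈ K.V (P.p ^ n * m)) {l : ℕ}
    (hl : l < P.p ^ n) : c l ∈ K.V m := by
  obtain ⟨d, hd, h'⟩ := K.exists_coordinates n h
  rw [K.coordinates_unique h' hl]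
  exact hd l

include K in
theorem infinite : Infinite R := by
  refine Infinite.of_injective (fun n : ℕ => K.toR (X ^ n)) fun a b h => ?_
  have := congrArg natDegree (K.inj h)
  simpa using this

/-- A non-trivial additive polynomial takes a given value at finitely many points only. -/
theorem finite_additive_roots [IsDomain R] (l : List (ℕ × ℕ)) (b : R) (j : ℕ)
    (h : ((l.filter fun m => decide (m.2 = j)).map fun m => K.z ^ m.1).sum ≠ 0) :
    {r : R | (l.map fun m => K.z ^ m.1 * r ^ P.p ^ m.2).sum = b}.Finite := by
  classical
  set f : R[X] := (l.map fun m => C (K.z ^ m.1) * X ^ P.p ^ m.2).sum - C b with hf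
  have h0 : f ≠ 0 := by
    intro h0
    -- Since `p^j ≠ 0`, the constant `b` does not contribute to this coefficient; since `j ↦ p^j` is
    -- injective, it is exactly the sum assumed to be nonzero.
    have h1 : f.coeff (P.p ^ j) = 0 := by rw [h0, coeff_zero]
    apply h
    rw [hf, coeff_sub, coeff_C_of_ne_zero (K.q_pos j).ne', sub_zero] at h1
    rw [← h1]
    clear h h1 hf h0
    clear f
    induction l with
    | nil => simp
    | cons m l ih =>
      rw [List.map_cons, List.sum_cons, coeff_add, ← ih, coeff_C_mul, coeff_X_pow]
      have : P.p ^ j = P.p ^ m.2 ↔ m.2 = j := by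
        rw [Nat.pow_right_inj K.prime.two_le, eq_comm]
      by_cases hm : m.2 = j <;> simp [this, hm]
  refine (f.roots.toFinset.finite_toSet).subset fun r hr => ?_
  simp only [Set.mem_ofPred_eq] at hr
  simp only [Finset.mem_coe, Multiset.mem_toFinset, mem_roots h0, IsRoot.def]
  rw [hf, eval_sub, eval_C, sub_eq_zero, ← hr]
  rw [← coe_evalRingHom, map_list_sum]
  simp [Function.comp_def]

end Setting

end AddFrob

namespace AddFrob

/-! ### Additive forms -/

/-- A sum of terms `z ^ i * y_v ^ (p ^ j)`, listed as `(v, i, j)`. -/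
abbrev RForm := List (ℕ × ℕ × ℕ)

/-- A sum of terms `z ^ i * Q ^ (-n) * c_v ^ (p ^ j)` in constants `c_v`, listed as
`(v, i, n, j)`. -/
abbrev FForm := List (ℕ × ℕ × ℕ × ℕ)

/-- An additive form in variables ranging over `R` and variables ranging over `F`. -/
abbrev Form := RForm × FForm

/-- Composition of `z ^ i * y ^ (p ^ j)` with a form. -/
def monoR (P : Par) (i j : ℕ) (g : RForm) : RForm :=
  g.map fun m => (m.1, i + P.p ^ j * m.2.1, j + m.2.2)

/-- Composition of `z ^ i * y ^ (p ^ j)` with a form. -/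
def monoF (P : Par) (i j : ℕ) (g : FForm) : FForm :=
  g.map fun m => (m.1, i + P.p ^ j * m.2.1, P.p ^ j * m.2.2.1, j + m.2.2.2)

/-- Substitution of the forms `h v` for the variables of `f`. -/
def sub (P : Par) (h : ℕ → Form) (f : RForm) : Form :=
  (f.flatMap fun m => monoR P m.2.1 m.2.2 (h m.1).1,
    f.flatMap fun m => monoF P m.2.1 m.2.2 (h m.1).2)

/-- Substitution in a form with constants. -/
def subForm (P : Par) (h : ℕ → Form) (f : Form) : Form :=
  ((sub P h f.1).1, (sub P h f.1).2 ++ f.2)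

/-- The negative of a form in characteristic `p`. -/
def neg (P : Par) {β : Type} (f : List β) : List β :=
  (List.range (P.p - 1)).flatMap fun _ => f

/-- Number of occurrences. -/
def cnt {β : Type} [DecidableEq β] (f : List β) (m : β) : ℕ :=
  (f.filter fun x => decide (x = m)).length

/-- Removal of the terms whose multiplicity is divisible by `p`. -/
def clean (P : Par) (f : RForm) : RForm := f.filter fun m => !decide (cnt f m % P.p = 0)

/-- The general element of `{f / Q ^ N : deg f < n}`. -/
def vform (n N L : ℕ) : FForm := (List.range n).map fun k => (L + k, k, N, 0)

/-- A bound for the constants that occur. -/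
def fbd (f : FForm) : ℕ := (f.map fun m => m.1 + 1).sum

/-- A bound for the degrees of the coefficients. -/
def wtR (f : RForm) : ℕ := (f.map fun m => m.2.1).sum

/-- A bound for the orders of the coefficients. -/
def wtF (f : FForm) : ℕ := (f.map fun m => 1 + m.2.1 + m.2.2.1).sum

section Primrec

variable {α β : Type} [Primcodable α] [Primcodable β] {P : Par}

@[fun_prop]
theorem primrec_monoR {i j : α → ℕ} {g : α → RForm} (hi : Primrec i) (hj : Primrec j)
    (hg : Primrec g) : Primrec fun a => monoR P (i a) (j a) (g a) := by
  unfold monoR; fun_prop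

@[fun_prop]
theorem primrec_monoF {i j : α → ℕ} {g : α → FForm} (hi : Primrec i) (hj : Primrec j)
    (hg : Primrec g) : Primrec fun a => monoF P (i a) (j a) (g a) := by
  unfold monoF; fun_prop

@[fun_prop]
theorem primrec_subForm {h : α → ℕ → Form} {f : α → Form}
    (hh : Primrec fun q : α × ℕ => h q.1 q.2) (hf : Primrec f) :
    Primrec fun a => subForm P (h a) (f a) := by
  unfold subForm; fun_prop

@[fun_prop]
theorem primrec_neg {f : α → List β} (hf : Primrec f) : Primrec fun a => neg P (f a) := by
  unfold neg; fun_prop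

@[fun_prop]
theorem primrec_cnt [DecidableEq β] {f : α → List β} {m : α → β} (hf : Primrec f)
    (hm : Primrec m) : Primrec fun a => cnt (f a) (m a) := by
  unfold cnt; fun_prop

@[fun_prop]
theorem primrec_clean {f : α → RForm} (hf : Primrec f) : Primrec fun a => clean P (f a) := by
  unfold clean; fun_prop

@[fun_prop]
theorem primrec_vform {n N L : α → ℕ} (hn : Primrec n) (hN : Primrec N) (hL : Primrec L) :
    Primrec fun a => vform (n a) (N a) (L a) := by
  unfold vform; fun_prop

@[fun_prop]
theorem primrec_fbd {f : α → FForm} (hf : Primrec f) : Primrec fun a => fbd (f a) := by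
  unfold fbd; fun_prop

@[fun_prop]
theorem primrec_wtR {f : α → RForm} (hf : Primrec f) : Primrec fun a => wtR (f a) := by
  unfold wtR; fun_prop

@[fun_prop]
theorem primrec_wtF {f : α → FForm} (hf : Primrec f) : Primrec fun a => wtF (f a) := by
  unfold wtF; fun_prop

end Primrec

theorem lt_fbd {f : FForm} {m} (h : m ∈ f) : m.1 < fbd f :=
  List.single_le_sum (by simp) _ (List.mem_map_of_mem (f := fun m => m.1 + 1) h)

theorem le_wtR {f : RForm} {m} (h : m ∈ f) : m.2.1 ≤ wtR f :=
  List.single_le_sum (by simp) _ (List.mem_map_of_mem (f := fun m => m.2.1) h)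

theorem le_wtF {f : FForm} {m} (h : m ∈ f) : 1 + m.2.1 + m.2.2.1 ≤ wtF f :=
  List.single_le_sum (by simp) _ (List.mem_map_of_mem (f := fun m => 1 + m.2.1 + m.2.2.1) h)

theorem cnt_eq_count {β : Type} [DecidableEq β] (f : List β) (m : β) : cnt f m = f.count m := by
  rw [cnt, List.count, List.countP_eq_length_filter]
  congr 1

/-- Terms whose multiplicity is divisible by `p` do not contribute to a sum in
characteristic `p`. -/
theorem sum_map_clean {A : Type*} [AddCommMonoid A] {P : Par} (hA : ∀ a : A, P.p • a = 0)
    (f : RForm) (g : ℕ × ℕ × ℕ → A) : ((clean P f).map g).sum = (f.map g).sum := by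
  rw [Finset.sum_list_map_count, Finset.sum_list_map_count, clean]
  rw [List.toFinset_filter, Finset.sum_filter]
  refine Finset.sum_congr rfl fun m _ => ?_
  split_ifs with h
  · congr 1
    exact @List.count_filter _ instBEqOfDecidableEq _ (fun m => !decide (cnt f m % P.p = 0)) _ _ h
  · simp only [Bool.not_eq_true', decide_eq_false_iff_not, not_not] at h
    rw [cnt_eq_count] at h
    obtain ⟨c, hc⟩ := Nat.dvd_of_mod_eq_zero h
    rw [hc, mul_comm, mul_nsmul', hA, nsmul_zero]

theorem mem_clean {P : Par} {f : RForm} {m} (h : m ∈ clean P f) : m ∈ f := List.mem_of_mem_filter h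

namespace Setting

variable {P : Par} {F R : Type*} [Field F] [CommRing R] (K : Setting P F R)

/-- Value of a form in the variables ranging over `R`. -/
noncomputable def evalR (ρ : ℕ → R) (f : RForm) : R :=
  (f.map fun m => K.z ^ m.2.1 * ρ m.1 ^ P.p ^ m.2.2).sum

/-- Value of a form in the variables ranging over `F`. -/
noncomputable def evalF (γ : ℕ → F) (f : FForm) : R :=
  (f.map fun m => K.z ^ m.2.1 * K.qi ^ m.2.2.1 * K.ι (γ m.1) ^ P.p ^ m.2.2.2).sum

/-- Value of a form. -/
noncomputable def ev (ρ : ℕ → R) (γ : ℕ → F) (f : Form) : R := K.evalR ρ f.1 + K.evalF γ f.2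

@[simp] theorem evalR_nil (ρ : ℕ → R) : K.evalR ρ [] = 0 := rfl

@[simp] theorem evalF_nil (γ : ℕ → F) : K.evalF γ [] = 0 := rfl

theorem evalR_cons (ρ : ℕ → R) (m) (f : RForm) :
    K.evalR ρ (m :: f) = K.z ^ m.2.1 * ρ m.1 ^ P.p ^ m.2.2 + K.evalR ρ f := by
  simp [evalR]

theorem evalF_cons (γ : ℕ → F) (m) (f : FForm) :
    K.evalF γ (m :: f)
      = K.z ^ m.2.1 * K.qi ^ m.2.2.1 * K.ι (γ m.1) ^ P.p ^ m.2.2.2 + K.evalF γ f := by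
  simp [evalF]

@[simp] theorem evalR_append (ρ : ℕ → R) (f g : RForm) :
    K.evalR ρ (f ++ g) = K.evalR ρ f + K.evalR ρ g := by simp [evalR]

@[simp] theorem evalF_append (γ : ℕ → F) (f g : FForm) :
    K.evalF γ (f ++ g) = K.evalF γ f + K.evalF γ g := by simp [evalF]

theorem evalR_monoR (ρ : ℕ → R) (i j : ℕ) (f : RForm) :
    K.evalR ρ (monoR P i j f) = K.z ^ i * K.evalR ρ f ^ P.p ^ j := by
  induction f with
  | nil => simp [monoR, zero_pow (K.q_pos j).ne']
  | cons m f ih =>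
    rw [evalR_cons, K.add_pow, mul_add, ← ih, monoR, List.map_cons, evalR_cons, ← monoR]
    simp only [pow_add, pow_mul, mul_pow]
    ring

theorem evalF_monoF (γ : ℕ → F) (i j : ℕ) (f : FForm) :
    K.evalF γ (monoF P i j f) = K.z ^ i * K.evalF γ f ^ P.p ^ j := by
  induction f with
  | nil => simp [monoF, zero_pow (K.q_pos j).ne']
  | cons m f ih =>
    rw [evalF_cons, K.add_pow, mul_add, ← ih, monoF, List.map_cons, evalF_cons, ← monoF]
    simp only [pow_add, pow_mul, mul_pow]
    ring

theorem ev_sub (ρ : ℕ → R) (γ : ℕ → F) (h : ℕ → Form) (f : RForm) :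
    K.ev ρ γ (sub P h f) = K.evalR (fun v => K.ev ρ γ (h v)) f := by
  induction f with
  | nil => simp [sub, ev]
  | cons m f ih =>
    rw [evalR_cons, ← ih]
    simp only [sub, ev, List.flatMap_cons, evalR_append, evalF_append, evalR_monoR, evalF_monoF,
      K.add_pow]
    ring

theorem ev_subForm (ρ : ℕ → R) (γ : ℕ → F) (h : ℕ → Form) (f : Form) :
    K.ev ρ γ (subForm P h f) = K.ev (fun v => K.ev ρ γ (h v)) γ f := by
  have := K.ev_sub ρ γ h f.1
  simp only [subForm, ev, evalF_append] at this ⊢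
  rw [← this]; ring

include K in
theorem p_smul (x : R) : P.p • x = 0 := by
  have := K.charR
  rw [nsmul_eq_mul, CharP.cast_eq_zero, zero_mul]

include K in
theorem sub_one_smul (x : R) : (P.p - 1) • x = -x := by
  have h := K.p_smul x
  obtain ⟨q, hq⟩ := Nat.exists_eq_succ_of_ne_zero K.prime.ne_zero
  rw [hq] at h ⊢
  rw [Nat.succ_sub_one]
  rw [succ_nsmul] at h
  exact eq_neg_of_add_eq_zero_left h

include K in
theorem sum_map_neg {β : Type} (f : List β) (g : β → R) :
    ((neg P f).map g).sum = -(f.map g).sum := by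
  rw [← K.sub_one_smul, neg]
  generalize P.p - 1 = n
  induction n with
  | zero => simp
  | succ n ih =>
    rw [List.range_succ, List.flatMap_append, List.map_append, List.sum_append, ih, succ_nsmul]
    simp

@[simp] theorem evalR_neg (ρ : ℕ → R) (f : RForm) : K.evalR ρ (neg P f) = -K.evalR ρ f :=
  K.sum_map_neg _ _

@[simp] theorem evalF_neg (γ : ℕ → F) (f : FForm) : K.evalF γ (neg P f) = -K.evalF γ f :=
  K.sum_map_neg _ _

@[simp] theorem evalR_clean (ρ : ℕ → R) (f : RForm) : K.evalR ρ (clean P f) = K.evalR ρ f :=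
  sum_map_clean K.p_smul _ _

theorem evalR_congr {ρ ρ' : ℕ → R} {f : RForm} (h : ∀ m ∈ f, ρ m.1 = ρ' m.1) :
    K.evalR ρ f = K.evalR ρ' f := by
  unfold evalR
  congr 1
  exact List.map_congr_left fun m hm => by rw [h m hm]

theorem evalF_congr {γ γ' : ℕ → F} {f : FForm} (h : ∀ m ∈ f, γ m.1 = γ' m.1) :
    K.evalF γ f = K.evalF γ' f := by
  unfold evalF
  congr 1
  exact List.map_congr_left fun m hm => by rw [h m hm]

theorem evalR_add (ρ ρ' : ℕ → R) (f : RForm) :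
    K.evalR (fun v => ρ v + ρ' v) f = K.evalR ρ f + K.evalR ρ' f := by
  induction f with
  | nil => simp
  | cons m f ih => rw [evalR_cons, evalR_cons, evalR_cons, ih, K.add_pow]; ring

theorem evalR_sub (ρ ρ' : ℕ → R) (f : RForm) :
    K.evalR (fun v => ρ v - ρ' v) f = K.evalR ρ f - K.evalR ρ' f := by
  induction f with
  | nil => simp
  | cons m f ih => rw [evalR_cons, evalR_cons, evalR_cons, ih, K.sub_pow]; ring

theorem evalR_mem_V {ρ : ℕ → R} {f : RForm} {n B : ℕ} (hρ : ∀ m ∈ f, ρ m.1 ∈ K.V n)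
    (hB : ∀ m ∈ f, P.p ^ m.2.2 * n + m.2.1 ≤ B) : K.evalR ρ f ∈ K.V B := by
  refine AddSubgroup.list_sum_mem _ fun x hx => ?_
  obtain ⟨m, hm, rfl⟩ := List.mem_map.1 hx
  exact K.V_mono (hB m hm) (K.V_z_pow (K.V_pow (hρ m hm) _ (K.q_pos _)))

theorem evalF_mem_V {γ : ℕ → F} {f : FForm} {B : ℕ}
    (hB : ∀ m ∈ f, 1 + m.2.1 + m.2.2.1 ≤ B) : K.evalF γ f ∈ K.V B := by
  refine AddSubgroup.list_sum_mem _ fun x hx => ?_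
  obtain ⟨m, hm, rfl⟩ := List.mem_map.1 hx
  rw [← map_pow]
  exact K.V_mono (hB m hm) (K.V_monomial (K.ι_mem_V _))

theorem evalF_mem_V_wtF (γ : ℕ → F) (f : FForm) : K.evalF γ f ∈ K.V (wtF f) :=
  K.evalF_mem_V fun _ hm => le_wtF hm

open Polynomial in
theorem evalF_vform (γ : ℕ → F) (n N L : ℕ) :
    K.evalF γ (vform n N L)
      = K.toR (∑ k ∈ Finset.range n, C (γ (L + k)) * X ^ k) * K.qi ^ N := by
  rw [evalF, vform, List.map_map, map_sum, Finset.sum_mul, ← List.sum_toFinset _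
    (List.nodup_range), List.toFinset_range]
  refine Finset.sum_congr rfl fun k _ => ?_
  simp [K.toR_X, K.toR_C]
  ring

open Polynomial in
theorem evalF_vform_coeff {γ : ℕ → F} {n N L : ℕ} {f : F[X]} (hf : f.degree < (n : ℕ))
    (h : ∀ k < n, γ (L + k) = f.coeff k) :
    K.evalF γ (vform n N L) = K.toR f * K.qi ^ N := by
  rw [evalF_vform]
  congr 2
  ext i
  rw [finsetSum_coeff]
  simp only [coeff_C_mul, coeff_X_pow, mul_ite, mul_one, mul_zero]
  rw [Finset.sum_ite_eq]
  split_ifs with hi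
  · exact h i (Finset.mem_range.1 hi)
  · symm
    rw [degree_lt_iff_coeff_zero] at hf
    exact hf i (by simpa using hi)

open Polynomial in
theorem evalF_vform_mem (γ : ℕ → F) (N L : ℕ) : K.evalF γ (vform (N * P.D) N L) ∈ K.V N := by
  rw [evalF_vform]
  refine ⟨_, ?_, rfl⟩
  rw [degree_lt_iff_coeff_zero]
  intro i hi
  rw [finsetSum_coeff]
  refine Finset.sum_eq_zero fun k hk => ?_
  rw [coeff_C_mul_X_pow, if_neg]
  rw [Finset.mem_range] at hk
  omega

theorem exists_evalF_vform {N : ℕ} {x : R} (hx : x ∈ K.V N) :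
    ∃ c : ℕ → F, ∀ (γ : ℕ → F) (L : ℕ), (∀ k < N * P.D, γ (L + k) = c k) →
      K.evalF γ (vform (N * P.D) N L) = x := by
  obtain ⟨f, hf, rfl⟩ := hx
  exact ⟨f.coeff, fun γ L h => K.evalF_vform_coeff hf h⟩

end Setting

end AddFrob

namespace AddFrob

open Polynomial

/-! ### Certificates of independence -/

/-- Data `(b, s, U, B, Δ)` certifying that the leading part of a form, completed by `b`, is an
invertible system: the part of degree `p ^ s` is `∑ z ^ l * (U_l) ^ (p ^ s)`, and `B` is inverse to
`U` up to the factor `Δ`. -/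
abbrev Cert := RForm × ℕ × List RForm × List (ℕ × RForm) × List ℕ

/-- Renaming of variables. -/
def renR (a b : ℕ) (f : RForm) : RForm := f.map fun m => (a * m.1 + b, m.2)

/-- A form in even variables completed by a form in odd variables. -/
def full (f b : RForm) : RForm := renR 2 0 f ++ renR 2 1 b

/-- The form `∑ z ^ l * (U_l) ^ (p ^ s)`. -/
def topForm (P : Par) (s : ℕ) (U : List RForm) : RForm :=
  (List.range (P.p ^ s)).flatMap fun l => monoR P l s (U.getD l [])

/-- Substitution that replaces the variables that are listed. -/
def assoc (B : List (ℕ × RForm)) (v : ℕ) : RForm := (List.lookup v B).getD []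

/-- The form `Δ y_v`. -/
def scalar (Δ : List ℕ) (v : ℕ) : RForm := Δ.map fun i => (v, i, 0)

/-- The bound for the variables of a form with a certificate. -/
def Cert.bound (f : RForm) (c : Cert) (M : ℕ) : ℕ :=
  2 * (M + wtR (full f c.1) + (c.2.2.2.1.map fun x => wtR x.2).sum + c.2.2.2.2.sum + 3)

/-- The bound for the cokernel of a form with a certificate. -/
def Cert.cobound (P : Par) (f : RForm) (c : Cert) : ℕ :=
  2 * (P.p ^ c.2.1 * (3 * c.2.2.2.2.sum + (c.2.2.2.1.map fun x => wtR x.2).sum + 3)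
    + wtR (full f c.1) + 1)

/-- A list represents a non-zero polynomial. -/
def nonzero (P : Par) (Δ : List ℕ) : Bool := Δ.any fun i => !decide (cnt Δ i % P.p = 0)

/-- Validity of a certificate. -/
def Cert.ok (P : Par) (f : RForm) (c : Cert) : Bool :=
  nonzero P c.2.2.2.2
  && (full f c.1).all (fun m => decide (m.2.2 ≤ c.2.1) && c.2.2.2.1.any fun x => decide (x.1 = m.1))
  && c.2.2.2.1.all (fun x => x.2.all fun m => decide (m.2.2 = 0))
  && decide (clean P ((full f c.1).filter (fun m => decide (m.2.2 = c.2.1))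
      ++ neg P (topForm P c.2.1 c.2.2.1)) = [])
  && c.2.2.2.1.all (fun x => decide (clean P
      ((sub P (fun l => (c.2.2.1.getD l [], [])) x.2).1 ++ neg P (scalar c.2.2.2.2 x.1)) = [])
      && x.2.all fun m => decide (m.1 < P.p ^ c.2.1))
  && (List.range (P.p ^ c.2.1)).all fun l => decide (clean P
      ((sub P (fun v => (assoc c.2.2.2.1 v, [])) (c.2.2.1.getD l [])).1
        ++ neg P (scalar c.2.2.2.2 l)) = [])

section Primrec

variable {α : Type} [Primcodable α] {P : Par}

@[fun_prop]
theorem primrec_renR {a b : α → ℕ} {f : α → RForm} (ha : Primrec a) (hb : Primrec b)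
    (hf : Primrec f) : Primrec fun x => renR (a x) (b x) (f x) := by
  unfold renR; fun_prop

@[fun_prop]
theorem primrec_full {f b : α → RForm} (hf : Primrec f) (hb : Primrec b) :
    Primrec fun x => full (f x) (b x) := by
  unfold full; fun_prop

@[fun_prop]
theorem primrec_topForm {s : α → ℕ} {U : α → List RForm} (hs : Primrec s) (hU : Primrec U) :
    Primrec fun x => topForm P (s x) (U x) := by
  unfold topForm; fun_prop

@[fun_prop]
theorem primrec_assoc {B : α → List (ℕ × RForm)} {v : α → ℕ} (hB : Primrec B) (hv : Primrec v) :
    Primrec fun x => assoc (B x) (v x) := by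
  unfold assoc; fun_prop

@[fun_prop]
theorem primrec_scalar {Δ : α → List ℕ} {v : α → ℕ} (hΔ : Primrec Δ) (hv : Primrec v) :
    Primrec fun x => scalar (Δ x) (v x) := by
  unfold scalar; fun_prop

@[fun_prop]
theorem primrec_nonzero {Δ : α → List ℕ} (hΔ : Primrec Δ) :
    Primrec fun x => nonzero P (Δ x) := by
  unfold nonzero; fun_prop

@[fun_prop]
theorem primrec_bound {f : α → RForm} {c : α → Cert} {M : α → ℕ} (hf : Primrec f)
    (hc : Primrec c) (hM : Primrec M) : Primrec fun x => Cert.bound (f x) (c x) (M x) := by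
  unfold Cert.bound; fun_prop

@[fun_prop]
theorem primrec_cobound {f : α → RForm} {c : α → Cert} (hf : Primrec f) (hc : Primrec c) :
    Primrec fun x => Cert.cobound P (f x) (c x) := by
  unfold Cert.cobound; fun_prop

@[fun_prop]
theorem primrec_ok {f : α → RForm} {c : α → Cert} (hf : Primrec f) (hc : Primrec c) :
    Primrec fun x => Cert.ok P (f x) (c x) := by
  unfold Cert.ok; fun_prop

end Primrec

section lpoly

variable {k : Type*} [CommRing k]

theorem coeff_lpoly (l : List ℕ) (i : ℕ) : (lpoly l : k[X]).coeff i = (cnt l i : k) := by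
  induction l with
  | nil => simp [lpoly, cnt]
  | cons a l ih =>
    simp only [lpoly, List.map_cons, List.sum_cons, coeff_add, coeff_X_pow] at ih ⊢
    rw [ih]
    by_cases h : i = a
    · subst h; simp [cnt, add_comm]
    · simp [cnt, h, Ne.symm h]

theorem natDegree_lpoly_le (l : List ℕ) : (lpoly l : k[X]).natDegree ≤ l.sum := by
  rw [natDegree_le_iff_coeff_eq_zero]
  intro i hi
  rw [coeff_lpoly]
  have : cnt l i = 0 := by
    rw [cnt_eq_count, List.count_eq_zero]
    intro h
    exact absurd (List.single_le_sum (by simp) _ h) (by omega)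
  rw [this, Nat.cast_zero]

theorem lpoly_ne_zero_iff (P : Par) [CharP k P.p] (l : List ℕ) :
    (lpoly l : k[X]) ≠ 0 ↔ nonzero P l := by
  simp only [nonzero, List.any_eq_true, Bool.not_eq_true', decide_eq_false_iff_not]
  constructor
  · intro h
    by_contra hc
    push Not at hc
    apply h
    ext i
    rw [coeff_lpoly, coeff_zero]
    by_cases hi : i ∈ l
    · rw [CharP.cast_eq_zero_iff k P.p]
      exact Nat.dvd_of_mod_eq_zero (hc i hi)
    · rw [cnt_eq_count, List.count_eq_zero.2 hi, Nat.cast_zero]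
  · rintro ⟨i, -, hi⟩ h
    apply hi
    have := coeff_lpoly (k := k) l i
    rw [h, coeff_zero, eq_comm, CharP.cast_eq_zero_iff k P.p] at this
    exact Nat.mod_eq_zero_of_dvd this

end lpoly

namespace Setting

variable {P : Par} {F R : Type*} [Field F] [CommRing R] (K : Setting P F R)

theorem evalR_renR (ρ : ℕ → R) (a b : ℕ) (f : RForm) :
    K.evalR ρ (renR a b f) = K.evalR (fun v => ρ (a * v + b)) f := by
  simp [evalR, renR, Function.comp_def]

theorem evalR_full (ρ : ℕ → R) (f b : RForm) :
    K.evalR ρ (full f b)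
      = K.evalR (fun v => ρ (2 * v)) f + K.evalR (fun v => ρ (2 * v + 1)) b := by
  simp [full, evalR_renR]

theorem evalR_scalar (ρ : ℕ → R) (Δ : List ℕ) (v : ℕ) :
    K.evalR ρ (scalar Δ v) = K.toR (lpoly Δ) * ρ v := by
  simp [evalR, scalar, Function.comp_def, toR_lpoly, List.sum_map_mul_right]

theorem evalR_topForm (ρ : ℕ → R) (s : ℕ) (U : List RForm) :
    K.evalR ρ (topForm P s U)
      = ∑ l ∈ Finset.range (P.p ^ s), K.z ^ l * K.evalR ρ (U.getD l []) ^ P.p ^ s := by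
  have key : ∀ n, K.evalR ρ ((List.range n).flatMap fun l => monoR P l s (U.getD l []))
      = ∑ l ∈ Finset.range n, K.z ^ l * K.evalR ρ (U.getD l []) ^ P.p ^ s := by
    intro n
    induction n with
    | zero => simp
    | succ n ih =>
      rw [List.range_succ, List.flatMap_append, evalR_append, ih, Finset.sum_range_succ]
      simp [evalR_monoR]
  exact key _

theorem evalR_filter (ρ : ℕ → R) (f : RForm) (c : ℕ × ℕ × ℕ → Bool) :
    K.evalR ρ f = K.evalR ρ (f.filter c) + K.evalR ρ (f.filter fun m => !c m) := by
  induction f with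
  | nil => simp
  | cons m f ih =>
    rw [evalR_cons, ih, List.filter_cons, List.filter_cons]
    cases c m <;> simp [evalR_cons] <;> ring

theorem evalR_eq_of_clean {f g : RForm} (h : clean P (f ++ neg P g) = []) (ρ : ℕ → R) :
    K.evalR ρ f = K.evalR ρ g := by
  have h1 := K.evalR_clean ρ (f ++ neg P g)
  rw [h, evalR_nil, evalR_append, evalR_neg] at h1
  exact (sub_eq_zero.1 (by rw [sub_eq_add_neg, ← h1])) 

theorem evalR_sub_fst (ρ : ℕ → R) (h : ℕ → RForm) (f : RForm) :
    K.evalR ρ (sub P (fun v => (h v, [])) f).1 = K.evalR (fun v => K.evalR ρ (h v)) f := by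
  have h1 := K.ev_sub ρ 0 (fun v => (h v, [])) f
  have h2 : (sub P (fun v => (h v, [])) f).2 = [] := by simp [sub, monoF]
  simpa [ev, h2] using h1

/-- The properties of a form that a valid certificate expresses. -/
structure Certified (f : RForm) (s : ℕ) (U : List RForm) (B : List (ℕ × RForm)) (Δ : List ℕ) :
    Prop where
  ne_zero : (lpoly Δ : F[X]) ≠ 0
  le : ∀ m ∈ f, m.2.2 ≤ s
  mem : ∀ m ∈ f, ∃ x ∈ B, x.1 = m.1
  deg : ∀ x ∈ B, ∀ m ∈ x.2, m.2.2 = 0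
  lt : ∀ x ∈ B, ∀ m ∈ x.2, m.1 < P.p ^ s
  top : ∀ ρ : ℕ → R, K.evalR ρ (f.filter fun m => decide (m.2.2 = s))
    = ∑ l ∈ Finset.range (P.p ^ s), K.z ^ l * K.evalR ρ (U.getD l []) ^ P.p ^ s
  left : ∀ x ∈ B, ∀ ρ : ℕ → R,
    K.evalR (fun l => K.evalR ρ (U.getD l [])) x.2 = K.toR (lpoly Δ) * ρ x.1
  right : ∀ l < P.p ^ s, ∀ ρ : ℕ → R,
    K.evalR (fun v => K.evalR ρ (assoc B v)) (U.getD l []) = K.toR (lpoly Δ) * ρ l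

/-- `Cert.ok` compares lists of monomials after discarding those of multiplicity divisible by `p`, a
decidable test on finite data that does not refer to `F` or `R`. Each formal identity holds under
every evaluation. -/
theorem certified_of_ok {f : RForm} {c : Cert} (h : c.ok P f) :
    K.Certified (full f c.1) c.2.1 c.2.2.1 c.2.2.2.1 c.2.2.2.2 := by
  have := K.char
  simp only [Cert.ok, Bool.and_eq_true, List.all_eq_true, decide_eq_true_eq, List.any_eq_true,
    List.mem_range] at h
  obtain ⟨⟨⟨⟨⟨h1, h2⟩, h3⟩, h4⟩, h5⟩, h6⟩ := h
  refine ⟨(lpoly_ne_zero_iff P _).2 h1, fun m hm => (h2 m hm).1, fun m hm => (h2 m hm).2, h3,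
    fun x hx => (h5 x hx).2, fun ρ => ?_, fun x hx ρ => ?_, fun l hl ρ => ?_⟩
  · rw [K.evalR_eq_of_clean h4, evalR_topForm]
  · rw [← K.evalR_scalar, ← K.evalR_eq_of_clean (h5 x hx).1, evalR_sub_fst]
  · rw [← K.evalR_scalar, ← K.evalR_eq_of_clean (h6 l hl), evalR_sub_fst]

namespace Certified

variable {K} {f : RForm} {s : ℕ} {U : List RForm} {B : List (ℕ × RForm)} {Δ : List ℕ}

/-- A term below the top order raises its variable to a power of at most `p^(s-1) = p^s / p`. For `s
= 0` the quotient is zero and there are no such terms. -/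
theorem lower_mem (h : K.Certified f s U B Δ) {ρ : ℕ → R} {n : ℕ}
    (hρ : ∀ m ∈ f, ρ m.1 ∈ K.V n) :
    K.evalR ρ (f.filter fun m => !decide (m.2.2 = s)) ∈ K.V (P.p ^ s / P.p * n + wtR f) := by
  refine K.evalR_mem_V (n := n) (fun m hm => hρ m (List.mem_of_mem_filter hm)) fun m hm => ?_
  obtain ⟨h1, h2⟩ := List.mem_filter.1 hm
  have h3 := h.le m h1
  have h4 : m.2.2 < s := by simp at h2; omega
  have h5 : P.p ^ m.2.2 ≤ P.p ^ s / P.p := by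
    rw [Nat.le_div_iff_mul_le K.p_pos, ← pow_succ]
    exact Nat.pow_le_pow_right K.p_pos h4
  have h6 := le_wtR h1
  have := Nat.mul_le_mul_right n h5
  omega

theorem q_div_mul_le (K : Setting P F R) (s n : ℕ) :
    P.p ^ s / P.p * n ≤ P.p ^ s * (n / 2 + 1) := by
  have h1 : P.p ^ s / P.p * 2 ≤ P.p ^ s :=
    (Nat.mul_le_mul_left _ K.prime.two_le).trans (Nat.div_mul_le_self _ _)
  have h2 : n ≤ 2 * (n / 2 + 1) := by omega
  calc P.p ^ s / P.p * n ≤ P.p ^ s / P.p * (2 * (n / 2 + 1)) := Nat.mul_le_mul_left _ h2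
    _ = P.p ^ s / P.p * 2 * (n / 2 + 1) := by ring
    _ ≤ _ := Nat.mul_le_mul_right _ h1

theorem B_mem (h : K.Certified f s U B Δ) {x} (hx : x ∈ B) {u : ℕ → R} {n : ℕ}
    (hu : ∀ l < P.p ^ s, u l ∈ K.V n) :
    K.evalR u x.2 ∈ K.V (n + (B.map fun x => wtR x.2).sum) := by
  refine K.evalR_mem_V (n := n) (fun m hm => hu _ (h.lt x hx m hm)) fun m hm => ?_
  rw [h.deg x hx m hm, pow_zero, one_mul]
  have h1 := le_wtR hm
  have h2 := List.single_le_sum (by simp) _ (List.mem_map_of_mem (f := fun x => wtR x.2) hx)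
  omega

/-- The contraction. The top part is the value of `f` minus the lower part, so its order is at most
about `p^s n / 2` plus a constant multiple of `p^s`. Taking coordinates divides this by `p^s`;
applying `B` and cancelling `Δ` recovers the variables at bounded cost. A bound `n` thus improves to
`n / 2` plus a constant. -/
theorem step (h : K.Certified f s U B Δ) {ρ : ℕ → R} {n M : ℕ} (hρ : ∀ x ∈ B, ρ x.1 ∈ K.V n)
    (hf : K.evalR ρ f ∈ K.V M) :
    ∀ x ∈ B, ρ x.1 ∈ K.V (n / 2 + 1 + M + wtR f + (B.map fun x => wtR x.2).sum + Δ.sum) := by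
  have h1 := h.lower_mem (ρ := ρ) (n := n) fun m hm => by
    obtain ⟨x, hx, hxm⟩ := h.mem m hm
    rw [← hxm]; exact hρ x hx
  have h2 : K.evalR ρ (f.filter fun m => decide (m.2.2 = s))
      ∈ K.V (P.p ^ s * (n / 2 + 1 + M + wtR f)) := by
    have h3 := K.evalR_filter ρ f fun m => decide (m.2.2 = s)
    rw [← sub_eq_iff_eq_add] at h3
    rw [← h3]
    have h4 := q_div_mul_le K s n
    have h5 := K.q_pos s
    refine (K.V _).sub_mem (K.V_mono ?_ hf) (K.V_mono ?_ h1)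
    · exact (show M ≤ n / 2 + 1 + M + wtR f by omega).trans (Nat.le_mul_of_pos_left _ h5)
    · rw [add_assoc (n / 2 + 1), mul_add]
      exact Nat.add_le_add h4 ((Nat.le_add_left _ _).trans (Nat.le_mul_of_pos_left _ h5))
  rw [h.top] at h2
  intro x hx
  have h3 := h.B_mem hx (u := fun l => K.evalR ρ (U.getD l []))
    fun l hl => K.coordinates_mem_V h2 hl
  rw [h.left x hx] at h3
  exact K.mem_V_of_mul_mem h.ne_zero (natDegree_lpoly_le Δ) h3

/-- A certified form is injective up to elements of bounded order. -/
theorem bounded (h : K.Certified f s U B Δ) {ρ : ℕ → R} {M : ℕ} (hf : K.evalR ρ f ∈ K.V M) :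
    ∀ x ∈ B, ρ x.1 ∈ K.V (2 * (M + wtR f + (B.map fun x => wtR x.2).sum + Δ.sum + 3)) := by
  have key : ∀ n, (∀ x ∈ B, ρ x.1 ∈ K.V n) →
      ∀ x ∈ B, ρ x.1 ∈ K.V (2 * (M + wtR f + (B.map fun x => wtR x.2).sum + Δ.sum + 3)) := by
    intro n
    induction n with
    | zero => exact fun h x hx => K.V_mono (Nat.zero_le _) (h x hx)
    | succ n ih =>
      intro hn
      by_cases hle : n + 1 ≤ 2 * (M + wtR f + (B.map fun x => wtR x.2).sum + Δ.sum + 3)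
      · exact fun x hx => K.V_mono hle (hn x hx)
      -- Above the stated bound, halving and adding the constant of `step` gives at most `n`, so the
      -- descent continues.
      · refine ih fun x hx => K.V_mono ?_ (h.step hn hf x hx)
        omega
  choose N hN using fun x => K.exists_mem_V (ρ x)
  refine key (B.map fun x => N x.1).sum fun x hx => K.V_mono ?_ (hN x.1)
  exact List.single_le_sum (by simp) _ (List.mem_map_of_mem (f := fun x => N x.1) hx)

theorem assoc_mem (h : K.Certified f s U B Δ) (v : ℕ) {u : ℕ → R} {n : ℕ}
    (hu : ∀ l < P.p ^ s, u l ∈ K.V n) :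
    K.evalR u (assoc B v) ∈ K.V (n + (B.map fun x => wtR x.2).sum) := by
  rw [assoc]
  cases hl : List.lookup v B with
  | none => simp [(K.V _).zero_mem]
  | some g => exact h.B_mem (List.lookup_eq_some_iff.1 hl |> fun ⟨l₁, l₂, e, _⟩ => by
      rw [e]; simp : (v, g) ∈ B) hu

/-- One step of successive approximation. Divide the coordinates of `x` by `Δ` with remainder, `c =
v + Δ y`, and set `ρ = B(y)`. The top part of `f(ρ)` then has the coordinates `Δ y`. What is left of
`x` consists of the remainders `v`, which are bounded, and of the lower part of `f(ρ)`, of order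
about `n / p`, hence at most `n / 2` plus a constant. -/
theorem costep (h : K.Certified f s U B Δ) {x : R} {n : ℕ} (hx : x ∈ K.V n) :
    ∃ ρ : ℕ → R, x - K.evalR ρ f ∈ K.V (n / 2 +
      (P.p ^ s * (3 * Δ.sum + (B.map fun x => wtR x.2).sum + 3) + wtR f)) := by
  have hq := K.q_pos s
  obtain ⟨c, hc, hxc⟩ := K.exists_coordinates s (m := n / P.p ^ s + 1) (K.V_mono (by
    have := Nat.div_add_mod n (P.p ^ s)
    have := Nat.mod_lt n hq
    rw [mul_add]; omega) hx)
  choose v y hv hcv using fun l =>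
    K.exists_eq_add_mul Δ.sum (lpoly Δ) h.ne_zero (natDegree_lpoly_le Δ) (c l)
  have hv' : ∀ l, K.toR (v l) ∈ K.V Δ.sum := fun l => K.toR_mem_V (hv l)
  have hy : ∀ l, y l ∈ K.V (n / P.p ^ s + 1 + Δ.sum + Δ.sum) := by
    intro l
    refine K.mem_V_of_mul_mem h.ne_zero (natDegree_lpoly_le Δ) ?_
    have : K.toR (lpoly Δ) * y l = c l - K.toR (v l) := by rw [hcv l]; ring
    rw [this]
    exact (K.V _).sub_mem (K.V_mono (Nat.le_add_right _ _) (hc l))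
      (K.V_mono (Nat.le_add_left _ _) (hv' l))
  refine ⟨fun w => K.evalR y (assoc B w), ?_⟩
  set ρ : ℕ → R := fun w => K.evalR y (assoc B w) with hρ
  have hlow := h.lower_mem (ρ := ρ) fun m _ => h.assoc_mem m.1 fun l _ => hy l
  have htop := h.top ρ
  have h1 : x - K.evalR ρ f = (∑ l ∈ Finset.range (P.p ^ s), K.z ^ l * K.toR (v l) ^ P.p ^ s)
      - K.evalR ρ (f.filter fun m => !decide (m.2.2 = s)) := by
    rw [K.evalR_filter ρ f fun m => decide (m.2.2 = s), htop, hxc, ← sub_sub, sub_left_inj,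
      ← Finset.sum_sub_distrib]
    refine Finset.sum_congr rfl fun l hl => ?_
    rw [h.right l (Finset.mem_range.1 hl)]
    nth_rewrite 1 [hcv l]
    rw [K.add_pow]; ring
  rw [h1]
  have h2 : P.p ^ s / P.p * (n / P.p ^ s) ≤ n / 2 := by
    rw [Nat.le_div_iff_mul_le two_pos]
    have h3 : P.p ^ s / P.p * 2 ≤ P.p ^ s :=
      (Nat.mul_le_mul_left _ K.prime.two_le).trans (Nat.div_mul_le_self _ _)
    calc P.p ^ s / P.p * (n / P.p ^ s) * 2 = P.p ^ s / P.p * 2 * (n / P.p ^ s) := by ring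
      _ ≤ P.p ^ s * (n / P.p ^ s) := Nat.mul_le_mul_right _ h3
      _ ≤ n := Nat.mul_div_le _ _
  refine (K.V _).sub_mem ?_ (K.V_mono ?_ hlow)
  · refine AddSubgroup.sum_mem _ fun l hl => ?_
    refine K.V_mono ?_ (K.V_z_pow (K.V_pow (hv' l) _ hq))
    have h3 := Finset.mem_range.1 hl
    have h4 := Nat.mul_le_mul_left (P.p ^ s)
      (show Δ.sum + 1 ≤ 3 * Δ.sum + (B.map fun x => wtR x.2).sum + 3 by omega)
    rw [mul_add, mul_one] at h4
    omega
  · have h3 : P.p ^ s / P.p ≤ P.p ^ s := Nat.div_le_self _ _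
    have h4 := Nat.mul_le_mul_right (1 + Δ.sum + Δ.sum + (B.map fun x => wtR x.2).sum) h3
    have h5 := Nat.mul_le_mul_left (P.p ^ s)
      (show 1 + Δ.sum + Δ.sum + (B.map fun x => wtR x.2).sum ≤
        3 * Δ.sum + (B.map fun x => wtR x.2).sum + 3 by omega)
    have h6 : P.p ^ s / P.p * (n / P.p ^ s + 1 + Δ.sum + Δ.sum + (B.map fun x => wtR x.2).sum)
      = P.p ^ s / P.p * (n / P.p ^ s) +
        P.p ^ s / P.p * (1 + Δ.sum + Δ.sum + (B.map fun x => wtR x.2).sum) := by ring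
    omega

/-- A certified form is surjective up to elements of bounded order. -/
theorem cobounded (h : K.Certified f s U B Δ) (x : R) :
    ∃ ρ : ℕ → R, x - K.evalR ρ f ∈ K.V (2 *
      (P.p ^ s * (3 * Δ.sum + (B.map fun x => wtR x.2).sum + 3) + wtR f + 1)) := by
  have key : ∀ n, ∀ x ∈ K.V n, ∃ ρ : ℕ → R, x - K.evalR ρ f ∈ K.V (2 *
      (P.p ^ s * (3 * Δ.sum + (B.map fun x => wtR x.2).sum + 3) + wtR f + 1)) := by
    intro n
    induction n using Nat.strong_induction_on with
    | _ n ih =>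
      intro x hx
      by_cases hle : n ≤ 2 *
          (P.p ^ s * (3 * Δ.sum + (B.map fun x => wtR x.2).sum + 3) + wtR f + 1)
      · have hz : (fun _ => 0 : ℕ → R) = fun v => (fun _ => 0 : ℕ → R) v - (fun _ => 0) v := by
          simp
        refine ⟨fun _ => 0, K.V_mono hle ?_⟩
        rw [hz, evalR_sub, _root_.sub_self, sub_zero]
        exact hx
      -- The order of the error has dropped strictly; by additivity the successive corrections add
      -- up to one argument.
      · obtain ⟨ρ, hρ⟩ := h.costep hx
        obtain ⟨ρ', hρ'⟩ := ih _ (by omega) _ hρ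
        refine ⟨fun v => ρ v + ρ' v, ?_⟩
        rw [evalR_add, ← sub_sub]
        exact hρ'
  obtain ⟨n, hn⟩ := K.exists_mem_V x
  exact key n x hn

end Certified

end Setting

end AddFrob

namespace AddFrob

open FirstOrder FirstOrder.Language

/-! ### Course-of-values recursion -/

/-- The list of the first `n` values of a function defined by course-of-values recursion. -/
def courseVals {X : Type} (g : List X → X) (n : ℕ) : List X :=
  (List.range n).foldl (fun l _ => l ++ [g l]) []

/-- Course-of-values recursion. -/
def course {X : Type} (g : List X → X) (n : ℕ) : X := g (courseVals g n)

theorem courseVals_eq {X : Type} (g : List X → X) (n : ℕ) :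
    courseVals g n = (List.range n).map (course g) := by
  induction n with
  | zero => rfl
  | succ n ih =>
    rw [courseVals, List.range_succ, List.foldl_append, ← courseVals, List.map_append, ← ih]
    rfl

theorem length_courseVals {X : Type} (g : List X → X) (n : ℕ) :
    (courseVals g n).length = n := by simp [courseVals_eq]

theorem getD_courseVals {X : Type} (g : List X → X) {n m : ℕ} (h : m < n) (d : X) :
    (courseVals g n).getD m d = course g m := by
  simp [courseVals_eq, List.getD_eq_getElem?_getD, h]

@[fun_prop]
theorem primrec_course {α X : Type} [Primcodable α] [Primcodable X] {g : α → List X → X}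
    {n : α → ℕ} (hg : Primrec fun q : α × List X => g q.1 q.2) (hn : Primrec n) :
    Primrec fun a => course (g a) (n a) := by
  have : ∀ {γ : Type} [Primcodable γ] {u : γ → α} {w : γ → List X}, Primrec u → Primrec w →
      Primrec fun c => g (u c) (w c) := fun hu hw => hg.comp (hu.pair hw)
  unfold course courseVals; fun_prop

/-- Codes of arguments are smaller than the code of the compound expression, so course-of-values
recursion may refer to them. -/
theorem le_encode_of_mem {l : List ℕ} {a : ℕ} (h : a ∈ l) : a < Encodable.encode l := by
  induction l with
  | nil => simp at h
  | cons b l ih =>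
    rw [Encodable.encode_list_cons]
    rcases List.mem_cons.1 h with rfl | h
    · exact Nat.lt_succ_of_le (Nat.left_le_pair _ _)
    · exact (ih h).trans_le ((Nat.right_le_pair _ _).trans (Nat.le_succ _))

/-! ### Gödel numbers of formulas about the field -/

/-- Gödel number of an application of a function symbol. -/
def funcC (n f : ℕ) (args : List ℕ) : ℕ := Nat.pair 1 (Nat.pair n (Nat.pair f (Encodable.encode args)))

/-- Gödel number of falsum. -/
def falsumC : ℕ := Nat.pair 0 0

/-- Gödel number of an implication. -/
def impC (a b : ℕ) : ℕ := Nat.pair 3 (Nat.pair a b)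

/-- Gödel number of a negation. -/
def notC (a : ℕ) : ℕ := impC a falsumC

/-- Gödel number of a conjunction. -/
def andC (a b : ℕ) : ℕ := notC (impC a (notC b))

/-- Gödel number of an equation. -/
def eqC (a b : ℕ) : ℕ := Nat.pair 1 (Nat.pair a b)

/-- Gödel number of a universal quantification. -/
def allC (a : ℕ) : ℕ := Nat.pair 4 a

/-- Renaming of the variables of a term. -/
def mapTerm (h : ℕ → ℕ) : ℕ → ℕ :=
  course fun l =>
    bif decide (l.length.unpair.1 = 0) then Nat.pair 0 (h l.length.unpair.2)
    else funcC l.length.unpair.2.unpair.1 l.length.unpair.2.unpair.2.unpair.1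
      (((Encodable.decode l.length.unpair.2.unpair.2.unpair.2 : Option (List ℕ)).getD []).map
        fun i => l.getD i 0)

/-- Renaming of the variables of a formula without relation symbols. -/
def mapCode (h : ℕ → ℕ) : ℕ → ℕ :=
  course fun l =>
    bif decide (l.length.unpair.1 = 1) then
      eqC (mapTerm h l.length.unpair.2.unpair.1) (mapTerm h l.length.unpair.2.unpair.2)
    else bif decide (l.length.unpair.1 = 3) then
      impC (l.getD l.length.unpair.2.unpair.1 0) (l.getD l.length.unpair.2.unpair.2 0)
    else bif decide (l.length.unpair.1 = 4) then allC (l.getD l.length.unpair.2 0)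
    else l.length

section Primrec

variable {α : Type} [Primcodable α]

@[fun_prop]
theorem primrec_funcC {n f : α → ℕ} {args : α → List ℕ} (hn : Primrec n) (hf : Primrec f)
    (ha : Primrec args) : Primrec fun x => funcC (n x) (f x) (args x) := by
  unfold funcC; fun_prop

@[fun_prop]
theorem primrec_impC {a b : α → ℕ} (ha : Primrec a) (hb : Primrec b) :
    Primrec fun x => impC (a x) (b x) := by unfold impC; fun_prop

@[fun_prop]
theorem primrec_notC {a : α → ℕ} (ha : Primrec a) : Primrec fun x => notC (a x) := by
  unfold notC; fun_prop

@[fun_prop]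
theorem primrec_andC {a b : α → ℕ} (ha : Primrec a) (hb : Primrec b) :
    Primrec fun x => andC (a x) (b x) := by unfold andC; fun_prop

@[fun_prop]
theorem primrec_eqC {a b : α → ℕ} (ha : Primrec a) (hb : Primrec b) :
    Primrec fun x => eqC (a x) (b x) := by unfold eqC; fun_prop

@[fun_prop]
theorem primrec_allC {a : α → ℕ} (ha : Primrec a) : Primrec fun x => allC (a x) := by
  unfold allC; fun_prop

@[fun_prop]
theorem primrec_mapTerm {h : α → ℕ → ℕ} {n : α → ℕ} (hh : Primrec fun q : α × ℕ => h q.1 q.2)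
    (hn : Primrec n) : Primrec fun x => mapTerm (h x) (n x) := by
  have : ∀ {γ : Type} [Primcodable γ] {u : γ → α} {w : γ → ℕ}, Primrec u → Primrec w →
      Primrec fun c => h (u c) (w c) := fun hu hw => hh.comp (hu.pair hw)
  unfold mapTerm; fun_prop

@[fun_prop]
theorem primrec_mapCode {h : α → ℕ → ℕ} {n : α → ℕ} (hh : Primrec fun q : α × ℕ => h q.1 q.2)
    (hn : Primrec n) : Primrec fun x => mapCode (h x) (n x) := by
  have : ∀ {γ : Type} [Primcodable γ] {u : γ → α} {w : γ → ℕ}, Primrec u → Primrec w →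
      Primrec fun c => h (u c) (w c) := fun hu hw => hh.comp (hu.pair hw)
  unfold mapCode; fun_prop

end Primrec

theorem mapTerm_var (h : ℕ → ℕ) (x : ℕ) : mapTerm h (Nat.pair 0 x) = Nat.pair 0 (h x) := by
  rw [mapTerm, course, length_courseVals]; simp

theorem mapTerm_func (h : ℕ → ℕ) (n f : ℕ) (args : List ℕ) :
    mapTerm h (funcC n f args) = funcC n f (args.map (mapTerm h)) := by
  rw [mapTerm, course, length_courseVals]
  simp only [funcC, Nat.unpair_pair, Encodable.encodek, Option.getD_some]
  simp only [one_ne_zero, decide_false, cond_false]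
  congr 4
  refine List.map_congr_left fun a ha => getD_courseVals _ ?_ _
  exact (le_encode_of_mem ha).trans_le ((Nat.right_le_pair _ _).trans
    ((Nat.right_le_pair _ _).trans (Nat.right_le_pair _ _)))

theorem mapCode_falsum (h : ℕ → ℕ) : mapCode h falsumC = falsumC := by
  rw [mapCode, course, length_courseVals]; simp [falsumC]

theorem mapCode_eq (h : ℕ → ℕ) (a b : ℕ) :
    mapCode h (eqC a b) = eqC (mapTerm h a) (mapTerm h b) := by
  rw [mapCode, course, length_courseVals]; simp [eqC]

theorem mapCode_imp (h : ℕ → ℕ) (a b : ℕ) :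
    mapCode h (impC a b) = impC (mapCode h a) (mapCode h b) := by
  rw [mapCode, course, length_courseVals]
  have h1 : Nat.pair a b < Nat.pair 3 (Nat.pair a b) := by
    have := Nat.add_le_pair 3 (Nat.pair a b); omega
  rw [getD_courseVals, getD_courseVals]
  · simp [impC]
  · simp only [impC, Nat.unpair_pair]; exact (Nat.right_le_pair _ _).trans_lt h1
  · simp only [impC, Nat.unpair_pair]; exact (Nat.left_le_pair _ _).trans_lt h1

theorem mapCode_all (h : ℕ → ℕ) (a : ℕ) : mapCode h (allC a) = allC (mapCode h a) := by
  rw [mapCode, course, length_courseVals]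
  have h1 : a < Nat.pair 4 a := by
    have := Nat.add_le_pair 4 a; omega
  simp only [allC, Nat.unpair_pair]
  rw [getD_courseVals (m := a) _ h1]
  simp [mapCode, allC]

section Codes

variable {L : FirstOrder.Language.{0, 0}} [SymbolNumbering L] {l m k : ℕ}

theorem termCode_func {n : ℕ} (f : L.Functions n) (ts : Fin n → L.Term (Fin m ⊕ Fin k)) :
    termCode (Term.func f ts)
      = funcC n (SymbolNumbering.funNum n f) (List.ofFn fun i => termCode (ts i)) := by
  rw [termCode, funcC]

theorem termCode_relabel {k' : ℕ} (h : ℕ → ℕ) (g : Fin m ⊕ Fin k → Fin l ⊕ Fin k')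
    (hg : ∀ x, varCode (g x) = h (varCode x)) (t : L.Term (Fin m ⊕ Fin k)) :
    termCode (t.relabel g) = mapTerm h (termCode t) := by
  induction t with
  | var x => rw [Term.relabel, termCode, termCode, mapTerm_var, hg]
  | func f ts ih =>
    rw [Term.relabel, termCode_func, termCode_func, mapTerm_func, List.map_ofFn]
    congr 2
    funext i
    exact ih i

end Codes

/-- Relabelling inserts `n` new bound variables in front of the old ones, so the old bound variable
`i` acquires the index `n + i`. The hypothesis `hb` prescribes this shift, and one numerical
renaming `h` then works at every quantifier depth. -/
theorem formulaCode_relabel {p l m n k : ℕ} (h : ℕ → ℕ) (g : Fin m → Fin l ⊕ Fin n)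
    (hg : ∀ i : Fin m, varCode (g i) = h (2 * i)) (hb : ∀ i, h (2 * i + 1) = 2 * (n + i) + 1)
    (φ : (Lp p).BoundedFormula (Fin m) k) :
    formulaCode (φ.relabel g) = mapCode h (formulaCode φ) := by
  have hv : ∀ (k : ℕ) (x : Fin m ⊕ Fin k),
      varCode (BoundedFormula.relabelAux g k x) = h (varCode x) := by
    rintro k (i | i)
    · simp only [BoundedFormula.relabelAux, Function.comp_def, Sum.map_inl]
      rw [varCode, ← hg i]
      cases g i <;> simp [varCode]
    · simp [BoundedFormula.relabelAux, varCode, hb]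
  induction φ with
  | falsum => exact (mapCode_falsum h).symm
  | equal t₁ t₂ =>
    have := mapCode_eq h (termCode t₁) (termCode t₂)
    rw [← termCode_relabel h _ (hv _), ← termCode_relabel h _ (hv _)] at this
    exact this.symm
  | rel R ts => exact R.elim
  | imp φ ψ ih₁ ih₂ =>
    have := mapCode_imp h (formulaCode φ) (formulaCode ψ)
    rw [← ih₁, ← ih₂] at this
    exact this.symm
  | all φ ih =>
    have := mapCode_all h (formulaCode φ)
    rw [← ih] at this
    rw [BoundedFormula.relabel_all]
    simp only [formulaCode]
    exact this.symm

end AddFrob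

namespace AddFrob

open FirstOrder FirstOrder.Language

/-! ### Truth of coded formulas -/

/-- The number `a` is the Gödel number of a formula in the first `l` variables. -/
def WF (p l a : ℕ) : Prop := ∃ φ : (Lp p).Formula (Fin l), formulaCode φ = a

/-- Truth of the formula with Gödel number `a`. -/
def Sem (p : ℕ) {F : Type*} [Field F] (l a : ℕ) (γ : ℕ → F) : Prop :=
  ∃ φ : (Lp p).Formula (Fin l), formulaCode φ = a ∧ φ.Realize fun i => γ i

/-- Quantification of the variables that the renaming `h` turns into bound variables. -/
def allsC (n : ℕ) (h : ℕ → ℕ) (a : ℕ) : ℕ := allC^[n] (mapCode h a)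

/-- Renaming of the free variable `i` as `k * i + c`. -/
def renC (k c a : ℕ) : ℕ :=
  mapCode (fun v => bif decide (v % 2 = 0) then 2 * (k * (v / 2) + c) else v) a

/-- Quantification of the even variables of a formula, the variable `2 * i + 1` becoming `i`. -/
def qC (l a : ℕ) : ℕ :=
  allsC l (fun v => bif decide (v % 2 = 0) then (bif decide (v % 4 = 0) then v / 2 + 1 else v / 2 - 1)
    else 2 * l + v) a

/-- The existential closure. -/
def exC (l a : ℕ) : ℕ :=
  notC (allsC l (fun v => bif decide (v % 2 = 0) then v + 1 else 2 * l + v) (notC a))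

section Primrec

variable {α : Type} [Primcodable α]

@[fun_prop]
theorem primrec_allsC {n : α → ℕ} {h : α → ℕ → ℕ} {a : α → ℕ} (hn : Primrec n)
    (hh : Primrec fun q : α × ℕ => h q.1 q.2) (ha : Primrec a) :
    Primrec fun x => allsC (n x) (h x) (a x) := by
  unfold allsC; fun_prop

@[fun_prop]
theorem primrec_renC {k c a : α → ℕ} (hk : Primrec k) (hc : Primrec c) (ha : Primrec a) :
    Primrec fun x => renC (k x) (c x) (a x) := by
  unfold renC; fun_prop

@[fun_prop]
theorem primrec_qC {l a : α → ℕ} (hl : Primrec l) (ha : Primrec a) :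
    Primrec fun x => qC (l x) (a x) := by
  unfold qC; fun_prop

@[fun_prop]
theorem primrec_exC {l a : α → ℕ} (hl : Primrec l) (ha : Primrec a) :
    Primrec fun x => exC (l x) (a x) := by
  unfold exC; fun_prop

end Primrec

section Sem

variable {p : ℕ} {F : Type*} [Field F] {l l' a b : ℕ} {γ γ' : ℕ → F}

/-- Gödel numbering is injective for a fixed number of variables, so the formula in the definition
of `Sem` is unique. -/
theorem sem_formulaCode (φ : (Lp p).Formula (Fin l)) :
    Sem p l (formulaCode φ) γ ↔ φ.Realize fun i : Fin l => γ i := by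
  constructor
  · rintro ⟨ψ, h, h'⟩
    rwa [formulaCode_injective h] at h'
  · exact fun h => ⟨φ, rfl, h⟩

theorem sem_congr (h : ∀ i < l, γ i = γ' i) : Sem p l a γ ↔ Sem p l a γ' := by
  have : (fun i : Fin l => γ i) = fun i : Fin l => γ' i := funext fun i => h i i.2
  rw [Sem, Sem, this]

theorem wf_falsumC : WF p l falsumC := ⟨⊥, rfl⟩

theorem WF.impC (ha : WF p l a) (hb : WF p l b) : WF p l (impC a b) := by
  obtain ⟨φ, rfl⟩ := ha; obtain ⟨ψ, rfl⟩ := hb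
  exact ⟨φ.imp ψ, rfl⟩

theorem WF.notC (ha : WF p l a) : WF p l (notC a) := ha.impC wf_falsumC

theorem WF.andC (ha : WF p l a) (hb : WF p l b) : WF p l (andC a b) := (ha.impC hb.notC).notC

theorem not_sem_falsumC : ¬ Sem p l falsumC γ := by
  rintro ⟨φ, h, h'⟩
  have : φ = (⊥ : (Lp p).Formula (Fin l)) := formulaCode_injective (h.trans rfl)
  rw [this] at h'
  exact h'

theorem sem_impC (ha : WF p l a) (hb : WF p l b) :
    Sem p l (impC a b) γ ↔ (Sem p l a γ → Sem p l b γ) := by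
  obtain ⟨φ, rfl⟩ := ha; obtain ⟨ψ, rfl⟩ := hb
  have : impC (formulaCode φ) (formulaCode ψ) = formulaCode (φ.imp ψ) := rfl
  rw [this, sem_formulaCode, sem_formulaCode, sem_formulaCode]
  exact Formula.realize_imp

theorem sem_notC (ha : WF p l a) : Sem p l (notC a) γ ↔ ¬ Sem p l a γ := by
  rw [AddFrob.notC, sem_impC ha wf_falsumC]
  exact ⟨fun h h' => not_sem_falsumC (h h'), fun h h' => absurd h' h⟩

theorem sem_andC (ha : WF p l a) (hb : WF p l b) :
    Sem p l (andC a b) γ ↔ Sem p l a γ ∧ Sem p l b γ := by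
  rw [AddFrob.andC, sem_notC (ha.impC hb.notC), sem_impC ha hb.notC, sem_notC hb]
  tauto

theorem formulaCode_alls {n : ℕ} (φ : (Lp p).BoundedFormula (Fin l) n) :
    formulaCode φ.alls = allC^[n] (formulaCode φ) := by
  induction n with
  | zero => rfl
  | succ n ih => rw [BoundedFormula.alls, ih, Function.iterate_succ_apply]; rfl

section Alls

variable {n : ℕ} {h : ℕ → ℕ} (g : Fin l → Fin l' ⊕ Fin n)
  (hg : ∀ i : Fin l, varCode (g i) = h (2 * i)) (hb : ∀ i, h (2 * i + 1) = 2 * (n + i) + 1)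

include hg hb

theorem allsC_formulaCode (φ : (Lp p).Formula (Fin l)) :
    allsC n h (formulaCode φ) = formulaCode (BoundedFormula.relabel g φ).alls := by
  rw [formulaCode_alls, formulaCode_relabel h g hg hb]
  rfl

theorem WF.allsC (ha : WF p l a) : WF p l' (allsC n h a) := by
  obtain ⟨φ, rfl⟩ := ha
  exact ⟨_, (allsC_formulaCode g hg hb φ).symm⟩

/-- The map `g` decides which variables stay free and which become quantified; `θ δ` is the
assignment obtained by reading the former from `γ` and the latter from `δ`. Renaming, partial
quantification and closure are the special cases used. -/
theorem sem_allsC (ha : WF p l a) (θ : (ℕ → F) → ℕ → F)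
    (hθ : ∀ δ (i : Fin l), θ δ i = Sum.elim (fun j : Fin l' => γ j) (fun j : Fin n => δ j) (g i)) :
    Sem p l' (allsC n h a) γ ↔ ∀ δ, Sem p l a (θ δ) := by
  obtain ⟨φ, rfl⟩ := ha
  rw [allsC_formulaCode g hg hb, sem_formulaCode, BoundedFormula.realize_alls]
  have key : ∀ δ : ℕ → F, (BoundedFormula.relabel g φ).Realize (fun j : Fin l' => γ j)
      (fun j : Fin (n + 0) => δ j) ↔ Sem p l (formulaCode φ) (θ δ) := by
    intro δ
    rw [sem_formulaCode, BoundedFormula.realize_relabel, Formula.Realize]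
    refine iff_of_eq ?_
    congr 1
    · funext i; exact (hθ δ i).symm
    · exact Subsingleton.elim _ _
  constructor
  · exact fun H δ => (key δ).1 (H fun j => δ j)
  · intro H xs
    have := (key fun j => if hj : j < n then xs ⟨j, hj⟩ else 0).2 (H _)
    convert this using 2
    simp

end Alls

theorem varCode_inl {m k : ℕ} (i : Fin m) : varCode (Sum.inl i : Fin m ⊕ Fin k) = 2 * (i : ℕ) := rfl

theorem varCode_inr {m k : ℕ} (i : Fin k) :
    varCode (Sum.inr i : Fin m ⊕ Fin k) = 2 * (i : ℕ) + 1 := rfl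

section Ren

variable {k c : ℕ} (h : ∀ i < l, k * i + c < l') (ha : WF p l a)

include h ha

/-- Renaming is the case of `allsC` in which no variable is quantified. -/
theorem renC_aux : WF p l' (renC k c a) ∧
    (Sem p l' (renC k c a) γ ↔ Sem p l a fun i => γ (k * i + c)) := by
  let g : Fin l → Fin l' ⊕ Fin 0 := fun i => Sum.inl ⟨k * i + c, h i i.2⟩
  have hg : ∀ i : Fin l, varCode (g i)
      = bif decide (2 * (i : ℕ) % 2 = 0) then 2 * (k * (2 * i / 2) + c) else 2 * i := by
    intro i; simp [g, varCode_inl]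
  have hb : ∀ i, (bif decide ((2 * i + 1) % 2 = 0) then 2 * (k * ((2 * i + 1) / 2) + c)
      else 2 * i + 1) = 2 * (0 + i) + 1 := by
    intro i; simp
  refine ⟨WF.allsC (n := 0) (h := fun v => bif decide (v % 2 = 0) then 2 * (k * (v / 2) + c) else v)
    g hg hb ha, ?_⟩
  have := sem_allsC (n := 0) (γ := γ)
    (h := fun v => bif decide (v % 2 = 0) then 2 * (k * (v / 2) + c) else v)
    g hg hb ha (fun _ i => γ (k * i + c)) (by simp [g])
  rw [forall_const] at this
  exact this

/-- Well-formedness does not involve a field, so the common lemma is used with an arbitrary one;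
likewise for `WF.qC` and `WF.exC`. -/
theorem WF.renC : WF p l' (renC k c a) := (renC_aux (F := ZMod 2) (γ := 0) h ha).1

theorem sem_renC : Sem p l' (renC k c a) γ ↔ Sem p l a fun i => γ (k * i + c) :=
  (renC_aux h ha).2

end Ren

/-- The numbers of free variables do not depend on how many variables are allowed. Hence the same
number also codes a formula in more variables, as `WF.mono` and `sem_mono` state. -/
theorem mapCode_id (h : WF p l a) : renC 1 0 a = a := by
  obtain ⟨φ, rfl⟩ := h
  have hf : (fun v => bif decide (v % 2 = 0) then 2 * (1 * (v / 2) + 0) else v) = id := by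
    funext v
    by_cases h : v % 2 = 0
    · simp [h]; omega
    · simp [h]
  rw [renC, hf]
  have ht : ∀ {k : ℕ} (t : (Lp p).Term (Fin l ⊕ Fin k)), mapTerm id (termCode t) = termCode t := by
    intro k t
    rw [← termCode_relabel id id (fun _ => rfl), Term.relabel_id]
  clear hf
  suffices H : ∀ {k : ℕ} (φ : (Lp p).BoundedFormula (Fin l) k),
      mapCode id (formulaCode φ) = formulaCode φ from H φ
  intro k φ
  induction φ with
  | falsum => exact mapCode_falsum id
  | equal t₁ t₂ =>
    have := mapCode_eq id (termCode t₁) (termCode t₂)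
    rw [ht, ht] at this
    exact this
  | rel R ts => exact R.elim
  | imp φ ψ ih₁ ih₂ =>
    have := mapCode_imp id (formulaCode φ) (formulaCode ψ)
    rw [ih₁, ih₂] at this
    exact this
  | all φ ih =>
    have := mapCode_all id (formulaCode φ)
    rw [ih] at this
    exact this

theorem WF.mono (h : WF p l a) (hl : l ≤ l') : WF p l' a := by
  rw [← mapCode_id h]
  exact WF.renC (fun i hi => by omega) h

theorem sem_mono (h : WF p l a) (hl : l ≤ l') : Sem p l' a γ ↔ Sem p l a γ := by
  conv_lhs => rw [← mapCode_id h]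
  rw [sem_renC (fun i hi => by omega) h]
  simp

section Quantify

variable (ha : WF p l a)

include ha

theorem qC_aux : WF p l (qC l a) ∧ (Sem p l (qC l a) γ ↔
    ∀ δ : ℕ → F, Sem p l a fun i => if i % 2 = 0 then δ (i / 2) else γ (i / 2)) := by
  let g : Fin l → Fin l ⊕ Fin l := fun i =>
    if (i : ℕ) % 2 = 0 then Sum.inr ⟨i / 2, by omega⟩ else Sum.inl ⟨i / 2, by omega⟩
  -- The free variable `i` has number `v = 2 i`. If `i` is even it becomes the bound variable `i /
  -- 2`, with number `i + 1 = v / 2 + 1`; if `i` is odd it becomes the free variable `(i - 1) / 2`,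
  -- with number `i - 1 = v / 2 - 1`. Variables already bound move up by `l` places.
  let h : ℕ → ℕ := fun v => bif decide (v % 2 = 0) then
    (bif decide (v % 4 = 0) then v / 2 + 1 else v / 2 - 1) else 2 * l + v
  have hg : ∀ i : Fin l, varCode (g i) = h (2 * i) := by
    intro i
    by_cases hi : (i : ℕ) % 2 = 0
    · have : 2 * (i : ℕ) % 4 = 0 := by omega
      simp [g, h, hi, this, varCode_inr]; omega
    · have : ¬ 2 * (i : ℕ) % 4 = 0 := by omega
      simp [g, h, hi, this, varCode_inl]; omega
  have hb : ∀ i, h (2 * i + 1) = 2 * (l + i) + 1 := by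
    intro i; simp [h]; omega
  refine ⟨WF.allsC g hg hb ha, ?_⟩
  refine sem_allsC g hg hb ha _ fun δ i => ?_
  by_cases hi : (i : ℕ) % 2 = 0 <;> simp [g, hi]

theorem WF.qC : WF p l (qC l a) := (qC_aux (F := ZMod 2) (γ := 0) ha).1

theorem sem_qC : Sem p l (qC l a) γ ↔
    ∀ δ : ℕ → F, Sem p l a fun i => if i % 2 = 0 then δ (i / 2) else γ (i / 2) := (qC_aux ha).2

theorem exC_aux : WF p 0 (exC l a) ∧ (Sem p 0 (exC l a) γ ↔ ∃ δ : ℕ → F, Sem p l a δ) := by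
  let g : Fin l → Fin 0 ⊕ Fin l := Sum.inr
  let h : ℕ → ℕ := fun v => bif decide (v % 2 = 0) then v + 1 else 2 * l + v
  have hg : ∀ i : Fin l, varCode (g i) = h (2 * i) := by
    intro i; simp [g, h, varCode_inr]
  have hb : ∀ i, h (2 * i + 1) = 2 * (l + i) + 1 := by
    intro i; simp [h]; omega
  have hw := WF.allsC g hg hb ha.notC
  refine ⟨hw.notC, (sem_notC hw).trans ?_⟩
  rw [sem_allsC g hg hb ha.notC (γ := γ) (fun δ => δ) fun δ i => by simp only [g, Sum.elim_inr]  ]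
  simp only [sem_notC ha]
  push Not
  rfl

theorem WF.exC : WF p 0 (exC l a) := (exC_aux (F := ZMod 2) (γ := 0) ha).1

theorem sem_exC : Sem p 0 (exC l a) γ ↔ ∃ δ : ℕ → F, Sem p l a δ := (exC_aux ha).2

end Quantify

end Sem

end AddFrob

namespace AddFrob

open FirstOrder FirstOrder.Language

universe u

/-! ### Additive equations between constants as formulas -/

/-- Gödel number of the term `x_v ^ (p ^ j)`. -/
def powC (v j : ℕ) : ℕ := (fun t => funcC 1 2 [t])^[j] (Nat.pair 0 (2 * v))

/-- Gödel number of a sum of terms `x_v ^ (p ^ j)`. -/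
def sumC (l : List (ℕ × ℕ)) : ℕ := l.foldr (fun m t => funcC 2 3 [powC m.1 m.2, t]) (funcC 0 0 [])

/-- Gödel number of a conjunction. -/
def conjC (l : List ℕ) : ℕ := l.foldr andC (notC falsumC)

/-- Exponents of the monomials of the `n`-th power of a polynomial. -/
def powL (Q : List ℕ) (n : ℕ) : List ℕ := (fun l => l.flatMap fun a => Q.map fun b => a + b)^[n] [0]

/-- Multiplication by `Q ^ N`, removing the denominators. -/
def clr (P : Par) (N : ℕ) (f : FForm) : RForm :=
  f.flatMap fun m => (powL P.Q (N - m.2.2.1)).map fun e => (m.1, m.2.1 + e, m.2.2.2)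

/-- Gödel number of a formula expressing that the value of a form in constants is zero. -/
def linC (P : Par) (f : FForm) : ℕ :=
  conjC ((List.range (wtR (clr P (wtF f) f) + 1)).map fun i =>
    eqC (sumC (((clr P (wtF f) f).filter fun m => decide (m.2.1 = i)).map fun m => (m.1, m.2.2)))
      (funcC 0 0 []))

section Primrec

variable {α : Type} [Primcodable α] {P : Par}

@[fun_prop]
theorem primrec_powC {v j : α → ℕ} (hv : Primrec v) (hj : Primrec j) :
    Primrec fun x => powC (v x) (j x) := by
  unfold powC; fun_prop

@[fun_prop]
theorem primrec_sumC {l : α → List (ℕ × ℕ)} (hl : Primrec l) : Primrec fun x => sumC (l x) := by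
  unfold sumC; fun_prop

@[fun_prop]
theorem primrec_conjC {l : α → List ℕ} (hl : Primrec l) : Primrec fun x => conjC (l x) := by
  unfold conjC; fun_prop

@[fun_prop]
theorem primrec_powL {Q : α → List ℕ} {n : α → ℕ} (hQ : Primrec Q) (hn : Primrec n) :
    Primrec fun x => powL (Q x) (n x) := by
  unfold powL; fun_prop

@[fun_prop]
theorem primrec_clr {N : α → ℕ} {f : α → FForm} (hN : Primrec N) (hf : Primrec f) :
    Primrec fun x => clr P (N x) (f x) := by
  unfold clr; fun_prop

@[fun_prop]
theorem primrec_linC {f : α → FForm} (hf : Primrec f) : Primrec fun x => linC P (f x) := by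
  unfold linC; fun_prop

end Primrec

section Terms

variable {p L : ℕ}

/-- The term is fixed before the field is chosen, so that its number can be computed without
reference to `F`. -/
theorem exists_powC {v : ℕ} (hv : v < L) (j : ℕ) : ∃ t : (Lp p).Term (Fin L ⊕ Fin 0),
    termCode t = powC v j ∧ ∀ {F : Type u} [Field F] (γ : ℕ → F) (xs : Fin 0 → F),
      t.realize (Sum.elim (fun i : Fin L => γ i) xs) = γ v ^ p ^ j := by
  induction j with
  | zero => exact ⟨.var (Sum.inl ⟨v, hv⟩), rfl, by intros; simp⟩
  | succ j ih =>
    obtain ⟨t, ht, ht'⟩ := ih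
    refine ⟨.func (L := Lp p) (l := 1) LpFunctions.frob fun _ => t, ?_, ?_⟩
    · have : powC v (j + 1) = funcC 1 2 [powC v j] := Function.iterate_succ_apply' _ _ _
      rw [this, ← ht]
      rfl
    · intro F _ γ xs
      have : (Term.func (L := Lp p) (l := 1) LpFunctions.frob fun _ => t).realize
        (Sum.elim (fun i : Fin L => γ i) xs)
          = t.realize (Sum.elim (fun i : Fin L => γ i) xs) ^ p := rfl
      rw [this, ht', ← pow_mul, pow_succ]

theorem exists_sumC {l : List (ℕ × ℕ)} (hl : ∀ m ∈ l, m.1 < L) :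
    ∃ t : (Lp p).Term (Fin L ⊕ Fin 0),
    termCode t = sumC l ∧ ∀ {F : Type u} [Field F] (γ : ℕ → F) (xs : Fin 0 → F),
      t.realize (Sum.elim (fun i : Fin L => γ i) xs) = (l.map fun m => γ m.1 ^ p ^ m.2).sum := by
  induction l with
  | nil => exact ⟨.func (L := Lp p) (l := 0) LpFunctions.zero Fin.elim0, rfl, by intros; rfl⟩
  | cons m l ih =>
    obtain ⟨t, ht, ht'⟩ := ih fun m hm => hl m (List.mem_cons_of_mem _ hm)
    obtain ⟨s, hs, hs'⟩ := exists_powC (p := p) (hl m List.mem_cons_self) m.2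
    refine ⟨.func (L := Lp p) (l := 2) LpFunctions.add fun i => if i = 0 then s else t, ?_, ?_⟩
    · have : sumC (m :: l) = funcC 2 3 [powC m.1 m.2, sumC l] := rfl
      rw [this, ← ht, ← hs]
      rfl
    · intro F _ γ xs
      have : (Term.func (L := Lp p) (l := 2) LpFunctions.add fun i => if i = 0 then s else t).realize
        (Sum.elim (fun i : Fin L => γ i) xs)
          = s.realize (Sum.elim (fun i : Fin L => γ i) xs)
            + t.realize (Sum.elim (fun i : Fin L => γ i) xs) := rfl
      rw [this, ht', hs', List.map_cons, List.sum_cons]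

variable {F : Type*} [Field F] {γ : ℕ → F}

theorem sumC_aux {l : List (ℕ × ℕ)} (hl : ∀ m ∈ l, m.1 < L) :
    ∃ φ : (Lp p).Formula (Fin L), formulaCode φ = eqC (sumC l) (funcC 0 0 []) ∧
    ∀ {F : Type u} [Field F] (γ : ℕ → F),
      φ.Realize (fun i : Fin L => γ i) ↔ (l.map fun m => γ m.1 ^ p ^ m.2).sum = 0 := by
  obtain ⟨t, ht, ht'⟩ := exists_sumC (p := p) hl
  refine ⟨.equal t (.func (L := Lp p) (l := 0) LpFunctions.zero Fin.elim0), ?_, ?_⟩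
  · rw [← ht]; rfl
  · intro F _ γ
    rw [← ht' γ default]
    rfl

theorem wf_eqC_sumC {l : List (ℕ × ℕ)} (hl : ∀ m ∈ l, m.1 < L) :
    WF p L (eqC (sumC l) (funcC 0 0 [])) := by
  obtain ⟨φ, h, -⟩ := sumC_aux.{0} (p := p) hl
  exact ⟨φ, h⟩

theorem sem_eqC_sumC {l : List (ℕ × ℕ)} (hl : ∀ m ∈ l, m.1 < L) :
    Sem p L (eqC (sumC l) (funcC 0 0 [])) γ ↔ (l.map fun m => γ m.1 ^ p ^ m.2).sum = 0 := by
  obtain ⟨φ, h, h'⟩ := sumC_aux (p := p) hl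
  rw [← h, sem_formulaCode, h']

theorem wf_conjC {l : List ℕ} (hl : ∀ a ∈ l, WF p L a) : WF p L (conjC l) := by
  induction l with
  | nil => exact wf_falsumC.notC
  | cons a l ih =>
    exact (hl a List.mem_cons_self).andC (ih fun a ha => hl a (List.mem_cons_of_mem _ ha))

theorem sem_conjC {l : List ℕ} (hl : ∀ a ∈ l, WF p L a) :
    Sem p L (conjC l) γ ↔ ∀ a ∈ l, Sem p L a γ := by
  induction l with
  | nil => simpa [conjC, sem_notC wf_falsumC] using not_sem_falsumC
  | cons a l ih =>
    have h1 := hl a List.mem_cons_self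
    have h2 : ∀ a ∈ l, WF p L a := fun a ha => hl a (List.mem_cons_of_mem _ ha)
    have : conjC (a :: l) = andC a (conjC l) := rfl
    rw [this, sem_andC h1 (wf_conjC h2), ih h2, List.forall_mem_cons]

end Terms

theorem mem_clr {P : Par} {N : ℕ} {f : FForm} {m} (h : m ∈ clr P N f) : ∃ m' ∈ f, m.1 = m'.1 := by
  obtain ⟨m', h', h⟩ := List.mem_flatMap.1 h
  obtain ⟨e, -, rfl⟩ := List.mem_map.1 h
  exact ⟨m', h', rfl⟩

theorem wf_linC {p L : ℕ} (P : Par) {f : FForm} (hf : ∀ m ∈ f, m.1 < L) : WF p L (linC P f) := by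
  refine wf_conjC fun a ha => ?_
  obtain ⟨i, -, rfl⟩ := List.mem_map.1 ha
  refine wf_eqC_sumC fun m hm => ?_
  obtain ⟨m₀, hm₀, rfl⟩ := List.mem_map.1 hm
  obtain ⟨m', hm', h⟩ := mem_clr (List.mem_of_mem_filter hm₀)
  exact h ▸ hf m' hm'

namespace Setting

open Polynomial

variable {P : Par} {F R : Type*} [Field F] [CommRing R] (K : Setting P F R)

theorem sum_powL (Q : List ℕ) (n : ℕ) :
    ((powL Q n).map fun e => K.z ^ e).sum = K.toR (lpoly Q) ^ n := by
  rw [toR_lpoly]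
  induction n with
  | zero => simp [powL]
  | succ n ih =>
    rw [pow_succ, ← ih, powL, Function.iterate_succ_apply', ← powL]
    induction powL Q n with
    | nil => simp
    | cons a l ih =>
      rw [List.flatMap_cons, List.map_append, List.sum_append, ih, List.map_cons, List.sum_cons,
        add_mul]
      congr 1
      rw [List.map_map, ← List.sum_map_mul_left]
      simp [Function.comp_def, pow_add]

theorem evalR_clr (γ : ℕ → F) {N : ℕ} {f : FForm} (h : ∀ m ∈ f, m.2.2.1 ≤ N) :
    K.evalR (fun v => K.ι (γ v)) (clr P N f) = K.toR (lpoly P.Q) ^ N * K.evalF γ f := by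
  induction f with
  | nil => simp [clr]
  | cons m f ih =>
    rw [evalF_cons, clr, List.flatMap_cons, ← clr, evalR_append,
      ih fun m hm => h m (List.mem_cons_of_mem _ hm), mul_add]
    congr 1
    have h1 : K.toR (lpoly P.Q) ^ N
        = K.toR (lpoly P.Q) ^ (N - m.2.2.1) * K.toR (lpoly P.Q) ^ m.2.2.1 := by
      rw [← pow_add, Nat.sub_add_cancel (h m List.mem_cons_self)]
    rw [h1]
    have h2 := K.mul_qi_pow m.2.2.1
    calc K.evalR _ _ = K.z ^ m.2.1 * K.ι (γ m.1) ^ P.p ^ m.2.2.2 *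
          ((powL P.Q (N - m.2.2.1)).map fun e => K.z ^ e).sum := by
          rw [evalR, List.map_map, ← List.sum_map_mul_left]
          congr 1
          refine List.map_congr_left fun e _ => ?_
          simp only [Function.comp_apply, pow_add]
          ring
      _ = _ := by
          rw [sum_powL]
          linear_combination (-K.z ^ m.2.1 * K.ι (γ m.1) ^ P.p ^ m.2.2.2 *
            K.toR (lpoly P.Q) ^ (N - m.2.2.1)) * h2

/-- The value is a polynomial in `z` over `F`, and the right-hand side is the vanishing of its
coefficients, each an additive expression in the constants. -/
theorem evalR_ι_eq_zero_iff (γ : ℕ → F) (g : RForm) :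
    K.evalR (fun v => K.ι (γ v)) g = 0 ↔
      ∀ i, ((g.filter fun m => decide (m.2.1 = i)).map fun m => γ m.1 ^ P.p ^ m.2.2).sum = 0 := by
  have h1 : K.evalR (fun v => K.ι (γ v)) g
      = K.toR ((g.map fun m => C (γ m.1 ^ P.p ^ m.2.2) * X ^ m.2.1).sum) := by
    rw [evalR, map_list_sum, List.map_map]
    congr 1
    refine List.map_congr_left fun m _ => ?_
    simp only [Function.comp_apply, map_mul, map_pow, toR_X, toR_C]
    ring
  rw [h1, map_eq_zero_iff _ K.inj, Polynomial.ext_iff]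
  refine forall_congr' fun i => ?_
  rw [coeff_zero]
  refine iff_of_eq (congrArg (· = 0) ?_)
  induction g with
  | nil => simp
  | cons m g ih =>
    rw [List.map_cons, List.sum_cons, coeff_add, List.filter_cons]
    have h2 := ih (by
      rw [evalR, map_list_sum, List.map_map]
      congr 1
      refine List.map_congr_left fun m _ => ?_
      simp only [Function.comp_apply, map_mul, map_pow, toR_X, toR_C]
      ring)
    rw [h2, coeff_C_mul_X_pow]
    by_cases hi : m.2.1 = i
    · simp [hi]
    · simp [hi, Ne.symm hi]

/-- `Q^N` is a unit of `R`, so clearing denominators does not affect vanishing. Coefficients beyond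
`wtR` are empty sums, hence a finite conjunction suffices. -/
theorem sem_linC {L : ℕ} {γ : ℕ → F} {f : FForm} (hf : ∀ m ∈ f, m.1 < L) :
    Sem P.p L (linC P f) γ ↔ K.evalF γ f = 0 := by
  have hl : ∀ i, ∀ m ∈ ((clr P (wtF f) f).filter fun m => decide (m.2.1 = i)).map
      fun m => (m.1, m.2.2), m.1 < L := by
    intro i m hm
    obtain ⟨m₀, hm₀, rfl⟩ := List.mem_map.1 hm
    obtain ⟨m', hm', h⟩ := mem_clr (List.mem_of_mem_filter hm₀)
    exact h ▸ hf m' hm'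
  have h1 : K.evalF γ f = 0 ↔ K.evalR (fun v => K.ι (γ v)) (clr P (wtF f) f) = 0 := by
    rw [K.evalR_clr γ fun m hm => by have := le_wtF hm; omega]
    constructor
    · intro h; rw [h, mul_zero]
    · intro h
      have h2 := K.mul_qi_pow (wtF f)
      calc K.evalF γ f = K.qi ^ wtF f * (K.toR (lpoly P.Q) ^ wtF f * K.evalF γ f) := by
            linear_combination (-K.evalF γ f) * h2
        _ = 0 := by rw [h, mul_zero]
  rw [h1, evalR_ι_eq_zero_iff, linC, sem_conjC]
  · rw [List.forall_mem_map]
    simp only [sem_eqC_sumC (hl _), List.map_map, Function.comp_def, List.mem_range]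
    constructor
    · intro h i
      by_cases hi : i < wtR (clr P (wtF f) f) + 1
      · exact h i hi
      · rw [List.filter_eq_nil_iff.2]
        · rfl
        · intro m hm
          have := le_wtR hm
          simp; omega
    · exact fun h i _ => h i
  · intro a ha
    obtain ⟨i, -, rfl⟩ := List.mem_map.1 ha
    exact wf_eqC_sumC (hl i)

end Setting

end AddFrob

namespace AddFrob

/-! ### Clauses and their transformations -/

/-- A clause `(Λ, E, I, l, σ)` describes the set of the values of `Λ` at the points where the forms
in `E` vanish, those in `I` do not vanish, and the formula with number `σ` holds. -/
abbrev Clause := Form × List Form × List Form × ℕ × ℕ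

/-- A finite union of clauses. -/
abbrev Data := List Clause

/-- The forms in a clause. -/
def Clause.forms (C : Clause) : List Form := C.1 :: (C.2.1 ++ C.2.2.1)

/-- A bound for the constants that occur in a clause. -/
def Clause.bd (C : Clause) : ℕ := C.2.2.2.1 + (C.forms.map fun f => fbd f.2).sum

/-- A form with its redundant terms removed. -/
def cleanF (P : Par) (f : Form) : Form := (clean P f.1, f.2)

/-- Substitution in a clause. -/
def Clause.subst (P : Par) (h : ℕ → Form) (C : Clause) : Clause :=
  (cleanF P (subForm P h C.1), C.2.1.map fun f => cleanF P (subForm P h f),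
    C.2.2.1.map fun f => cleanF P (subForm P h f), C.2.2.2)

/-- A variable occurs in a form. -/
def occurs (P : Par) (v : ℕ) (f : Form) : Bool := (clean P f.1).any fun m => decide (m.1 = v)

/-- The substitution `y_v := e * y_v + c`, `y_w := y_w + T_w y_v`. -/
def elimSub (L v : ℕ) (e : List ℕ) (T : List (ℕ × RForm)) (w : ℕ) : Form :=
  bif decide (w = v) then (scalar e v, vform (e.sum + 1) 0 L)
  else ((w, 0, 0) :: renR 0 v (assoc T w), [])

/-- The substitution `y_v := ∑ z ^ i * y_{v,i} ^ (p ^ r)`. -/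
def expandSub (P : Par) (r : List ℕ) (v : ℕ) : Form :=
  ((List.range (P.p ^ r.getD v 0)).map fun i => (Nat.pair v i, i, r.getD v 0), [])

/-- The substitution of bounded elements for the variables that occur in a certificate. -/
def solveSub (P : Par) (L N : ℕ) (c : Cert) (v : ℕ) : Form :=
  bif c.2.2.2.1.any (fun x => decide (x.1 = 2 * v)) then ([], vform (N * P.D) N (L + v * (N * P.D)))
  else ([(v, 0, 0)], [])

/-- The conditions on the constants in a clause. -/
def Clause.conds (P : Par) (C : Clause) : ℕ :=
  andC C.2.2.2.2 (andC (conjC ((C.2.1.filter fun f => f.1.isEmpty).map fun f => linC P f.2))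
    (conjC ((C.2.2.1.filter fun f => f.1.isEmpty).map fun f => notC (linC P f.2))))

/-- Inclusion of the conditions on the constants in the formula of a clause. -/
def Clause.absorb (P : Par) (C : Clause) : Clause :=
  (C.1, C.2.1.filter fun f => !f.1.isEmpty, C.2.2.1.filter fun f => !f.1.isEmpty, C.bd, C.conds P)

/-- Removal of the inequalities that involve a given variable. -/
def Clause.drop (P : Par) (v : ℕ) (C : Clause) : Clause :=
  (C.1, C.2.1, C.2.2.1.filter fun f => !occurs P v f, C.2.2.2)

/-- Parameters of a transformation of clauses. -/
abbrev Step := ℕ × ℕ × List ℕ × List (ℕ × RForm) × Cert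

/-- Transformations of clauses that do not change the set described. -/
def Clause.step (P : Par) (C : Clause) (q : Step) : Clause :=
  bif decide (q.1 = 0) then
    bif nonzero P q.2.2.1 then C.subst P (elimSub C.bd q.2.1 q.2.2.1 q.2.2.2.1) else C
  else bif decide (q.1 = 1) then C.subst P (expandSub P q.2.2.1)
  else bif decide (q.1 = 2) then
    bif !C.2.1.isEmpty && q.2.2.2.2.ok P (C.2.1.headD ([], [])).1 then
      C.subst P (solveSub P C.bd
        (q.2.2.2.2.bound (C.2.1.headD ([], [])).1 (wtF (C.2.1.headD ([], [])).2)) q.2.2.2.2)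
    else C
  else bif decide (q.1 = 3) then
    bif !(C.1 :: C.2.1).any (occurs P q.2.1) then C.drop P q.2.1 else C
  else C.absorb P

/-- A sequence of transformations. -/
def Clause.run (P : Par) (C : Clause) (l : List Step) : Clause := l.foldl (Clause.step P) C

section Primrec

variable {α : Type} [Primcodable α] {P : Par}

@[fun_prop]
theorem primrec_isEmpty {β : Type} [Primcodable β] {f : α → List β} (hf : Primrec f) :
    Primrec fun a => (f a).isEmpty := by
  have : Primrec fun a => decide ((f a).length = 0) := by fun_prop
  exact this.of_eq fun a => by cases f a <;> simp

@[fun_prop]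
theorem primrec_bd {C : α → Clause} (hC : Primrec C) : Primrec fun a => (C a).bd := by
  unfold Clause.bd Clause.forms; fun_prop

@[fun_prop]
theorem primrec_cleanF {f : α → Form} (hf : Primrec f) : Primrec fun a => cleanF P (f a) := by
  unfold cleanF; fun_prop

@[fun_prop]
theorem primrec_subst {h : α → ℕ → Form} {C : α → Clause} (hh : Primrec fun q : α × ℕ => h q.1 q.2)
    (hC : Primrec C) : Primrec fun a => (C a).subst P (h a) := by
  have : ∀ {γ : Type} [Primcodable γ] {u : γ → α} {w : γ → ℕ}, Primrec u → Primrec w →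
      Primrec fun c => h (u c) (w c) := fun hu hw => hh.comp (hu.pair hw)
  unfold Clause.subst; fun_prop

@[fun_prop]
theorem primrec_occurs {v : α → ℕ} {f : α → Form} (hv : Primrec v) (hf : Primrec f) :
    Primrec fun a => occurs P (v a) (f a) := by
  unfold occurs; fun_prop

@[fun_prop]
theorem primrec_elimSub {L v : α → ℕ} {e : α → List ℕ} {T : α → List (ℕ × RForm)} {w : α → ℕ}
    (hL : Primrec L) (hv : Primrec v) (he : Primrec e) (hT : Primrec T) (hw : Primrec w) :
    Primrec fun a => elimSub (L a) (v a) (e a) (T a) (w a) := by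
  unfold elimSub; fun_prop

@[fun_prop]
theorem primrec_expandSub {r : α → List ℕ} {v : α → ℕ} (hr : Primrec r) (hv : Primrec v) :
    Primrec fun a => expandSub P (r a) (v a) := by
  unfold expandSub; fun_prop

@[fun_prop]
theorem primrec_solveSub {L N : α → ℕ} {c : α → Cert} {v : α → ℕ} (hL : Primrec L)
    (hN : Primrec N) (hc : Primrec c) (hv : Primrec v) :
    Primrec fun a => solveSub P (L a) (N a) (c a) (v a) := by
  unfold solveSub; fun_prop

@[fun_prop]
theorem primrec_absorb {C : α → Clause} (hC : Primrec C) : Primrec fun a => (C a).absorb P := by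
  unfold Clause.absorb Clause.conds; fun_prop

@[fun_prop]
theorem primrec_drop {v : α → ℕ} {C : α → Clause} (hv : Primrec v) (hC : Primrec C) :
    Primrec fun a => (C a).drop P (v a) := by
  unfold Clause.drop; fun_prop

@[fun_prop]
theorem primrec_step {C : α → Clause} {q : α → Step} (hC : Primrec C) (hq : Primrec q) :
    Primrec fun a => (C a).step P (q a) := by
  unfold Clause.step; fun_prop

@[fun_prop]
theorem primrec_run {C : α → Clause} {l : α → List Step} (hC : Primrec C) (hl : Primrec l) :
    Primrec fun a => (C a).run P (l a) := by
  unfold Clause.run; fun_prop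

end Primrec

end AddFrob

/-! ### The sets described by clauses and their invariance under the transformations -/

namespace AddFrob

namespace Clause

/-- The formula of a clause is well formed. -/
def WF (p : ℕ) (C : Clause) : Prop := AddFrob.WF p C.2.2.2.1 C.2.2.2.2

theorem l_le_bd (C : Clause) : C.2.2.2.1 ≤ C.bd := Nat.le_add_right _ _

theorem lt_bd {C : Clause} {f : Form} (hf : f ∈ C.forms) {m} (hm : m ∈ f.2) : m.1 < C.bd :=
  (lt_fbd hm).trans_le ((List.single_le_sum (by simp) _
    (List.mem_map_of_mem (f := fun f : Form => fbd f.2) hf)).trans (Nat.le_add_left _ _))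

theorem fst_mem_forms (C : Clause) : C.1 ∈ C.forms := List.mem_cons_self

theorem mem_forms_of_E {C : Clause} {f : Form} (h : f ∈ C.2.1) : f ∈ C.forms :=
  List.mem_cons_of_mem _ (List.mem_append_left _ h)

theorem mem_forms_of_I {C : Clause} {f : Form} (h : f ∈ C.2.2.1) : f ∈ C.forms :=
  List.mem_cons_of_mem _ (List.mem_append_right _ h)

end Clause

namespace Setting

variable {P : Par} {F R : Type*} [Field F] [CommRing R] (K : Setting P F R)

/-- A point satisfies the conditions of a clause. -/
def Sat (C : Clause) (ρ : ℕ → R) (γ : ℕ → F) : Prop :=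
  (∀ f ∈ C.2.1, K.ev ρ γ f = 0) ∧ (∀ f ∈ C.2.2.1, K.ev ρ γ f ≠ 0) ∧ Sem P.p C.2.2.2.1 C.2.2.2.2 γ

/-- The set described by a clause. -/
def den (C : Clause) : Set R := {x | ∃ ρ γ, K.Sat C ρ γ ∧ K.ev ρ γ C.1 = x}

theorem ev_cleanF (ρ : ℕ → R) (γ : ℕ → F) (f : Form) : K.ev ρ γ (cleanF P f) = K.ev ρ γ f := by
  simp [ev, cleanF]

theorem ev_congr {ρ ρ' : ℕ → R} {γ γ' : ℕ → F} {f : Form} (hρ : ∀ m ∈ f.1, ρ m.1 = ρ' m.1)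
    (hγ : ∀ m ∈ f.2, γ m.1 = γ' m.1) : K.ev ρ γ f = K.ev ρ' γ' f := by
  rw [ev, ev, K.evalR_congr hρ, K.evalF_congr hγ]

theorem sat_subst (h : ℕ → Form) (C : Clause) (ρ : ℕ → R) (γ : ℕ → F) :
    K.Sat (C.subst P h) ρ γ ↔ K.Sat C (fun v => K.ev ρ γ (h v)) γ := by
  simp only [Sat, Clause.subst, List.forall_mem_map, ev_cleanF, ev_subForm]

theorem sat_congr {C : Clause} {ρ ρ' : ℕ → R} {γ γ' : ℕ → F}
    (hρ : ∀ f ∈ C.forms, ∀ m ∈ f.1, ρ m.1 = ρ' m.1) (hγ : ∀ i < C.bd, γ i = γ' i) :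
    K.Sat C ρ γ ↔ K.Sat C ρ' γ' := by
  have h1 : ∀ f ∈ C.forms, K.ev ρ γ f = K.ev ρ' γ' f := fun f hf =>
    K.ev_congr (hρ f hf) fun m hm => hγ _ (Clause.lt_bd hf hm)
  refine and_congr (forall₂_congr fun f hf => ?_) (and_congr (forall₂_congr fun f hf => ?_)
    (sem_congr fun i hi => hγ i (hi.trans_le C.l_le_bd)))
  · rw [h1 f (Clause.mem_forms_of_E hf)]
  · rw [h1 f (Clause.mem_forms_of_I hf)]

/-- A substitution that is surjective on the solutions does not change the set described. -/
theorem den_subst {h : ℕ → Form} {C : Clause}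
    (hs : ∀ ρ γ, K.Sat C ρ γ → ∃ ρ' γ', (∀ i < C.bd, γ i = γ' i) ∧
      ∀ v, ρ v = K.ev ρ' γ' (h v)) : K.den (C.subst P h) = K.den C := by
  ext x
  constructor
  · rintro ⟨ρ, γ, h1, rfl⟩
    refine ⟨_, γ, (K.sat_subst h C ρ γ).1 h1, ?_⟩
    rw [Clause.subst, ev_cleanF, ev_subForm]
  · rintro ⟨ρ, γ, h1, rfl⟩
    obtain ⟨ρ', γ', h2, h3⟩ := hs ρ γ h1
    obtain rfl : ρ = fun v => K.ev ρ' γ' (h v) := funext h3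
    refine ⟨ρ', γ', ?_, ?_⟩
    · rw [sat_subst]
      exact (K.sat_congr (fun _ _ _ _ => rfl) h2).1 h1
    · rw [Clause.subst, ev_cleanF, ev_subForm]
      exact K.ev_congr (fun _ _ => rfl) fun m hm => (h2 _ (Clause.lt_bd C.fst_mem_forms hm)).symm

/-- The substitution is surjective: `ρ v` is divided by the nonzero polynomial of `e`, the remainder
being given by fresh constants from `C.bd` on, and the shift of the other variables by multiples of
powers of the quotient is undone by subtraction. -/
theorem den_elim {v : ℕ} {e : List ℕ} (he : nonzero P e) (T : List (ℕ × RForm)) (C : Clause) :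
    K.den (C.subst P (elimSub C.bd v e T)) = K.den C := by
  have := K.char
  refine K.den_subst fun ρ γ _ => ?_
  obtain ⟨w, y, hw, hy⟩ := K.exists_eq_add_mul (e.sum + 1) (lpoly e)
    ((lpoly_ne_zero_iff P _).2 he) ((natDegree_lpoly_le e).trans (Nat.le_succ _)) (ρ v)
  refine ⟨fun u => if u = v then y else ρ u - K.evalR (fun _ => y) (assoc T u),
    fun i => if i < C.bd then γ i else w.coeff (i - C.bd), fun i hi => by simp [hi], fun u => ?_⟩
  by_cases hu : u = v
  · subst hu
    simp only [elimSub, decide_true, cond_true, ev, evalR_scalar]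
    rw [K.evalF_vform_coeff hw (fun k hk => by simp), if_pos trivial, hy, pow_zero, mul_one]
    ring
  · simp only [elimSub, hu, decide_false, cond_false, ev, evalF_nil, evalR_cons, evalR_renR,
      if_false]
    simp

/-- Every element has coordinates over the `p^r`-th powers, so the substitution is surjective. -/
theorem den_expand (r : List ℕ) (C : Clause) :
    K.den (C.subst P (expandSub P r)) = K.den C := by
  refine K.den_subst fun ρ γ _ => ?_
  choose c hc using fun v => K.exists_coordinates' (r.getD v 0) (ρ v)
  refine ⟨fun u => c u.unpair.1 u.unpair.2, γ, fun _ _ => rfl, fun v => ?_⟩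
  rw [hc v]
  simp only [ev, expandSub, evalF_nil, add_zero, evalR, List.map_map]
  rw [← List.sum_toFinset _ (List.nodup_range), List.toFinset_range]
  simp

/-- Simultaneous choice of the coefficients of elements of bounded order. -/
theorem exists_blocks {N : ℕ} {u : ℕ → R} (hu : ∀ v, u v ∈ K.V N) (L : ℕ) (γ : ℕ → F) :
    ∃ γ' : ℕ → F, (∀ i < L, γ' i = γ i) ∧
      ∀ v, K.evalF γ' (vform (N * P.D) N (L + v * (N * P.D))) = u v := by
  choose a ha using fun v => K.exists_evalF_vform (hu v)
  -- The constants from `L` on are cut into consecutive blocks of length `N D`; block `v` holds the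
  -- coefficients of the numerator of `u v`.
  refine ⟨fun i => if i < L then γ i else a ((i - L) / (N * P.D)) ((i - L) % (N * P.D)),
    fun i hi => by simp [hi], fun v => ha v _ _ fun k hk => ?_⟩
  rw [if_neg (by omega)]
  have h7 : L + v * (N * P.D) + k - L = k + v * (N * P.D) := by omega
  rw [h7, Nat.add_mul_div_right _ _ (by omega), Nat.add_mul_mod_self_right, Nat.div_eq_of_lt hk,
    zero_add, Nat.mod_eq_of_lt hk]

/-- On solutions of the equation, the part of `f` in ring variables equals minus the part in
constants, which is bounded. By the certificate its variables then lie in `V N`, so nothing is lost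
when they are replaced by general elements of `V N` with new constants as coefficients. -/
theorem den_solve {C : Clause} {f : Form} (hf : f ∈ C.2.1) {c : Cert} (hc : c.ok P f.1) :
    K.den (C.subst P (solveSub P C.bd (c.bound f.1 (wtF f.2)) c)) = K.den C := by
  refine K.den_subst fun ρ γ hsat => ?_
  set N := c.bound f.1 (wtF f.2) with hN
  -- The completing variables are set to zero, so that the completed form takes the value of `f`.
  have h1 : K.evalR (fun v => if v % 2 = 0 then ρ (v / 2) else 0) (full f.1 c.1)
      ∈ K.V (wtF f.2) := by
    have h2 := hsat.1 f hf
    have h3 : K.evalR (fun v => ((if (2 * v + 1) % 2 = 0 then ρ ((2 * v + 1) / 2) else 0) : R)) c.1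
        = 0 := by
      refine List.sum_eq_zero fun x hx => ?_
      obtain ⟨m, -, rfl⟩ := List.mem_map.1 hx
      simp [zero_pow (K.q_pos _).ne']
    rw [evalR_full, h3, add_zero]
    simp only [Nat.mul_mod_right, if_true, Nat.mul_div_cancel_left _ two_pos]
    rw [eq_neg_of_add_eq_zero_left h2]
    exact neg_mem (K.evalF_mem_V_wtF γ f.2)
  have h4 := (K.certified_of_ok hc).bounded h1
  rw [← Cert.bound, ← hN] at h4
  obtain ⟨γ', h5, h6⟩ := K.exists_blocks (N := N)
    (u := fun v => if ∃ x ∈ c.2.2.2.1, x.1 = 2 * v then ρ v else 0) (fun v => by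
      split_ifs with hv
      · obtain ⟨x, hx, hxv⟩ := hv
        have h6 := h4 x hx
        simpa only [hxv, Nat.mul_mod_right, if_true, Nat.mul_div_cancel_left _ two_pos] using h6
      · exact zero_mem _) C.bd γ
  refine ⟨ρ, γ', fun i hi => (h5 i hi).symm, fun v => ?_⟩
  cases hv : c.2.2.2.1.any (fun x => decide (x.1 = 2 * v))
  · simp [solveSub, hv, ev, evalR_cons]
  · simp only [solveSub, hv, cond_true, ev, evalR_nil, zero_add, h6]
    rw [if_pos]
    simpa using hv

theorem wf_conds {C : Clause} (h : C.WF P.p) : AddFrob.WF P.p C.bd (C.conds P) := by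
  refine (h.mono C.l_le_bd).andC ((wf_conjC fun a ha => ?_).andC (wf_conjC fun a ha => ?_))
  · obtain ⟨f, hf, rfl⟩ := List.mem_map.1 ha
    exact wf_linC P fun m hm =>
      Clause.lt_bd (Clause.mem_forms_of_E (List.mem_of_mem_filter hf)) hm
  · obtain ⟨f, hf, rfl⟩ := List.mem_map.1 ha
    exact (wf_linC P fun m hm =>
      Clause.lt_bd (Clause.mem_forms_of_I (List.mem_of_mem_filter hf)) hm).notC

theorem wf_absorb {C : Clause} (h : C.WF P.p) : (C.absorb P).WF P.p := by
  simp only [Clause.WF, Clause.absorb]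
  exact wf_conds h

theorem sem_conds {C : Clause} (h : C.WF P.p) (γ : ℕ → F) :
    Sem P.p C.bd (C.conds P) γ ↔ Sem P.p C.2.2.2.1 C.2.2.2.2 γ ∧
      (∀ f ∈ C.2.1, f.1 = [] → K.evalF γ f.2 = 0) ∧
      ∀ f ∈ C.2.2.1, f.1 = [] → K.evalF γ f.2 ≠ 0 := by
  have h1 : ∀ a ∈ (C.2.1.filter fun f => f.1.isEmpty).map fun f => linC P f.2,
      AddFrob.WF P.p C.bd a := by
    intro a ha
    obtain ⟨f, hf, rfl⟩ := List.mem_map.1 ha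
    exact wf_linC P fun m hm =>
      Clause.lt_bd (Clause.mem_forms_of_E (List.mem_of_mem_filter hf)) hm
  have h2 : ∀ a ∈ (C.2.2.1.filter fun f => f.1.isEmpty).map fun f => notC (linC P f.2),
      AddFrob.WF P.p C.bd a := by
    intro a ha
    obtain ⟨f, hf, rfl⟩ := List.mem_map.1 ha
    exact (wf_linC P fun m hm =>
      Clause.lt_bd (Clause.mem_forms_of_I (List.mem_of_mem_filter hf)) hm).notC
  rw [Clause.conds, sem_andC (h.mono C.l_le_bd) ((wf_conjC h1).andC (wf_conjC h2)),
    sem_andC (wf_conjC h1) (wf_conjC h2), sem_mono h C.l_le_bd, sem_conjC h1, sem_conjC h2,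
    List.forall_mem_map, List.forall_mem_map]
  simp only [List.mem_filter, List.isEmpty_iff, and_imp]
  refine and_congr_right fun _ => and_congr (forall₃_congr fun f hf _ => ?_)
    (forall₃_congr fun f hf _ => ?_)
  · exact K.sem_linC fun m hm => Clause.lt_bd (Clause.mem_forms_of_E hf) hm
  · have hm : ∀ m ∈ f.2, m.1 < C.bd := fun m hm => Clause.lt_bd (Clause.mem_forms_of_I hf) hm
    rw [sem_notC (wf_linC P hm), K.sem_linC hm]

theorem sat_absorb {C : Clause} (h : C.WF P.p) (ρ : ℕ → R) (γ : ℕ → F) :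
    K.Sat (C.absorb P) ρ γ ↔ K.Sat C ρ γ := by
  have key : ∀ f : Form, f.1 = [] → K.ev ρ γ f = K.evalF γ f.2 := by
    intro f hf; rw [ev, hf, evalR_nil, zero_add]
  simp only [Sat, Clause.absorb, K.sem_conds h, List.mem_filter, Bool.not_eq_true',
    List.isEmpty_eq_false_iff, and_imp]
  constructor
  · rintro ⟨h1, h2, h3, h4, h5⟩
    refine ⟨fun f hf => ?_, fun f hf => ?_, h3⟩
    · by_cases hf1 : f.1 = []
      · rw [key f hf1]; exact h4 f hf hf1
      · exact h1 f hf hf1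
    · by_cases hf1 : f.1 = []
      · rw [key f hf1]; exact h5 f hf hf1
      · exact h2 f hf hf1
  · rintro ⟨h1, h2, h3⟩
    exact ⟨fun f hf _ => h1 f hf, fun f hf _ => h2 f hf, h3,
      fun f hf hf1 => key f hf1 ▸ h1 f hf, fun f hf hf1 => key f hf1 ▸ h2 f hf⟩

theorem den_absorb {C : Clause} (h : C.WF P.p) : K.den (C.absorb P) = K.den C := by
  simp only [den, K.sat_absorb h]
  rfl

theorem ev_update_of_not_occurs {v : ℕ} {f : Form} (h : occurs P v f = false) (ρ : ℕ → R) (r : R)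
    (γ : ℕ → F) : K.ev (Function.update ρ v r) γ f = K.ev ρ γ f := by
  rw [← ev_cleanF, ← K.ev_cleanF ρ]
  refine K.ev_congr (fun m hm => ?_) fun _ _ => rfl
  rw [occurs, List.any_eq_false] at h
  exact Function.update_of_ne (by simpa using h m hm) _ _

/-- As a function of `r` the form is an additive polynomial plus a constant, and a term that
survives cleaning makes one of its coefficients nonzero. -/
theorem finite_setOf_ev_eq_zero [IsDomain R] {v : ℕ} {f : Form} (h : occurs P v f) (ρ : ℕ → R)
    (γ : ℕ → F) : {r | K.ev (Function.update ρ v r) γ f = 0}.Finite := by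
  have hc := K.char
  rw [occurs, List.any_eq_true] at h
  obtain ⟨m, hm, hmv⟩ := h
  rw [decide_eq_true_eq] at hmv
  have hsplit : ∀ (ρ : ℕ → R) (g : RForm), K.evalR ρ g
      = K.evalR ρ (g.filter fun m => decide (m.1 = v))
        + K.evalR ρ (g.filter fun m => !decide (m.1 = v)) := by
    intro ρ g
    induction g with
    | nil => simp
    | cons m g ih =>
      rw [evalR_cons, ih]
      by_cases hm : m.1 = v
      · simp [hm, evalR_cons]; ring
      · simp [hm, evalR_cons]; ring
  set g := clean P f.1 with hg
  have h1 : ∀ r, K.ev (Function.update ρ v r) γ f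
      = (((g.filter fun m => decide (m.1 = v)).map fun m => m.2).map
          fun m => K.z ^ m.1 * r ^ P.p ^ m.2).sum
        + (K.evalR ρ (g.filter fun m => !decide (m.1 = v)) + K.evalF γ f.2) := by
    intro r
    rw [ev, ← evalR_clean, ← hg, hsplit, add_assoc]
    congr 1
    · rw [evalR, List.map_map]
      congr 1
      refine List.map_congr_left fun m hm => ?_
      have : m.1 = v := by simpa using (List.mem_filter.1 hm).2
      simp [this]
    · congr 1
      refine K.evalR_congr fun m hm => Function.update_of_ne ?_ _ _
      simpa using (List.mem_filter.1 hm).2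
  have h2 := K.finite_additive_roots ((g.filter fun m => decide (m.1 = v)).map fun m => m.2)
    (-(K.evalR ρ (g.filter fun m => !decide (m.1 = v)) + K.evalF γ f.2)) m.2.2 ?_
  · refine h2.subset fun r hr => ?_
    rw [Set.mem_ofPred_eq, h1] at hr
    exact eq_neg_of_add_eq_zero_left hr
  · intro h0
    -- This polynomial is the coefficient of `r^(p^j)` with `j = m.2.2`. Its coefficient at
    -- `z^(m.2.1)` is the multiplicity of `m`, which is not divisible by `p` because `m` was kept by
    -- `clean`.
    have h3 : K.toR (lpoly ((((g.filter fun m => decide (m.1 = v)).map fun m => m.2).filter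
        fun m' => decide (m'.2 = m.2.2)).map fun m => m.1)) = 0 := by
      rw [toR_lpoly, List.map_map]; exact h0
    rw [map_eq_zero_iff _ K.inj] at h3
    have h4 := coeff_lpoly (k := F) ((((g.filter fun m => decide (m.1 = v)).map
      fun m => m.2).filter fun m' => decide (m'.2 = m.2.2)).map fun m => m.1) m.2.1
    rw [h3, Polynomial.coeff_zero, eq_comm, CharP.cast_eq_zero_iff F P.p] at h4
    have h5 : cnt ((((g.filter fun m => decide (m.1 = v)).map fun m => m.2).filter
        fun m' => decide (m'.2 = m.2.2)).map fun m => m.1) m.2.1 = cnt g m := by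
      rw [cnt, cnt, List.filter_map, List.length_map, List.filter_map, List.filter_map,
        List.length_map, List.filter_filter, List.filter_filter]
      congr 1
      refine List.filter_congr fun m' _ => ?_
      obtain ⟨a, b, c⟩ := m'
      obtain ⟨a', b', c'⟩ := m
      simp only at hmv
      subst hmv
      simp only [Function.comp_apply, Prod.mk.injEq, Bool.decide_and]
      cases decide (a = a') <;> cases decide (b = b') <;> cases decide (c = c') <;> rfl
    rw [h5] at h4
    have h7 := (List.mem_filter.1 (hg ▸ hm : m ∈ clean P f.1)).2
    have h6 : cnt g m = cnt f.1 m := by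
      rw [cnt_eq_count, cnt_eq_count, hg, clean]
      exact @List.count_filter _ instBEqOfDecidableEq _ (fun m => !decide (cnt f.1 m % P.p = 0)) _ _
        h7
    rw [h6] at h4
    simp [Nat.mod_eq_zero_of_dvd h4] at h7

/-- The variable affects neither the value nor the equations. Each inequality containing it excludes
only finitely many values, and `R` is infinite. -/
theorem den_drop [IsDomain R] {v : ℕ} {C : Clause} (h : ∀ f ∈ C.1 :: C.2.1, occurs P v f = false) :
    K.den (C.drop P v) = K.den C := by
  have := K.infinite
  ext x
  constructor
  · rintro ⟨ρ, γ, ⟨h1, h2, h3⟩, rfl⟩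
    have hfin : (⋃ f ∈ C.2.2.1.toFinset.filter fun f => occurs P v f,
        {r | K.ev (Function.update ρ v r) γ f = 0}).Finite :=
      Set.Finite.biUnion (Finset.finite_toSet _) fun f hf =>
        K.finite_setOf_ev_eq_zero (by simpa using (Finset.mem_filter.1 hf).2) ρ γ
    obtain ⟨r, hr⟩ := hfin.exists_notMem
    refine ⟨Function.update ρ v r, γ, ⟨fun f hf => ?_, fun f hf => ?_, h3⟩, ?_⟩
    · rw [K.ev_update_of_not_occurs (h f (List.mem_cons_of_mem _ hf))]
      exact h1 f hf
    · cases ho : occurs P v f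
      · rw [K.ev_update_of_not_occurs ho]
        exact h2 f (List.mem_filter.2 ⟨hf, by simp [ho]⟩)
      · intro h0
        exact hr (Set.mem_biUnion (x := f) (by simp [hf, ho]) h0)
    · exact K.ev_update_of_not_occurs (h _ List.mem_cons_self) _ _ _
  · rintro ⟨ρ, γ, ⟨h1, h2, h3⟩, rfl⟩
    exact ⟨ρ, γ, ⟨h1, fun f hf => h2 f (List.mem_of_mem_filter hf), h3⟩, rfl⟩

/-- The transformations preserve well-formedness and the set described. -/
theorem step_spec [IsDomain R] {C : Clause} (h : C.WF P.p) (q : Step) :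
    (C.step P q).WF P.p ∧ K.den (C.step P q) = K.den C := by
  unfold Clause.step
  cases h0 : decide (q.1 = 0)
  · cases h1 : decide (q.1 = 1)
    · cases h2 : decide (q.1 = 2)
      · cases h3 : decide (q.1 = 3)
        · simp only [cond_false]
          exact ⟨wf_absorb h, K.den_absorb h⟩
        · cases h4 : !(C.1 :: C.2.1).any (occurs P q.2.1)
          · exact ⟨h, rfl⟩
          · refine ⟨h, K.den_drop fun f hf => ?_⟩
            rw [Bool.not_eq_true', List.any_eq_false] at h4
            simpa using h4 f hf
      · cases h4 : !C.2.1.isEmpty && q.2.2.2.2.ok P (C.2.1.headD ([], [])).1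
        · exact ⟨h, rfl⟩
        · rw [Bool.and_eq_true] at h4
          refine ⟨h, K.den_solve ?_ h4.2⟩
          obtain ⟨Λ, E, C'⟩ := C
          cases E with
          | nil => simp at h4
          | cons f E => exact List.mem_cons_self
    · exact ⟨h, K.den_expand _ _⟩
  · cases h1 : nonzero P q.2.2.1
    · exact ⟨h, rfl⟩
    · exact ⟨h, K.den_elim h1 _ _⟩

theorem run_spec [IsDomain R] {C : Clause} (h : C.WF P.p) (l : List Step) :
    (C.run P l).WF P.p ∧ K.den (C.run P l) = K.den C := by
  induction l generalizing C with
  | nil => exact ⟨h, rfl⟩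
  | cons q l ih =>
    have h1 := K.step_spec h q
    have h2 := ih h1.1
    exact ⟨h2.1, h2.2.trans h1.2⟩

end Setting

end AddFrob

namespace AddFrob

/-! ### Intersections and complements -/

/-- Renaming of the constants. -/
def renF (a b : ℕ) (f : FForm) : FForm := f.map fun m => (a * m.1 + b, m.2)

/-- Renaming of all variables. -/
def renForm (b : ℕ) (f : Form) : Form := (renR 2 b f.1, renF 2 b f.2)

/-- Renaming of all variables of a clause. -/
def Clause.ren (b : ℕ) (C : Clause) : Clause :=
  (renForm b C.1, C.2.1.map (renForm b), C.2.2.1.map (renForm b), 2 * C.2.2.2.1,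
    renC 2 b C.2.2.2.2)

/-- The difference of two forms. -/
def diff (P : Par) (f g : Form) : Form := (f.1 ++ neg P g.1, f.2 ++ neg P g.2)

/-- Intersection of clauses in separate variables. -/
def Clause.meet (P : Par) (C C' : Clause) : Clause :=
  (C.1, diff P C.1 C'.1 :: (C.2.1 ++ C'.2.1), C.2.2.1 ++ C'.2.2.1,
    C.2.2.2.1 + C'.2.2.2.1, andC C.2.2.2.2 C'.2.2.2.2)

/-- Intersection of unions of clauses. -/
def inter (P : Par) (d d' : Data) : Data :=
  d.flatMap fun C => d'.map fun C' => (C.ren 0).meet P (C'.ren 1)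

/-- Exponents of the monomials of a polynomial prime to `Q`. -/
def listG (P : Par) : List ℕ := 0 :: P.Q.map fun i => i + 1

namespace Clause

/-- A clause without equations has a certificate for its leading form which also controls its
inequalities. -/
def good (P : Par) (C : Clause) (c : Cert) : Bool :=
  C.2.1.isEmpty && (c.ok P C.1.1 && C.2.2.1.all fun f => f.1.all fun m =>
    c.2.2.2.1.any fun x => decide (x.1 = 2 * m.1))

/-- Order of the remainder in the presentation of all elements by a certified form. -/
def ordM (P : Par) (C : Clause) (c : Cert) : ℕ := c.cobound P C.1.1 + wtF C.1.2

/-- Order of the ambiguity of the variables. -/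
def ordN (P : Par) (C : Clause) (c : Cert) : ℕ := c.bound C.1.1 (C.ordM P c)

/-- Order of the ambiguity of the inequalities. -/
def ordI (P : Par) (C : Clause) (c : Cert) : ℕ :=
  (C.2.2.1.map fun f => wtF f.2 + (f.1.map fun m => P.p ^ m.2.2 * C.ordN P c + m.2.1).sum).sum

/-- The general element, up to the bounded ambiguity. -/
def general (P : Par) (C : Clause) (c : Cert) : Form :=
  (full C.1.1 c.1, vform (C.ordM P c * P.D) (C.ordM P c) 0)

/-- The linear condition which expresses that an element lies in the image of the leading form. -/
def link (P : Par) (C : Clause) (c : Cert) : FForm :=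
  renF 2 0 (sub P (fun v => ([], vform (C.ordN P c * P.D) (C.ordN P c)
      (C.bd + v * (C.ordN P c * P.D)))) C.1.1).2
    ++ (renF 2 0 C.1.2
    ++ (neg P (renF 2 1 (sub P (fun v => ([], vform (C.ordN P c * P.D) (C.ordN P c)
      (C.ordM P c * P.D + v * (C.ordN P c * P.D)))) c.1).2)
    ++ neg P (renF 2 1 (vform (C.ordM P c * P.D) (C.ordM P c) 0))))

/-- A bound for the constants in the linear condition. -/
def linkBd (P : Par) (C : Clause) (c : Cert) : ℕ := 2 * C.2.2.2.1 + fbd (C.link P c)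

/-- The elements with bounded odd variables which are not in the image of the leading form. -/
def outer (P : Par) (C : Clause) (c : Cert) : Clause :=
  (subForm P (fun v => bif decide (v % 2 = 0) then ([(v, 0, 0)], []) else
      ([], vform (C.ordN P c * P.D) (C.ordN P c) (C.ordM P c * P.D + v / 2 * (C.ordN P c * P.D))))
      (C.general P c), [], [], C.linkBd P c,
    qC (C.linkBd P c) (notC (andC (renC 2 0 C.2.2.2.2) (linC P (C.link P c)))))

/-- The elements with an odd variable of large order. -/
def large (P : Par) (C : Clause) (c : Cert) (k : ℕ) : Clause :=
  (subForm P (fun v => bif decide (v = k) then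
      (scalar (powL (listG P) (C.ordN P c)) v,
        vform (C.ordN P c * P.D) (C.ordN P c) (C.ordM P c * P.D)) else ([(v, 0, 0)], []))
      (C.general P c), [], [([(k, 0, 0)], [])], 0, notC falsumC)

/-- The elements at which an inequality is not automatic. -/
def critical (P : Par) (C : Clause) (c : Cert) (f : Form) : Clause :=
  (C.general P c, [(renR 2 0 f.1, neg P (vform (C.ordI P c * P.D) (C.ordI P c)
    (C.ordM P c * P.D)))], [], 0, notC falsumC)

/-- A superset of the complement of a clause. -/
def cover (P : Par) (C : Clause) (c : Cert) : Data :=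
  C.outer P c :: (((c.2.2.2.1.filter fun x => decide (x.1 % 2 = 1)).map fun x => C.large P c x.1)
    ++ C.2.2.1.map (C.critical P c))

/-- The part of a clause where the value of a form is bounded. -/
def restrict (P : Par) (C : Clause) (c : Cert) (f : Form) : Clause :=
  (C.1, [(f.1, neg P (vform (C.ordI P c * P.D) (C.ordI P c) C.bd))],
    ([], vform (C.ordI P c * P.D) (C.ordI P c) C.bd ++ f.2) ::
      C.2.2.1.filter fun g => !decide (g = f), C.2.2.2)

/-- The parts of a clause where an inequality is not automatic. -/
def parts (P : Par) (C : Clause) (c : Cert) : Data := C.2.2.1.map (C.restrict P c)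

end Clause

section Primrec

variable {α : Type} [Primcodable α] {P : Par}

@[fun_prop]
theorem primrec_renF {a b : α → ℕ} {f : α → FForm} (ha : Primrec a) (hb : Primrec b)
    (hf : Primrec f) : Primrec fun x => renF (a x) (b x) (f x) := by
  unfold renF; fun_prop

@[fun_prop]
theorem primrec_renForm {b : α → ℕ} {f : α → Form} (hb : Primrec b) (hf : Primrec f) :
    Primrec fun x => renForm (b x) (f x) := by
  unfold renForm; fun_prop

@[fun_prop]
theorem primrec_clause_ren {b : α → ℕ} {C : α → Clause} (hb : Primrec b) (hC : Primrec C) :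
    Primrec fun x => (C x).ren (b x) := by
  unfold Clause.ren; fun_prop

@[fun_prop]
theorem primrec_diff {f g : α → Form} (hf : Primrec f) (hg : Primrec g) :
    Primrec fun x => diff P (f x) (g x) := by
  unfold diff; fun_prop

@[fun_prop]
theorem primrec_meet {C C' : α → Clause} (hC : Primrec C) (hC' : Primrec C') :
    Primrec fun x => (C x).meet P (C' x) := by
  unfold Clause.meet; fun_prop

@[fun_prop]
theorem primrec_inter {d d' : α → Data} (hd : Primrec d) (hd' : Primrec d') :
    Primrec fun x => inter P (d x) (d' x) := by
  unfold inter; fun_prop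

variable {C : α → Clause} {c : α → Cert} {f : α → Form} {k : α → ℕ}

@[fun_prop]
theorem primrec_good (hC : Primrec C) (hc : Primrec c) :
    Primrec fun x => (C x).good P (c x) := by
  unfold Clause.good; fun_prop

@[fun_prop]
theorem primrec_ordM (hC : Primrec C) (hc : Primrec c) :
    Primrec fun x => (C x).ordM P (c x) := by
  unfold Clause.ordM; fun_prop

@[fun_prop]
theorem primrec_ordN (hC : Primrec C) (hc : Primrec c) :
    Primrec fun x => (C x).ordN P (c x) := by
  unfold Clause.ordN; fun_prop

@[fun_prop]
theorem primrec_ordI (hC : Primrec C) (hc : Primrec c) :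
    Primrec fun x => (C x).ordI P (c x) := by
  unfold Clause.ordI; fun_prop

@[fun_prop]
theorem primrec_general (hC : Primrec C) (hc : Primrec c) :
    Primrec fun x => (C x).general P (c x) := by
  unfold Clause.general; fun_prop

@[fun_prop]
theorem primrec_link (hC : Primrec C) (hc : Primrec c) :
    Primrec fun x => (C x).link P (c x) := by
  unfold Clause.link; fun_prop

@[fun_prop]
theorem primrec_linkBd (hC : Primrec C) (hc : Primrec c) :
    Primrec fun x => (C x).linkBd P (c x) := by
  unfold Clause.linkBd; fun_prop

@[fun_prop]
theorem primrec_outer (hC : Primrec C) (hc : Primrec c) :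
    Primrec fun x => (C x).outer P (c x) := by
  unfold Clause.outer; fun_prop

@[fun_prop]
theorem primrec_large (hC : Primrec C) (hc : Primrec c) (hk : Primrec k) :
    Primrec fun x => (C x).large P (c x) (k x) := by
  unfold Clause.large; fun_prop

@[fun_prop]
theorem primrec_critical (hC : Primrec C) (hc : Primrec c) (hf : Primrec f) :
    Primrec fun x => (C x).critical P (c x) (f x) := by
  unfold Clause.critical; fun_prop

@[fun_prop]
theorem primrec_cover (hC : Primrec C) (hc : Primrec c) :
    Primrec fun x => (C x).cover P (c x) := by
  unfold Clause.cover; fun_prop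

@[fun_prop]
theorem primrec_restrict (hC : Primrec C) (hc : Primrec c) (hf : Primrec f) :
    Primrec fun x => (C x).restrict P (c x) (f x) := by
  unfold Clause.restrict; fun_prop

@[fun_prop]
theorem primrec_parts (hC : Primrec C) (hc : Primrec c) :
    Primrec fun x => (C x).parts P (c x) := by
  unfold Clause.parts; fun_prop

end Primrec

/-- All clauses are well formed. -/
def Data.WF (p : ℕ) (d : Data) : Prop := ∀ C ∈ d, Clause.WF p C

theorem Clause.WF.ren {p b : ℕ} (hb : b ≤ 1) {C : Clause} (h : C.WF p) : (C.ren b).WF p := by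
  simp only [Clause.WF, Clause.ren] at h ⊢
  exact AddFrob.WF.renC (fun i hi => by omega) h

theorem Clause.WF.meet {p : ℕ} {P : Par} {C C' : Clause} (h : C.WF p) (h' : C'.WF p) :
    (C.meet P C').WF p := by
  simp only [Clause.WF, Clause.meet] at h h' ⊢
  exact (h.mono (by omega)).andC (h'.mono (by omega))

theorem Data.WF.inter {p : ℕ} {P : Par} {d d' : Data} (h : d.WF p) (h' : d'.WF p) :
    Data.WF p (inter P d d') := by
  intro C hC
  obtain ⟨C₁, h1, hC⟩ := List.mem_flatMap.1 hC
  obtain ⟨C₂, h2, rfl⟩ := List.mem_map.1 hC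
  exact ((h _ h1).ren (Nat.zero_le _)).meet ((h' _ h2).ren le_rfl)

namespace Setting

variable {P : Par} {F R : Type*} [Field F] [CommRing R] (K : Setting P F R)

/-- The set described by a finite union of clauses. -/
def Den (d : Data) : Set R := {x | ∃ C ∈ d, x ∈ K.den C}

theorem evalF_renF (γ : ℕ → F) (a b : ℕ) (f : FForm) :
    K.evalF γ (renF a b f) = K.evalF (fun i => γ (a * i + b)) f := by
  simp [evalF, renF, Function.comp_def]

theorem ev_renForm (ρ : ℕ → R) (γ : ℕ → F) (b : ℕ) (f : Form) :
    K.ev ρ γ (renForm b f) = K.ev (fun v => ρ (2 * v + b)) (fun i => γ (2 * i + b)) f := by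
  rw [ev, ev, renForm, evalR_renR, evalF_renF]

theorem ev_diff (ρ : ℕ → R) (γ : ℕ → F) (f g : Form) :
    K.ev ρ γ (diff P f g) = K.ev ρ γ f - K.ev ρ γ g := by
  simp [ev, diff]; ring

theorem sat_ren {b : ℕ} (hb : b ≤ 1) {C : Clause} (h : C.WF P.p) (ρ : ℕ → R) (γ : ℕ → F) :
    K.Sat (C.ren b) ρ γ ↔ K.Sat C (fun v => ρ (2 * v + b)) (fun i => γ (2 * i + b)) := by
  simp only [Sat, Clause.ren, List.forall_mem_map, ev_renForm]
  rw [sem_renC (fun i hi => by omega) h]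

theorem mem_den_meet {C C' : Clause} (h : C.WF P.p) (h' : C'.WF P.p) (x : R) :
    x ∈ K.den (C.meet P C') ↔
      ∃ ρ γ, K.Sat C ρ γ ∧ K.Sat C' ρ γ ∧ K.ev ρ γ C.1 = x ∧ K.ev ρ γ C'.1 = x := by
  simp only [den, Set.mem_ofPred_eq, Sat, Clause.meet, List.forall_mem_cons, List.mem_append,
    or_imp, forall_and, ev_diff, sub_eq_zero]
  refine exists₂_congr fun ρ γ => ?_
  simp only [Clause.WF] at h h'
  rw [sem_andC (h.mono (by omega)) (h'.mono (by omega)), sem_mono h (by omega),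
    sem_mono h' (by omega)]
  constructor
  · rintro ⟨⟨⟨h1, h2, h3⟩, ⟨h4, h5⟩, h6, h7⟩, rfl⟩
    exact ⟨⟨h2, h4, h6⟩, ⟨h3, h5, h7⟩, rfl, h1.symm⟩
  · rintro ⟨⟨h2, h4, h6⟩, ⟨h3, h5, h7⟩, rfl, h1⟩
    exact ⟨⟨⟨h1.symm, h2, h3⟩, ⟨h4, h5⟩, h6, h7⟩, rfl⟩

/-- One clause uses the even variables and constants and the other the odd ones, so pairs of points
of the two clauses can be interleaved; the additional equation forces their values to agree. -/
theorem den_inter {d d' : Data} (h : d.WF P.p) (h' : d'.WF P.p) :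
    K.Den (inter P d d') = K.Den d ∩ K.Den d' := by
  have key : ∀ C ∈ d, ∀ C' ∈ d', ∀ x, x ∈ K.den ((C.ren 0).meet P (C'.ren 1)) ↔
      x ∈ K.den C ∧ x ∈ K.den C' := by
    intro C hC C' hC' x
    rw [K.mem_den_meet ((h _ hC).ren (Nat.zero_le _)) ((h' _ hC').ren le_rfl)]
    simp only [K.sat_ren (Nat.zero_le _) (h _ hC), K.sat_ren le_rfl (h' _ hC')]
    have e1 : ∀ ρ γ, K.ev ρ γ (C.ren 0).1 = K.ev (fun v => ρ (2 * v + 0)) (fun i => γ (2 * i + 0)) C.1 :=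
      fun ρ γ => K.ev_renForm ρ γ 0 C.1
    have e2 : ∀ ρ γ, K.ev ρ γ (C'.ren 1).1
        = K.ev (fun v => ρ (2 * v + 1)) (fun i => γ (2 * i + 1)) C'.1 :=
      fun ρ γ => K.ev_renForm ρ γ 1 C'.1
    simp only [e1, e2]
    constructor
    · rintro ⟨ρ, γ, h1, h2, h3, h4⟩
      exact ⟨⟨_, _, h1, h3⟩, ⟨_, _, h2, h4⟩⟩
    · rintro ⟨⟨ρ, γ, h1, h3⟩, ⟨ρ', γ', h2, h4⟩⟩
      refine ⟨fun v => if v % 2 = 0 then ρ (v / 2) else ρ' (v / 2),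
        fun v => if v % 2 = 0 then γ (v / 2) else γ' (v / 2), ?_⟩
      have a1 : ∀ v, (2 * v + 1) / 2 = v := fun v => by omega
      have a2 : ∀ v, (2 * v + 1) % 2 = 1 := fun v => by omega
      simp only [add_zero, Nat.mul_mod_right, if_true, Nat.mul_div_cancel_left _ two_pos, a1, a2,
        one_ne_zero, if_false]
      exact ⟨h1, h2, h3, h4⟩
  ext x
  simp only [Den, inter, Set.mem_ofPred_eq, Set.mem_inter_iff, List.mem_flatMap, List.mem_map]
  constructor
  · rintro ⟨_, ⟨C, hC, C', hC', rfl⟩, hx⟩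
    rw [key C hC C' hC'] at hx
    exact ⟨⟨C, hC, hx.1⟩, ⟨C', hC', hx.2⟩⟩
  · rintro ⟨⟨C, hC, h1⟩, ⟨C', hC', h2⟩⟩
    exact ⟨_, ⟨C, hC, C', hC', rfl⟩, (key C hC C' hC' x).2 ⟨h1, h2⟩⟩

end Setting

end AddFrob

/-! ### The complement of a clause with a certificate -/

namespace AddFrob

namespace Clause

variable {P : Par} {C : Clause} {c : Cert}

theorem good_E (h : C.good P c) : C.2.1 = [] := by
  simp only [good, Bool.and_eq_true, List.isEmpty_iff] at h
  exact h.1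

theorem good_ok (h : C.good P c) : c.ok P C.1.1 := by
  simp only [good, Bool.and_eq_true] at h
  exact h.2.1

theorem good_I (h : C.good P c) {f : Form} (hf : f ∈ C.2.2.1) {m} (hm : m ∈ f.1) :
    ∃ x ∈ c.2.2.2.1, x.1 = 2 * m.1 := by
  simp only [good, Bool.and_eq_true, List.all_eq_true, List.any_eq_true, decide_eq_true_eq] at h
  exact h.2.2 f hf m hm

theorem le_ordI {f : Form} (hf : f ∈ C.2.2.1) :
    wtF f.2 + (f.1.map fun m => P.p ^ m.2.2 * C.ordN P c + m.2.1).sum ≤ C.ordI P c :=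
  List.single_le_sum (by simp) _ (List.mem_map_of_mem
    (f := fun f : Form => wtF f.2 + (f.1.map fun m => P.p ^ m.2.2 * C.ordN P c + m.2.1).sum) hf)

end Clause

namespace Setting

variable {P : Par} {F R : Type*} [Field F] [CommRing R] (K : Setting P F R)
  {C : Clause} {c : Cert}

theorem evalF_I_mem {f : Form} (hf : f ∈ C.2.2.1) (γ : ℕ → F) :
    K.evalF γ f.2 ∈ K.V (C.ordI P c) :=
  K.V_mono ((Nat.le_add_right _ _).trans (Clause.le_ordI hf)) (K.evalF_mem_V_wtF γ f.2)

theorem evalR_I_mem {f : Form} (hf : f ∈ C.2.2.1) {u : ℕ → R}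
    (hu : ∀ m ∈ f.1, u m.1 ∈ K.V (C.ordN P c)) : K.evalR u f.1 ∈ K.V (C.ordI P c) := by
  refine K.evalR_mem_V hu fun m hm => ?_
  refine le_trans ?_ (Clause.le_ordI hf)
  exact (List.single_le_sum (by simp) _ (List.mem_map_of_mem
    (f := fun m : ℕ × ℕ × ℕ => P.p ^ m.2.2 * C.ordN P c + m.2.1) hm)).trans (Nat.le_add_left _ _)

theorem evalF_mem_ordM (γ : ℕ → F) : K.evalF γ C.1.2 ∈ K.V (C.ordM P c) :=
  K.V_mono (Nat.le_add_left _ _) (K.evalF_mem_V_wtF γ _)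

theorem mem_ordN (h : C.good P c) {ρ : ℕ → R}
    (hρ : K.evalR ρ (full C.1.1 c.1) ∈ K.V (C.ordM P c)) :
    ∀ x ∈ c.2.2.2.1, ρ x.1 ∈ K.V (C.ordN P c) :=
  (K.certified_of_ok (C.good_ok h)).bounded hρ

include K in
theorem exists_key (h : C.good P c) {m} (hm : m ∈ full C.1.1 c.1) :
    ∃ x ∈ c.2.2.2.1, x.1 = m.1 := (K.certified_of_ok (C.good_ok h)).mem m hm

include K in
theorem exists_key_left (h : C.good P c) {m} (hm : m ∈ C.1.1) :
    ∃ x ∈ c.2.2.2.1, x.1 = 2 * m.1 := by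
  obtain ⟨x, hx, h1⟩ := K.exists_key h (m := (2 * m.1 + 0, m.2))
    (List.mem_append_left _ (List.mem_map.2 ⟨m, hm, rfl⟩))
  exact ⟨x, hx, h1⟩

include K in
theorem exists_key_right (h : C.good P c) {m} (hm : m ∈ c.1) :
    ∃ x ∈ c.2.2.2.1, x.1 = 2 * m.1 + 1 := by
  obtain ⟨x, hx, h1⟩ := K.exists_key h (m := (2 * m.1 + 1, m.2))
    (List.mem_append_right _ (List.mem_map.2 ⟨m, hm, rfl⟩))
  exact ⟨x, hx, h1⟩

theorem exists_general (h : C.good P c) (x : R) :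
    ∃ ρ : ℕ → R, ∃ v ∈ K.V (C.ordM P c), x = K.evalR ρ (full C.1.1 c.1) + v := by
  obtain ⟨ρ, hρ⟩ := (K.certified_of_ok (C.good_ok h)).cobounded x
  exact ⟨ρ, _, K.V_mono (Nat.le_add_right _ _) hρ, by ring⟩

/-- Two presentations of an element differ by a bounded amount. -/
theorem ambiguity (h : C.good P c) {ρ y : ℕ → R} {γ : ℕ → F} {v : R}
    (hv : v ∈ K.V (C.ordM P c))
    (he : K.evalR ρ (full C.1.1 c.1) + v = K.evalR y C.1.1 + K.evalF γ C.1.2) :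
    ∀ x ∈ c.2.2.2.1,
      (if x.1 % 2 = 0 then ρ x.1 - y (x.1 / 2) else ρ x.1) ∈ K.V (C.ordN P c) := by
  -- By additivity the completed form maps the difference of the two presentations, with zero for
  -- the completing variables of the second, to `K.evalF γ C.1.2 - v`. This is bounded, so the
  -- difference is bounded on the variables of the certificate.
  refine K.mem_ordN h (ρ := fun v => if v % 2 = 0 then ρ v - y (v / 2) else ρ v) ?_
  have h1 : K.evalR (fun v => if v % 2 = 0 then ρ v - y (v / 2) else ρ v) (full C.1.1 c.1)
      = K.evalF γ C.1.2 - v := by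
    rw [evalR_full] at he ⊢
    simp only [Nat.mul_mod_right, if_true, Nat.mul_div_cancel_left _ two_pos,
      Nat.mul_add_mod, Nat.one_mod, one_ne_zero, if_false]
    rw [evalR_sub]
    linear_combination he
  rw [h1]
  exact (K.V _).sub_mem (K.evalF_mem_ordM γ) hv

/-- Every element has a presentation `full(ρ) + v` with `v` bounded, and any presentation by the
clause agrees with it up to `V N` in the variables of the certificate. A completing (odd) variable
of large order therefore excludes membership. If all of them are bounded, the part of `x` in the
even variables already belongs to the image, and membership in the image becomes the solvability of
a condition in bounded elements and constants. Replacing one presentation by another changes the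
form of an inequality only by an element of `V (ordI)`. If its value lies outside this space, then
adding the constants of order at most `ordI` cannot make it zero, and the inequality holds
automatically. The three alternatives cover the complement. They meet the clause only in points
where some inequality has a bounded value, and the last conjunct removes these points. -/
theorem notMem_den_iff (h : C.good P c) (x : R) :
    x ∉ K.den C ↔
    ((∃ ρ, ∃ v ∈ K.V (C.ordM P c), x = K.evalR ρ (full C.1.1 c.1) + v ∧
        (∀ k, ρ (2 * k + 1) ∈ K.V (C.ordN P c)) ∧
        ∀ (u : ℕ → R) (γ : ℕ → F), (∀ i, u i ∈ K.V (C.ordN P c)) →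
          Sem P.p C.2.2.2.1 C.2.2.2.2 γ → K.evalR u C.1.1 + K.evalF γ C.1.2
            ≠ K.evalR (fun k => ρ (2 * k + 1)) c.1 + v) ∨
      (∃ ρ, ∃ v ∈ K.V (C.ordM P c), x = K.evalR ρ (full C.1.1 c.1) + v ∧
        ∃ a ∈ c.2.2.2.1, a.1 % 2 = 1 ∧ ρ a.1 ∉ K.V (C.ordN P c)) ∨
      (∃ ρ, ∃ v ∈ K.V (C.ordM P c), x = K.evalR ρ (full C.1.1 c.1) + v ∧
        ∃ f ∈ C.2.2.1, K.evalR (fun k => ρ (2 * k)) f.1 ∈ K.V (C.ordI P c))) ∧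
    ¬ ∃ ρ γ, K.Sat C ρ γ ∧ K.ev ρ γ C.1 = x ∧
        ∃ f ∈ C.2.2.1, K.evalR ρ f.1 ∈ K.V (C.ordI P c) := by
  constructor
  · intro hx
    refine ⟨?_, fun ⟨ρ, γ, h1, h2, _⟩ => hx ⟨ρ, γ, h1, h2⟩⟩
    obtain ⟨ρ, v, hv, rfl⟩ := K.exists_general h x
    by_cases h2 : ∃ a ∈ c.2.2.2.1, a.1 % 2 = 1 ∧ ρ a.1 ∉ K.V (C.ordN P c)
    · exact Or.inr (Or.inl ⟨ρ, v, hv, rfl, h2⟩)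
    by_cases h3 : ∃ f ∈ C.2.2.1, K.evalR (fun k => ρ (2 * k)) f.1 ∈ K.V (C.ordI P c)
    · exact Or.inr (Or.inr ⟨ρ, v, hv, rfl, h3⟩)
    push Not at h2 h3
    left
    -- Odd variables outside the certificate do not occur in the completed form. They are set to
    -- zero, since the first alternative asks for bounds on all odd variables.
    set ρ' : ℕ → R := fun k => if k % 2 = 1 ∧ ∀ a ∈ c.2.2.2.1, a.1 ≠ k then 0 else ρ k with hρ'
    have h4 : ∀ a ∈ c.2.2.2.1, ρ' a.1 = ρ a.1 := fun a ha =>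
      if_neg fun hc => hc.2 a ha rfl
    refine ⟨ρ', v, hv, ?_, fun k => ?_, fun u γ hu hγ he => hx ⟨fun k => ρ (2 * k) + u k, γ, ?_, ?_⟩⟩
    · congr 1
      refine K.evalR_congr fun m hm => ?_
      obtain ⟨a, ha, ham⟩ := K.exists_key h hm
      rw [← ham, h4 a ha]
    · simp only [hρ']
      split_ifs with hk
      · exact zero_mem _
      · simp only [not_and, not_forall, not_not] at hk
        obtain ⟨a, ha, hak⟩ := hk (by omega)
        rw [← hak]
        exact h2 a ha (by omega)
    -- If an inequality failed at `ρ + u`, the value of its form at `ρ` would be bounded, which is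
    -- excluded by `h3`.
    · refine ⟨by rw [C.good_E h]; simp, fun f hf h0 => h3 f hf ?_, hγ⟩
      rw [ev, evalR_add] at h0
      have : K.evalR (fun k => ρ (2 * k)) f.1 = -(K.evalR u f.1 + K.evalF γ f.2) := by
        linear_combination h0
      rw [this]
      exact neg_mem (add_mem (K.evalR_I_mem hf fun _ _ => hu _) (K.evalF_I_mem hf γ))
    · rw [ev, evalR_add, evalR_full]
      have h5 : K.evalR (fun k => ρ' (2 * k + 1)) c.1 = K.evalR (fun k => ρ (2 * k + 1)) c.1 := by
        refine K.evalR_congr fun m hm => ?_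
        obtain ⟨a, ha, ham⟩ := K.exists_key_right h hm
        rw [← ham, h4 a ha]
      rw [h5] at he
      linear_combination he
  · rintro ⟨h1, h2⟩ ⟨y, γ, hsat, rfl⟩
    have h3 : ∀ f ∈ C.2.2.1, K.evalR y f.1 ∉ K.V (C.ordI P c) := fun f hf hm =>
      h2 ⟨y, γ, hsat, rfl, f, hf, hm⟩
    rcases h1 with ⟨ρ, v, hv, he, h4, h5⟩ | ⟨ρ, v, hv, he, a, ha, h4, h5⟩ | ⟨ρ, v, hv, he, f, hf, h4⟩
    · have h6 := K.ambiguity h hv he.symm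
      -- The bound on `y - ρ` is known only for variables of the certificate; elsewhere the
      -- difference is replaced by zero, which does not change the value of the leading form.
      set u : ℕ → R := fun k => if ∀ a ∈ c.2.2.2.1, a.1 ≠ 2 * k then 0 else y k - ρ (2 * k) with hu
      refine h5 u γ (fun k => ?_) hsat.2.2 ?_
      · simp only [hu]
        split_ifs with hk
        · exact zero_mem _
        · push Not at hk
          obtain ⟨a, ha, hak⟩ := hk
          have h7 := h6 a ha
          rw [hak, if_pos (Nat.mul_mod_right _ _), Nat.mul_div_cancel_left _ two_pos] at h7
          rw [← neg_sub]
          exact neg_mem h7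
      · have h7 : K.evalR u C.1.1 = K.evalR (fun k => y k - ρ (2 * k)) C.1.1 := by
          refine K.evalR_congr fun m hm => if_neg fun hc => ?_
          obtain ⟨a, ha, ham⟩ := K.exists_key_left h hm
          exact hc a ha ham
        rw [h7, evalR_sub]
        rw [ev, evalR_full] at he
        linear_combination he
    · have h6 := K.ambiguity h hv he.symm a ha
      rw [if_neg (by omega)] at h6
      exact h5 h6
    · refine h3 f hf ?_
      have h6 := K.ambiguity h hv he.symm
      have h7 : K.evalR (fun k => ρ (2 * k) - y k) f.1 ∈ K.V (C.ordI P c) := by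
        refine K.evalR_I_mem hf fun m hm => ?_
        obtain ⟨a, ha, ham⟩ := C.good_I h hf hm
        have h7 := h6 a ha
        rwa [ham, if_pos (Nat.mul_mod_right _ _), Nat.mul_div_cancel_left _ two_pos] at h7
      rw [evalR_sub] at h7
      have := (K.V _).sub_mem h4 h7
      rwa [sub_sub_cancel] at this

end Setting

end AddFrob

/-! ### The pieces of the complement are again described by clauses -/

namespace AddFrob

namespace Setting

variable {P : Par} {F R : Type*} [Field F] [CommRing R] (K : Setting P F R)
  {C : Clause} {c : Cert}

theorem toR_lpoly_powL (Q : List ℕ) (n : ℕ) :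
    K.toR (lpoly (powL Q n)) = K.toR (lpoly Q) ^ n := by
  rw [toR_lpoly, sum_powL]

theorem lpoly_listG : (lpoly (listG P) : Polynomial F) = G (P := P) := by
  rw [listG, lpoly, List.map_cons, List.sum_cons, G, pow_zero, add_comm, lpoly, List.map_map,
    ← List.sum_map_mul_left]
  simp [Function.comp_def, pow_succ']

theorem ev_general (ρ : ℕ → R) (γ : ℕ → F) : K.ev ρ γ (C.general P c)
    = K.evalR ρ (full C.1.1 c.1) + K.evalF γ (vform (C.ordM P c * P.D) (C.ordM P c) 0) := rfl

/-- The choice of constants representing a remainder and further elements. -/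
theorem exists_remainder {v : R} {M N : ℕ} (hv : v ∈ K.V M) {w : ℕ → R} (hw : ∀ k, w k ∈ K.V N) :
    ∃ γ : ℕ → F, K.evalF γ (vform (M * P.D) M 0) = v ∧
      ∀ k, K.evalF γ (vform (N * P.D) N (M * P.D + k * (N * P.D))) = w k := by
  obtain ⟨a, ha⟩ := K.exists_evalF_vform hv
  obtain ⟨γ, h1, h2⟩ := K.exists_blocks hw (M * P.D) a
  exact ⟨γ, ha γ 0 fun k hk => by rw [zero_add, h1 k hk], h2⟩

theorem evalF_sub_vform (γ : ℕ → F) (N L : ℕ) (f : RForm) :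
    K.evalF γ (sub P (fun v => ([], vform (N * P.D) N (L + v * (N * P.D)))) f).2
      = K.evalR (fun v => K.evalF γ (vform (N * P.D) N (L + v * (N * P.D)))) f := by
  have h := K.ev_sub (fun _ => 0) γ
    (fun v => ([], vform (N * P.D) N (L + v * (N * P.D)))) f
  have h1 : (sub P (fun v => ([], vform (N * P.D) N (L + v * (N * P.D)))) f).1 = [] := by
    simp [sub, monoR]
  rw [ev, h1, evalR_nil, zero_add] at h
  rw [h]
  simp [ev]

/-- The even constants `δ` describe a candidate solution, that is, the bounded `u` and the constants
of the clause; the odd constants `γ` describe the completing variables and the remainder of the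
given element. -/
theorem evalF_link (δ γ : ℕ → F) :
    K.evalF (fun i => if i % 2 = 0 then δ (i / 2) else γ (i / 2)) (C.link P c)
      = K.evalR (fun v => K.evalF δ (vform (C.ordN P c * P.D) (C.ordN P c)
          (C.bd + v * (C.ordN P c * P.D)))) C.1.1 + K.evalF δ C.1.2
        - K.evalR (fun v => K.evalF γ (vform (C.ordN P c * P.D) (C.ordN P c)
          (C.ordM P c * P.D + v * (C.ordN P c * P.D)))) c.1
        - K.evalF γ (vform (C.ordM P c * P.D) (C.ordM P c) 0) := by
  have a1 : ∀ v, (2 * v + 1) / 2 = v := fun v => by omega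
  have a2 : ∀ v, (2 * v + 1) % 2 = 1 := fun v => by omega
  simp only [Clause.link, evalF_append, evalF_neg, evalF_renF, evalF_sub_vform, add_zero,
    Nat.mul_mod_right, if_true, Nat.mul_div_cancel_left _ two_pos, a1, a2, one_ne_zero, if_false]
  ring

theorem sem_true (γ : ℕ → F) (l : ℕ) : Sem P.p l (notC falsumC) γ :=
  (sem_notC wf_falsumC).2 not_sem_falsumC

theorem wf_link_aux (h : C.WF P.p) :
    AddFrob.WF P.p (C.linkBd P c) (renC 2 0 C.2.2.2.2) ∧
    AddFrob.WF P.p (C.linkBd P c) (linC P (C.link P c)) :=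
  ⟨WF.renC (fun i hi => by unfold Clause.linkBd; omega) h,
    wf_linC P fun m hm => (lt_fbd hm).trans_le (Nat.le_add_left _ _)⟩

theorem wf_outer (h : C.WF P.p) : (C.outer P c).WF P.p := by
  obtain ⟨h1, h2⟩ := wf_link_aux (c := c) h
  simp only [Clause.WF, Clause.outer]
  exact (h1.andC h2).notC.qC

theorem sem_outer (h : C.WF P.p) (γ : ℕ → F) :
    Sem P.p (C.linkBd P c) (qC (C.linkBd P c)
      (notC (andC (renC 2 0 C.2.2.2.2) (linC P (C.link P c))))) γ ↔
    ∀ δ : ℕ → F, ¬ (Sem P.p C.2.2.2.1 C.2.2.2.2 δ ∧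
      K.evalF (fun i => if i % 2 = 0 then δ (i / 2) else γ (i / 2)) (C.link P c) = 0) := by
  obtain ⟨h1, h2⟩ := wf_link_aux (c := c) h
  rw [sem_qC (h1.andC h2).notC]
  refine forall_congr' fun δ => ?_
  rw [sem_notC (h1.andC h2), sem_andC h1 h2,
    sem_renC (fun i hi => by unfold Clause.linkBd; omega) h,
    K.sem_linC (L := C.linkBd P c) fun m hm => (lt_fbd hm).trans_le (Nat.le_add_left _ _)]
  simp only [add_zero, Nat.mul_mod_right, if_true, Nat.mul_div_cancel_left _ two_pos]

/-- In the first alternative of `notMem_den_iff` the odd variables and `v` are bounded, hence given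
by constants. The quantification over bounded `u` and over `γ` runs over constants as well, so the
whole condition is a formula about `F`, obtained with `qC`. -/
theorem mem_den_outer (h : C.WF P.p) (x : R) : x ∈ K.den (C.outer P c) ↔
    ∃ ρ, ∃ v ∈ K.V (C.ordM P c), x = K.evalR ρ (full C.1.1 c.1) + v ∧
        (∀ k, ρ (2 * k + 1) ∈ K.V (C.ordN P c)) ∧
        ∀ (u : ℕ → R) (γ : ℕ → F), (∀ i, u i ∈ K.V (C.ordN P c)) →
          Sem P.p C.2.2.2.1 C.2.2.2.2 γ → K.evalR u C.1.1 + K.evalF γ C.1.2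
            ≠ K.evalR (fun k => ρ (2 * k + 1)) c.1 + v := by
  have a1 : ∀ v, (2 * v + 1) / 2 = v := fun v => by omega
  have a2 : ∀ v, (2 * v + 1) % 2 = 1 := fun v => by omega
  have hev : ∀ (ρ : ℕ → R) (γ : ℕ → F), K.ev ρ γ (C.outer P c).1
      = K.evalR (fun v => if v % 2 = 0 then ρ v else K.evalF γ (vform (C.ordN P c * P.D)
        (C.ordN P c) (C.ordM P c * P.D + v / 2 * (C.ordN P c * P.D)))) (full C.1.1 c.1)
        + K.evalF γ (vform (C.ordM P c * P.D) (C.ordM P c) 0) := by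
    intro ρ γ
    simp only [Clause.outer]
    rw [ev_subForm, ev_general]
    congr 2
    funext v
    by_cases hv : v % 2 = 0 <;> simp [hv, ev, evalR_cons]
  have hsat : ∀ (ρ : ℕ → R) (γ : ℕ → F), K.Sat (C.outer P c) ρ γ ↔
    ∀ δ : ℕ → F, ¬ (Sem P.p C.2.2.2.1 C.2.2.2.2 δ ∧
      K.evalF (fun i => if i % 2 = 0 then δ (i / 2) else γ (i / 2)) (C.link P c) = 0) := by
    intro ρ γ
    rw [← K.sem_outer h]
    simp [Sat, Clause.outer]
  simp only [den, Set.mem_ofPred_eq, hsat, hev, evalF_link]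
  constructor
  · rintro ⟨ρ, γ, h1, rfl⟩
    refine ⟨_, _, K.evalF_vform_mem γ _ 0, rfl, fun k => ?_, fun u γ' hu hγ' he => ?_⟩
    · rw [a2, if_neg one_ne_zero]
      exact K.evalF_vform_mem _ _ _
    -- The constants below `C.bd` are those of the clause; the blocks above hold the coefficients of
    -- `u`.
    · obtain ⟨δ, h2, h3⟩ := K.exists_blocks hu C.bd γ'
      refine h1 δ ⟨?_, ?_⟩
      · exact (sem_congr fun i hi => h2 i (hi.trans_le C.l_le_bd)).2 hγ'
      · have h4 : K.evalF δ C.1.2 = K.evalF γ' C.1.2 :=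
          K.evalF_congr fun m hm => h2 _ (Clause.lt_bd C.fst_mem_forms hm)
        simp only [a1, a2, one_ne_zero, if_false] at he
        rw [funext h3, h4, he]
        ring
  · rintro ⟨ρ, v, hv, rfl, h1, h2⟩
    obtain ⟨γ, h3, h4⟩ := K.exists_remainder hv h1
    refine ⟨ρ, γ, fun δ hδ => ?_, ?_⟩
    · refine h2 _ δ (fun i => K.evalF_vform_mem δ (C.ordN P c)
        (C.bd + i * (C.ordN P c * P.D))) hδ.1 ?_
      have h5 := hδ.2
      rw [h3, funext h4] at h5
      linear_combination h5
    · rw [h3]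
      congr 2
      funext k
      split_ifs with hk
      · rfl
      · rw [h4]; congr 1; omega

/-- By the decomposition `R = V N ⊕ G^N R`, an element lies outside `V N` exactly when its component
`y` in `G^N R` is nonzero. The variable is replaced by `G^N y` plus a general element of `V N`,
under the inequality `y ≠ 0`. -/
theorem mem_den_large (k : ℕ) (x : R) : x ∈ K.den (C.large P c k) ↔
    ∃ ρ, ∃ v ∈ K.V (C.ordM P c), x = K.evalR ρ (full C.1.1 c.1) + v ∧ ρ k ∉ K.V (C.ordN P c) := by
  have hev : ∀ (ρ : ℕ → R) (γ : ℕ → F), K.ev ρ γ (C.large P c k).1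
      = K.evalR (fun v => if v = k then K.toR (G (P := P)) ^ C.ordN P c * ρ v
          + K.evalF γ (vform (C.ordN P c * P.D) (C.ordN P c) (C.ordM P c * P.D)) else ρ v)
          (full C.1.1 c.1)
        + K.evalF γ (vform (C.ordM P c * P.D) (C.ordM P c) 0) := by
    intro ρ γ
    simp only [Clause.large]
    rw [ev_subForm, ev_general]
    congr 2
    funext v
    by_cases hv : v = k
    · simp [hv, ev, evalR_scalar, toR_lpoly_powL, lpoly_listG]
    · simp [hv, ev, evalR_cons]
  have hsat : ∀ (ρ : ℕ → R) (γ : ℕ → F), K.Sat (C.large P c k) ρ γ ↔ ρ k ≠ 0 := by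
    intro ρ γ
    have := sem_true (P := P) γ 0
    simp [Sat, Clause.large, this, ev, evalR_cons]
  simp only [den, Set.mem_ofPred_eq, hsat, hev]
  constructor
  · rintro ⟨ρ, γ, h1, rfl⟩
    refine ⟨_, _, K.evalF_vform_mem γ _ 0, rfl, fun h2 => h1 ?_⟩
    rw [if_pos rfl] at h2
    refine K.eq_zero_of_G_pow_mul_mem (N := C.ordN P c) ?_
    have h3 := (K.V _).sub_mem h2 (K.evalF_vform_mem γ (C.ordN P c) (C.ordM P c * P.D))
    rwa [add_sub_cancel_right] at h3
  · rintro ⟨ρ, v, hv, rfl, h1⟩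
    obtain ⟨w, hw, y, hy⟩ := K.exists_eq_add_G_pow_mul (C.ordN P c) (ρ k)
    obtain ⟨γ, h3, h4⟩ := K.exists_remainder hv (w := fun _ => w) (fun _ => hw)
    have h5 := h4 0
    rw [zero_mul, add_zero] at h5
    refine ⟨Function.update ρ k y, γ, ?_, ?_⟩
    · rw [Function.update_self]
      rintro rfl
      rw [mul_zero, add_zero] at hy
      exact h1 (hy ▸ hw)
    · rw [h3, h5]
      congr 2
      funext u
      split_ifs with hu
      · subst hu
        rw [Function.update_self, hy, add_comm]
      · rw [Function.update_of_ne hu]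

/-- Boundedness of a value is expressed by an equation with a general element of `V (ordI)`. This
clause has an equation again, but no inequality. -/
theorem mem_den_critical (f : Form) (x : R) : x ∈ K.den (C.critical P c f) ↔
    ∃ ρ, ∃ v ∈ K.V (C.ordM P c), x = K.evalR ρ (full C.1.1 c.1) + v ∧
        K.evalR (fun k => ρ (2 * k)) f.1 ∈ K.V (C.ordI P c) := by
  have hsat : ∀ (ρ : ℕ → R) (γ : ℕ → F), K.Sat (C.critical P c f) ρ γ ↔
      K.evalR (fun k => ρ (2 * k)) f.1
        = K.evalF γ (vform (C.ordI P c * P.D) (C.ordI P c) (C.ordM P c * P.D)) := by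
    intro ρ γ
    have := sem_true (P := P) γ 0
    simp [Sat, Clause.critical, this, ev, evalR_renR, add_neg_eq_zero]
  have hev : ∀ (ρ : ℕ → R) (γ : ℕ → F), K.ev ρ γ (C.critical P c f).1
      = K.evalR ρ (full C.1.1 c.1) + K.evalF γ (vform (C.ordM P c * P.D) (C.ordM P c) 0) :=
    fun ρ γ => K.ev_general ρ γ
  simp only [den, Set.mem_ofPred_eq, hsat, hev]
  constructor
  · rintro ⟨ρ, γ, h1, rfl⟩
    exact ⟨ρ, _, K.evalF_vform_mem γ _ 0, rfl, h1 ▸ K.evalF_vform_mem _ _ _⟩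
  · rintro ⟨ρ, v, hv, rfl, h1⟩
    obtain ⟨γ, h3, h4⟩ := K.exists_remainder hv (w := fun _ => _) (fun _ => h1)
    have h5 := h4 0
    rw [zero_mul, add_zero] at h5
    exact ⟨ρ, γ, h5.symm, by rw [h3]⟩

/-- An equation identifies the part of `f` in ring variables with a general element of `V (ordI)`,
so the inequality `f ≠ 0` becomes one between constants only. This is why the recursion on
inequalities in ring variables terminates. -/
theorem mem_den_restrict {f : Form} (hE : C.2.1 = []) (hf : f ∈ C.2.2.1) (x : R) :
    x ∈ K.den (C.restrict P c f) ↔ ∃ ρ γ, K.Sat C ρ γ ∧ K.ev ρ γ C.1 = x ∧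
      K.evalR ρ f.1 ∈ K.V (C.ordI P c) := by
  have hsat : ∀ (ρ : ℕ → R) (γ : ℕ → F), K.Sat (C.restrict P c f) ρ γ ↔
      K.evalR ρ f.1 = K.evalF γ (vform (C.ordI P c * P.D) (C.ordI P c) C.bd) ∧ K.Sat C ρ γ := by
    intro ρ γ
    simp only [Sat, Clause.restrict, List.forall_mem_cons, hE, List.not_mem_nil, false_imp_iff,
      implies_true, and_true, true_and, List.mem_filter, Bool.not_eq_true', decide_eq_false_iff_not,
      ev, evalF_neg, evalF_append, evalR_nil, zero_add, add_neg_eq_zero, and_imp]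
    refine and_congr_right fun h1 => ?_
    rw [← h1]
    constructor
    · rintro ⟨⟨h2, h3⟩, h4⟩
      refine ⟨fun g hg => ?_, h4⟩
      by_cases hgf : g = f
      · rwa [hgf]
      · exact h3 g hg hgf
    · rintro ⟨h3, h4⟩
      exact ⟨⟨h3 f hf, fun g hg _ => h3 g hg⟩, h4⟩
  simp only [den, Set.mem_ofPred_eq, hsat]
  constructor
  · rintro ⟨ρ, γ, ⟨h1, h2⟩, rfl⟩
    exact ⟨ρ, γ, h2, rfl, h1 ▸ K.evalF_vform_mem _ _ _⟩
  · rintro ⟨ρ, γ, h1, rfl, h2⟩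
    obtain ⟨γ', h3, h4⟩ := K.exists_blocks (u := fun _ => _) (fun _ => h2) C.bd γ
    have h5 := h4 0
    rw [zero_mul, add_zero] at h5
    refine ⟨ρ, γ', ⟨h5.symm, ?_⟩, ?_⟩
    · exact (K.sat_congr (fun _ _ _ _ => rfl) h3).2 h1
    · exact K.ev_congr (fun _ _ => rfl) fun m hm => h3 _ (Clause.lt_bd C.fst_mem_forms hm)

theorem notMem_den_iff_cover (h : C.good P c) (hw : C.WF P.p) (x : R) :
    x ∉ K.den C ↔ x ∈ K.Den (C.cover P c) ∧ x ∉ K.Den (C.parts P c) := by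
  rw [K.notMem_den_iff h]
  refine and_congr ?_ (not_congr ?_)
  · simp only [Den, Clause.cover, Set.mem_ofPred_eq, List.exists_mem_cons_iff, List.mem_append, or_and_right,
      exists_or, K.mem_den_outer hw]
    refine or_congr_right (or_congr ?_ ?_)
    · simp only [List.mem_map, List.mem_filter, decide_eq_true_eq]
      constructor
      · rintro ⟨ρ, v, hv, he, a, ha, h1, h2⟩
        exact ⟨_, ⟨a, ⟨ha, h1⟩, rfl⟩, (K.mem_den_large _ _).2 ⟨ρ, v, hv, he, h2⟩⟩
      · rintro ⟨_, ⟨a, ⟨ha, h1⟩, rfl⟩, h2⟩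
        obtain ⟨ρ, v, hv, he, h3⟩ := (K.mem_den_large _ _).1 h2
        exact ⟨ρ, v, hv, he, a, ha, h1, h3⟩
    · simp only [List.mem_map]
      constructor
      · rintro ⟨ρ, v, hv, he, f, hf, h1⟩
        exact ⟨_, ⟨f, hf, rfl⟩, (K.mem_den_critical _ _).2 ⟨ρ, v, hv, he, h1⟩⟩
      · rintro ⟨_, ⟨f, hf, rfl⟩, h1⟩
        obtain ⟨ρ, v, hv, he, h2⟩ := (K.mem_den_critical _ _).1 h1
        exact ⟨ρ, v, hv, he, f, hf, h2⟩
  · simp only [Den, Clause.parts, Set.mem_ofPred_eq, List.mem_map]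
    constructor
    · rintro ⟨ρ, γ, h1, h2, f, hf, h3⟩
      exact ⟨_, ⟨f, hf, rfl⟩, (K.mem_den_restrict (C.good_E h) hf _).2 ⟨ρ, γ, h1, h2, h3⟩⟩
    · rintro ⟨_, ⟨f, hf, rfl⟩, h1⟩
      obtain ⟨ρ, γ, h2, h3, h4⟩ := (K.mem_den_restrict (C.good_E h) hf _).1 h1
      exact ⟨ρ, γ, h2, h3, f, hf, h4⟩

theorem wf_cover (h : C.WF P.p) : Data.WF P.p (C.cover P c) := by
  intro C' hC'
  simp only [Clause.cover, List.mem_cons, List.mem_append, List.mem_map] at hC'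
  rcases hC' with rfl | ⟨a, -, rfl⟩ | ⟨f, -, rfl⟩
  · exact wf_outer h
  · exact wf_falsumC.notC
  · exact wf_falsumC.notC

theorem wf_parts (h : C.WF P.p) : Data.WF P.p (C.parts P c) := by
  intro C' hC'
  obtain ⟨f, -, rfl⟩ := List.mem_map.1 hC'
  exact h

end Setting

end AddFrob

namespace AddFrob

open FirstOrder FirstOrder.Language

/-! ### Enumeration of complements -/

set_option synthInstance.maxSize 1000
set_option synthInstance.maxHeartbeats 200000

/-- The clause that describes the whole ring. -/
def univC : Clause := (([(0, 0, 0)], []), [], [], 0, notC falsumC)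

/-- Comparison of finite unions of clauses. -/
def sameData (d d' : Data) : Bool := decide (d = d')

theorem sameData_iff {d d' : Data} : sameData d d' = true ↔ d = d' := decide_eq_true_iff

/-- The complement of a clause, given the complement of a transformed clause. -/
def runRule (P : Par) (C : Clause) (l : List Step) (a b : Data × Data) : Data × Data :=
  bif sameData a.1 [C.run P l] then ([C], a.2) else b

/-- The complement of a clause, given the complement of its parts. -/
def partsRule (P : Par) (C : Clause) (c : Cert) (a b : Data × Data) : Data × Data :=
  bif C.good P c && sameData a.1 (C.parts P c) then ([C], inter P (C.cover P c) a.2) else b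

/-- Rules for pairs of complementary sets. -/
def compRule (P : Par) (q : ℕ × Clause × List Step × Cert) (a b : Data × Data) : Data × Data :=
  bif decide (q.1 = 0) then (a.1 ++ b.1, inter P a.2 b.2)
  else bif decide (q.1 = 1) then runRule P q.2.1 q.2.2.1 a b
  else partsRule P q.2.1 q.2.2.2 a b

/-- An enumeration of pairs of complementary sets. -/
def compEnum (P : Par) : ℕ → Data × Data := treeEval ([], [univC]) (compRule P)

/-! ### Enumeration of the sets defined by formulas -/

/-- Application of the function symbol with number `f` to forms. -/
def opForm (P : Par) (f : ℕ) (g h : Form) : Form :=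
  bif decide (f = 0) then ([], [])
  else bif decide (f = 1) then ([], [(0, 0, 0, 0)])
  else bif decide (f = 2) then (monoR P 0 1 g.1, monoF P 0 1 g.2)
  else bif decide (f = 3) then (monoR P 1 0 g.1, monoF P 1 0 g.2)
  else (g.1 ++ h.1, g.2 ++ h.2)

/-- The list with a given number. -/
def listC (n : ℕ) : List ℕ := (Encodable.decode n : Option (List ℕ)).getD []

/-- The form that is the value of the term with a given number, in `m` free variables. The constant
`1` is represented by the constant with index zero. -/
def termForm (P : Par) (m : ℕ) : ℕ → Form :=
  course fun l =>
    bif decide (l.length.unpair.1 = 0) then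
      ([(bif decide (l.length.unpair.2 % 2 = 0) then l.length.unpair.2 / 2
        else m + l.length.unpair.2 / 2, 0, 0)], [])
    else opForm P l.length.unpair.2.unpair.2.unpair.1
      (l.getD ((listC l.length.unpair.2.unpair.2.unpair.2).getD 0 0) ([], []))
      (l.getD ((listC l.length.unpair.2.unpair.2.unpair.2).getD 1 0) ([], []))

/-- The general element, presented by `p ^ e` coordinates. -/
def packForm (P : Par) (e : ℕ) : Form := ((List.range (P.p ^ e)).map fun i => (i, i, e), [])

/-- Number of the formula `x₀ = 1`. -/
def oneC : ℕ := eqC (powC 0 0) (funcC 0 1 [])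

/-- The set defined by an equation. -/
def eqData (P : Par) (e m a b : ℕ) : Data :=
  [(packForm P e, [diff P (termForm P m a) (termForm P m b)], [], 1, oneC)]

/-- The set defined by the predicate `∈ F`. -/
def memData (P : Par) (e m a : ℕ) : Data :=
  [(packForm P e, [diff P (termForm P m a) ([], [(1, 0, 0, 0)])], [], 1, oneC)]

/-- The set defined by a predicate `P_σ`. -/
def predData (P : Par) (e m σ : ℕ) (a : List ℕ) : Data :=
  [(packForm P e, (List.range a.length).map fun i =>
    diff P (termForm P m (a.getD i 0)) ([], [(i + 1, 0, 0, 0)]), [], a.length + 1,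
    andC oneC (renC 1 1 σ))]

/-- The set defined by an atomic formula. -/
def atomData (P : Par) (e m n : ℕ) : Data :=
  bif decide (n.unpair.1 = 0) then []
  else bif decide (n.unpair.1 = 1) then eqData P e m n.unpair.2.unpair.1 n.unpair.2.unpair.2
  else bif decide (n.unpair.2.unpair.2.unpair.1 = 0) then
    memData P e m ((listC n.unpair.2.unpair.2.unpair.2).getD 0 0)
  else predData P e m (n.unpair.2.unpair.2.unpair.1 - 1) (listC n.unpair.2.unpair.2.unpair.2)

/-- A bound for the variables over `R` that occur in a clause. -/
def Clause.rbd (C : Clause) : ℕ := (C.forms.map fun f => (f.1.map fun m => m.1 + 1).sum).sum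

/-- Projection along the coordinate `j` of `p ^ e`. -/
def projC (e j : ℕ) (C : Clause) : Clause := ((C.1.1 ++ [(C.rbd, j, e)], C.1.2), C.2)

/-- The entries `(s, e, m, k, n, d)` are a sign, a number of coordinates, the numbers of free and of
further variables, the number of a formula, and the set defined by the formula or by its negation,
according to the sign. -/
abbrev Defn := Bool × ℕ × ℕ × ℕ × ℕ × Data

/-- Change of the sign. -/
def negRule (P : Par) (t : ℕ) (a b : Defn) : Defn :=
  bif sameData (compEnum P t).1 a.2.2.2.2.2 then
    (!a.1, a.2.1, a.2.2.1, a.2.2.2.1, a.2.2.2.2.1, (compEnum P t).2) else b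

/-- Implications. -/
def impRule (a b : Defn) : Defn :=
  bif !a.1 && (b.1 && (decide (a.2.1 = b.2.1) && (decide (a.2.2.1 = b.2.2.1) &&
    decide (a.2.2.2.1 = b.2.2.2.1)))) then
    (true, a.2.1, a.2.2.1, a.2.2.2.1, impC a.2.2.2.2.1 b.2.2.2.2.1, a.2.2.2.2.2 ++ b.2.2.2.2.2)
  else b

/-- Universal quantification. -/
def allRule (P : Par) (a b : Defn) : Defn :=
  bif !a.1 && (decide (1 ≤ a.2.2.2.1) && decide (a.2.2.1 + a.2.2.2.1 ≤ P.p ^ a.2.1)) then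
    (false, a.2.1, a.2.2.1, a.2.2.2.1 - 1, allC a.2.2.2.2.1,
      a.2.2.2.2.2.map (projC a.2.1 (a.2.2.1 + (a.2.2.2.1 - 1))))
  else b

/-- Atomic formulas, and numbers that are not numbers of formulas. -/
def atomRule (P : Par) (e m k n : ℕ) (b : Defn) : Defn :=
  bif decide (n.unpair.1 = 3) || decide (n.unpair.1 = 4) then b
  else (true, e, m, k, n, atomData P e m n)

/-- Rules for the sets defined by formulas or their negations. -/
def defRule (P : Par) (q : ℕ × ℕ × ℕ × ℕ × ℕ) (a b : Defn) : Defn :=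
  bif decide (q.1 = 0) then negRule P q.2.1 a b
  else bif decide (q.1 = 1) then impRule a b
  else bif decide (q.1 = 2) then allRule P a b
  else atomRule P q.2.1 q.2.2.1 q.2.2.2.1 q.2.2.2.2 b

/-- An enumeration of the sets defined by formulas or their negations. -/
def defEnum (P : Par) : ℕ → Defn :=
  treeEval (true, 0, 0, 0, falsumC, []) (defRule P)

section Primrec

variable {α : Type} [Primcodable α] {P : Par}

@[fun_prop]
theorem primrec_sameData {d d' : α → Data} (hd : Primrec d) (hd' : Primrec d') :
    Primrec fun x => sameData (d x) (d' x) := by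
  unfold sameData; fun_prop

@[fun_prop]
theorem primrec_runRule {C : α → Clause} {l : α → List Step} {a b : α → Data × Data}
    (hC : Primrec C) (hl : Primrec l) (ha : Primrec a) (hb : Primrec b) :
    Primrec fun x => runRule P (C x) (l x) (a x) (b x) := by
  unfold runRule; fun_prop

@[fun_prop]
theorem primrec_partsRule {C : α → Clause} {c : α → Cert} {a b : α → Data × Data}
    (hC : Primrec C) (hc : Primrec c) (ha : Primrec a) (hb : Primrec b) :
    Primrec fun x => partsRule P (C x) (c x) (a x) (b x) := by
  unfold partsRule; fun_prop

theorem primrec_compRule {q : α → ℕ × Clause × List Step × Cert} {a b : α → Data × Data}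
    (hq : Primrec q) (ha : Primrec a) (hb : Primrec b) :
    Primrec fun x => compRule P (q x) (a x) (b x) := by
  unfold compRule; fun_prop

theorem primrec_compEnum' : Primrec (compEnum P) :=
  primrec_treeEval (primrec_compRule Primrec.fst (Primrec.fst.comp Primrec.snd)
    (Primrec.snd.comp Primrec.snd))

@[fun_prop]
theorem primrec_compEnum {n : α → ℕ} (hn : Primrec n) : Primrec fun x => compEnum P (n x) :=
  primrec_compEnum'.comp hn

@[fun_prop]
theorem primrec_opForm {f : α → ℕ} {g h : α → Form} (hf : Primrec f) (hg : Primrec g)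
    (hh : Primrec h) : Primrec fun x => opForm P (f x) (g x) (h x) := by
  unfold opForm; fun_prop

@[fun_prop]
theorem primrec_listC {n : α → ℕ} (hn : Primrec n) : Primrec fun x => listC (n x) := by
  unfold listC; fun_prop

@[fun_prop]
theorem primrec_termForm {m n : α → ℕ} (hm : Primrec m) (hn : Primrec n) :
    Primrec fun x => termForm P (m x) (n x) := by
  unfold termForm; fun_prop

@[fun_prop]
theorem primrec_packForm {e : α → ℕ} (he : Primrec e) : Primrec fun x => packForm P (e x) := by
  unfold packForm; fun_prop

@[fun_prop]
theorem primrec_eqData {e m a b : α → ℕ} (he : Primrec e) (hm : Primrec m) (ha : Primrec a)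
    (hb : Primrec b) : Primrec fun x => eqData P (e x) (m x) (a x) (b x) := by
  unfold eqData; fun_prop

@[fun_prop]
theorem primrec_memData {e m a : α → ℕ} (he : Primrec e) (hm : Primrec m) (ha : Primrec a) :
    Primrec fun x => memData P (e x) (m x) (a x) := by
  unfold memData; fun_prop

@[fun_prop]
theorem primrec_predData {e m σ : α → ℕ} {a : α → List ℕ} (he : Primrec e) (hm : Primrec m)
    (hσ : Primrec σ) (ha : Primrec a) :
    Primrec fun x => predData P (e x) (m x) (σ x) (a x) := by
  unfold predData; fun_prop

@[fun_prop]
theorem primrec_atomData {e m n : α → ℕ} (he : Primrec e) (hm : Primrec m) (hn : Primrec n) :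
    Primrec fun x => atomData P (e x) (m x) (n x) := by
  unfold atomData; fun_prop

@[fun_prop]
theorem primrec_rbd {C : α → Clause} (hC : Primrec C) : Primrec fun x => (C x).rbd := by
  unfold Clause.rbd Clause.forms; fun_prop

@[fun_prop]
theorem primrec_projC {e j : α → ℕ} {C : α → Clause} (he : Primrec e) (hj : Primrec j)
    (hC : Primrec C) : Primrec fun x => projC (e x) (j x) (C x) := by
  unfold projC; fun_prop

@[fun_prop]
theorem primrec_negRule {t : α → ℕ} {a b : α → Defn} (ht : Primrec t) (ha : Primrec a)
    (hb : Primrec b) : Primrec fun x => negRule P (t x) (a x) (b x) := by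
  unfold negRule; fun_prop

@[fun_prop]
theorem primrec_impRule {a b : α → Defn} (ha : Primrec a) (hb : Primrec b) :
    Primrec fun x => impRule (a x) (b x) := by
  unfold impRule; fun_prop

@[fun_prop]
theorem primrec_allRule {a b : α → Defn} (ha : Primrec a) (hb : Primrec b) :
    Primrec fun x => allRule P (a x) (b x) := by
  unfold allRule; fun_prop

@[fun_prop]
theorem primrec_atomRule {e m k n : α → ℕ} {b : α → Defn} (he : Primrec e) (hm : Primrec m)
    (hk : Primrec k) (hn : Primrec n) (hb : Primrec b) :
    Primrec fun x => atomRule P (e x) (m x) (k x) (n x) (b x) := by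
  unfold atomRule; fun_prop

theorem primrec_defRule {q : α → ℕ × ℕ × ℕ × ℕ × ℕ} {a b : α → Defn} (hq : Primrec q)
    (ha : Primrec a) (hb : Primrec b) : Primrec fun x => defRule P (q x) (a x) (b x) := by
  unfold defRule; fun_prop

theorem primrec_defEnum' : Primrec (defEnum P) :=
  primrec_treeEval (primrec_defRule Primrec.fst (Primrec.fst.comp Primrec.snd)
    (Primrec.snd.comp Primrec.snd))

@[fun_prop]
theorem primrec_defEnum {n : α → ℕ} (hn : Primrec n) : Primrec fun x => defEnum P (n x) :=
  primrec_defEnum'.comp hn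

end Primrec

namespace Setting

variable {P : Par} {F R : Type*} [Field F] [CommRing R] (K : Setting P F R)

theorem Den_append (d d' : Data) : K.Den (d ++ d') = K.Den d ∪ K.Den d' := by
  ext x; simp [Den, or_and_right, exists_or]

theorem Den_singleton (C : Clause) : K.Den [C] = K.den C := by
  ext x; simp [Den]

theorem den_univC : K.den univC = Set.univ := by
  refine Set.eq_univ_of_forall fun x => ⟨fun _ => x, 0, ?_, ?_⟩
  · exact ⟨by simp [univC], by simp [univC], sem_true _ _⟩
  · simp [univC, ev, evalR_cons]

/-- The enumeration yields pairs of complementary sets. -/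
theorem compEnum_spec [IsDomain R] (n : ℕ) (h : Data.WF P.p (compEnum P n).1) :
    Data.WF P.p (compEnum P n).2 ∧ K.Den (compEnum P n).2 = (K.Den (compEnum P n).1)ᶜ := by
  revert h
  -- The clauses in the parameters of the rules are arbitrary and may carry numbers that code no
  -- formula; the invariant is therefore conditional on well-formedness of the first component.
  refine treeEval_valid (valid := fun x : Data × Data => Data.WF P.p x.1 →
    Data.WF P.p x.2 ∧ K.Den x.2 = (K.Den x.1)ᶜ) ?_ ?_ n
  · have hu : Data.WF P.p [univC] := by
      intro C hC
      rw [List.mem_singleton] at hC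
      subst hC
      exact wf_falsumC.notC
    intro _
    refine ⟨hu, ?_⟩
    rw [Den_singleton, den_univC]
    ext x; simp [Den]
  · intro q a b ha hb
    unfold compRule
    cases h0 : decide (q.1 = 0)
    · cases h1 : decide (q.1 = 1)
      · simp only [cond_false]
        unfold partsRule
        cases h2 : q.2.1.good P q.2.2.2 && sameData a.1 (q.2.1.parts P q.2.2.2)
        · exact hb
        · simp only [cond_true]
          intro hw
          have hC : q.2.1.WF P.p := hw _ (List.mem_singleton_self _)
          rw [Bool.and_eq_true, sameData_iff] at h2
          obtain ⟨hg, he⟩ := h2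
          obtain ⟨h3, h4⟩ := ha (he ▸ wf_parts hC)
          refine ⟨(wf_cover hC).inter h3, ?_⟩
          rw [K.den_inter (wf_cover hC) h3, h4, he, Den_singleton]
          ext x
          rw [Set.mem_compl_iff, K.notMem_den_iff_cover hg hC]
          rfl
      · simp only [cond_false, cond_true]
        unfold runRule
        cases h2 : sameData a.1 [q.2.1.run P q.2.2.1]
        · exact hb
        · simp only [cond_true]
          intro hw
          have hC : q.2.1.WF P.p := hw _ (List.mem_singleton_self _)
          rw [sameData_iff] at h2
          obtain ⟨h3, h4⟩ := K.run_spec hC q.2.2.1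
          rw [h2, Den_singleton, h4] at ha
          rw [Den_singleton]
          refine ha ?_
          intro C hC'
          rw [List.mem_singleton] at hC'
          exact hC' ▸ h3
    · simp only [cond_true]
      intro hw
      obtain ⟨h1, h2⟩ := ha fun C hC => hw C (List.mem_append_left _ hC)
      obtain ⟨h3, h4⟩ := hb fun C hC => hw C (List.mem_append_right _ hC)
      refine ⟨h1.inter h3, ?_⟩
      rw [K.den_inter h1 h3, Den_append, h2, h4, Set.compl_union]

end Setting

end AddFrob

/-! ### Correctness of the enumeration of sets defined by formulas -/

namespace AddFrob

open FirstOrder FirstOrder.Language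

theorem getD_le_encode (l : List ℕ) (i : ℕ) : l.getD i 0 ≤ Encodable.encode l := by
  by_cases h : i < l.length
  · rw [List.getD_eq_getElem _ _ h]
    exact (le_encode_of_mem (List.getElem_mem h)).le
  · rw [List.getD_eq_default _ _ (by omega)]
    exact Nat.zero_le _

theorem termForm_var (P : Par) (m x : ℕ) : termForm P m (Nat.pair 0 x)
    = ([(if x % 2 = 0 then x / 2 else m + x / 2, 0, 0)], []) := by
  rw [termForm, course, length_courseVals]
  simp [Bool.cond_decide]

theorem termForm_func (P : Par) (m n f : ℕ) (args : List ℕ) :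
    termForm P m (funcC n f args)
      = opForm P f (termForm P m (args.getD 0 0)) (termForm P m (args.getD 1 0)) := by
  have h : ∀ i, args.getD i 0 < funcC n f args := by
    intro i
    have h1 := getD_le_encode args i
    have h2 := Nat.add_le_pair 1 (Nat.pair n (Nat.pair f (Encodable.encode args)))
    have h3 := Nat.right_le_pair n (Nat.pair f (Encodable.encode args))
    have h4 := Nat.right_le_pair f (Encodable.encode args)
    unfold funcC
    omega
  conv_lhs => rw [termForm, course, length_courseVals]
  have h1 : (funcC n f args).unpair.1 = 1 := by simp [funcC]
  have h2 : (funcC n f args).unpair.2.unpair.2.unpair.1 = f := by simp [funcC]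
  have h3 : listC (funcC n f args).unpair.2.unpair.2.unpair.2 = args := by simp [funcC, listC]
  rw [h1, h2, h3, getD_courseVals _ (h 0), getD_courseVals _ (h 1)]
  rfl

theorem wf_oneC {p l : ℕ} : WF p (l + 1) oneC := by
  refine ⟨.equal (.var (Sum.inl 0)) (.func (L := Lp p) (l := 0) LpFunctions.one Fin.elim0), rfl⟩

theorem sem_oneC {p l : ℕ} {F : Type*} [Field F] {γ : ℕ → F} :
    Sem p (l + 1) oneC γ ↔ γ 0 = 1 := by
  have h : oneC = formulaCode (BoundedFormula.equal (L := Lp p) (α := Fin (l + 1)) (n := 0)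
    (.var (Sum.inl 0)) (.func (L := Lp p) (l := 0) LpFunctions.one Fin.elim0)) := rfl
  rw [h]
  exact sem_formulaCode _

namespace Setting

variable {P : Par} {F R : Type*} [Field F] [CommRing R] (K : Setting P F R)

/-- The interpretation of the symbols in `R` is the intended one. -/
structure Compat [(Lpze P.p).Structure R] : Prop where
  zero : ∀ v, Structure.funMap (L := Lpze P.p) (M := R) (n := 0) LpzFunctions.zero v = 0
  one : ∀ v, Structure.funMap (L := Lpze P.p) (M := R) (n := 0) LpzFunctions.one v = 1
  frob : ∀ v, Structure.funMap (L := Lpze P.p) (M := R) (n := 1) LpzFunctions.frob v = v 0 ^ P.p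
  mulZ : ∀ v, Structure.funMap (L := Lpze P.p) (M := R) (n := 1) LpzFunctions.mulZ v = K.z * v 0
  add : ∀ v, Structure.funMap (L := Lpze P.p) (M := R) (n := 2) LpzFunctions.add v = v 0 + v 1
  memF : ∀ v, Structure.RelMap (L := Lpze P.p) (M := R) (n := 1) LpzeRelations.memF v ↔
    ∃ a, K.ι a = v 0
  pred : ∀ {n : ℕ} (σ : (Lp P.p).Formula (Fin n)) (v : Fin n → R),
    Structure.RelMap (L := Lpze P.p) (M := R) (n := n) (LpzeRelations.P σ) v ↔
      ∃ a : Fin n → F, (∀ i, K.ι (a i) = v i) ∧ σ.Realize a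

/-- The element with the given coordinates. -/
noncomputable def pack (e : ℕ) (x : ℕ → R) : R :=
  ∑ i ∈ Finset.range (P.p ^ e), K.z ^ i * x i ^ P.p ^ e

theorem ev_packForm (e : ℕ) (ρ : ℕ → R) (γ : ℕ → F) : K.ev ρ γ (packForm P e) = K.pack e ρ := by
  rw [ev, packForm, evalF_nil, add_zero, evalR, List.map_map, ← List.sum_toFinset _
    (List.nodup_range), List.toFinset_range, pack]
  rfl

theorem pack_congr {e : ℕ} {x y : ℕ → R} (h : ∀ i < P.p ^ e, x i = y i) :
    K.pack e x = K.pack e y :=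
  Finset.sum_congr rfl fun i hi => by rw [h i (Finset.mem_range.1 hi)]

theorem pack_inj {e : ℕ} {x y : ℕ → R} (h : K.pack e x = K.pack e y) {i : ℕ} (hi : i < P.p ^ e) :
    x i = y i := K.coordinates_unique h hi

/-- Uniqueness of coordinates forces the first `p^e` ring variables of the clause to be the given
tuple. -/
theorem pack_mem_den {e : ℕ} {E : List Form} {l σ : ℕ} {x : ℕ → R} :
    K.pack e x ∈ K.den (packForm P e, E, [], l, σ) ↔ ∃ ρ γ, (∀ i < P.p ^ e, ρ i = x i) ∧
      (∀ f ∈ E, K.ev ρ γ f = 0) ∧ Sem P.p l σ γ := by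
  constructor
  · rintro ⟨ρ, γ, ⟨h1, -, h2⟩, h3⟩
    rw [ev_packForm] at h3
    exact ⟨ρ, γ, fun i hi => K.pack_inj h3 hi, h1, h2⟩
  · rintro ⟨ρ, γ, h0, h1, h2⟩
    refine ⟨ρ, γ, ⟨h1, by simp, h2⟩, ?_⟩
    rw [ev_packForm]
    exact K.pack_congr h0

variable {K} [(Lpze P.p).Structure R] (hK : K.Compat)

include hK

/-- All function symbols are additive except for the constant 1, which is represented by the
constant with index zero; hence the assumption on `γ 0`. Free variables come first, followed from
index `m` on by the quantified ones. -/
theorem ev_termForm {m k : ℕ} {ρ : ℕ → R} {γ : ℕ → F} (hγ : γ 0 = 1)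
    (t : (Lpze P.p).Term (Fin m ⊕ Fin k)) : K.ev ρ γ (termForm P m (termCode t))
      = t.realize (Sum.elim (fun i : Fin m => ρ i) fun i : Fin k => ρ (m + i)) := by
  induction t with
  | var x =>
    rw [termCode, termForm_var]
    rcases x with i | i
    · simp [varCode, ev, evalR_cons]
    · have h1 : (2 * (i : ℕ) + 1) / 2 = i := by omega
      have h2 : (2 * (i : ℕ) + 1) % 2 = 1 := by omega
      simp [varCode, ev, evalR_cons, h1, h2]
  | func f ts ih =>
    rw [Term.realize, termCode_func, termForm_func]
    cases f with
    | zero =>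
      rw [hK.zero]
      simp [SymbolNumbering.funNum, LpzFunctions.num, opForm, ev]
    | one =>
      rw [hK.one]
      simp [SymbolNumbering.funNum, LpzFunctions.num, opForm, ev, evalF_cons, hγ]
    | frob =>
      rw [hK.frob, ← ih 0]
      simp [SymbolNumbering.funNum, LpzFunctions.num, opForm, ev, evalR_monoR, evalF_monoF]
      have := K.add_pow (K.evalR ρ (termForm P m (termCode (ts 0))).1)
        (K.evalF γ (termForm P m (termCode (ts 0))).2) 1
      rw [pow_one] at this
      exact this.symm
    | mulZ =>
      rw [hK.mulZ, ← ih 0]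
      simp [SymbolNumbering.funNum, LpzFunctions.num, opForm, ev, evalR_monoR, evalF_monoF]
      ring
    | add =>
      rw [hK.add, ← ih 0, ← ih 1]
      simp [SymbolNumbering.funNum, LpzFunctions.num, opForm, ev]
      ring

omit [CommRing R] hK [(Lpze P.p).Structure R] in
theorem sumElim_congr {m k e : ℕ} (he : m + k ≤ P.p ^ e) {x ρ : ℕ → R}
    (h : ∀ i < P.p ^ e, ρ i = x i) :
    (Sum.elim (fun i : Fin m => ρ i) fun i : Fin k => ρ (m + i))
      = Sum.elim (fun i : Fin m => x i) fun i : Fin k => x (m + i) := by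
  congr 1 <;> funext i <;> exact h _ (by omega)

theorem eqData_spec {e m k : ℕ} (he : m + k ≤ P.p ^ e) (t₁ t₂ : (Lpze P.p).Term (Fin m ⊕ Fin k))
    (x : ℕ → R) : K.pack e x ∈ K.Den (eqData P e m (termCode t₁) (termCode t₂)) ↔
      t₁.realize (Sum.elim (fun i : Fin m => x i) fun i : Fin k => x (m + i))
        = t₂.realize (Sum.elim (fun i : Fin m => x i) fun i : Fin k => x (m + i)) := by
  rw [eqData, Den_singleton, pack_mem_den]
  simp only [List.mem_singleton, forall_eq, ev_diff, sem_oneC (l := 0), sub_eq_zero]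
  constructor
  · rintro ⟨ρ, γ, h1, h2, h3⟩
    rwa [ev_termForm hK h3, ev_termForm hK h3, sumElim_congr he h1] at h2
  · intro h
    refine ⟨x, fun _ => 1, fun _ _ => rfl, ?_, rfl⟩
    rwa [ev_termForm hK rfl, ev_termForm hK rfl]

theorem memData_spec {e m k : ℕ} (he : m + k ≤ P.p ^ e) (t : (Lpze P.p).Term (Fin m ⊕ Fin k))
    (x : ℕ → R) : K.pack e x ∈ K.Den (memData P e m (termCode t)) ↔
      ∃ a, K.ι a = t.realize (Sum.elim (fun i : Fin m => x i) fun i : Fin k => x (m + i)) := by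
  rw [memData, Den_singleton, pack_mem_den]
  have hev : ∀ (ρ : ℕ → R) (γ : ℕ → F), K.ev ρ γ ([], [(1, 0, 0, 0)]) = K.ι (γ 1) := by
    intro ρ γ; simp [ev, evalF_cons]
  simp only [List.mem_singleton, forall_eq, ev_diff, sem_oneC (l := 0), sub_eq_zero, hev]
  constructor
  · rintro ⟨ρ, γ, h1, h2, h3⟩
    rw [ev_termForm hK h3, sumElim_congr he h1] at h2
    exact ⟨_, h2.symm⟩
  · rintro ⟨a, ha⟩
    refine ⟨x, fun i => if i = 0 then 1 else a, fun _ _ => rfl, ?_, rfl⟩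
    rw [ev_termForm hK (by simp), ← ha]
    simp

theorem predData_spec {e m k n : ℕ} (he : m + k ≤ P.p ^ e) (σ : (Lp P.p).Formula (Fin n))
    (ts : Fin n → (Lpze P.p).Term (Fin m ⊕ Fin k)) (x : ℕ → R) :
    K.pack e x ∈ K.Den (predData P e m (formulaCode σ) (List.ofFn fun i => termCode (ts i))) ↔
      ∃ a : Fin n → F, (∀ i, K.ι (a i)
        = (ts i).realize (Sum.elim (fun i : Fin m => x i) fun i : Fin k => x (m + i))) ∧
          σ.Realize a := by
  rw [predData, Den_singleton, pack_mem_den, List.length_ofFn]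
  have hw : WF P.p n (formulaCode σ) := ⟨σ, rfl⟩
  have hlt : ∀ i < n, 1 * i + 1 < n + 1 := fun i hi => by omega
  have hsem : ∀ γ : ℕ → F, Sem P.p (n + 1) (andC oneC (renC 1 1 (formulaCode σ))) γ ↔
      γ 0 = 1 ∧ σ.Realize fun i : Fin n => γ (i + 1) := by
    intro γ
    rw [sem_andC wf_oneC (hw.renC hlt), sem_oneC, sem_renC hlt hw, sem_formulaCode]
    simp
  have hev : ∀ (ρ : ℕ → R) (γ : ℕ → F) (i : ℕ), K.ev ρ γ ([], [(i + 1, 0, 0, 0)]) = K.ι (γ (i + 1)) := by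
    intro ρ γ i; simp [ev, evalF_cons]
  simp only [hsem, List.forall_mem_map, List.mem_range, ev_diff, sub_eq_zero, hev]
  have hget : ∀ i : Fin n, (List.ofFn fun i => termCode (ts i)).getD i 0 = termCode (ts i) := by
    intro i; simp
  constructor
  · rintro ⟨ρ, γ, h1, h2, h3, h4⟩
    refine ⟨_, fun i => ?_, h4⟩
    have := h2 i i.2
    rw [hget, ev_termForm hK h3, sumElim_congr he h1] at this
    exact this.symm
  · rintro ⟨a, ha, hs⟩
    -- Index zero is reserved for the constant 1, so the arguments of the predicate occupy the
    -- positions from 1 on.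
    refine ⟨x, fun i => if i = 0 then 1 else if h : i - 1 < n then a ⟨i - 1, h⟩ else 0,
      fun _ _ => rfl, fun i hi => ?_, rfl, ?_⟩
    · have := hget ⟨i, hi⟩
      simp only at this
      rw [this, ev_termForm hK rfl, ← ha]
      simp [hi]
    · simpa using hs

omit hK [(Lpze P.p).Structure R] in
theorem wf_predData {e m n : ℕ} (σ : (Lp P.p).Formula (Fin n)) {a : List ℕ} (ha : a.length = n) :
    Data.WF P.p (predData P e m (formulaCode σ) a) := by
  intro C hC
  rw [predData, List.mem_singleton] at hC
  subst hC
  subst ha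
  simp only [Clause.WF]
  exact wf_oneC.andC (WF.renC (fun i hi => by omega) ⟨σ, rfl⟩)

/-- Correctness of an entry of the enumeration of definable sets. -/
def DefnSpec (K : Setting P F R) (a : Defn) : Prop :=
  a.2.2.1 + a.2.2.2.1 ≤ P.p ^ a.2.1 →
    ∀ φ : (Lpze P.p).BoundedFormula (Fin a.2.2.1) a.2.2.2.1, formulaCode φ = a.2.2.2.2.1 →
      Data.WF P.p a.2.2.2.2.2 ∧ ∀ x : ℕ → R, K.pack a.2.1 x ∈ K.Den a.2.2.2.2.2 ↔
        (a.1 = true ↔ φ.Realize (fun i => x i) fun i => x (a.2.2.1 + i))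

/-- Numbers that code no formula make `DefnSpec` vacuous, so only the atomic constructors have to be
checked. -/
theorem atomRule_spec (e m k n : ℕ) {b : Defn} (hb : DefnSpec K b) :
    DefnSpec K (atomRule P e m k n b) := by
  unfold atomRule
  cases h0 : decide (n.unpair.1 = 3) || decide (n.unpair.1 = 4)
  swap
  · exact hb
  · simp only [cond_false, DefnSpec, true_iff]
    rw [Bool.or_eq_false_iff, decide_eq_false_iff_not, decide_eq_false_iff_not] at h0
    intro he φ hφ
    have hone : ∀ {E : List Form}, Data.WF P.p [(packForm P e, E, [], 1, oneC)] := by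
      intro E C hC
      rw [List.mem_singleton] at hC
      subst hC
      exact wf_oneC (l := 0)
    subst hφ
    cases φ with
    | falsum =>
      have : atomData P e m (formulaCode (BoundedFormula.falsum (L := Lpze P.p) (α := Fin m) (n := k)))
          = [] := by simp [atomData, formulaCode]
      rw [this]
      refine ⟨by simp [Data.WF], fun x => ?_⟩
      simp [Den, BoundedFormula.Realize]
    | equal t₁ t₂ =>
      have : atomData P e m (formulaCode (BoundedFormula.equal t₁ t₂))
          = eqData P e m (termCode t₁) (termCode t₂) := by simp [atomData, formulaCode]
      rw [this]
      exact ⟨hone, eqData_spec hK he t₁ t₂⟩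
    | @rel _ l r ts =>
      cases r with
      | memF =>
        have : atomData P e m (formulaCode (BoundedFormula.rel (L := Lpze P.p) (l := 1)
            LpzeRelations.memF ts)) = memData P e m (termCode (ts 0)) := by
          simp [atomData, formulaCode, listC, SymbolNumbering.relNum, LpzeRelations.num]
        rw [this]
        refine ⟨hone, fun x => (memData_spec hK he (ts 0) x).trans ?_⟩
        exact (hK.memF fun i => (ts i).realize
          (Sum.elim (fun i : Fin m => x i) fun i : Fin k => x (m + i))).symm
      | P σ =>
        have : atomData P e m (formulaCode (BoundedFormula.rel (L := Lpze P.p) (l := l)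
            (LpzeRelations.P σ) ts))
            = predData P e m (formulaCode σ) (List.ofFn fun i => termCode (ts i)) := by
          simp [atomData, formulaCode, listC, SymbolNumbering.relNum, LpzeRelations.num]
        rw [this]
        refine ⟨wf_predData σ (by simp), fun x => (predData_spec hK he σ ts x).trans ?_⟩
        exact (hK.pred σ _).symm
    | imp φ ψ => simp [formulaCode] at h0
    | all φ => simp [formulaCode] at h0

omit hK in
theorem negRule_spec [IsDomain R] (t : ℕ) {a b : Defn} (ha : DefnSpec K a) (hb : DefnSpec K b) :
    DefnSpec K (negRule P t a b) := by
  unfold negRule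
  cases h0 : sameData (compEnum P t).1 a.2.2.2.2.2
  · exact hb
  · simp only [cond_true, DefnSpec] at ha ⊢
    rw [sameData_iff] at h0
    intro he φ hφ
    obtain ⟨h1, h2⟩ := ha he φ hφ
    rw [← h0] at h1 h2
    obtain ⟨h3, h4⟩ := K.compEnum_spec t h1
    refine ⟨h3, fun x => ?_⟩
    rw [h4, Set.mem_compl_iff, h2 x]
    cases a.1 <;> simp

omit hK in
-- An implication is the union of the set of the negated premise and the set of the conclusion; this
-- explains the signs that the rule requires.
theorem impRule_spec {a b : Defn} (ha : DefnSpec K a) (hb : DefnSpec K b) :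
    DefnSpec K (impRule a b) := by
  unfold impRule
  cases h0 : !a.1 && (b.1 && (decide (a.2.1 = b.2.1) && (decide (a.2.2.1 = b.2.2.1) &&
    decide (a.2.2.2.1 = b.2.2.2.1))))
  · exact hb
  · obtain ⟨s, e, m, k, n, d⟩ := a
    obtain ⟨s', e', m', k', n', d'⟩ := b
    simp only [Bool.and_eq_true, Bool.not_eq_true', decide_eq_true_eq] at h0
    obtain ⟨rfl, rfl, rfl, rfl, rfl⟩ := h0
    simp only [cond_true, DefnSpec] at ha hb ⊢
    intro he φ hφ
    cases φ with
    | imp φ ψ =>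
      simp only [formulaCode, impC, Nat.pair_eq_pair, true_and] at hφ
      obtain ⟨h1, h2⟩ := ha he φ hφ.1
      obtain ⟨h3, h4⟩ := hb he ψ hφ.2
      refine ⟨fun C hC => (List.mem_append.1 hC).elim (h1 C) (h3 C), fun x => ?_⟩
      rw [Den_append, Set.mem_union, h2 x, h4 x, BoundedFormula.realize_imp]
      simp only [Bool.false_eq_true, false_iff, true_iff]
      tauto
    | _ => simp [formulaCode, impC] at hφ

omit hK [(Lpze P.p).Structure R] in
theorem lt_rbd {C : Clause} {f : Form} (hf : f ∈ C.forms) {m} (hm : m ∈ f.1) : m.1 < C.rbd :=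
  (List.single_le_sum (by simp) _ (List.mem_map_of_mem (f := fun m : ℕ × ℕ × ℕ => m.1 + 1) hm)).trans
    (List.single_le_sum (by simp) _ (List.mem_map_of_mem
      (f := fun f : Form => (f.1.map fun m => m.1 + 1).sum) hf))

omit hK [(Lpze P.p).Structure R] in
-- The variable with index `C.rbd` does not occur in `C`, so the new summand varies independently of
-- the conditions.
theorem mem_den_projC (e j : ℕ) (C : Clause) (x : R) :
    x ∈ K.den (projC e j C) ↔ ∃ w, x - K.z ^ j * w ^ P.p ^ e ∈ K.den C := by
  have hev : ∀ (ρ : ℕ → R) (γ : ℕ → F), K.ev ρ γ (projC e j C).1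
      = K.ev ρ γ C.1 + K.z ^ j * ρ C.rbd ^ P.p ^ e := by
    intro ρ γ; simp [projC, ev, evalR_cons]; ring
  constructor
  · rintro ⟨ρ, γ, h1, h2⟩
    refine ⟨ρ C.rbd, ρ, γ, h1, ?_⟩
    rw [← h2, hev]; ring
  · rintro ⟨w, ρ, γ, h1, h2⟩
    refine ⟨Function.update ρ C.rbd w, γ, ?_, ?_⟩
    · refine (K.sat_congr (C := C) (fun f hf m hm => ?_) fun _ _ => rfl).1 h1
      exact (Function.update_of_ne (lt_rbd hf hm).ne _ _).symm
    · have h3 : K.ev (Function.update ρ C.rbd w) γ C.1 = K.ev ρ γ C.1 :=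
        K.ev_congr (fun m hm => Function.update_of_ne (lt_rbd C.fst_mem_forms hm).ne _ _)
          fun _ _ => rfl
      rw [hev, Function.update_self, h3, h2]; ring

omit hK [(Lpze P.p).Structure R] in
-- Subtracting `z^j w^(p^e)` changes the coordinate `j` from `x j` to `x j - w`, by additivity of
-- the `p^e`-th power, and leaves the others alone. A free `w` therefore means an existentially
-- quantified coordinate `j`.
theorem pack_mem_Den_projC {e j : ℕ} (hj : j < P.p ^ e) (d : Data) (x : ℕ → R) :
    K.pack e x ∈ K.Den (d.map (projC e j)) ↔
      ∃ r, K.pack e (Function.update x j r) ∈ K.Den d := by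
  have h : ∀ w, K.pack e x - K.z ^ j * w ^ P.p ^ e = K.pack e (Function.update x j (x j - w)) := by
    intro w
    have hm : j ∈ Finset.range (P.p ^ e) := Finset.mem_range.2 hj
    rw [pack, pack, ← Finset.add_sum_erase _ _ hm, ← Finset.add_sum_erase _ _ hm,
      Function.update_self, K.sub_pow]
    have : ∀ i ∈ (Finset.range (P.p ^ e)).erase j,
        K.z ^ i * Function.update x j (x j - w) i ^ P.p ^ e = K.z ^ i * x i ^ P.p ^ e := by
      intro i hi
      rw [Function.update_of_ne (Finset.ne_of_mem_erase hi)]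
    rw [Finset.sum_congr rfl this]
    ring
  simp only [Den, List.mem_map, Set.mem_ofPred_eq]
  constructor
  · rintro ⟨_, ⟨C, hC, rfl⟩, hx⟩
    obtain ⟨w, hw⟩ := (mem_den_projC _ _ _ _).1 hx
    rw [h] at hw
    exact ⟨_, C, hC, hw⟩
  · rintro ⟨r, C, hC, hr⟩
    refine ⟨_, ⟨C, hC, rfl⟩, (mem_den_projC _ _ _ _).2 ⟨x j - r, ?_⟩⟩
    rw [h, sub_sub_cancel]
    exact hr

omit hK in
-- The negation of a universal formula is a projection of the negation of its matrix. Both entries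
-- therefore carry the negative sign, and the eliminated coordinate is that of the last quantified
-- variable.
theorem allRule_spec {a b : Defn} (ha : DefnSpec K a) (hb : DefnSpec K b) :
    DefnSpec K (allRule P a b) := by
  unfold allRule
  cases h0 : !a.1 && (decide (1 ≤ a.2.2.2.1) && decide (a.2.2.1 + a.2.2.2.1 ≤ P.p ^ a.2.1))
  · exact hb
  · obtain ⟨s, e, m, k, n, d⟩ := a
    simp only [Bool.and_eq_true, Bool.not_eq_true', decide_eq_true_eq] at h0
    obtain ⟨rfl, h1, he⟩ := h0
    obtain ⟨k, rfl⟩ := Nat.exists_eq_add_of_le' h1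
    simp only [cond_true, DefnSpec, Nat.add_sub_cancel] at ha ⊢
    intro _ φ hφ
    cases φ with
    | all φ =>
      simp only [formulaCode, allC, Nat.pair_eq_pair, true_and] at hφ
      obtain ⟨h2, h3⟩ := ha he φ hφ
      refine ⟨?_, fun x => ?_⟩
      · intro C' hC'
        obtain ⟨C, hC, rfl⟩ := List.mem_map.1 hC'
        exact h2 C hC
      rw [pack_mem_Den_projC (by omega), BoundedFormula.realize_all]
      simp only [h3, Bool.false_eq_true, false_iff, not_forall]
      refine exists_congr fun r => not_congr (iff_of_eq ?_)
      congr 1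
      · funext i
        exact Function.update_of_ne (by omega) _ _
      · funext i
        refine Fin.lastCases ?_ (fun i => ?_) i
        · simp
        · simp only [Fin.snoc_castSucc, Fin.val_castSucc]
          exact Function.update_of_ne (by omega) _ _
    | _ => simp [formulaCode, allC] at hφ

/-- The enumeration yields definable sets. -/
theorem defEnum_spec [IsDomain R] (t : ℕ) : DefnSpec K (defEnum P t) := by
  refine treeEval_valid (valid := DefnSpec K) ?_ ?_ t
  · intro _ φ hφ
    have : φ = BoundedFormula.falsum := formulaCode_injective (hφ.trans rfl)
    subst this
    exact ⟨by simp [Data.WF], fun x => by simp [Den, BoundedFormula.Realize]⟩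
  · intro q a b ha hb
    unfold defRule
    cases h0 : decide (q.1 = 0)
    · cases h1 : decide (q.1 = 1)
      · cases h2 : decide (q.1 = 2)
        · exact atomRule_spec hK _ _ _ _ hb
        · exact allRule_spec ha hb
      · exact impRule_spec ha hb
    · exact negRule_spec _ ha hb

end Setting

end AddFrob

namespace AddFrob

open Polynomial

/-! ### Coefficients of additive forms -/

/-- Exponents of the monomials of a polynomial over the prime field, with multiplicities. -/
noncomputable def exps {p : ℕ} (q : (ZMod p)[X]) : List ℕ :=
  (List.range (q.natDegree + 1)).flatMap fun i => List.replicate (q.coeff i).val i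

theorem lpoly_append {k : Type*} [CommRing k] (l l' : List ℕ) :
    (lpoly (l ++ l') : k[X]) = lpoly l + lpoly l' := by simp [lpoly]

theorem lpoly_exps {p : ℕ} [NeZero p] (q : (ZMod p)[X]) : lpoly (exps q) = q := by
  have key : ∀ n, (lpoly ((List.range n).flatMap fun i => List.replicate (q.coeff i).val i) :
      (ZMod p)[X]) = ∑ i ∈ Finset.range n, C (q.coeff i) * X ^ i := by
    intro n
    induction n with
    | zero => simp [lpoly]
    | succ n ih =>
      rw [List.range_succ, List.flatMap_append, lpoly_append, ih, Finset.sum_range_succ]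
      congr 1
      simp only [lpoly, List.flatMap_cons, List.flatMap_nil, List.append_nil, List.map_replicate,
        List.sum_replicate]
      rw [nsmul_eq_mul, ← C_eq_natCast, ZMod.natCast_zmod_val]
  rw [exps, key]
  exact (as_sum_range_C_mul_X_pow q).symm

/-- The coefficient of `y_v ^ (p ^ j)` in a form. -/
noncomputable def cf (p : ℕ) (f : RForm) (v j : ℕ) : (ZMod p)[X] :=
  (f.map fun m => if m.1 = v ∧ m.2.2 = j then X ^ m.2.1 else 0).sum

section Coefficients

variable {p : ℕ}

@[simp] theorem cf_nil (v j : ℕ) : cf p [] v j = 0 := rfl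

theorem cf_cons (m) (f : RForm) (v j : ℕ) :
    cf p (m :: f) v j = (if m.1 = v ∧ m.2.2 = j then X ^ m.2.1 else 0) + cf p f v j := by
  simp [cf]

theorem cf_append (f g : RForm) (v j : ℕ) : cf p (f ++ g) v j = cf p f v j + cf p g v j := by
  simp [cf]

/-- A form is the sum of its coefficients. -/
theorem sum_map_eq_sum_cf {A : Type*} [CommRing A] (c : (ZMod p)[X] →+* A) (Φ : ℕ → ℕ → A)
    {f : RForm} {B J : ℕ} (hB : ∀ m ∈ f, m.1 < B) (hJ : ∀ m ∈ f, m.2.2 < J) :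
    (f.map fun m => c X ^ m.2.1 * Φ m.1 m.2.2).sum
      = ∑ v ∈ Finset.range B, ∑ j ∈ Finset.range J, c (cf p f v j) * Φ v j := by
  induction f with
  | nil => simp
  | cons m f ih =>
    rw [List.map_cons, List.sum_cons, ih (fun m hm => hB m (List.mem_cons_of_mem _ hm))
      fun m hm => hJ m (List.mem_cons_of_mem _ hm)]
    simp only [cf_cons, map_add, add_mul, Finset.sum_add_distrib]
    congr 1
    have h1 := hB m List.mem_cons_self
    have h2 := hJ m List.mem_cons_self
    rw [Finset.sum_eq_single m.1]
    · rw [Finset.sum_eq_single m.2.2]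
      · simp
      · intro b _ hb; simp [Ne.symm hb]
      · intro h; exact absurd (Finset.mem_range.2 h2) h
    · intro b _ hb; simp [Ne.symm hb]
    · intro h; exact absurd (Finset.mem_range.2 h1) h

theorem cf_eq_zero_of_forall {f : RForm} {v j : ℕ} (h : ∀ m ∈ f, ¬ (m.1 = v ∧ m.2.2 = j)) :
    cf p f v j = 0 := by
  refine List.sum_eq_zero fun x hx => ?_
  obtain ⟨m, hm, rfl⟩ := List.mem_map.1 hx
  rw [if_neg (h m hm)]

theorem coeff_cf (f : RForm) (v j i : ℕ) : (cf p f v j).coeff i = (cnt f (v, i, j) : ZMod p) := by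
  induction f with
  | nil => simp [cnt]
  | cons m f ih =>
    rw [cf_cons, coeff_add, ih]
    have : cnt (m :: f) (v, i, j) = (if m = (v, i, j) then 1 else 0) + cnt f (v, i, j) := by
      by_cases h : m = (v, i, j)
      · simp [cnt, h, add_comm]
      · simp [cnt, h]
    rw [this, Nat.cast_add]
    congr 1
    obtain ⟨a, b, c⟩ := m
    by_cases h1 : a = v ∧ c = j
    · obtain ⟨rfl, rfl⟩ := h1
      simp [coeff_X_pow, eq_comm]
    · rw [if_neg h1, if_neg fun h => h1 (by simp at h; exact ⟨h.1, h.2.2⟩)]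
      simp

variable {P : Par}

theorem cf_ne_zero_of_mem_clean {f : RForm} {m} (hm : m ∈ clean P f) :
    cf P.p f m.1 m.2.2 ≠ 0 := by
  intro h
  have h1 := coeff_cf (p := P.p) f m.1 m.2.2 m.2.1
  rw [h, coeff_zero, eq_comm, ZMod.natCast_eq_zero_iff] at h1
  have h2 := (List.mem_filter.1 hm).2
  simp [Nat.mod_eq_zero_of_dvd h1] at h2

theorem cnt_clean {f : RForm} {m} (hm : m ∈ clean P f) : cnt (clean P f) m = cnt f m := by
  have h7 := (List.mem_filter.1 hm).2
  rw [cnt_eq_count, cnt_eq_count, clean]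
  exact @List.count_filter _ instBEqOfDecidableEq _ (fun m => !decide (cnt f m % P.p = 0)) _ _ h7

theorem mem_clean_clean {f : RForm} {m} (hm : m ∈ clean P f) : m ∈ clean P (clean P f) := by
  have h7 := (List.mem_filter.1 hm).2
  rw [clean, List.mem_filter, cnt_clean hm]
  exact ⟨hm, h7⟩

theorem cf_clean (f : RForm) (v j : ℕ) : cf P.p (clean P f) v j = cf P.p f v j := by
  refine sum_map_clean (P := P) (fun a => ?_) f _
  rw [nsmul_eq_mul, ← C_eq_natCast, ZMod.natCast_self, C_0, zero_mul]

variable [Fact P.p.Prime]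

theorem cf_monoR (a b : ℕ) (g : RForm) (v j : ℕ) : cf P.p (monoR P a b g) v j
    = if b ≤ j then X ^ a * cf P.p g v (j - b) ^ P.p ^ b else 0 := by
  have hpos : P.p ^ b ≠ 0 := (Nat.pow_pos (Fact.out : P.p.Prime).pos).ne'
  induction g with
  | nil => simp [monoR, zero_pow hpos]
  | cons m g ih =>
    rw [monoR, List.map_cons, ← monoR, cf_cons, ih, cf_cons]
    by_cases hb : b ≤ j
    · rw [if_pos hb, if_pos hb, add_pow_char_pow, mul_add]
      congr 1
      by_cases h : m.1 = v ∧ m.2.2 = j - b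
      · rw [if_pos h, if_pos ⟨h.1, by simp only; omega⟩, pow_add, ← pow_mul, mul_comm m.2.1]
      · rw [if_neg h, if_neg fun h' => h ⟨h'.1, by simp only at h'; omega⟩, zero_pow hpos, mul_zero]
    · rw [if_neg hb, if_neg hb, if_neg fun h' => hb (by simp only at h'; omega), add_zero]

/-- Composition of additive polynomials: substituting `c y^(p^(j-b))` into `a y^(p^b)` gives the
coefficient `a c^(p^b)` at `y^(p^j)`, so coefficients combine by a convolution twisted by Frobenius.
-/
theorem cf_sub (h : ℕ → Form) (f : RForm) (v j : ℕ) : cf P.p (sub P h f).1 v j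
    = (f.map fun m => (RingHom.id _ X) ^ m.2.1 * (fun w b => if b ≤ j then
        cf P.p (h w).1 v (j - b) ^ P.p ^ b else 0) m.1 m.2.2).sum := by
  induction f with
  | nil => rfl
  | cons m f ih =>
    rw [List.map_cons, List.sum_cons, ← ih]
    have : (sub P h (m :: f)).1 = monoR P m.2.1 m.2.2 (h m.1).1 ++ (sub P h f).1 := rfl
    rw [this, cf_append, cf_monoR]
    simp

end Coefficients

/-- The order of a form in a variable, increased by one; zero if the variable does not occur. -/
noncomputable def ordV (p : ℕ) (f : RForm) (v : ℕ) : ℕ :=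
  sInf {n | ∀ j, n ≤ j → cf p f v j = 0}

section Order

variable {p : ℕ} {f : RForm} {v : ℕ}

theorem exists_cf_bound (p : ℕ) (f : RForm) : ∃ J, (∀ m ∈ f, m.2.2 < J) ∧
    ∀ v j, J ≤ j → cf p f v j = 0 := by
  have h : ∀ m ∈ f, m.2.2 < (f.map fun m => m.2.2 + 1).sum := fun m hm =>
    List.single_le_sum (by simp) _ (List.mem_map_of_mem (f := fun m : ℕ × ℕ × ℕ => m.2.2 + 1) hm)
  refine ⟨_, h, fun v j hj => cf_eq_zero_of_forall fun m hm h' => ?_⟩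
  have := h m hm
  omega

theorem cf_eq_zero {j : ℕ} (h : ordV p f v ≤ j) : cf p f v j = 0 := by
  have hne : {n | ∀ j, n ≤ j → cf p f v j = 0}.Nonempty := by
    obtain ⟨J, -, hJ⟩ := exists_cf_bound p f
    exact ⟨J, hJ v⟩
  exact Nat.sInf_mem hne j h

theorem ordV_le {n : ℕ} (h : ∀ j, n ≤ j → cf p f v j = 0) : ordV p f v ≤ n := Nat.sInf_le h

theorem lt_ordV {j : ℕ} (h : cf p f v j ≠ 0) : j < ordV p f v := by
  by_contra hc
  exact h (cf_eq_zero (by omega))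

theorem cf_ordV_ne_zero {s : ℕ} (h : ordV p f v = s + 1) : cf p f v s ≠ 0 := by
  intro h0
  have : ordV p f v ≤ s := by
    refine ordV_le fun j hj => ?_
    rcases hj.eq_or_lt with rfl | hj
    · exact h0
    · exact cf_eq_zero (by omega)
  omega

theorem ordV_congr {g : RForm} {w : ℕ} (h : ∀ j, cf p f v j = cf p g w j) :
    ordV p f v = ordV p g w := by
  simp only [ordV, h]

end Order

end AddFrob

/-! ### Certificates for forms of constant order with independent leading coefficients -/

namespace AddFrob

open Polynomial

/-- Linearly independent columns over a domain can be completed to a nonsingular matrix. -/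
theorem exists_completion {A ι : Type*} [CommRing A] [IsDomain A] {q : ℕ} {U : ι → Fin q → A}
    (hU : LinearIndependent A U) : ∃ (M : Matrix (Fin q) (Fin q) A) (φ : ι → Fin q),
      Function.Injective φ ∧ (∀ u l, M l (φ u) = U u l) ∧ M.det ≠ 0 := by
  let K := FractionRing A
  have hinj : Function.Injective (algebraMap A K) := IsFractionRing.injective A K
  let v : ι → Fin q → K := fun u l => algebraMap A K (U u l)
  have hv : LinearIndependent K v := by
    rw [← LinearIndependent.iff_fractionRing A K]
    refine hU.map' (LinearMap.compLeft (Algebra.linearMap A K) (Fin q)) ?_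
    rw [LinearMap.ker_eq_bot]
    intro a b h
    funext i
    exact hinj (congrFun h i)
  -- The columns are extended to a basis using standard basis vectors only, so all entries of the
  -- completed matrix stay in `A`.
  set t : Set (Fin q → K) := Set.range v ∪ Set.range (Pi.basisFun K (Fin q)) with ht
  have hst : Set.range v ⊆ t := Set.subset_union_left
  have hspan : ⊤ ≤ Submodule.span K t := by
    rw [← (Pi.basisFun K (Fin q)).span_eq]
    exact Submodule.span_mono Set.subset_union_right
  let b := Module.Basis.extendLe hv.linearIndepOn_id hst hspan
  let e := b.indexEquiv (Pi.basisFun K (Fin q))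
  let b' := b.reindex e
  have hmem : ∀ c, ∃ w : Fin q → A, ∀ l, algebraMap A K (w l) = b' c l := by
    intro c
    have h1 : b' c ∈ t := by
      rw [Module.Basis.reindex_apply]
      exact Module.Basis.extendLe_subset hv.linearIndepOn_id hst hspan ⟨_, rfl⟩
    rcases h1 with ⟨u, hu⟩ | ⟨i, hi⟩
    · exact ⟨U u, fun l => by rw [← hu]⟩
    · refine ⟨Pi.single i 1, fun l => ?_⟩
      rw [← hi, Pi.basisFun_apply]
      by_cases h : l = i
      · subst h; simp
      · simp [h]
  choose w hw using hmem
  have hφ : ∀ u, ∃ c, b' c = v u := by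
    intro u
    obtain ⟨x, hx⟩ := Module.Basis.subset_extendLe hv.linearIndepOn_id hst hspan ⟨u, rfl⟩
    exact ⟨e x, by rw [Module.Basis.reindex_apply, Equiv.symm_apply_apply]; exact hx⟩
  choose φ hφ using hφ
  refine ⟨Matrix.of fun l c => w c l, φ, fun a c h => ?_, fun u l => ?_, fun h0 => ?_⟩
  · refine hv.injective ?_
    rw [← hφ, ← hφ, h]
  · refine hinj ?_
    rw [Matrix.of_apply, hw, hφ]
  · have h1 : ((Matrix.of fun l c => w c l).map (algebraMap A K)).det = 0 := by
      rw [← RingHom.mapMatrix_apply, ← RingHom.map_det, h0, map_zero]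
    have h2 : LinearIndependent K ((Matrix.of fun l c => w c l).map (algebraMap A K)).col := by
      have : ((Matrix.of fun l c => w c l).map (algebraMap A K)).col = b' := by
        funext c l
        simp [Matrix.col, hw]
      rw [this]
      exact b'.linearIndependent
    rw [Matrix.linearIndependent_cols_iff_isUnit, Matrix.isUnit_iff_isUnit_det, h1] at h2
    exact not_isUnit_zero h2

namespace Setting

variable {P : Par} {F R : Type*} [Field F] [CommRing R] (K : Setting P F R)

/-- Polynomials over the prime field as elements of `R`. -/
noncomputable def prim : (ZMod P.p)[X] →+* R :=
  K.toR.comp (mapRingHom (@ZMod.castHom P.p P.p (dvd_refl _) F _ K.char))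

theorem prim_X : K.prim X = K.z := by simp [prim, toR_X]

theorem prim_lpoly (l : List ℕ) : K.prim (lpoly l) = K.toR (lpoly l) := by
  rw [toR_lpoly, lpoly, map_list_sum, List.map_map]
  congr 1
  exact List.map_congr_left fun i _ => by simp [prim_X]

theorem evalR_scalar_exps [NeZero P.p] (ρ : ℕ → R) (a : (ZMod P.p)[X]) (v : ℕ) :
    K.evalR ρ (scalar (exps a) v) = K.prim a * ρ v := by
  rw [evalR_scalar, ← prim_lpoly, lpoly_exps]

theorem evalR_flatten (ρ : ℕ → R) {q : ℕ} (g : Fin q → RForm) :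
    K.evalR ρ (List.ofFn g).flatten = ∑ i, K.evalR ρ (g i) := by
  rw [← List.sum_ofFn]
  have : ∀ l : List RForm, K.evalR ρ l.flatten = (l.map (K.evalR ρ)).sum := by
    intro l
    induction l with
    | nil => rfl
    | cons a l ih => rw [List.flatten_cons, evalR_append, ih, List.map_cons, List.sum_cons]
  rw [this, List.map_ofFn]
  rfl

/-- A form which vanishes identically is trivial. -/
theorem clean_eq_nil [IsDomain R] {f : RForm} (h : ∀ ρ : ℕ → R, K.evalR ρ f = 0) :
    clean P f = [] := by
  have := K.infinite
  rw [List.eq_nil_iff_forall_not_mem]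
  intro m hm
  -- A surviving term would make the set of zeros in its variable finite, whereas here it is all of
  -- the infinite ring.
  have h1 := K.finite_setOf_ev_eq_zero (v := m.1) (f := (f, []))
    (List.any_eq_true.2 ⟨m, hm, by simp⟩) 0 0
  have h2 : {r | K.ev (Function.update 0 m.1 r) 0 (f, []) = 0} = Set.univ := by
    refine Set.eq_univ_of_forall fun r => ?_
    simp [ev, h]
  rw [h2] at h1
  exact Set.infinite_univ h1

theorem clean_sub_eq_nil [IsDomain R] {f g : RForm} (h : ∀ ρ : ℕ → R, K.evalR ρ f = K.evalR ρ g) :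
    clean P (f ++ neg P g) = [] :=
  K.clean_eq_nil fun ρ => by rw [evalR_append, evalR_neg, h, add_neg_cancel]

theorem sub_fst_eq (ρ : ℕ → R) (g : ℕ → RForm) (f : RForm) :
    K.evalR ρ (sub P (fun v => (g v, [])) f).1 = K.evalR (fun v => K.evalR ρ (g v)) f := by
  rw [evalR_sub_fst]

theorem mem_scalar {l : List ℕ} {v : ℕ} {m} (h : m ∈ scalar l v) : m.1 = v ∧ m.2.2 = 0 := by
  obtain ⟨i, -, rfl⟩ := List.mem_map.1 h
  exact ⟨rfl, rfl⟩

theorem getD_ofFn {β : Type*} {q : ℕ} (g : Fin q → β) {l : ℕ} (hl : l < q) (d : β) :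
    (List.ofFn g).getD l d = g ⟨l, hl⟩ := by
  simp [List.getD_eq_getElem?_getD, hl]

theorem evalR_filter_order {f : RForm} {B : ℕ} (hB : ∀ m ∈ f, m.1 < B) (s : ℕ) (ρ : ℕ → R) :
    K.evalR ρ (f.filter fun m => decide (m.2.2 = s))
      = ∑ v ∈ Finset.range B, K.prim (cf P.p f v s) * ρ v ^ P.p ^ s := by
  induction f with
  | nil => simp
  | cons m f ih =>
    have ih := ih fun m hm => hB m (List.mem_cons_of_mem _ hm)
    simp only [cf_cons, map_add, add_mul, Finset.sum_add_distrib, ← ih]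
    have h1 := hB m List.mem_cons_self
    rw [Finset.sum_eq_single m.1]
    · by_cases h : m.2.2 = s
      · simp [h, evalR_cons, prim_X]
      · simp [h]
    · intro b _ hb; simp [Ne.symm hb]
    · intro h; exact absurd (Finset.mem_range.2 h1) h

include K in
/-- A form all of whose variables have the same order and independent leading coefficients has a
certificate. -/
theorem exists_cert [IsDomain R] {f : RForm} {B s : ℕ} (hc : ∀ m ∈ f, m ∈ clean P f)
    (hB : ∀ m ∈ f, m.1 < B) (hs : ∀ v, ordV P.p f v = 0 ∨ ordV P.p f v = s + 1)
    (hind : ∀ e : ℕ → (ZMod P.p)[X], (∀ v, ordV P.p f v = 0 → e v = 0) →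
      ∑ v ∈ Finset.range B, cf P.p f v s * e v ^ P.p ^ s = 0 → ∀ v, e v = 0) :
    ∃ c : Cert, c.ok P f := by
  have hp := Fact.mk K.prime
  have hqpos := K.q_pos s
  set q := P.p ^ s with hq
  -- the variables that occur
  set W : Finset ℕ := (Finset.range B).filter fun v => ordV P.p f v ≠ 0 with hW
  have hmemW : ∀ m ∈ f, m.1 ∈ W ∧ m.2.2 ≤ s := by
    intro m hm
    have h1 := lt_ordV (cf_ne_zero_of_mem_clean (hc m hm))
    refine ⟨Finset.mem_filter.2 ⟨Finset.mem_range.2 (hB m hm), by omega⟩, ?_⟩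
    rcases hs m.1 with h | h <;> omega
  have hperf : ∀ a : ZMod P.p, ∃ b, b ^ P.p = a := fun a => ⟨a, ZMod.pow_card a⟩
  -- The prime field is perfect, so the leading coefficients already have coordinates over `F_p[z]`,
  -- independently of `F`.
  have hcoord : ∀ a : (ZMod P.p)[X], ∃ c : ℕ → (ZMod P.p)[X],
      a = ∑ l ∈ Finset.range q, X ^ l * c l ^ q := by
    intro a
    obtain ⟨c, -, hc⟩ := AddFrob.exists_coordinates (p := P.p) hperf s (m := a.natDegree + 1) (f := a)
      (by
        refine degree_le_natDegree.trans_lt ?_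
        rw [Nat.cast_lt]
        exact Nat.lt_of_lt_of_le (Nat.lt_succ_self _) (Nat.le_mul_of_pos_left _ hqpos))
    exact ⟨c, hc⟩
  choose co hco using hcoord
  let U : W → Fin q → (ZMod P.p)[X] := fun u l => co (cf P.p f u s) l
  -- A relation with coefficients `g` between the coordinate columns becomes, after `q`-th powers
  -- and recombination with `z^l`, a relation between the leading coefficients with multipliers
  -- `g^q`.
  have hUind : LinearIndependent (ZMod P.p)[X] U := by
    rw [Fintype.linearIndependent_iff]
    intro g hg
    have h1 := hind (fun v => if h : v ∈ W then g ⟨v, h⟩ else 0) (fun v hv => by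
      rw [dif_neg]; simp [hW, hv]) ?_
    · intro u
      have := h1 u
      simpa using this
    · have h2 : ∀ l < q, ∑ u : W, co (cf P.p f u s) l * g u = 0 := by
        intro l hl
        have := congrFun hg ⟨l, hl⟩
        simp only [Finset.sum_apply, Pi.smul_apply, smul_eq_mul, Pi.zero_apply] at this
        rw [← this]
        exact Finset.sum_congr rfl fun u _ => mul_comm _ _
      have h3 : ∑ v ∈ Finset.range B, cf P.p f v s * (if h : v ∈ W then g ⟨v, h⟩ else 0) ^ q
          = ∑ u : W, cf P.p f u s * g u ^ q := by
        rw [← Finset.sum_subset (Finset.filter_subset _ _ : W ⊆ Finset.range B),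
          ← Finset.sum_coe_sort W]
        · refine Finset.sum_congr rfl fun u _ => ?_
          rw [dif_pos u.2]
        · intro v _ hv
          rw [dif_neg hv, zero_pow hqpos.ne', mul_zero]
      rw [h3]
      calc ∑ u : W, cf P.p f u s * g u ^ q
          = ∑ u : W, ∑ l ∈ Finset.range q, X ^ l * (co (cf P.p f u s) l * g u) ^ q := by
            refine Finset.sum_congr rfl fun u _ => ?_
            conv_lhs => rw [hco (cf P.p f u s)]
            rw [Finset.sum_mul]
            exact Finset.sum_congr rfl fun l _ => by rw [mul_pow, mul_assoc]
        _ = ∑ l ∈ Finset.range q, X ^ l * (∑ u : W, co (cf P.p f u s) l * g u) ^ q := by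
            rw [Finset.sum_comm]
            refine Finset.sum_congr rfl fun l _ => ?_
            rw [hq, sum_pow_char_pow, Finset.mul_sum]
        _ = 0 := by
            refine Finset.sum_eq_zero fun l hl => ?_
            rw [h2 l (Finset.mem_range.1 hl), zero_pow hqpos.ne', mul_zero]
  obtain ⟨M, φ, hφ, hMφ, hdet⟩ := exists_completion hUind
  classical
  -- Columns coming from a variable `u` of `f` belong to the even variable `2 u`; a column added in
  -- the completion belongs to a completing variable, which has the odd number `2 t + 1`.
  let name : Fin q → ℕ := fun t => if h : ∃ u, φ u = t then 2 * (h.choose : ℕ) else 2 * t + 1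
  have hname : ∀ u, name (φ u) = 2 * (u : ℕ) := by
    intro u
    have h : ∃ u', φ u' = φ u := ⟨u, rfl⟩
    simp only [name, dif_pos h]
    rw [hφ h.choose_spec]
  have hname' : ∀ t, (¬ ∃ u, φ u = t) → name t = 2 * (t : ℕ) + 1 := fun t h => dif_neg h
  have hinj : Function.Injective name := by
    intro t t' h
    by_cases h1 : ∃ u, φ u = t <;> by_cases h2 : ∃ u, φ u = t'
    · obtain ⟨u, rfl⟩ := h1
      obtain ⟨u', rfl⟩ := h2
      rw [hname, hname] at h
      rw [Subtype.ext (Nat.eq_of_mul_eq_mul_left two_pos h)]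
    · obtain ⟨u, rfl⟩ := h1
      rw [hname, hname' t' h2] at h; omega
    · obtain ⟨u, rfl⟩ := h2
      rw [hname, hname' t h1] at h; omega
    · rw [hname' t h1, hname' t' h2] at h
      ext; omega
  -- The rows of `M` give the forms `U_l` of the certificate and the rows of the adjugate the forms
  -- `B`; the determinant plays the role of `Δ`. The completing form `b` recombines the added
  -- columns, with coordinates `z^l` and `q`-th powers.
  let row : Fin q → RForm := fun l => (List.ofFn fun t => scalar (exps (M l t)) (name t)).flatten
  let inv : Fin q → RForm := fun t => (List.ofFn fun l : Fin q => scalar (exps (M.adjugate t l)) l).flatten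
  let b : RForm := (List.ofFn fun t : Fin q => if ∃ u, φ u = t then [] else
    (List.ofFn fun l : Fin q => monoR P l s (scalar (exps (M l t)) t)).flatten).flatten
  let Bl : List (ℕ × RForm) := List.ofFn fun t => (name t, inv t)
  have hrow : ∀ (ρ : ℕ → R) (l : Fin q), K.evalR ρ (row l) = ∑ t, K.prim (M l t) * ρ (name t) := by
    intro ρ l
    simp only [row, evalR_flatten, evalR_scalar_exps]
  have hinv : ∀ (ρ : ℕ → R) (t : Fin q), K.evalR ρ (inv t)
      = ∑ l : Fin q, K.prim (M.adjugate t l) * ρ l := by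
    intro ρ t
    simp only [inv, evalR_flatten, evalR_scalar_exps]
  have hgetrow : ∀ l (hl : l < q), (List.ofFn row).getD l [] = row ⟨l, hl⟩ := fun l hl =>
    getD_ofFn row hl []
  have hlook : ∀ t, assoc Bl (name t) = inv t := by
    intro t
    have hfind : List.lookup (name t) Bl = some (inv t) := by
      rw [List.lookup_eq_some_iff]
      refine ⟨(List.ofFn fun t => (name t, inv t)).take t, (List.ofFn fun t => (name t, inv t)).drop (t + 1),
        ?_, ?_⟩
      · rw [← List.take_append_drop (t : ℕ) Bl]
        congr 1
        rw [List.drop_eq_getElem_cons (show (t : ℕ) < Bl.length by simp [Bl])]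
        simp [Bl]
      · intro x hx
        obtain ⟨i, hi, rfl⟩ := List.mem_take_iff_getElem.1 hx
        simp only [List.length_ofFn, lt_min_iff] at hi
        simp only [List.getElem_ofFn, bne_iff_ne, ne_eq]
        intro h
        have := congrArg Fin.val (hinj h)
        simp at this
        omega
    rw [assoc, hfind, Option.getD_some]
  refine ⟨(b, s, List.ofFn row, Bl, exps M.det), ?_⟩
  have hmemb : ∀ m ∈ b, (∃ t, (¬ ∃ u, φ u = t) ∧ m.1 = (t : ℕ)) ∧ m.2.2 = s := by
    intro m hm
    simp only [b, List.mem_flatten, List.mem_ofFn] at hm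
    obtain ⟨_, ⟨t, rfl⟩, hm⟩ := hm
    split_ifs at hm with ht
    · simp at hm
    · simp only [List.mem_flatten, List.mem_ofFn] at hm
      obtain ⟨_, ⟨l, rfl⟩, hm⟩ := hm
      obtain ⟨m', hm', rfl⟩ := List.mem_map.1 hm
      obtain ⟨h1, h2⟩ := mem_scalar hm'
      exact ⟨⟨t, ht, h1⟩, by simp [h2]⟩
  have hkey : ∀ m ∈ full f b, m.2.2 ≤ s ∧ ∃ t, name t = m.1 := by
    intro m hm
    rcases List.mem_append.1 hm with hm | hm
    · obtain ⟨m', hm', rfl⟩ := List.mem_map.1 hm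
      obtain ⟨h1, h2⟩ := hmemW m' hm'
      exact ⟨h2, φ ⟨m'.1, h1⟩, by rw [hname]; simp⟩
    · obtain ⟨m', hm', rfl⟩ := List.mem_map.1 hm
      obtain ⟨⟨t, h1, h2⟩, h3⟩ := hmemb m' hm'
      exact ⟨h3.le, t, by rw [hname' t h1, h2]⟩
  have htop : ∀ ρ : ℕ → R, K.evalR ρ ((full f b).filter fun m => decide (m.2.2 = s))
      = K.evalR ρ (topForm P s (List.ofFn row)) := by
    intro ρ
    have hfb : (full f b).filter (fun m => decide (m.2.2 = s))
        = renR 2 0 (f.filter fun m => decide (m.2.2 = s)) ++ renR 2 1 b := by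
      rw [full, List.filter_append, renR, renR, List.filter_map, renR]
      congr 1
      rw [List.filter_eq_self]
      intro m hm
      obtain ⟨m', hm', rfl⟩ := List.mem_map.1 hm
      simp [(hmemb m' hm').2]
    rw [hfb, evalR_append, evalR_renR, evalR_renR, evalR_filter_order K hB, evalR_topForm]
    have h1 : ∑ l ∈ Finset.range (P.p ^ s), K.z ^ l * K.evalR ρ ((List.ofFn row).getD l []) ^ P.p ^ s
        = ∑ t : Fin q, (∑ l : Fin q, K.z ^ (l : ℕ) * K.prim (M l t) ^ q) * ρ (name t) ^ q := by
      rw [← hq, Finset.sum_range fun l => K.z ^ l * K.evalR ρ ((List.ofFn row).getD l []) ^ q]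
      simp only [hgetrow _ (Fin.is_lt _), hrow, Finset.sum_mul]
      rw [Finset.sum_comm]
      refine Finset.sum_congr rfl fun l _ => ?_
      refine (congrArg (K.z ^ (l : ℕ) * ·) (K.sum_pow _ _ s)).trans ?_
      rw [Finset.mul_sum]
      exact Finset.sum_congr rfl fun t _ => by rw [mul_pow, mul_assoc]
    rw [h1, ← Finset.sum_filter_add_sum_filter_not Finset.univ fun t => ∃ u, φ u = t]
    congr 1
    · have h2 : (Finset.univ.filter fun t => ∃ u, φ u = t) = Finset.univ.image φ := by
        ext t; simp
      rw [h2, Finset.sum_image fun _ _ _ _ h => hφ h,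
        ← Finset.sum_subset (Finset.filter_subset _ _ : W ⊆ Finset.range B), ← Finset.sum_coe_sort W]
      · refine Finset.sum_congr rfl fun u _ => ?_
        rw [hname, add_zero]
        congr 1
        conv_lhs => rw [hco (cf P.p f u s)]
        rw [map_sum, Finset.sum_range]
        refine Finset.sum_congr rfl fun l _ => ?_
        rw [map_mul, map_pow, map_pow, prim_X, hMφ]
      · intro v hv hv'
        have h0 : ordV P.p f v = 0 := by
          by_contra h; exact hv' (Finset.mem_filter.2 ⟨hv, h⟩)
        rw [cf_eq_zero (by omega), map_zero, zero_mul]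
    · simp only [b, evalR_flatten]
      rw [Finset.sum_filter]
      refine Finset.sum_congr rfl fun t _ => ?_
      by_cases ht : ∃ u, φ u = t
      · simp [ht]
      · rw [if_neg ht, if_pos ht, evalR_flatten, Finset.sum_mul, hname' t ht]
        refine Finset.sum_congr rfl fun l _ => ?_
        rw [evalR_monoR, evalR_scalar_exps, mul_pow, mul_assoc]
  simp only [Cert.ok, Bool.and_eq_true, List.all_eq_true, decide_eq_true_eq, List.any_eq_true,
    List.mem_range]
  refine ⟨⟨⟨⟨⟨?_, fun m hm => ⟨(hkey m hm).1, ?_⟩⟩, ?_⟩, ?_⟩, ?_⟩, ?_⟩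
  · rw [← lpoly_ne_zero_iff (k := ZMod P.p), lpoly_exps]
    exact hdet
  · obtain ⟨t, ht⟩ := (hkey m hm).2
    exact ⟨(name t, inv t), List.mem_ofFn.2 ⟨t, rfl⟩, ht⟩
  · intro x hx m hm
    obtain ⟨t, rfl⟩ := List.mem_ofFn.1 hx
    simp only [inv, List.mem_flatten, List.mem_ofFn] at hm
    obtain ⟨_, ⟨l, rfl⟩, hm⟩ := hm
    exact (mem_scalar hm).2
  -- The certificate asks for formal identities; they follow from equality of all values, since a
  -- form that vanishes identically has no surviving term.
  · exact K.clean_sub_eq_nil htop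
  · intro x hx
    obtain ⟨t, rfl⟩ := List.mem_ofFn.1 hx
    refine ⟨K.clean_sub_eq_nil fun ρ => ?_, fun m hm => ?_⟩
    · rw [sub_fst_eq, hinv, evalR_scalar_exps]
      simp only [hgetrow _ (Fin.is_lt _), hrow, Finset.mul_sum]
      rw [Finset.sum_comm]
      have h1 : ∀ t', ∑ l, K.prim (M.adjugate t l) * (K.prim (M l t') * ρ (name t'))
          = K.prim ((M.adjugate * M) t t') * ρ (name t') := by
        intro t'
        rw [Matrix.mul_apply, map_sum, Finset.sum_mul]
        exact Finset.sum_congr rfl fun l _ => by rw [map_mul, mul_assoc]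
      simp only [h1, Matrix.adjugate_mul, Matrix.smul_apply, Matrix.one_apply]
      rw [Finset.sum_eq_single t]
      · simp
      · intro t' _ h; simp [Ne.symm h]
      · intro h; exact absurd (Finset.mem_univ _) h
    · simp only [inv, List.mem_flatten, List.mem_ofFn] at hm
      obtain ⟨_, ⟨l, rfl⟩, hm⟩ := hm
      rw [(mem_scalar hm).1]
      exact l.2
  · intro l hl
    refine K.clean_sub_eq_nil fun ρ => ?_
    rw [sub_fst_eq, hgetrow l hl, hrow, evalR_scalar_exps]
    simp only [hlook, hinv, Finset.mul_sum]
    rw [Finset.sum_comm]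
    have h1 : ∀ l', ∑ t, K.prim (M ⟨l, hl⟩ t) * (K.prim (M.adjugate t l') * ρ l')
        = K.prim ((M * M.adjugate) ⟨l, hl⟩ l') * ρ l' := by
      intro l'
      rw [Matrix.mul_apply, map_sum, Finset.sum_mul]
      exact Finset.sum_congr rfl fun l _ => by rw [map_mul, mul_assoc]
    simp only [h1, Matrix.mul_adjugate, Matrix.smul_apply, Matrix.one_apply]
    rw [Finset.sum_eq_single ⟨l, hl⟩]
    · simp
    · intro l' _ h; simp [Ne.symm h]
    · intro h; exact absurd (Finset.mem_univ _) h

end Setting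

end AddFrob

namespace AddFrob

open Polynomial

/-! ### Normal forms -/

section Coefficients

variable {P : Par} [hp : Fact P.p.Prime]

theorem cf_sub_eq_sum (h : ℕ → Form) {f : RForm} {B J : ℕ} (hB : ∀ m ∈ f, m.1 < B)
    (hJ : ∀ m ∈ f, m.2.2 < J) (u j : ℕ) : cf P.p (sub P h f).1 u j
      = ∑ v ∈ Finset.range B, ∑ b ∈ Finset.range J, cf P.p f v b *
          (if b ≤ j then cf P.p (h v).1 u (j - b) ^ P.p ^ b else 0) := by
  rw [cf_sub]
  exact sum_map_eq_sum_cf (RingHom.id _) (fun w b => if b ≤ j then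
    cf P.p (h w).1 u (j - b) ^ P.p ^ b else 0) hB hJ

theorem cf_map_exps (q : (ZMod P.p)[X]) (w a v j : ℕ) :
    cf P.p ((exps q).map fun i => (w, i, a)) v j = if v = w ∧ j = a then q else 0 := by
  rw [cf, List.map_map]
  by_cases h : v = w ∧ j = a
  · rw [if_pos h]
    obtain ⟨rfl, rfl⟩ := h
    conv_rhs => rw [← lpoly_exps q]
    simp [lpoly, Function.comp_def]
  · rw [if_neg h]
    refine List.sum_eq_zero fun x hx => ?_
    obtain ⟨m, -, rfl⟩ := List.mem_map.1 hx
    exact if_neg fun h' => h ⟨h'.1.symm, h'.2.symm⟩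

theorem renR_map_exps (q : (ZMod P.p)[X]) (w a b : ℕ) :
    renR 0 b ((exps q).map fun i => (w, i, a)) = (exps q).map fun i => (b, i, a) := by
  simp [renR, Function.comp_def]

theorem assoc_map_range (B w : ℕ) (g : ℕ → RForm) (hw : w < B) :
    assoc ((List.range B).map fun w => (w, g w)) w = g w := by
  have h : List.lookup w ((List.range B).map fun w => (w, g w)) = some (g w) := by
    rw [List.lookup_eq_some_iff]
    refine ⟨(List.range w).map fun w => (w, g w),
      ((List.range B).drop (w + 1)).map fun w => (w, g w), ?_, ?_⟩
    · rw [← List.map_cons (f := fun w => (w, g w)), ← List.map_append]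
      congr 1
      nth_rewrite 1 [← List.take_append_drop w (List.range B)]
      rw [List.take_range, min_eq_left hw.le,
        List.drop_eq_getElem_cons (by simpa using hw)]
      simp
    · intro x hx
      obtain ⟨i, hi, rfl⟩ := List.mem_map.1 hx
      simpa using (List.mem_range.1 hi).ne'
  rw [assoc, h, Option.getD_some]

theorem cf_map_range (v n r u j : ℕ) :
    cf P.p ((List.range n).map fun i => (Nat.pair v i, i, r)) u j
      = if u.unpair.1 = v ∧ u.unpair.2 < n ∧ j = r then X ^ u.unpair.2 else 0 := by
  induction n with
  | zero => simp
  | succ n ih =>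
    rw [List.range_succ, List.map_append, cf_append, ih, List.map_singleton, cf_cons, cf_nil,
      add_zero]
    have h0 : Nat.pair v n = u ↔ u.unpair.1 = v ∧ u.unpair.2 = n := by
      constructor
      · rintro rfl; simp
      · rintro ⟨rfl, rfl⟩; simp
    simp only [h0]
    by_cases h1 : u.unpair.1 = v
    · by_cases h2 : j = r
      · rcases lt_trichotomy u.unpair.2 n with h3 | h3 | h3
        · simp [h1, h2, h3, h3.ne, Nat.lt_succ_of_lt h3]
        · simp [h1, h2, h3]
        · simp [h1, h2, h3.ne', h3.not_gt, show ¬ u.unpair.2 < n + 1 by omega]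
      · simp [h2, Ne.symm h2]
    · simp [h1]

/-- The leading coefficients are independent. -/
def Indep (p B : ℕ) (f : RForm) : Prop := ∀ e : ℕ → (ZMod p)[X], (∀ v, ordV p f v = 0 → e v = 0) →
  ∑ v ∈ Finset.range B, cf p f v (ordV p f v - 1) * e v ^ p ^ (ordV p f v - 1) = 0 → ∀ v, e v = 0

/-- Sum of the orders. -/
noncomputable def ordSum (p B : ℕ) (f : RForm) : ℕ := ∑ v ∈ Finset.range B, ordV p f v

omit hp in
theorem ordV_eq_zero {f : RForm} {B v : ℕ} (hB : ∀ m ∈ f, m.1 < B) (hv : B ≤ v) :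
    ordV P.p f v = 0 :=
  Nat.le_zero.1 (ordV_le fun j _ => cf_eq_zero_of_forall fun m hm h => by
    have := hB m hm; omega)

omit hp in
theorem lt_of_mem_clean {f : RForm} {B : ℕ} (h : ∀ v j, B ≤ v → cf P.p f v j = 0) :
    ∀ m ∈ clean P f, m.1 < B := by
  intro m hm
  by_contra hc
  exact cf_ne_zero_of_mem_clean hm (h _ _ (not_lt.1 hc))

/-- A dependence of the leading coefficients allows to decrease the orders. -/
theorem exists_elim {f : RForm} {B : ℕ} (hB : ∀ m ∈ f, m.1 < B) (h : ¬ Indep P.p B f) (L : ℕ) :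
    ∃ v e T, nonzero P e ∧
      (∀ m ∈ clean P (sub P (elimSub L v e T) f).1, m.1 < B) ∧
      ordSum P.p B (clean P (sub P (elimSub L v e T) f).1) < ordSum P.p B f := by
  classical
  unfold Indep at h
  push Not at h
  obtain ⟨e, hsupp, hsum, v₀, hv₀⟩ := h
  have hlt : ∀ v, e v ≠ 0 → v < B := fun v hv => by
    by_contra hc
    exact hv (hsupp v (ordV_eq_zero hB (not_lt.1 hc)))
  -- Among the variables taking part in the dependence, one of maximal order is eliminated, so that
  -- the exponents `t - (ordV P.p f w - 1)` below involve no truncation for these variables.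
  obtain ⟨v₁, hv₁, hmax⟩ := Finset.exists_max_image ((Finset.range B).filter fun v => e v ≠ 0)
    (ordV P.p f) ⟨v₀, Finset.mem_filter.2 ⟨Finset.mem_range.2 (hlt _ hv₀), hv₀⟩⟩
  obtain ⟨hv₁B, hv₁⟩ := Finset.mem_filter.1 hv₁
  rw [Finset.mem_range] at hv₁B
  have hmax' : ∀ v, e v ≠ 0 → ordV P.p f v ≤ ordV P.p f v₁ := fun v hv =>
    hmax v (Finset.mem_filter.2 ⟨Finset.mem_range.2 (hlt _ hv), hv⟩)
  have hpos : ∀ v, e v ≠ 0 → ordV P.p f v ≠ 0 := fun v hv h0 => hv (hsupp v h0)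
  set t := ordV P.p f v₁ - 1 with ht
  have hp1 := hpos v₁ hv₁
  -- The other variables receive the summand `e_w y^(p^a)` in the variable `y` of `v₁`, with `a`
  -- chosen so that their leading terms contribute to `y^(p^t)`, while `y` itself is multiplied by
  -- `e_(v₁)`. The contributions in degree `p^t` then add up to the dependence relation.
  set T : List (ℕ × RForm) := (List.range B).map fun w =>
    (w, (exps (e w)).map fun i => (0, i, t - (ordV P.p f w - 1))) with hT
  obtain ⟨J, hJ, -⟩ := exists_cf_bound P.p f
  set h := elimSub L v₁ (exps (e v₁)) T with hh
  have hpow : ∀ b, P.p ^ b ≠ 0 := fun b => (Nat.pow_pos hp.out.pos).ne'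
  have hcf₁ : ∀ v < B, ∀ k, cf P.p (h v).1 v₁ k
      = if k = t - (ordV P.p f v - 1) then e v else 0 := by
    intro v hv k
    by_cases hvv : v = v₁
    · subst hvv
      simp only [hh, elimSub, decide_true, cond_true, scalar, cf_map_exps, true_and, ← ht,
        Nat.sub_self]
    · simp only [hh, elimSub, hvv, decide_false, cond_false, cf_cons, false_and, if_false, zero_add]
      rw [hT, assoc_map_range B v _ hv, renR_map_exps, cf_map_exps]
      simp
  have hcf₂ : ∀ v < B, ∀ u, u ≠ v₁ → ∀ k, cf P.p (h v).1 u k = if v = u ∧ k = 0 then 1 else 0 := by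
    intro v hv u hu k
    by_cases hvv : v = v₁
    · subst hvv
      simp only [hh, elimSub, decide_true, cond_true, scalar, cf_map_exps]
      rw [if_neg fun h => hu h.1, if_neg fun h => hu h.1.symm]
    · simp only [hh, elimSub, hvv, decide_false, cond_false, cf_cons]
      rw [hT, assoc_map_range B v _ hv, renR_map_exps, cf_map_exps, if_neg (fun h : u = v₁ ∧ _ => hu h.1), add_zero,
        pow_zero]
      simp only [eq_comm]
  have hother : ∀ u, u ≠ v₁ → ∀ j, cf P.p (clean P (sub P h f).1) u j = cf P.p f u j := by
    intro u hu j
    rw [cf_clean, cf_sub_eq_sum h hB hJ]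
    have h1 : ∀ v ∈ Finset.range B, ∀ b ∈ Finset.range J, cf P.p f v b *
          (if b ≤ j then cf P.p (h v).1 u (j - b) ^ P.p ^ b else 0)
        = if v = u ∧ b = j then cf P.p f u j else 0 := by
      intro v hv b _
      rw [hcf₂ v (Finset.mem_range.1 hv) u hu]
      by_cases h2 : v = u ∧ b = j
      · obtain ⟨rfl, rfl⟩ := h2
        simp
      · rw [if_neg h2]
        split_ifs with h3 h4
        · exact absurd ⟨h4.1, by omega⟩ h2
        · rw [zero_pow (hpow _), mul_zero]
        · rw [mul_zero]
    rw [Finset.sum_congr rfl fun v hv => Finset.sum_congr rfl (h1 v hv)]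
    by_cases huB : u < B
    · by_cases hjJ : j < J
      · rw [Finset.sum_eq_single u (fun v _ hv => by simp [hv]) (fun h => absurd (Finset.mem_range.2 huB) h),
          Finset.sum_eq_single j (fun v _ hv => by simp [hv]) (fun h => absurd (Finset.mem_range.2 hjJ) h)]
        simp
      · rw [cf_eq_zero_of_forall fun m hm h => by have := hJ m hm; omega]
        simp
    · rw [cf_eq_zero_of_forall fun m hm h => by have := hB m hm; omega]
      simp
  have hself : ∀ j, t ≤ j → cf P.p (clean P (sub P h f).1) v₁ j = 0 := by
    intro j hj
    rw [cf_clean, cf_sub_eq_sum h hB hJ]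
    -- In degree `p^t` only the leading term of each variable contributes, and it gives its summand
    -- of the dependence relation; in higher degrees there is no contribution. The order in `v₁`
    -- therefore drops, and no other order changes.
    have h1 : ∀ v ∈ Finset.range B, ∑ b ∈ Finset.range J, cf P.p f v b *
          (if b ≤ j then cf P.p (h v).1 v₁ (j - b) ^ P.p ^ b else 0)
        = if j = t then cf P.p f v (ordV P.p f v - 1) * e v ^ P.p ^ (ordV P.p f v - 1) else 0 := by
      intro v hv
      by_cases hev : e v = 0
      · rw [hev, zero_pow (hpow _), mul_zero, ite_self]
        refine Finset.sum_eq_zero fun b _ => ?_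
        rw [hcf₁ v (Finset.mem_range.1 hv), hev, ite_self, zero_pow (hpow _), ite_self, mul_zero]
      have h5 := hpos v hev
      have h6 := hmax' v hev
      have h7 : ordV P.p f v - 1 < J := by
        by_contra hc
        refine cf_ordV_ne_zero (p := P.p) (f := f) (v := v) (s := ordV P.p f v - 1) (by omega)
          (cf_eq_zero_of_forall fun m hm h => ?_)
        have := hJ m hm
        omega
      rw [Finset.sum_eq_single (ordV P.p f v - 1)]
      · rw [hcf₁ v (Finset.mem_range.1 hv), if_pos (by omega)]
        by_cases hjt : j = t
        · rw [if_pos (by omega), if_pos hjt]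
        · rw [if_neg (by omega), if_neg hjt, zero_pow (hpow _), mul_zero]
      · intro b _ hb
        rw [hcf₁ v (Finset.mem_range.1 hv)]
        by_cases h8 : ordV P.p f v ≤ b
        · rw [cf_eq_zero h8, zero_mul]
        · split_ifs with h9 h10
          · omega
          · rw [zero_pow (hpow _), mul_zero]
          · rw [mul_zero]
      · intro h; exact absurd (Finset.mem_range.2 h7) h
    rw [Finset.sum_congr rfl h1]
    by_cases hjt : j = t
    · simp only [hjt, if_true]
      exact hsum
    · simp [hjt]
  refine ⟨v₁, exps (e v₁), T, ?_, ?_, ?_⟩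
  · rw [← lpoly_ne_zero_iff (k := ZMod P.p), lpoly_exps]
    exact hv₁
  · refine lt_of_mem_clean fun v j hv => ?_
    rw [← cf_clean, hother v (by omega)]
    exact cf_eq_zero_of_forall fun m hm h => by have := hB m hm; omega
  · refine Finset.sum_lt_sum (fun v _ => ?_) ⟨v₁, Finset.mem_range.2 hv₁B, ?_⟩
    · by_cases hv : v = v₁
      · subst hv
        exact (ordV_le hself).trans (Nat.sub_le _ _)
      · exact (ordV_congr (hother v hv)).le
    · exact (ordV_le hself).trans_lt (by omega)

end Coefficients

namespace Setting

variable {P : Par} {F R : Type*} [Field F] [CommRing R] (K : Setting P F R)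

include K in
/-- If the leading coefficients are independent, a suitable expansion has a certificate. -/
theorem exists_expand [IsDomain R] {f : RForm} {B : ℕ} (hB : ∀ m ∈ f, m.1 < B)
    (h : Indep P.p B f) : ∃ r c, Cert.ok P (clean P (sub P (expandSub P r) f).1) c := by
  classical
  have hp := Fact.mk K.prime
  obtain ⟨J, hJ, -⟩ := exists_cf_bound P.p f
  set s := (Finset.range B).sup (ordV P.p f) - 1 with hs
  have hle : ∀ v, ordV P.p f v ≤ s + 1 := by
    intro v
    by_cases hv : v < B
    · have := Finset.le_sup (f := ordV P.p f) (Finset.mem_range.2 hv)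
      omega
    · rw [ordV_eq_zero hB (not_lt.1 hv)]; omega
  -- Expanding a variable over `p^r`-th powers raises its order by `r`, so this choice gives all
  -- occurring variables the common order `s + 1`, that is, the top exponent `p^s`.
  let r : ℕ → ℕ := fun v => s + 1 - ordV P.p f v
  have hpow : ∀ b, P.p ^ b ≠ 0 := fun b => (Nat.pow_pos hp.out.pos).ne'
  have hcfh : ∀ v < B, ∀ u k, cf P.p (expandSub P ((List.range B).map r) v).1 u k
      = if u.unpair.1 = v ∧ u.unpair.2 < P.p ^ r v ∧ k = r v then X ^ u.unpair.2 else 0 := by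
    intro v hv u k
    have : ((List.range B).map r).getD v 0 = r v := by
      simp [List.getD_eq_getElem?_getD, hv]
    rw [expandSub, this, cf_map_range]
  set f' := clean P (sub P (expandSub P ((List.range B).map r)) f).1 with hf'
  have hcf : ∀ u j, cf P.p f' u j =
      if u.unpair.1 < B ∧ u.unpair.2 < P.p ^ r u.unpair.1 ∧ r u.unpair.1 ≤ j then
        cf P.p f u.unpair.1 (j - r u.unpair.1) * (X ^ u.unpair.2) ^ P.p ^ (j - r u.unpair.1)
      else 0 := by
    intro u j
    rw [hf', cf_clean, cf_sub_eq_sum _ hB hJ]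
    have h1 : ∀ v ∈ Finset.range B, ∀ b ∈ Finset.range J, cf P.p f v b *
          (if b ≤ j then cf P.p (expandSub P ((List.range B).map r) v).1 u (j - b) ^ P.p ^ b else 0)
        = if v = u.unpair.1 ∧ b = j - r u.unpair.1 then
            (if u.unpair.1 < B ∧ u.unpair.2 < P.p ^ r u.unpair.1 ∧ r u.unpair.1 ≤ j then
              cf P.p f u.unpair.1 (j - r u.unpair.1) * (X ^ u.unpair.2) ^ P.p ^ (j - r u.unpair.1)
            else 0) else 0 := by
      intro v hv b _
      rw [Finset.mem_range] at hv
      rw [hcfh v hv]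
      by_cases h2 : v = u.unpair.1
      · subst h2
        by_cases h3 : b ≤ j ∧ u.unpair.2 < P.p ^ r u.unpair.1 ∧ j - b = r u.unpair.1
        · have h4 : b = j - r u.unpair.1 := by omega
          rw [if_pos h3.1, if_pos ⟨rfl, h3.2⟩, if_pos ⟨rfl, h4⟩, if_pos ⟨hv, h3.2.1, by omega⟩, h4]
        · have h4 : (if b ≤ j then (if u.unpair.1 = u.unpair.1 ∧ u.unpair.2 < P.p ^ r u.unpair.1 ∧
              j - b = r u.unpair.1 then (X : (ZMod P.p)[X]) ^ u.unpair.2 else 0) ^ P.p ^ b else 0)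
              = 0 := by
            split_ifs with h5 h6
            · exact absurd ⟨h5, h6.2⟩ h3
            · exact zero_pow (hpow _)
            · rfl
          rw [h4, mul_zero]
          split_ifs with h5 h6
          · exact absurd ⟨by omega, h6.2.1, by omega⟩ h3
          · rfl
          · rfl
      · rw [if_neg (fun h : u.unpair.1 = v ∧ _ => h2 h.1.symm), if_neg (fun h : v = _ ∧ _ => h2 h.1),
          zero_pow (hpow _), ite_self, mul_zero]
    rw [Finset.sum_congr rfl fun v hv => Finset.sum_congr rfl (h1 v hv)]
    by_cases huB : u.unpair.1 < B
    · by_cases hjJ : j - r u.unpair.1 < J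
      · rw [Finset.sum_eq_single u.unpair.1 (fun v _ hv => by simp [hv])
            (fun h => absurd (Finset.mem_range.2 huB) h),
          Finset.sum_eq_single (j - r u.unpair.1) (fun v _ hv => by simp [hv])
            (fun h => absurd (Finset.mem_range.2 hjJ) h)]
        simp
      · rw [cf_eq_zero_of_forall (j := j - r u.unpair.1) fun m hm h => by have := hJ m hm; omega]
        simp
    · simp [huB]
  have hord : ∀ u, ordV P.p f' u =
      if u.unpair.1 < B ∧ u.unpair.2 < P.p ^ r u.unpair.1 ∧ ordV P.p f u.unpair.1 ≠ 0 then s + 1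
      else 0 := by
    intro u
    have h5 := hle u.unpair.1
    split_ifs with h1
    · refine le_antisymm (ordV_le fun j hj => ?_) (lt_ordV (j := s) ?_)
      · rw [hcf, cf_eq_zero (j := j - r u.unpair.1) (by simp only [r]; omega), zero_mul, ite_self]
      · rw [hcf, if_pos ⟨h1.1, h1.2.1, by simp only [r]; omega⟩]
        exact mul_ne_zero (cf_ordV_ne_zero (by simp only [r]; omega))
          (pow_ne_zero _ (pow_ne_zero _ X_ne_zero))
    · refine Nat.le_zero.1 (ordV_le fun j _ => ?_)
      rw [hcf]
      split_ifs with h2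
      · rw [cf_eq_zero (j := j - r u.unpair.1), zero_mul]
        have : ordV P.p f u.unpair.1 = 0 := by
          by_contra h3
          exact h1 ⟨h2.1, h2.2.1, h3⟩
        omega
      · rfl
  set B' := Nat.pair B (P.p ^ (s + 1)) with hB'
  have hlt : ∀ v < B, ∀ i < P.p ^ r v, Nat.pair v i < B' := by
    intro v hv i hi
    have h1 : i < P.p ^ (s + 1) :=
      hi.trans_le (Nat.pow_le_pow_right hp.out.pos (Nat.sub_le _ _))
    exact (Nat.pair_lt_pair_left i hv).trans (Nat.pair_lt_pair_right B h1)
  suffices hex : ∃ c, Cert.ok P f' c from ⟨_, hex⟩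
  refine K.exists_cert (f := f') (B := B') (s := s)
    (fun m hm => mem_clean_clean hm) (fun m hm => ?_) (fun v => ?_) fun e he hsum => ?_
  · have h1 := cf_ne_zero_of_mem_clean (mem_clean_clean hm)
    rw [← hf', hcf] at h1
    have h2 := (ite_ne_right_iff.1 h1).1
    have h3 := hlt _ h2.1 _ h2.2.1
    rwa [Nat.pair_unpair] at h3
  · rw [hord]; split_ifs <;> simp
  -- The multipliers of the expanded variables are the coordinates of multipliers `E v` for the
  -- original ones: after the respective powers, the relation between expanded leading coefficients
  -- is the original relation in `E`.
  · let E : ℕ → (ZMod P.p)[X] := fun v => if ordV P.p f v = 0 then 0 else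
      ∑ i ∈ Finset.range (P.p ^ r v), X ^ i * e (Nat.pair v i) ^ P.p ^ r v
    have hE : ∀ v, E v = 0 := by
      refine h E (fun v hv => if_pos hv) ?_
      rw [← hsum]
      have h1 : ∑ u ∈ Finset.range B', cf P.p f' u s * e u ^ P.p ^ s
          = ∑ x ∈ (Finset.range B).sigma fun v => Finset.range (P.p ^ r v),
              cf P.p f' (Nat.pair x.1 x.2) s * e (Nat.pair x.1 x.2) ^ P.p ^ s := by
        symm
        refine Finset.sum_of_injOn (fun x => Nat.pair x.1 x.2) ?_ ?_ ?_ fun x _ => rfl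
        · rintro ⟨v, i⟩ _ ⟨v', i'⟩ _ hx
          obtain ⟨rfl, rfl⟩ := Nat.pair_eq_pair.1 hx
          rfl
        · rintro ⟨v, i⟩ hx
          simp only [Finset.coe_sigma, Set.mem_sigma_iff, Finset.mem_coe, Finset.mem_range] at hx ⊢
          exact hlt v hx.1 i hx.2
        · intro u _ hu
          rw [hcf, if_neg, zero_mul]
          rintro ⟨h1, h2, -⟩
          exact hu ⟨⟨u.unpair.1, u.unpair.2⟩, by simp [h1, h2], by simp⟩
      rw [h1, Finset.sum_sigma]
      refine Finset.sum_congr rfl fun v hv => ?_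
      rw [Finset.mem_range] at hv
      by_cases h0 : ordV P.p f v = 0
      · rw [cf_eq_zero (by omega), zero_mul]
        refine (Finset.sum_eq_zero fun i _ => ?_).symm
        rw [cf_eq_zero (f := f'), zero_mul]
        rw [hord, if_neg]
        · exact Nat.zero_le _
        · simp [h0]
      · have h5 := hle v
        have h6 : s - r v = ordV P.p f v - 1 := by simp only [r]; omega
        have h7 : s = r v + (ordV P.p f v - 1) := by simp only [r]; omega
        simp only [E, if_neg h0]
        rw [sum_pow_char_pow, Finset.mul_sum]
        refine Finset.sum_congr rfl fun i hi => ?_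
        rw [hcf]
        simp only [Nat.unpair_pair]
        rw [if_pos ⟨hv, Finset.mem_range.1 hi, by omega⟩, h6, mul_pow, mul_assoc]
        congr 2
        rw [← pow_mul, ← pow_add, ← h7]
    intro u
    by_cases hu : ordV P.p f' u = 0
    · exact he u hu
    · rw [hord] at hu
      obtain ⟨h1, h2, h3⟩ := (ite_ne_right_iff.1 hu).1
      have h4 := hE u.unpair.1
      simp only [E, if_neg h3] at h4
      -- Independence gives `E v = 0`, and uniqueness of coordinates gives the vanishing of each
      -- `e`.
      have h5 := AddFrob.coordinates_unique (p := P.p) (g := fun i => e (Nat.pair u.unpair.1 i))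
        (h := fun _ => 0) (n := r u.unpair.1) (by
          rw [h4]
          exact (Finset.sum_eq_zero fun i _ => by rw [zero_pow (hpow _), mul_zero]).symm) h2
      simpa using h5

end Setting

end AddFrob

namespace AddFrob

/-! ### Existence of complements -/

set_option synthInstance.maxSize 1000
set_option synthInstance.maxHeartbeats 200000

namespace Clause

/-- The number of inequalities that involve variables over the ring. -/
def inum (C : Clause) : ℕ := (C.2.2.1.filter fun f => !f.1.isEmpty).length

variable {P : Par}

/-- Properties of clauses preserved by substitutions. -/
structure Le (C' C : Clause) : Prop where
  length : C'.2.1.length = C.2.1.length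
  inum : C'.inum ≤ C.inum
  fst : C.1.1 = [] → C'.1.1 = []

theorem Le.trans {C C' C'' : Clause} (h : C''.Le C') (h' : C'.Le C) : C''.Le C :=
  ⟨h.1.trans h'.1, h.2.trans h'.2, fun e => h.3 (h'.3 e)⟩

theorem subForm_fst_eq_nil (h : ℕ → Form) {f : Form}
    (hf : ∀ m ∈ f.1, (h m.1).1 = []) : (cleanF P (subForm P h f)).1 = [] := by
  have : (sub P h f.1).1 = [] := by
    simp only [sub, List.flatMap_eq_nil_iff]
    intro m hm
    simp [monoR, hf m hm]
  simp [cleanF, subForm, this, clean]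

theorem subst_le (h : ℕ → Form) (C : Clause) : (C.subst P h).Le C := by
  refine ⟨by simp [subst], ?_, fun e => subForm_fst_eq_nil h (by simp [e])⟩
  simp only [inum, subst]
  rw [List.filter_map, List.length_map, ← List.countP_eq_length_filter,
    ← List.countP_eq_length_filter]
  refine List.countP_mono_left fun f _ hf => ?_
  simp only [Function.comp_apply, Bool.not_eq_true', List.isEmpty_eq_false_iff] at hf ⊢
  exact fun e => hf (subForm_fst_eq_nil h (by simp [e]))

/-- The inequalities have no redundant terms. -/
def Cleaned (P : Par) (C : Clause) : Prop := ∀ f ∈ C.2.2.1, ∀ m ∈ f.1, m ∈ clean P f.1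

theorem cleaned_subst (h : ℕ → Form) (C : Clause) : (C.subst P h).Cleaned P := by
  intro f hf m hm
  obtain ⟨f', -, rfl⟩ := List.mem_map.1 hf
  exact mem_clean_clean hm

theorem run_cons (C : Clause) (q : Step) (l : List Step) :
    C.run P (q :: l) = (C.step P q).run P l := rfl

theorem run_append (C : Clause) (l l' : List Step) :
    C.run P (l ++ l') = (C.run P l).run P l' := List.foldl_append ..

theorem inum_absorb (C : Clause) : (C.absorb P).inum = C.inum := by
  simp [inum, absorb, List.filter_filter]

theorem run_drop (l : List ℕ) (c : Cert) {C : Clause}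
    (h : ∀ v ∈ l, ∀ f ∈ C.1 :: C.2.1, occurs P v f = false) :
    C.run P (l.map fun v => (3, v, [], [], c))
      = (C.1, C.2.1, C.2.2.1.filter fun f => l.all fun v => !occurs P v f, C.2.2.2) := by
  induction l generalizing C with
  | nil => simp [run]
  | cons v l ih =>
    have h1 : C.step P (3, v, [], [], c) = C.drop P v := by
      have h2 : (C.1 :: C.2.1).any (occurs P v) = false := by
        rw [List.any_eq_false]
        exact fun f hf => by simp [h v List.mem_cons_self f hf]
      simp [step, h2]
    rw [List.map_cons, run_cons, h1, ih]
    · simp only [drop, List.filter_filter, List.all_cons]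
      congr 4
      funext f
      exact Bool.and_comm _ _
    · exact fun w hw => h w (List.mem_cons_of_mem _ hw)

end Clause

namespace Setting

open Clause

variable {P : Par} {F R : Type*} [Field F] [CommRing R] (K : Setting P F R) [IsDomain R]

include K

/-- A form of a clause can be given a certificate. -/
theorem exists_normal {g : Clause → Form}
    (hg : ∀ h C, g (C.subst P h) = cleanF P (subForm P h (g C))) (C : Clause) :
    ∃ l c, Cert.ok P (g (C.run P l)).1 c ∧ (C.run P l).Le C ∧ (C.run P l).Cleaned P := by
  have hp := Fact.mk K.prime
  obtain ⟨B, hB⟩ : ∃ B, ∀ m ∈ (g C).1, m.1 < B :=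
    ⟨((g C).1.map fun m => m.1 + 1).sum, fun m hm => List.single_le_sum (by simp) _
      (List.mem_map_of_mem (f := fun m : ℕ × ℕ × ℕ => m.1 + 1) hm)⟩
  -- The function `g` selects the form to be normalised, either the value of the clause or its first
  -- equation; the hypothesis says that it commutes with substitutions. Each elimination lowers the
  -- sum of the orders and preserves the bound `B`, and once the leading coefficients are
  -- independent a single expansion gives the certificate.
  induction hn : ordSum P.p B (g C).1 using Nat.strong_induction_on generalizing C with
  | _ n ih =>
    by_cases hI : Indep P.p B (g C).1
    · obtain ⟨r, c, hc⟩ := K.exists_expand hB hI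
      have h1 : C.run P [(1, 0, r, [], c)] = C.subst P (expandSub P r) := by simp [run, step]
      refine ⟨[(1, 0, r, [], c)], c, ?_, h1 ▸ subst_le _ _, h1 ▸ cleaned_subst _ _⟩
      rw [h1, hg]
      exact hc
    · obtain ⟨v, e, T, he, hlt, hs⟩ := exists_elim hB hI C.bd
      have h1 : C.step P (0, v, e, T, ([], 0, [], [], [])) = C.subst P (elimSub C.bd v e T) := by
        simp [step, he]
      have h2 : g (C.step P (0, v, e, T, ([], 0, [], [], [])))
          = cleanF P (subForm P (elimSub C.bd v e T) (g C)) := by rw [h1, hg]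
      obtain ⟨l, c, h3, h4, h5⟩ := ih _ (hn ▸ hs) (C.step P (0, v, e, T, ([], 0, [], [], [])))
        (by rw [h2]; exact hlt) (by rw [h2]; rfl)
      exact ⟨_ :: l, c, h3, h4.trans (h1 ▸ subst_le _ _), h5⟩

/-- The equations can be removed. -/
theorem exists_run_equations (C : Clause) :
    ∃ l, (C.run P l).2.1 = [] ∧ (C.run P l).inum ≤ C.inum ∧ (C.1.1 = [] → (C.run P l).1.1 = []) := by
  induction hn : C.2.1.length using Nat.strong_induction_on generalizing C with
  | _ n ih =>
    by_cases h0 : C.2.1 = []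
    · exact ⟨[], h0, le_rfl, id⟩
    obtain ⟨l, c, hc, hle, -⟩ := K.exists_normal (g := fun C => C.2.1.headD ([], []))
      (fun h C => by
        obtain ⟨Λ, E, I⟩ := C
        cases E with
        | nil => rfl
        | cons f E => rfl) C
    set C₁ := C.run P l with hC₁
    have hE : C₁.2.1 ≠ [] := by
      intro h
      have := hle.length
      rw [h] at this
      exact h0 (List.length_eq_zero_iff.1 this.symm)
    obtain ⟨f, E, hfE⟩ := List.exists_cons_of_ne_nil hE
    have hf : C₁.2.1.headD ([], []) = f := by rw [hfE]; rfl
    simp only [hf] at hc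
    set h := solveSub P C₁.bd (c.bound f.1 (wtF f.2)) c with hh
    have h1 : C₁.step P (2, 0, [], [], c) = C₁.subst P h := by
      have hE' : C₁.2.1.isEmpty = false := by simpa using hE
      simp only [step, hf, hc, hE', hh, Bool.not_false, Bool.and_true, cond_true]
      rfl
    -- All ring variables of the solved equation occur in the certificate and are replaced by
    -- constants, so `absorb` moves this equation into the formula about `F`.
    have h2 : (cleanF P (subForm P h f)).1 = [] := by
      refine subForm_fst_eq_nil h fun m hm => ?_
      obtain ⟨x, hx, hxm⟩ := (K.certified_of_ok hc).mem (2 * m.1 + 0, m.2)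
        (List.mem_append_left _ (List.mem_map.2 ⟨m, hm, rfl⟩))
      have : c.2.2.2.1.any (fun x => decide (x.1 = 2 * m.1)) = true :=
        List.any_eq_true.2 ⟨x, hx, decide_eq_true hxm⟩
      simp [hh, solveSub, this]
    set C₂ := (C₁.subst P h).absorb P with hC₂
    have h3 : C₂.2.1.length < n := by
      have h4 : C₂.2.1 = (E.map fun f => cleanF P (subForm P h f)).filter fun f => !f.1.isEmpty := by
        simp [hC₂, absorb, subst, hfE, h2]
      rw [h4]
      refine (List.length_filter_le _ _).trans_lt ?_
      rw [List.length_map, ← hn, ← hle.length, hfE]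
      exact Nat.lt_succ_self _
    obtain ⟨l', h4, h5, h6⟩ := ih _ h3 C₂ rfl
    have h7 : C.run P (l ++ (2, 0, [], [], c) :: (4, 0, [], [], c) :: l') = C₂.run P l' := by
      rw [run_append, run_cons, run_cons, ← hC₁, h1]
      congr 1
    have h8 := (subst_le (P := P) h C₁).trans hle
    refine ⟨_, h7 ▸ h4, h7 ▸ (h5.trans ?_), h7 ▸ fun e => h6 (h8.fst e)⟩
    rw [hC₂, inum_absorb]
    exact h8.inum

/-- A clause without equations can be transformed into one that has a certificate. -/
theorem exists_run_good {C : Clause} (hE : C.2.1 = []) :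
    ∃ l c, (C.run P l).good P c ∧ (C.run P l).inum ≤ C.inum ∧
      (∀ f ∈ (C.run P l).2.2.1, f.1 ≠ []) ∧ (C.1.1 = [] → (C.run P l).2.2.1 = []) := by
  obtain ⟨l, c, hc, hle, hcl⟩ := K.exists_normal (g := fun C => C.1) (fun h C => rfl) C
  set C₁ := C.run P l with hC₁
  have hE₁ : C₁.2.1 = [] := List.length_eq_zero_iff.1 (by rw [hle.length, hE]; rfl)
  -- These variables occur in inequalities but not in the value of the clause, and there are no
  -- equations; dropping them removes every inequality whose variables are not all controlled by the
  -- certificate.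
  set L := (C₁.2.2.1.flatMap fun f => f.1.map fun m => m.1).filter
    fun v => !occurs P v C₁.1 with hL
  have h1 := run_drop (P := P) L c (C := C₁) (by
    intro v hv f hf
    rw [hE₁, List.mem_singleton] at hf
    subst hf
    simpa using (List.mem_filter.1 hv).2)
  have h2 : C.run P (l ++ (L.map (fun v => (3, v, [], [], c)) ++ [(4, 0, [], [], c)]))
      = Clause.absorb P (C₁.1, C₁.2.1, C₁.2.2.1.filter fun f => L.all fun v => !occurs P v f,
        C₁.2.2.2) := by
    rw [run_append, run_append, ← hC₁, h1]
    rfl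
  have hI : ∀ f ∈ (C₁.2.2.1.filter fun f => L.all fun v => !occurs P v f).filter
      fun f => !f.1.isEmpty, f.1 ≠ [] ∧ ∀ m ∈ f.1, ∃ m' ∈ C₁.1.1, m'.1 = m.1 := by
    intro f hf
    obtain ⟨hf, hf'⟩ := List.mem_filter.1 hf
    obtain ⟨hf, hf2⟩ := List.mem_filter.1 hf
    refine ⟨by simpa using hf', fun m hm => ?_⟩
    have h3 : occurs P m.1 C₁.1 = true := by
      by_contra h4
      have h5 : m.1 ∈ L := List.mem_filter.2 ⟨List.mem_flatMap.2 ⟨f, hf, List.mem_map_of_mem hm⟩,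
        by simpa using h4⟩
      have h6 := List.all_eq_true.1 hf2 _ h5
      rw [Bool.not_eq_true', occurs, List.any_eq_false] at h6
      -- The inequalities were cleaned by the last substitution, so a listed term really makes its
      -- variable occur.
      exact h6 m (hcl f hf m hm) (by simp)
    obtain ⟨m', hm', h4⟩ := List.any_eq_true.1 h3
    exact ⟨m', mem_clean hm', of_decide_eq_true h4⟩
  refine ⟨l ++ (L.map (fun v => (3, v, [], [], c)) ++ [(4, 0, [], [], c)]), c, ?_, ?_, ?_,
    fun e => ?_⟩
  · rw [h2]
    simp only [good, absorb, hE₁, Bool.and_eq_true, List.all_eq_true, List.any_eq_true,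
      decide_eq_true_eq, List.filter_nil, List.isEmpty_nil, true_and]
    refine ⟨hc, fun f hf m hm => ?_⟩
    obtain ⟨m', hm', h3⟩ := (hI f hf).2 m hm
    obtain ⟨x, hx, hxm⟩ := (K.certified_of_ok hc).mem (2 * m'.1 + 0, m'.2)
      (List.mem_append_left _ (List.mem_map.2 ⟨m', hm', rfl⟩))
    exact ⟨x, hx, by rw [hxm, ← h3, add_zero]⟩
  · rw [h2, inum_absorb]
    refine le_trans ?_ hle.inum
    exact (List.Sublist.filter _ List.filter_sublist).length_le
  · rw [h2]
    exact fun f hf => (hI f hf).1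
  · rw [h2]
    refine List.eq_nil_iff_forall_not_mem.2 fun f hf => ?_
    obtain ⟨h3, h4⟩ := hI f hf
    obtain ⟨m, hm⟩ := List.exists_mem_of_ne_nil _ h3
    obtain ⟨m', hm', -⟩ := h4 m hm
    rw [hle.fst e] at hm'
    exact List.not_mem_nil hm'

omit K [IsDomain R] [Field F] [CommRing R] in
theorem exists_compEnum_of_forall {d : Data} (h : ∀ C ∈ d, ∃ t, (compEnum P t).1 = [C]) :
    ∃ t, (compEnum P t).1 = d := by
  induction d with
  | nil => exact ⟨0, by rw [compEnum, treeEval]⟩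
  | cons C d ih =>
    obtain ⟨t, ht⟩ := h C List.mem_cons_self
    obtain ⟨t', ht'⟩ := ih fun C hC => h C (List.mem_cons_of_mem _ hC)
    obtain ⟨n, hn⟩ := exists_treeEval_node ([], [univC]) (compRule P)
      (0, C, [], ([], 0, [], [], [])) t t'
    refine ⟨n, ?_⟩
    rw [compEnum, hn]
    simp only [compRule, decide_true, cond_true]
    rw [← compEnum, ht, ht']
    rfl

/-- Every clause occurs in the enumeration of complements. -/
theorem exists_compEnum_singleton (C : Clause) : ∃ t, (compEnum P t).1 = [C] := by
  induction hn : C.inum using Nat.strong_induction_on generalizing C with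
  | _ n ih =>
    obtain ⟨l, h1, h2, -⟩ := K.exists_run_equations C
    obtain ⟨l', c, h3, h4, h5, -⟩ := K.exists_run_good h1
    rw [← run_append] at h3 h4 h5
    set C' := C.run P (l ++ l') with hC'
    obtain ⟨t, ht⟩ := exists_compEnum_of_forall (P := P) (d := C'.parts P c) fun D hD => by
      obtain ⟨f, hf, rfl⟩ := List.mem_map.1 hD
      refine ih _ ?_ _ rfl
      -- The new inequality in constants is not counted, and at least the inequality `f` has been
      -- removed.
      have h6 : (C'.restrict P c f).inum < C'.2.2.1.length := by
        simp only [inum, restrict, List.isEmpty_nil, Bool.not_true, List.filter_cons,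
          Bool.false_eq_true, if_false]
        refine (List.length_filter_le _ _).trans_lt ?_
        refine List.length_filter_lt_length_iff_exists.2 ⟨f, hf, by simp⟩
      have h7 : C'.inum = C'.2.2.1.length := by
        rw [inum, List.filter_eq_self.2]
        intro g hg
        simpa using h5 g hg
      omega
    -- From the complements of the parts one obtains the complement of the transformed clause, and
    -- then that of the original clause, which describes the same set.
    obtain ⟨t', ht'⟩ := exists_treeEval_node ([], [univC]) (compRule P) (2, C', [], c) t 0
    rw [← compEnum] at ht'
    have h8 : (compEnum P t').1 = [C'] := by
      rw [ht']
      simp [compRule, partsRule, h3, ht, sameData_iff.2]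
    obtain ⟨t'', ht''⟩ := exists_treeEval_node ([], [univC]) (compRule P) (1, C, l ++ l', c) t' 0
    rw [← compEnum] at ht''
    refine ⟨t'', ?_⟩
    rw [ht'']
    simp [compRule, runRule, h8, ← hC', sameData_iff.2]

theorem exists_compEnum (d : Data) : ∃ t, (compEnum P t).1 = d :=
  exists_compEnum_of_forall fun C _ => K.exists_compEnum_singleton C

end Setting

end AddFrob

namespace AddFrob

/-! ### Existence of definitions -/

set_option synthInstance.maxSize 1000
set_option synthInstance.maxHeartbeats 200000

namespace Setting

variable {P : Par} {F R : Type*} [Field F] [CommRing R] (K : Setting P F R) [IsDomain R]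

include K

/-- Every union of clauses occurs in the enumeration of complements, so the sign of an entry can
always be changed. -/
theorem exists_defEnum_not {s : Bool} {e m k n : ℕ}
    (h : ∃ t d, defEnum P t = (s, e, m, k, n, d)) (s' : Bool) :
    ∃ t d, defEnum P t = (s', e, m, k, n, d) := by
  by_cases hs : s = s'
  · exact hs ▸ h
  obtain ⟨t, d, h⟩ := h
  obtain ⟨t', ht'⟩ := K.exists_compEnum d
  obtain ⟨t'', ht''⟩ := exists_treeEval_node (true, 0, 0, 0, falsumC, []) (defRule P)
    (0, t', 0, 0, 0) t 0
  refine ⟨t'', (compEnum P t').2, ?_⟩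
  rw [← defEnum] at ht''
  rw [ht'', h]
  simp only [defRule, decide_true, cond_true, negRule, ht', sameData_iff.2]
  cases s <;> cases s' <;> simp_all

/-- Every number of a formula occurs in the enumeration of definable sets. -/
theorem exists_defEnum (m n : ℕ) (k : ℕ) : ∃ e₀, ∀ e, e₀ ≤ e → ∀ s,
    ∃ t d, defEnum P t = (s, e, m, k, n, d) := by
  -- The rules follow the arithmetic structure of `n`, whether or not it codes a formula. The claim
  -- is made for all large `e`, because the two sides of an implication must be packed with the same
  -- number of coordinates.
  induction n using Nat.strong_induction_on generalizing k with
  | _ n ih =>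
    by_cases h3 : n.unpair.1 = 3
    · have hn : n = impC n.unpair.2.unpair.1 n.unpair.2.unpair.2 := by
        rw [impC, Nat.pair_unpair, ← h3, Nat.pair_unpair]
      have hlt : n.unpair.2 < n := by
        have := Nat.add_le_pair n.unpair.1 n.unpair.2
        rw [Nat.pair_unpair] at this
        omega
      obtain ⟨e₁, h1⟩ := ih n.unpair.2.unpair.1 ((Nat.unpair_left_le _).trans_lt hlt) k
      obtain ⟨e₂, h2⟩ := ih n.unpair.2.unpair.2 ((Nat.unpair_right_le _).trans_lt hlt) k
      refine ⟨max e₁ e₂, fun e he => K.exists_defEnum_not (s := true) ?_⟩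
      obtain ⟨t₁, d₁, h1⟩ := h1 e (le_of_max_le_left he) false
      obtain ⟨t₂, d₂, h2⟩ := h2 e (le_of_max_le_right he) true
      obtain ⟨t, ht⟩ := exists_treeEval_node (true, 0, 0, 0, falsumC, []) (defRule P)
        (1, 0, 0, 0, 0) t₁ t₂
      refine ⟨t, d₁ ++ d₂, ?_⟩
      rw [← defEnum] at ht
      rw [ht, h1, h2]
      simp [defRule, impRule, ← hn]
    by_cases h4 : n.unpair.1 = 4
    · have hn : n = allC n.unpair.2 := by
        rw [allC, ← h4, Nat.pair_unpair]
      have hlt : n.unpair.2 < n := by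
        have := Nat.add_le_pair n.unpair.1 n.unpair.2
        rw [Nat.pair_unpair] at this
        omega
      obtain ⟨e₁, h1⟩ := ih n.unpair.2 hlt (k + 1)
      -- Below the quantifier there is one more variable, and `p^e` coordinates must have room for
      -- all `m + (k + 1)` of them.
      refine ⟨max e₁ (m + (k + 1)), fun e he => K.exists_defEnum_not (s := false) ?_⟩
      obtain ⟨t₁, d₁, h1⟩ := h1 e (le_of_max_le_left he) false
      obtain ⟨t, ht⟩ := exists_treeEval_node (true, 0, 0, 0, falsumC, []) (defRule P)
        (2, 0, 0, 0, 0) t₁ 0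
      have h5 : m + (k + 1) ≤ P.p ^ e :=
        (le_of_max_le_right he).trans (Nat.lt_pow_self K.prime.one_lt).le
      refine ⟨t, d₁.map (projC e (m + k)), ?_⟩
      rw [← defEnum] at ht
      rw [ht, h1]
      simp [defRule, allRule, ← hn, h5]
    · refine ⟨0, fun e _ => K.exists_defEnum_not (s := true) ?_⟩
      obtain ⟨t, ht⟩ := exists_treeEval_node (true, 0, 0, 0, falsumC, []) (defRule P)
        (3, e, m, k, n) 0 0
      refine ⟨t, atomData P e m n, ?_⟩
      rw [← defEnum] at ht
      rw [ht]
      simp [defRule, atomRule, h3, h4]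

/-- A presentation of a definable set in the enumeration. -/
theorem exists_defEnum_true (m n : ℕ) : ∃ t e d, m ≤ P.p ^ e ∧
    defEnum P t = (true, e, m, 0, n, d) := by
  obtain ⟨e₀, h⟩ := K.exists_defEnum m n 0
  obtain ⟨t, d, h1⟩ := h (max e₀ m) (le_max_left _ _) true
  exact ⟨t, _, d, (le_max_right _ _).trans (Nat.lt_pow_self K.prime.one_lt).le, h1⟩

end Setting

end AddFrob

namespace AddFrob

open FirstOrder FirstOrder.Language

/-! ### Existential formulas for unions of clauses -/

set_option synthInstance.maxSize 1000
set_option synthInstance.maxHeartbeats 200000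

/-- Gödel number of a term that represents an additive form. -/
def termR (f : RForm) : ℕ :=
  f.foldr (fun m a => funcC 2 4 [(fun t => funcC 1 3 [t])^[m.2.1]
    ((fun t => funcC 1 2 [t])^[m.2.2] (Nat.pair 0 m.1)), a]) (funcC 0 0 [])

/-- Multiplication by `Q ^ N`. -/
def mulQ (P : Par) (N : ℕ) (f : RForm) : RForm :=
  f.flatMap fun m => (powL P.Q N).map fun e => (m.1, e + m.2.1, m.2.2)

/-- The multiple by `Q ^ N` of the element with given coordinates, the others being zero. -/
def packR (P : Par) (e m N : ℕ) : RForm :=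
  renR 2 0 (mulQ P N ((List.range m).map fun i => (i, i, e)))

/-- The multiple by `Q ^ N` of the value of a form; the constants come before the other
variables. -/
def valR (P : Par) (N L : ℕ) (f : Form) : RForm :=
  renR 2 1 (clr P N f.2 ++ renR 1 L (mulQ P N f.1))

/-- Gödel number of the equation between an additive form and zero. -/
def zeroC (f : RForm) : ℕ := eqC (termR f) (funcC 0 0 [])

/-- Gödel number of an atomic formula `P_σ`. -/
def predC (L σ : ℕ) : ℕ := Nat.pair 2 (Nat.pair L (Nat.pair (σ + 1)
  (Encodable.encode ((List.range L).map fun i => Nat.pair 0 (2 * i + 1)))))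

/-- Gödel number of the quantifier-free formula that expresses a clause. -/
def clauseC (P : Par) (e m N L : ℕ) (C : Clause) : ℕ :=
  andC (eqC (termR (packR P e m N)) (termR (valR P N L C.1)))
    (andC (conjC (C.2.1.map fun f => zeroC (valR P N L f)))
      (andC (conjC (C.2.2.1.map fun f => notC (zeroC (valR P N L f)))) (predC L C.2.2.2.2)))

/-- Gödel number of a disjunction. -/
def disjC (l : List ℕ) : ℕ := notC (conjC (l.map notC))

/-- Gödel number of an existential quantification. -/
def exsC (k a : ℕ) : ℕ := (fun a => notC (allC (notC a)))^[k] a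

/-- A bound for the constants. -/
def Data.bd (d : Data) : ℕ := (d.map Clause.bd).sum

/-- A bound for the other variables. -/
def Data.rbd (d : Data) : ℕ := (d.map Clause.rbd).sum

/-- A bound for the denominators. -/
def Data.ord (d : Data) : ℕ := (d.map fun C => (C.forms.map fun f => wtF f.2).sum).sum

/-- Gödel number of an existential formula that expresses a union of clauses. -/
def dataC (P : Par) (e m : ℕ) (d : Data) : ℕ :=
  exsC (d.bd + d.rbd) (disjC (d.map (clauseC P e m d.ord d.bd)))

section Primrec

variable {α : Type} [Primcodable α] {P : Par}

@[fun_prop]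
theorem primrec_termR {f : α → RForm} (hf : Primrec f) : Primrec fun x => termR (f x) := by
  unfold termR; fun_prop

@[fun_prop]
theorem primrec_mulQ {N : α → ℕ} {f : α → RForm} (hN : Primrec N) (hf : Primrec f) :
    Primrec fun x => mulQ P (N x) (f x) := by
  unfold mulQ; fun_prop

@[fun_prop]
theorem primrec_packR {e m N : α → ℕ} (he : Primrec e) (hm : Primrec m) (hN : Primrec N) :
    Primrec fun x => packR P (e x) (m x) (N x) := by
  unfold packR; fun_prop

@[fun_prop]
theorem primrec_valR {N L : α → ℕ} {f : α → Form} (hN : Primrec N) (hL : Primrec L)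
    (hf : Primrec f) : Primrec fun x => valR P (N x) (L x) (f x) := by
  unfold valR; fun_prop

@[fun_prop]
theorem primrec_zeroC {f : α → RForm} (hf : Primrec f) : Primrec fun x => zeroC (f x) := by
  unfold zeroC; fun_prop

@[fun_prop]
theorem primrec_predC {L σ : α → ℕ} (hL : Primrec L) (hσ : Primrec σ) :
    Primrec fun x => predC (L x) (σ x) := by
  unfold predC; fun_prop

@[fun_prop]
theorem primrec_clauseC {e m N L : α → ℕ} {C : α → Clause} (he : Primrec e) (hm : Primrec m)
    (hN : Primrec N) (hL : Primrec L) (hC : Primrec C) :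
    Primrec fun x => clauseC P (e x) (m x) (N x) (L x) (C x) := by
  unfold clauseC; fun_prop

@[fun_prop]
theorem primrec_disjC {l : α → List ℕ} (hl : Primrec l) : Primrec fun x => disjC (l x) := by
  unfold disjC; fun_prop

@[fun_prop]
theorem primrec_exsC {k a : α → ℕ} (hk : Primrec k) (ha : Primrec a) :
    Primrec fun x => exsC (k x) (a x) := by
  unfold exsC; fun_prop

@[fun_prop]
theorem primrec_dataC {e m : α → ℕ} {d : α → Data} (he : Primrec e) (hm : Primrec m)
    (hd : Primrec d) : Primrec fun x => dataC P (e x) (m x) (d x) := by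
  unfold dataC Data.bd Data.rbd Data.ord Clause.forms; fun_prop

end Primrec

section Codes

variable {p : ℕ} {R : Type*} [(Lpze p).Structure R] {m k : ℕ}

/-- The number `c` is the Gödel number of a term with the values `f`. -/
def TermSem (p : ℕ) {R : Type*} [(Lpze p).Structure R] (m k c : ℕ) (f : (ℕ → R) → R) : Prop :=
  ∃ t : (Lpze p).Term (Fin m ⊕ Fin k), termCode t = c ∧ ∀ u : ℕ → R,
    t.realize (Sum.elim (fun i : Fin m => u (2 * i)) fun i : Fin k => u (2 * i + 1)) = f u

/-- The number `c` is the Gödel number of a quantifier-free formula with the meaning `S`. -/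
def QFSem (p : ℕ) {R : Type*} [(Lpze p).Structure R] (m k c : ℕ) (S : (ℕ → R) → Prop) : Prop :=
  ∃ φ : (Lpze p).BoundedFormula (Fin m) k, φ.IsQF ∧ formulaCode φ = c ∧ ∀ u : ℕ → R,
    φ.Realize (fun i : Fin m => u (2 * i)) (fun i : Fin k => u (2 * i + 1)) ↔ S u

theorem TermSem.var {v : ℕ} (h : (v % 2 = 0 → v / 2 < m) ∧ (v % 2 = 1 → v / 2 < k)) :
    TermSem p (R := R) m k (Nat.pair 0 v) fun u => u v := by
  rcases Nat.mod_two_eq_zero_or_one v with h0 | h0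
  · have h1 : 2 * (v / 2) = v := by omega
    refine ⟨.var (Sum.inl ⟨v / 2, h.1 h0⟩), ?_, fun u => ?_⟩
    · simp [termCode, varCode, h1]
    · simp [h1]
  · have h1 : 2 * (v / 2) + 1 = v := by omega
    refine ⟨.var (Sum.inr ⟨v / 2, h.2 h0⟩), ?_, fun u => ?_⟩
    · simp [termCode, varCode, h1]
    · simp [h1]

theorem TermSem.eq {a b : ℕ} {f g : (ℕ → R) → R} (ha : TermSem p m k a f)
    (hb : TermSem p m k b g) : QFSem p m k (eqC a b) fun u => f u = g u := by
  obtain ⟨s, rfl, hs⟩ := ha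
  obtain ⟨t, rfl, ht⟩ := hb
  refine ⟨.equal s t, (BoundedFormula.IsAtomic.equal s t).isQF, rfl, fun u => ?_⟩
  simp only [← hs, ← ht]
  rfl

variable {a b : ℕ} {S T : (ℕ → R) → Prop}

theorem QFSem.congr (h : QFSem p m k a S) (hST : ∀ u, S u ↔ T u) : QFSem p m k a T := by
  obtain ⟨φ, h1, h2, h3⟩ := h
  exact ⟨φ, h1, h2, fun u => (h3 u).trans (hST u)⟩

theorem qfSem_falsumC : QFSem p (R := R) m k falsumC fun _ => False :=
  ⟨⊥, BoundedFormula.isQF_bot, rfl, fun _ => Iff.rfl⟩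

theorem QFSem.impC (ha : QFSem p m k a S) (hb : QFSem p m k b T) :
    QFSem p m k (impC a b) fun u => S u → T u := by
  obtain ⟨φ, h1, rfl, h2⟩ := ha
  obtain ⟨ψ, h3, rfl, h4⟩ := hb
  refine ⟨φ.imp ψ, h1.imp h3, rfl, fun u => ?_⟩
  rw [BoundedFormula.realize_imp, h2, h4]

theorem QFSem.notC (ha : QFSem p m k a S) : QFSem p m k (notC a) fun u => ¬ S u :=
  ha.impC qfSem_falsumC

theorem QFSem.andC (ha : QFSem p m k a S) (hb : QFSem p m k b T) :
    QFSem p m k (andC a b) fun u => S u ∧ T u :=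
  (ha.impC hb.notC).notC.congr fun u => by tauto

theorem QFSem.conjC {β : Type*} {l : List β} {c : β → ℕ} {S : β → (ℕ → R) → Prop}
    (h : ∀ x ∈ l, QFSem p m k (c x) (S x)) :
    QFSem p m k (conjC (l.map c)) fun u => ∀ x ∈ l, S x u := by
  induction l with
  | nil => exact qfSem_falsumC.notC.congr fun u => by simp
  | cons x l ih =>
    exact ((h x List.mem_cons_self).andC (ih fun x hx => h x (List.mem_cons_of_mem _ hx))).congr
      fun u => (List.forall_mem_cons (p := fun x => S x u)).symm

theorem QFSem.disjC {β : Type*} {l : List β} {c : β → ℕ} {S : β → (ℕ → R) → Prop}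
    (h : ∀ x ∈ l, QFSem p m k (c x) (S x)) :
    QFSem p m k (disjC (l.map c)) fun u => ∃ x ∈ l, S x u := by
  have h1 := (QFSem.conjC fun x hx => (h x hx).notC).notC
  rw [AddFrob.disjC, List.map_map]
  refine h1.congr fun u => ?_
  push Not
  rfl

theorem QFSem.exs (h : QFSem p m k a S) [Inhabited R] : ∃ φ : (Lpze p).Formula (Fin m),
    φ.IsExistential ∧ formulaCode φ = exsC k a ∧ ∀ x : ℕ → R, φ.Realize (fun i : Fin m => x i) ↔
      ∃ y : ℕ → R, S fun n => if n % 2 = 0 then x (n / 2) else y (n / 2) := by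
  obtain ⟨φ, h1, rfl, h2⟩ := h
  have h3 : ∀ {k} (φ : (Lpze p).BoundedFormula (Fin m) k), φ.IsExistential →
      BoundedFormula.IsExistential φ.exs ∧ formulaCode φ.exs = exsC k (formulaCode φ) := by
    intro k
    induction k with
    | zero => exact fun φ h => ⟨h, rfl⟩
    | succ k ih => exact fun φ h => ih φ.ex h.ex
  refine ⟨φ.exs, (h3 φ h1.isExistential).1, (h3 φ h1.isExistential).2, fun x => ?_⟩
  rw [BoundedFormula.realize_exs]
  have key : ∀ y : ℕ → R, φ.Realize (fun i : Fin m => x i) (fun i : Fin k => y i) ↔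
      S fun n => if n % 2 = 0 then x (n / 2) else y (n / 2) := by
    intro y
    rw [← h2]
    have a1 : ∀ v, (2 * v + 1) / 2 = v := fun v => by omega
    have a2 : ∀ v, (2 * v + 1) % 2 = 1 := fun v => by omega
    simp only [Nat.mul_mod_right, if_true, Nat.mul_div_cancel_left _ two_pos, a1, a2, one_ne_zero,
      if_false]
  constructor
  · rintro ⟨xs, hxs⟩
    refine ⟨fun n => if hn : n < k then xs ⟨n, hn⟩ else default,
      (key fun n => if hn : n < k then xs ⟨n, hn⟩ else default).1 ?_⟩
    simpa using hxs
  · rintro ⟨y, hy⟩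
    exact ⟨_, (key y).2 hy⟩

end Codes

namespace Setting

variable {P : Par} {F R : Type*} [Field F] [CommRing R] {K : Setting P F R}

theorem evalR_mulQ (K : Setting P F R) (ρ : ℕ → R) (N : ℕ) (f : RForm) :
    K.evalR ρ (mulQ P N f) = K.toR (lpoly P.Q) ^ N * K.evalR ρ f := by
  induction f with
  | nil => simp [mulQ]
  | cons m f ih =>
    rw [mulQ, List.flatMap_cons, ← mulQ, evalR_append, ih, evalR_cons, mul_add, ← sum_powL]
    congr 1
    rw [evalR, List.map_map, ← List.sum_map_mul_right]
    congr 1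
    refine List.map_congr_left fun e _ => ?_
    simp only [Function.comp_apply, pow_add]
    ring

variable [(Lpze P.p).Structure R] (hK : K.Compat) {m k : ℕ}

include hK

theorem termSem_termR {f : RForm}
    (h : ∀ t ∈ f, (t.1 % 2 = 0 → t.1 / 2 < m) ∧ (t.1 % 2 = 1 → t.1 / 2 < k)) :
    TermSem P.p m k (termR f) fun u => K.evalR u f := by
  have hfrob : ∀ {c : ℕ} {g : (ℕ → R) → R}, TermSem P.p m k c g → ∀ j,
      TermSem P.p m k ((fun t => funcC 1 2 [t])^[j] c) fun u => g u ^ P.p ^ j := by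
    intro c g hc j
    induction j with
    | zero => simpa using hc
    | succ j ih =>
      obtain ⟨t, h1, h2⟩ := ih
      refine ⟨.func (L := Lpze P.p) (l := 1) LpzFunctions.frob fun _ => t, ?_, fun u => ?_⟩
      · rw [Function.iterate_succ_apply', ← h1]
        rfl
      · refine (hK.frob _).trans ?_
        change t.realize (Sum.elim (fun i : Fin m => u (2 * i)) fun i : Fin k => u (2 * i + 1)) ^ P.p = g u ^ P.p ^ (j + 1)
        rw [h2, ← pow_mul, pow_succ]
  have hmul : ∀ {c : ℕ} {g : (ℕ → R) → R}, TermSem P.p m k c g → ∀ j,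
      TermSem P.p m k ((fun t => funcC 1 3 [t])^[j] c) fun u => K.z ^ j * g u := by
    intro c g hc j
    induction j with
    | zero => simpa using hc
    | succ j ih =>
      obtain ⟨t, h1, h2⟩ := ih
      refine ⟨.func (L := Lpze P.p) (l := 1) LpzFunctions.mulZ fun _ => t, ?_, fun u => ?_⟩
      · rw [Function.iterate_succ_apply', ← h1]
        rfl
      · refine (hK.mulZ _).trans ?_
        change K.z * t.realize (Sum.elim (fun i : Fin m => u (2 * i)) fun i : Fin k => u (2 * i + 1)) = K.z ^ (j + 1) * g u
        rw [h2, pow_succ']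
        ring
  induction f with
  | nil =>
    refine ⟨.func (L := Lpze P.p) (l := 0) LpzFunctions.zero Fin.elim0, rfl, fun u => ?_⟩
    exact hK.zero _
  | cons t f ih =>
    obtain ⟨s₂, h1, h2⟩ := ih fun t ht => h t (List.mem_cons_of_mem _ ht)
    obtain ⟨s₁, h3, h4⟩ := hmul (hfrob (TermSem.var (p := P.p) (R := R) (h t List.mem_cons_self))
      t.2.2) t.2.1
    refine ⟨.func (L := Lpze P.p) (l := 2) LpzFunctions.add fun i => if i = 0 then s₁ else s₂, ?_,
      fun u => ?_⟩
    · have : termR (t :: f) = funcC 2 4 [(fun t => funcC 1 3 [t])^[t.2.1]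
        ((fun t => funcC 1 2 [t])^[t.2.2] (Nat.pair 0 t.1)), termR f] := rfl
      rw [this, ← h1, ← h3]
      rfl
    · refine (hK.add _).trans ?_
      change s₁.realize (Sum.elim (fun i : Fin m => u (2 * i)) fun i : Fin k => u (2 * i + 1))
        + s₂.realize (Sum.elim (fun i : Fin m => u (2 * i)) fun i : Fin k => u (2 * i + 1)) = K.evalR u (t :: f)
      rw [h2, h4, evalR_cons]

theorem qfSem_zeroC {f : RForm}
    (h : ∀ t ∈ f, (t.1 % 2 = 0 → t.1 / 2 < m) ∧ (t.1 % 2 = 1 → t.1 / 2 < k)) :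
    QFSem P.p m k (zeroC f) fun u => K.evalR u f = 0 := by
  have := (termSem_termR hK h).eq (termSem_termR hK (f := []) (by simp))
  exact this

/-- `P_σ` asserts both that its arguments lie in `F` and that `σ` holds. Applied to the first `L`
quantified variables, this one atomic formula turns them into constants. -/
theorem qfSem_predC {L σ : ℕ} (hL : L ≤ k) (hσ : WF P.p L σ) :
    QFSem P.p m k (predC L σ) fun u => ∃ γ : ℕ → F, (∀ i < L, K.ι (γ i) = u (2 * i + 1)) ∧
      Sem P.p L σ γ := by
  obtain ⟨φ, rfl⟩ := hσ
  refine ⟨.rel (L := Lpze P.p) (l := L) (LpzeRelations.P φ)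
    fun i => .var (Sum.inr (Fin.castLE hL i)), (BoundedFormula.IsAtomic.rel _ _).isQF, ?_,
    fun u => ?_⟩
  · simp only [formulaCode, predC, termCode, varCode, Fin.val_castLE]
    congr 4
    rw [← List.map_coe_finRange_eq_range, List.map_map, List.ofFn_eq_map]
    rfl
  · refine (hK.pred _ _).trans ?_
    simp only [sem_formulaCode, Term.realize_var, Sum.elim_inr, Fin.val_castLE]
    constructor
    · rintro ⟨a, h1, h2⟩
      refine ⟨fun i => if h : i < L then a ⟨i, h⟩ else 0, fun i hi => ?_, ?_⟩
      · simpa [hi] using h1 ⟨i, hi⟩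
      · simpa using h2
    · rintro ⟨γ, h1, h2⟩
      exact ⟨fun i => γ i, fun i => h1 i i.2, h2⟩

omit hK [(Lpze P.p).Structure R] in
-- Among the quantified variables the constants come first and the ring variables are shifted by
-- `L`. The factor `Q^N` clears the denominators, for which the language has no symbol.
theorem evalR_valR {N L : ℕ} {f : Form} {γ : ℕ → F} {x y : ℕ → R} (hN : ∀ t ∈ f.2, t.2.2.1 ≤ N)
    (hL : ∀ t ∈ f.2, t.1 < L) (hy : ∀ i < L, K.ι (γ i) = y i) :
    K.evalR (fun n => if n % 2 = 0 then x (n / 2) else y (n / 2)) (valR P N L f)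
      = K.toR (lpoly P.Q) ^ N * K.ev (fun v => y (v + L)) γ f := by
  have a1 : ∀ v, (2 * v + 1) / 2 = v := fun v => by omega
  have a2 : ∀ v, (2 * v + 1) % 2 = 1 := fun v => by omega
  rw [valR, evalR_renR, evalR_append, evalR_renR, evalR_mulQ, ev, mul_add, ← K.evalR_clr γ hN,
    add_comm]
  simp only [a1, a2, one_ne_zero, if_false, one_mul]
  congr 1
  refine K.evalR_congr fun t ht => ?_
  obtain ⟨t', ht', h⟩ := mem_clr ht
  exact (hy _ (h ▸ hL t' ht')).symm

omit hK [(Lpze P.p).Structure R] in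
theorem evalR_packR (K : Setting P F R) {e m N : ℕ} (hm : m ≤ P.p ^ e) (x y : ℕ → R) :
    K.evalR (fun n => if n % 2 = 0 then x (n / 2) else y (n / 2)) (packR P e m N)
      = K.toR (lpoly P.Q) ^ N * K.pack e (fun i => if i < m then x i else 0) := by
  rw [packR, evalR_renR, evalR_mulQ, evalR, List.map_map, ← List.sum_toFinset _
    (List.nodup_range), List.toFinset_range, pack, ← Finset.sum_subset
      (Finset.range_mono hm : Finset.range m ⊆ Finset.range (P.p ^ e))]
  · congr 1
    refine Finset.sum_congr rfl fun i hi => ?_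
    simp [Finset.mem_range.1 hi]
  · intro i _ hi
    rw [if_neg (by simpa using hi), zero_pow (K.q_pos e).ne', mul_zero]

omit hK [(Lpze P.p).Structure R] in
theorem mem_valR {N L B : ℕ} {f : Form} (hL : ∀ t ∈ f.2, t.1 < L) (hB : ∀ t ∈ f.1, t.1 < B)
    {t} (h₀ : t ∈ valR P N L f) :
    (t.1 % 2 = 0 → t.1 / 2 < m) ∧ (t.1 % 2 = 1 → t.1 / 2 < L + B) := by
  obtain ⟨t, ht, rfl⟩ := List.mem_map.1 h₀
  have h : t.1 < L + B := by
    rcases List.mem_append.1 ht with ht | ht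
    · obtain ⟨t', ht', h⟩ := mem_clr ht
      have := hL t' ht'
      omega
    · obtain ⟨t, h₁, rfl⟩ := List.mem_map.1 ht
      obtain ⟨t', ht', ht⟩ := List.mem_flatMap.1 h₁
      obtain ⟨e, -, rfl⟩ := List.mem_map.1 ht
      have := hB t' ht'
      simp only
      omega
  simp only
  omega

/-- A union of clauses is expressed by an existential formula. -/
theorem exists_dataC [IsDomain R] {e : ℕ} {d : Data} (hd : Data.WF P.p d) (hm : m ≤ P.p ^ e) :
    ∃ φ : (Lpze P.p).Formula (Fin m), φ.IsExistential ∧ formulaCode φ = dataC P e m d ∧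
      ∀ x : ℕ → R, φ.Realize (fun i : Fin m => x i) ↔
        K.pack e (fun i => if i < m then x i else 0) ∈ K.Den d := by
  have hbd : ∀ C ∈ d, C.bd ≤ d.bd := fun C hC =>
    List.single_le_sum (by simp) _ (List.mem_map_of_mem hC)
  have hL : ∀ C ∈ d, ∀ f ∈ C.forms, ∀ t ∈ f.2, t.1 < d.bd := fun C hC f hf t ht =>
    (Clause.lt_bd hf ht).trans_le (hbd C hC)
  have hB : ∀ C ∈ d, ∀ f ∈ C.forms, ∀ t ∈ f.1, t.1 < d.rbd := fun C hC f hf t ht =>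
    (lt_rbd hf ht).trans_le (List.single_le_sum (by simp) _ (List.mem_map_of_mem hC))
  have hN : ∀ C ∈ d, ∀ f ∈ C.forms, ∀ t ∈ f.2, t.2.2.1 ≤ d.ord := by
    intro C hC f hf t ht
    have h1 := le_wtF ht
    have h2 : wtF f.2 ≤ (C.forms.map fun f => wtF f.2).sum :=
      List.single_le_sum (by simp) _ (List.mem_map_of_mem (f := fun f : Form => wtF f.2) hf)
    have h3 : (C.forms.map fun f => wtF f.2).sum ≤ d.ord :=
      List.single_le_sum (by simp) _ (List.mem_map_of_mem
        (f := fun C : Clause => (C.forms.map fun f => wtF f.2).sum) hC)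
    omega
  have hwf : ∀ C ∈ d, WF P.p d.bd C.2.2.2.2 := fun C hC =>
    AddFrob.WF.mono (hd C hC) (C.l_le_bd.trans (hbd C hC))
  have hpack : ∀ t ∈ packR P e m d.ord,
      (t.1 % 2 = 0 → t.1 / 2 < m) ∧ (t.1 % 2 = 1 → t.1 / 2 < d.bd + d.rbd) := by
    intro t h₀
    obtain ⟨t, ht, rfl⟩ := List.mem_map.1 h₀
    obtain ⟨t', ht', ht⟩ := List.mem_flatMap.1 ht
    obtain ⟨e, -, rfl⟩ := List.mem_map.1 ht
    obtain ⟨i, hi, rfl⟩ := List.mem_map.1 ht'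
    have := List.mem_range.1 hi
    simp only
    omega
  have : Inhabited R := ⟨0⟩
  -- The denominators were cleared in all equations and inequalities; in a domain the nonzero factor
  -- `Q^N` may be cancelled again.
  have hq : K.toR (lpoly P.Q) ^ d.ord ≠ 0 := fun h0 => by
    have := K.mul_qi_pow d.ord
    rw [h0, zero_mul] at this
    exact zero_ne_one this
  obtain ⟨φ, h1, h2, h3⟩ := (QFSem.disjC (l := d) (c := clauseC P e m d.ord d.bd) fun C hC =>
    ((termSem_termR hK hpack).eq (termSem_termR hK (f := valR P d.ord d.bd C.1)
        fun t ht => mem_valR (hL C hC _ C.fst_mem_forms) (hB C hC _ C.fst_mem_forms) ht)).andC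
      ((QFSem.conjC fun f hf => qfSem_zeroC hK fun t ht =>
          mem_valR (hL C hC f (Clause.mem_forms_of_E hf)) (hB C hC f (Clause.mem_forms_of_E hf)) ht).andC
        ((QFSem.conjC fun f hf => (qfSem_zeroC hK fun t ht =>
          mem_valR (hL C hC f (Clause.mem_forms_of_I hf)) (hB C hC f (Clause.mem_forms_of_I hf))
            ht).notC).andC (qfSem_predC hK (Nat.le_add_right _ _) (hwf C hC))))).exs
  refine ⟨φ, h1, h2, fun x => ?_⟩
  rw [h3]
  have a1 : ∀ v, (2 * v + 1) / 2 = v := fun v => by omega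
  have a2 : ∀ v, (2 * v + 1) % 2 = 1 := fun v => by omega
  simp only [a1, a2, one_ne_zero, if_false]
  have key : ∀ C ∈ d, ∀ (γ : ℕ → F) (y : ℕ → R), (∀ i < d.bd, K.ι (γ i) = y i) →
      ∀ f ∈ C.forms, K.evalR (fun n => if n % 2 = 0 then x (n / 2) else y (n / 2))
        (valR P d.ord d.bd f) = K.toR (lpoly P.Q) ^ d.ord * K.ev (fun v => y (v + d.bd)) γ f :=
    fun C hC γ y hy f hf => evalR_valR (hN C hC f hf) (hL C hC f hf) hy
  constructor
  · rintro ⟨y, C, hC, h4, h5, h6, γ, h7, h8⟩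
    refine ⟨C, hC, fun v => y (v + d.bd), γ, ⟨fun f hf => ?_, fun f hf => ?_, ?_⟩, ?_⟩
    · have := h5 f hf
      rw [key C hC γ y h7 f (Clause.mem_forms_of_E hf)] at this
      exact (mul_eq_zero.1 this).resolve_left hq
    · have := h6 f hf
      rw [key C hC γ y h7 f (Clause.mem_forms_of_I hf)] at this
      exact fun h0 => this (by rw [h0, mul_zero])
    · exact (sem_mono (hd C hC) (C.l_le_bd.trans (hbd C hC))).1 h8
    · rw [key C hC γ y h7 _ C.fst_mem_forms, evalR_packR K hm] at h4
      exact (mul_left_cancel₀ hq h4).symm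
  · rintro ⟨C, hC, ρ, γ, ⟨h4, h5, h6⟩, h7⟩
    -- The witnesses are the images of the constants, followed by the values of the ring variables.
    obtain ⟨y, hy, hρ⟩ : ∃ y : ℕ → R, (∀ i < d.bd, K.ι (γ i) = y i) ∧
        (fun v => y (v + d.bd)) = ρ :=
      ⟨fun i => if i < d.bd then K.ι (γ i) else ρ (i - d.bd), fun i hi => (if_pos hi).symm, by
        funext v; simp⟩
    have key' := key C hC γ y hy
    rw [hρ] at key'
    refine ⟨y, C, hC, ?_, fun f hf => ?_, fun f hf => ?_, γ, hy, ?_⟩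
    · rw [key' _ C.fst_mem_forms, evalR_packR K hm, h7]
    · rw [key' f (Clause.mem_forms_of_E hf), h4 f hf, mul_zero]
    · rw [key' f (Clause.mem_forms_of_I hf)]
      exact mul_ne_zero hq (h5 f hf)
    · exact (sem_mono (hd C hC) (C.l_le_bd.trans (hbd C hC))).2 h6

end Setting

end AddFrob

namespace AddFrob

open FirstOrder FirstOrder.Language

/-! ### The algorithms -/

set_option synthInstance.maxSize 1000
set_option synthInstance.maxHeartbeats 200000

/-- A successful search defines a computable function. -/
theorem exists_computable_search {α : Type} [Primcodable α] {test : α → ℕ → Bool}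
    {out : α → ℕ → ℕ} (ht : Primrec fun q : α × ℕ => test q.1 q.2)
    (ho : Primrec fun q : α × ℕ => out q.1 q.2) (h : ∀ a, ∃ t, test a t = true) :
    ∃ g : α → ℕ, Computable g ∧ ∀ a, ∃ t, test a t = true ∧ g a = out a t := by
  have h1 : Partrec fun a => Nat.rfind fun t => Part.some (test a t) :=
    Partrec.rfind (p := fun a t => Part.some (test a t)) ht.to_comp.partrec
  have h2 : ∀ a, (Nat.rfind fun t => Part.some (test a t)).Dom := fun a =>
    Nat.rfind_dom.2 (by
      obtain ⟨t, ht⟩ := h a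
      exact ⟨t, by simp [ht], fun _ => trivial⟩)
  have h3 : Computable fun a => (Nat.rfind fun t => Part.some (test a t)).get (h2 a) :=
    h1.of_eq fun a => (Part.some_get (h2 a)).symm
  refine ⟨fun a => out a ((Nat.rfind fun t => Part.some (test a t)).get (h2 a)),
    ho.to_comp.comp (Computable.id.pair h3), fun a => ⟨_, ?_, rfl⟩⟩
  have := Nat.rfind_spec (Part.get_mem (h2 a))
  exact (Part.mem_some_iff.1 this).symm

/-- An entry of the enumeration of definable sets concerns a given formula. -/
def defTest (P : Par) (m n : ℕ) (a : Defn) : Bool :=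
  a.1 && (decide (m ≤ P.p ^ a.2.1) && (decide (a.2.2.1 = m) && (decide (a.2.2.2.1 = 0) &&
    decide (a.2.2.2.2.1 = n))))

theorem defTest_iff {P : Par} {m n : ℕ} {a : Defn} : defTest P m n a = true ↔
    ∃ e d, m ≤ P.p ^ e ∧ a = (true, e, m, 0, n, d) := by
  obtain ⟨s, e, m', k, n', d⟩ := a
  simp only [defTest, Bool.and_eq_true, decide_eq_true_eq, Prod.mk.injEq]
  constructor
  · rintro ⟨rfl, h, rfl, rfl, rfl⟩
    exact ⟨e, d, h, rfl, rfl, rfl, rfl, rfl, rfl⟩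
  · rintro ⟨_, _, h, rfl, rfl, rfl, rfl, rfl, rfl⟩
    exact ⟨rfl, h, rfl, rfl, rfl⟩

/-- A clause with the same formula and trivial values. -/
def Clause.close (C : Clause) : Clause := (([], []), C.2)

/-- The result of transformations of the `i`-th clause. -/
def finish (P : Par) (d : Data) (L : List (List Step)) (i : ℕ) : Clause :=
  (d.getD i univC).close.run P (L.getD i [])

/-- The transformations remove all equations and inequalities. -/
def finishTest (P : Par) (d : Data) (L : List (List Step)) : Bool :=
  (List.range d.length).all fun i =>
    (finish P d L i).2.1.isEmpty && (finish P d L i).2.2.1.isEmpty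

/-- Gödel number of a sentence that expresses that a union of clauses is not empty. -/
def sentC (P : Par) (d : Data) (L : List (List Step)) : ℕ :=
  disjC ((List.range d.length).map fun i =>
    exC (finish P d L i).2.2.2.1 (finish P d L i).2.2.2.2)

/-- The list of sequences of transformations with a given number. -/
def stepsC (n : ℕ) : List (List Step) := (Encodable.decode n : Option (List (List Step))).getD []

section Primrec

variable {α : Type} [Primcodable α] {P : Par}

@[fun_prop]
theorem primrec_defTest {m n : α → ℕ} {a : α → Defn} (hm : Primrec m) (hn : Primrec n)
    (ha : Primrec a) : Primrec fun x => defTest P (m x) (n x) (a x) := by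
  unfold defTest; fun_prop

@[fun_prop]
theorem primrec_finish {d : α → Data} {L : α → List (List Step)} {i : α → ℕ} (hd : Primrec d)
    (hL : Primrec L) (hi : Primrec i) : Primrec fun x => finish P (d x) (L x) (i x) := by
  unfold finish Clause.close; fun_prop

@[fun_prop]
theorem primrec_finishTest {d : α → Data} {L : α → List (List Step)} (hd : Primrec d)
    (hL : Primrec L) : Primrec fun x => finishTest P (d x) (L x) := by
  unfold finishTest; fun_prop

@[fun_prop]
theorem primrec_sentC {d : α → Data} {L : α → List (List Step)} (hd : Primrec d)
    (hL : Primrec L) : Primrec fun x => sentC P (d x) (L x) := by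
  unfold sentC; fun_prop

@[fun_prop]
theorem primrec_stepsC {n : α → ℕ} (hn : Primrec n) : Primrec fun x => stepsC (n x) := by
  unfold stepsC; fun_prop

end Primrec

section Disj

variable {p l : ℕ} {F : Type*} [Field F] {γ : ℕ → F}

theorem wf_disjC {L : List ℕ} (h : ∀ a ∈ L, WF p l a) : WF p l (disjC L) := by
  refine (wf_conjC fun a ha => ?_).notC
  obtain ⟨b, hb, rfl⟩ := List.mem_map.1 ha
  exact (h b hb).notC

theorem sem_disjC {L : List ℕ} (h : ∀ a ∈ L, WF p l a) :
    Sem p l (disjC L) γ ↔ ∃ a ∈ L, Sem p l a γ := by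
  have h1 : ∀ a ∈ L.map notC, WF p l a := by
    intro a ha
    obtain ⟨b, hb, rfl⟩ := List.mem_map.1 ha
    exact (h b hb).notC
  rw [disjC, sem_notC (wf_conjC h1), sem_conjC h1, List.forall_mem_map]
  push Not
  exact exists_congr fun a => and_congr_right fun ha => by rw [sem_notC (h a ha), not_not]

end Disj

namespace Setting

variable {P : Par} {F R : Type*} [Field F] [CommRing R] (K : Setting P F R) [IsDomain R]

omit [IsDomain R] in
-- The conditions of a clause do not involve the form whose values are taken.
theorem den_close_nonempty (C : Clause) : (K.den C.close).Nonempty ↔ (K.den C).Nonempty := by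
  constructor
  · rintro ⟨_, ρ, γ, h, -⟩
    exact ⟨_, ρ, γ, h, rfl⟩
  · rintro ⟨_, ρ, γ, h, -⟩
    exact ⟨_, ρ, γ, h, rfl⟩

/-- A clause without equations and inequalities is non-empty exactly when its formula is satisfiable
in `F`, and the transformations leading to it do not change the set described. -/
theorem sentC_spec {d : Data} {L : List (List Step)} (hd : Data.WF P.p d)
    (hL : finishTest P d L = true) :
    WF P.p 0 (sentC P d L) ∧ ∀ γ : ℕ → F, Sem P.p 0 (sentC P d L) γ ↔ (K.Den d).Nonempty := by
  have hw : ∀ i < d.length, (finish P d L i).WF P.p ∧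
      K.den (finish P d L i) = K.den (d.getD i univC).close := by
    intro i hi
    refine K.run_spec ?_ _
    rw [List.getD_eq_getElem _ _ hi]
    have h := hd _ (List.getElem_mem hi)
    exact h
  have hw' : ∀ a ∈ (List.range d.length).map fun i =>
      exC (finish P d L i).2.2.2.1 (finish P d L i).2.2.2.2, WF P.p 0 a := by
    intro a ha
    obtain ⟨i, hi, rfl⟩ := List.mem_map.1 ha
    exact WF.exC (hw i (List.mem_range.1 hi)).1
  refine ⟨wf_disjC hw', fun γ => ?_⟩
  have key : ∀ i < d.length, Sem P.p 0 (exC (finish P d L i).2.2.2.1 (finish P d L i).2.2.2.2) γ ↔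
      (K.den (d.getD i univC)).Nonempty := by
    intro i hi
    obtain ⟨h1, h2⟩ := hw i hi
    rw [← den_close_nonempty, ← h2, sem_exC h1]
    have h3 := List.all_eq_true.1 hL i (List.mem_range.2 hi)
    rw [Bool.and_eq_true, List.isEmpty_iff, List.isEmpty_iff] at h3
    constructor
    · rintro ⟨δ, hδ⟩
      exact ⟨_, 0, δ, ⟨by simp [h3.1], by simp [h3.2], hδ⟩, rfl⟩
    · rintro ⟨_, ρ, δ, h, -⟩
      exact ⟨δ, h.2.2⟩
  rw [sentC, sem_disjC hw']
  constructor
  · rintro ⟨a, ha, h⟩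
    obtain ⟨i, hi, rfl⟩ := List.mem_map.1 ha
    rw [List.mem_range] at hi
    obtain ⟨x, hx⟩ := (key i hi).1 h
    rw [List.getD_eq_getElem _ _ hi] at hx
    exact ⟨x, _, List.getElem_mem hi, hx⟩
  · rintro ⟨x, C, hC, hx⟩
    obtain ⟨i, hi, rfl⟩ := List.mem_iff_getElem.1 hC
    refine ⟨_, List.mem_map.2 ⟨i, List.mem_range.2 hi, rfl⟩, (key i hi).2 ⟨x, ?_⟩⟩
    rwa [List.getD_eq_getElem _ _ hi]

include K in
-- The value of a closed clause contains no ring variables. After the equations have been solved,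
-- every ring variable in an inequality can therefore be dropped, and the inequalities between
-- constants are absorbed.
theorem exists_finishTest (d : Data) : ∃ L, finishTest P d L = true := by
  have h : ∀ C : Clause, ∃ l, (C.close.run P l).2.1 = [] ∧ (C.close.run P l).2.2.1 = [] := by
    intro C
    obtain ⟨l, h1, -, h2⟩ := K.exists_run_equations C.close
    obtain ⟨l', c, h3, -, -, h4⟩ := K.exists_run_good h1
    refine ⟨l ++ l', ?_, ?_⟩
    · rw [Clause.run_append]
      exact Clause.good_E h3
    · rw [Clause.run_append]
      exact h4 (h2 rfl)
  choose l hl using h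
  refine ⟨d.map l, List.all_eq_true.2 fun i hi => ?_⟩
  rw [List.mem_range] at hi
  have h1 : finish P d (d.map l) i = (d[i].close).run P (l d[i]) := by
    rw [finish, List.getD_eq_getElem _ _ hi, List.getD_eq_getElem _ _ (by simpa using hi),
      List.getElem_map]
  rw [h1, (hl _).1, (hl _).2]
  rfl

variable [(Lpze P.p).Structure R] {K} (hK : K.Compat)

include hK

/-- There is an algorithm that turns formulas into existential formulas. -/
theorem exists_computable_existential : ∃ g : ℕ × ℕ → ℕ, Computable g ∧
    ∀ (m : ℕ) (φ : (Lpze P.p).Formula (Fin m)), ∃ ψ : (Lpze P.p).Formula (Fin m),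
      ψ.IsExistential ∧ (∀ v : Fin m → R, φ.Realize v ↔ ψ.Realize v) ∧
        g (m, formulaCode φ) = formulaCode ψ := by
  obtain ⟨g, hg, h⟩ := exists_computable_search
    (test := fun a : ℕ × ℕ => fun t => defTest P a.1 a.2 (defEnum P t))
    (out := fun a : ℕ × ℕ => fun t => dataC P (defEnum P t).2.1 a.1 (defEnum P t).2.2.2.2.2)
    (by fun_prop) (by fun_prop) fun a => by
      obtain ⟨t, e, d, h1, h2⟩ := K.exists_defEnum_true a.1 a.2
      exact ⟨t, defTest_iff.2 ⟨e, d, h1, h2⟩⟩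
  refine ⟨g, hg, fun m φ => ?_⟩
  obtain ⟨t, h1, h2⟩ := h (m, formulaCode φ)
  obtain ⟨e, d, h3, h4⟩ := defTest_iff.1 h1
  have h5 := defEnum_spec hK t
  rw [h4] at h5 h2
  obtain ⟨h6, h7⟩ := h5 h3 φ rfl
  obtain ⟨ψ, h8, h9, h10⟩ := exists_dataC hK h6 h3
  refine ⟨ψ, h8, fun v => ?_, h2.trans h9.symm⟩
  have h11 := h7 fun i => if h : i < m then v ⟨i, h⟩ else 0
  have h12 := h10 fun i => if h : i < m then v ⟨i, h⟩ else 0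
  -- The tuple `v` is continued by zero, in agreement with the convention for coordinates beyond
  -- `m`.
  have h13 : (fun i : ℕ => if i < m then (if h : i < m then v ⟨i, h⟩ else 0) else 0)
      = fun i => if h : i < m then v ⟨i, h⟩ else 0 := by
    funext i; split_ifs <;> rfl
  rw [h13] at h12
  simp only [Fin.is_lt, dite_true, Fin.eta] at h11 h12
  rw [h12, h11]
  simp only [true_iff]
  rw [Formula.Realize]
  exact iff_of_eq (congrArg _ (Subsingleton.elim _ _))

/-- There is an algorithm that turns sentences into sentences about the field. -/
theorem exists_computable_sentence : ∃ g : ℕ → ℕ, Computable g ∧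
    ∀ φ : (Lpze P.p).Formula (Fin 0), ∃ σ : (Lp P.p).Formula (Fin 0),
      g (formulaCode φ) = formulaCode σ ∧
        ∀ (v : Fin 0 → R) (w : Fin 0 → F), φ.Realize v ↔ σ.Realize w := by
  -- The search runs over pairs: an index in the enumeration of definable sets, and a list of
  -- transformations that removes all equations and inequalities.
  obtain ⟨g, hg, h⟩ := exists_computable_search
    (test := fun n : ℕ => fun t => defTest P 0 n (defEnum P t.unpair.1) &&
      finishTest P (defEnum P t.unpair.1).2.2.2.2.2 (stepsC t.unpair.2))
    (out := fun _ : ℕ => fun t =>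
      sentC P (defEnum P t.unpair.1).2.2.2.2.2 (stepsC t.unpair.2))
    (by fun_prop) (by fun_prop) fun n => by
      obtain ⟨t, e, d, h1, h2⟩ := K.exists_defEnum_true 0 n
      obtain ⟨L, hL⟩ := K.exists_finishTest d
      refine ⟨Nat.pair t (Encodable.encode L), ?_⟩
      have h3 : stepsC (Encodable.encode L) = L := by simp [stepsC]
      rw [Nat.unpair_pair, h3, h2, hL, Bool.and_true]
      exact defTest_iff.2 ⟨e, d, h1, rfl⟩
  refine ⟨g, hg, fun φ => ?_⟩
  obtain ⟨t, h1, h2⟩ := h (formulaCode φ)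
  rw [Bool.and_eq_true] at h1
  obtain ⟨e, d, h3, h4⟩ := defTest_iff.1 h1.1
  have h5 := defEnum_spec hK t.unpair.1
  rw [h4] at h5 h2 h1
  obtain ⟨h6, h7⟩ := h5 h3 φ rfl
  obtain ⟨⟨σ, hσ⟩, h8⟩ := K.sentC_spec h6 h1.2
  refine ⟨σ, h2.trans hσ.symm, fun v w => ?_⟩
  have h9 : σ.Realize w ↔ (K.Den d).Nonempty := by
    rw [← h8 fun _ => 0]
    simp only
    rw [← hσ, sem_formulaCode]
    exact iff_of_eq (congrArg _ (Subsingleton.elim _ _))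
  rw [h9]
  -- A sentence does not depend on the packed point, so its set is empty or all of `R`;
  -- non-emptiness decides its truth, as every element of `R` is packed from some coordinates.
  have h10 : ∀ x : ℕ → R, K.pack e x ∈ K.Den d ↔ φ.Realize v := by
    intro x
    rw [h7 x]
    simp only [true_iff]
    rw [Formula.Realize]
    exact iff_of_eq (congrArg₂ _ (Subsingleton.elim _ _) (Subsingleton.elim _ _))
  constructor
  · exact fun h => ⟨_, (h10 fun _ => 0).2 h⟩
  · rintro ⟨x, hx⟩
    obtain ⟨c, hc⟩ := K.exists_coordinates' e x
    refine (h10 c).1 ?_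
    rw [pack, ← hc]
    exact hx

end Setting

end AddFrob

/-! ### The ring `F[z, s⁻¹ : s ∈ S]` as a localisation, and the conclusion -/

namespace AddFrob

open FirstOrder FirstOrder.Language Polynomial

theorem lpoly_map {k k' : Type*} [CommRing k] [CommRing k'] (f : k →+* k') (l : List ℕ) :
    (lpoly l : k[X]).map f = lpoly l := by
  rw [lpoly, ← coe_mapRingHom, map_list_sum, List.map_map]
  simp [lpoly, Function.comp_def]

section InvRing

variable (p : ℕ) [Fact p.Prime] (F : Type*) [Field F] [Algebra (ZMod p) F]
  (S : Finset (ZMod p)[X])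

/-- The exponents of the product of the inverted polynomials. -/
noncomputable def invExps : List ℕ := exps (∏ s ∈ S, s)

theorem lpoly_invExps : (lpoly (invExps p S) : F[X]) = ∏ s ∈ S, s.map (algebraMap (ZMod p) F) := by
  rw [← lpoly_map (algebraMap (ZMod p) F), invExps, lpoly_exps, Polynomial.map_prod]

/-- The numerical data that belong to `F[z, s⁻¹ : s ∈ S]`. -/
noncomputable def invPar : Par := ⟨p, (lpoly (invExps p S) : F[X]).natDegree + 1, invExps p S⟩

/-- Polynomials as elements of `F[z, s⁻¹ : s ∈ S]`. -/
noncomputable def polyToInvRing : F[X] →ₐ[F] invRing p F S := aeval (invRing.z p F S)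

theorem coe_polyToInvRing (f : F[X]) :
    (polyToInvRing p F S f : RatFunc F) = algebraMap F[X] (RatFunc F) f := by
  rw [polyToInvRing, ← Subalgebra.coe_val, ← aeval_algHom_apply]
  change aeval RatFunc.X f = _
  rw [← RatFunc.algebraMap_X, aeval_algebraMap_apply, aeval_X_left_apply]

theorem exists_inv_lpoly (hS : ∀ s ∈ S, s ≠ 0) :
    ∃ y, polyToInvRing p F S (lpoly (invExps p S)) * y = 1 := by
  have h : IsUnit (polyToInvRing p F S (lpoly (invExps p S))) := by
    rw [lpoly_invExps, map_prod, IsUnit.prod_iff]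
    intro s hs
    refine isUnit_iff_exists_inv.2 ⟨⟨_, Algebra.subset_adjoin (Or.inr ⟨s, hs, rfl⟩)⟩, ?_⟩
    apply Subtype.ext
    rw [MulMemClass.coe_mul, coe_polyToInvRing]
    refine mul_inv_cancel₀ ?_
    rw [Ne, map_eq_zero_iff _ (RatFunc.algebraMap_injective F),
      Polynomial.map_eq_zero_iff (algebraMap (ZMod p) F).injective]
    exact hS s hs
  exact isUnit_iff_exists_inv.1 h

/-- Fractions whose denominator is a power of `Q` contain the generators and are closed under sums
and products, by passing to a common denominator. -/
theorem exists_eq_polyToInvRing_mul {y : invRing p F S}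
    (hy : polyToInvRing p F S (lpoly (invExps p S)) * y = 1) (x : invRing p F S) :
    ∃ n f, x = polyToInvRing p F S f * y ^ n := by
  classical
  set t := polyToInvRing p F S with ht
  set Q : F[X] := lpoly (invExps p S) with hQ
  have hQy : ∀ n, t Q ^ n * y ^ n = 1 := fun n => by rw [← mul_pow, hy, one_pow]
  obtain ⟨x, hx⟩ := x
  induction hx using Algebra.adjoin_induction with
  | mem x hx =>
    rcases hx with hx | ⟨s, hs, rfl⟩
    · refine ⟨0, X, ?_⟩
      rw [pow_zero, mul_one]
      apply Subtype.ext
      rw [ht, coe_polyToInvRing, RatFunc.algebraMap_X]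
      exact hx
    -- The inverse of `s` is the product of the other elements of `S` divided by `Q`.
    · refine ⟨1, ∏ s' ∈ S.erase s, s'.map (algebraMap (ZMod p) F), ?_⟩
      have h1 : Q = s.map (algebraMap (ZMod p) F) *
          ∏ s' ∈ S.erase s, s'.map (algebraMap (ZMod p) F) := by
        rw [hQ, lpoly_invExps, Finset.mul_prod_erase S
          (fun s => s.map (algebraMap (ZMod p) F)) hs]
      rw [h1, map_mul, mul_assoc] at hy
      apply Subtype.ext
      have h2 := congrArg (Subtype.val) hy
      rw [MulMemClass.coe_mul, ht, coe_polyToInvRing] at h2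
      rw [pow_one]
      exact inv_eq_of_mul_eq_one_right h2
  | algebraMap r =>
    refine ⟨0, C r, ?_⟩
    rw [pow_zero, mul_one]
    exact ((polyToInvRing p F S).commutes r).symm
  | add x x' hx hx' h h' =>
    obtain ⟨n, f, h⟩ := h
    obtain ⟨n', f', h'⟩ := h'
    refine ⟨n + n', f * Q ^ n' + f' * Q ^ n, ?_⟩
    have : (⟨x + x', add_mem hx hx'⟩ : invRing p F S) = ⟨x, hx⟩ + ⟨x', hx'⟩ := rfl
    rw [this, h, h', map_add, map_mul, map_mul, map_pow, map_pow, _root_.pow_add]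
    linear_combination (-(t f * y ^ n)) * hQy n' - t f' * y ^ n' * hQy n
  | mul x x' hx hx' h h' =>
    obtain ⟨n, f, h⟩ := h
    obtain ⟨n', f', h'⟩ := h'
    refine ⟨n + n', f * f', ?_⟩
    have : (⟨x * x', mul_mem hx hx'⟩ : invRing p F S) = ⟨x, hx⟩ * ⟨x', hx'⟩ := rfl
    rw [this, h, h', map_mul, _root_.pow_add]
    ring

/-- `F[z, s⁻¹ : s ∈ S]` is a localisation of `F[z]`. -/
noncomputable def invSetting [Algebra.IsAlgebraic (ZMod p) F] (hS : ∀ s ∈ S, s ≠ 0) :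
    Setting (invPar p F S) F (invRing p F S) where
  prime := (Fact.out : p.Prime)
  char := charP_of_injective_algebraMap (algebraMap (ZMod p) F).injective p
  -- An algebraic extension of a perfect field is perfect; this gives the surjectivity of Frobenius
  -- on which all coordinates rest.
  perfect := by
    have := charP_of_injective_algebraMap (algebraMap (ZMod p) F).injective p
    have : ExpChar F p := .prime Fact.out
    have : PerfectField F := Algebra.IsAlgebraic.perfectField (K := ZMod p)
    have : PerfectRing F p := PerfectField.toPerfectRing p
    exact surjective_frobenius F p
  toR := polyToInvRing p F S
  inj f g h := RatFunc.algebraMap_injective F (by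
    rw [← coe_polyToInvRing p F S, ← coe_polyToInvRing p F S]
    exact congrArg Subtype.val h)
  qi := (exists_inv_lpoly p F S hS).choose
  mul_qi := (exists_inv_lpoly p F S hS).choose_spec
  surj := exists_eq_polyToInvRing_mul p F S (exists_inv_lpoly p F S hS).choose_spec
  hD := rfl

theorem invSetting_z [Algebra.IsAlgebraic (ZMod p) F] (hS : ∀ s ∈ S, s ≠ 0) :
    (invSetting p F S hS).z = invRing.z p F S :=
  aeval_X _

theorem invSetting_ι [Algebra.IsAlgebraic (ZMod p) F] (hS : ∀ s ∈ S, s ≠ 0) (a : F) :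
    (invSetting p F S hS).ι a = algebraMap F (invRing p F S) a :=
  (polyToInvRing p F S).commutes a

/-- The characteristic stored in `invPar p F S` is `p` by definition; the structure is restated in
the form in which the general results mention it. -/
noncomputable instance : (Lpze (invPar p F S).p).Structure (invRing p F S) :=
  invRingStructure p F S

theorem compat_invSetting [Algebra.IsAlgebraic (ZMod p) F] (hS : ∀ s ∈ S, s ≠ 0) :
    (invSetting p F S hS).Compat where
  zero _ := rfl
  one _ := rfl
  frob _ := rfl
  mulZ v := by rw [invSetting_z]; rfl
  add _ := rfl
  memF v := by simp only [invSetting_ι]; rfl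
  pred σ v := by simp only [invSetting_ι]; rfl

end InvRing

/-- Two formulas that define the same set in a structure are equivalent modulo its theory. -/
theorem completeTheory_iff {L : FirstOrder.Language} {M : Type*} [L.Structure M] [Nonempty M]
    {m : ℕ} {φ ψ : L.Formula (Fin m)} (h : ∀ v : Fin m → M, φ.Realize v ↔ ψ.Realize v) :
    (L.completeTheory M).Iff φ ψ := by
  rw [Theory.Iff, Theory.models_formula_iff]
  intro N v
  -- The universal closure of the equivalence is a sentence true in `M`, hence true in all models of
  -- the complete theory of `M`.
  let θ : L.Sentence := Formula.iAlls (α := Empty) (Fin m) ((φ.iff ψ).relabel Sum.inr)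
  have h1 : M ⊨ θ := by
    rw [Sentence.Realize, Formula.realize_iAlls]
    intro w
    rw [Formula.realize_relabel, Formula.realize_iff]
    exact h _
  have h2 : N ⊨ θ := (realize_iff_of_model_completeTheory M N θ).2 h1
  rw [Sentence.Realize, Formula.realize_iAlls] at h2
  have h3 := h2 v
  rwa [Formula.realize_relabel] at h3

theorem realize_sentenceP {p : ℕ} {F : Type*} [Field F] [Algebra (ZMod p) F]
    {S : Finset (ZMod p)[X]} (σ : (Lp p).Formula (Fin 0)) (v : Fin 0 → invRing p F S) :
    (sentenceP σ).Realize v ↔ ∃ a : Fin 0 → F, σ.Realize a := by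
  change (∃ a : Fin 0 → F, _ ∧ _) ↔ _
  exact exists_congr fun a => and_iff_right fun i => i.elim0

end AddFrob

theorem theorem1 (p : ℕ) [Fact p.Prime] (F : Type*) [Field F] [Algebra (ZMod p) F]
    [Algebra.IsAlgebraic (ZMod p) F] (S : Finset (Polynomial (ZMod p)))
    (hS : ∀ s ∈ S, Irreducible s)
    (hSF : ∀ s ∈ S, Irreducible (s.map (algebraMap (ZMod p) F))) :
    AddFrob.EffectivelyModelComplete
        ((AddFrob.Lpze p).completeTheory (AddFrob.invRing p F S)) ∧
    ∃ g : ℕ → ℕ, Computable g ∧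
      ∀ φ : (AddFrob.Lpze p).Formula (Fin 0), ∃ σ : (AddFrob.Lp p).Formula (Fin 0),
        g (AddFrob.formulaCode φ) = AddFrob.formulaCode σ ∧
        ∀ v : Fin 0 → AddFrob.invRing p F S,
          φ.Realize v ↔ (AddFrob.sentenceP σ).Realize v := by
  have hK := AddFrob.compat_invSetting p F S fun s hs => (hS s hs).ne_zero
  constructor
  · obtain ⟨g, hg, h⟩ := AddFrob.Setting.exists_computable_existential hK
    refine ⟨fun m n => g (m, n), hg, fun m φ => ?_⟩
    obtain ⟨ψ, h1, h2, h3⟩ := h m φ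
    exact ⟨ψ, h1, AddFrob.completeTheory_iff h2, h3⟩
  · obtain ⟨g, hg, h⟩ : ∃ g : ℕ → ℕ, Computable g ∧
        ∀ φ : (AddFrob.Lpze p).Formula (Fin 0), ∃ σ : (AddFrob.Lp p).Formula (Fin 0),
          g (AddFrob.formulaCode φ) = AddFrob.formulaCode σ ∧
            ∀ (v : Fin 0 → AddFrob.invRing p F S) (w : Fin 0 → F), φ.Realize v ↔ σ.Realize w :=
      AddFrob.Setting.exists_computable_sentence hK
    refine ⟨g, hg, fun φ => ?_⟩
    obtain ⟨σ, h1, h2⟩ := h φ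
    refine ⟨σ, h1, fun v => ?_⟩
    rw [AddFrob.realize_sentenceP]
    exact ⟨fun h => ⟨Fin.elim0, (h2 v _).1 h⟩, fun ⟨a, ha⟩ => (h2 v a).2 ha⟩
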